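/- Let $M$ be a non-empty smooth manifold of real dimension $4n$, $n\ge 1$, with an HKT-structure: a smooth action of the quaternion algebra $\mathbb H$ on $TM$ such that every $L\in\mathbb H$ with $L^2=-1$ is an integrable almost complex structure, and a Riemannian metric $g$ invariant under the unit quaternions, such that $\partial\Omega=0$, where $I,J,K=IJ$ is the standard basis of imaginary quaternions, $\omega_L(x,y)=g(x,Ly)$, $\Omega=\frac12(\omega_J+\sqrt{-1}\,\omega_K)\in\Lambda^{2,0}(M,I)$, and $\partial$ is the $(1,0)$-part of the de Rham differential on the complex manifold $(M,I)$. Let $\theta\in\Lambda^{1,0}(M,I)$ be the smooth form determined by $\partial(\bar\Omega^n)=\theta\wedge\bar\Omega^n$. Identify the space of $(p,0)$-half-forms $\Lambda^{*,0}(M,I)\otimes\mathsf K^{1/2}$ with $\Lambda^{*,0}(M,I)=\bigoplus_p\Lambda^{p,0}(M,I)$ (smooth forms), $\mathsf K^{1/2}$ being the smoothly trivial square root of the canonical bundle $\mathsf K$ of $(M,I)$ given by the trivialization $\Omega^n$ of $\mathsf K$, whose connection has the $(1,0)$-part $\partial+\frac12\theta$ in this trivialization. On this space consider the even operators $L_\Omega=\Omega\wedge\cdot$,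 its pointwise Hermitian adjoint $\Lambda_\Omega$, $H_\Omega=[L_\Omega,\Lambda_\Omega]$, and the odd operators $$ {}^n\partial=\partial+\tfrac12\theta\wedge\cdot,\qquad {}^n\partial_J=J_c\circ{}^n\partial\circ J_c^{-1}, $$ where $J_c(\eta)=J(\bar\eta)$ and $J$ acts on forms multiplicatively, $(J\eta)(v_1,\dots,v_p)=\eta(Jv_1,\dots,Jv_p)$. Then these operators are well defined, $({}^n\partial)^2=({}^n\partial_J)^2=\{{}^n\partial,{}^n\partial_J\}=0$, and the complex Lie superalgebra generated by $L_\Omega,\Lambda_\Omega,H_\Omega,{}^n\partial,{}^n\partial_J$ in $\operatorname{End}_{\mathbb C}(\Lambda^{*,0}(M,I))$ is isomorphic to the $8$-dimensional Kähler-de Rham superalgebra, by an isomorphism that takes $L,\Lambda,H,d,d^c$ to $L_\Omega,\Lambda_\Omega,H_\Omega,{}^n\partial,{}^n\partial_J$. Here the Kähler-de Rham superalgebra is the complex Lie superalgebra with even basis $L,\Lambda,H,\Delta$ and odd basis $d,d^c,d^*,(d^c)^*$, whose non-zero brackets of basis elements are, up to graded anticommutativity, $[L,\Lambda]=H$, $[H,L]=2L$,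 $[H,\Lambda]=-2\Lambda$, $[H,d]=d$, $[H,d^c]=d^c$, $[H,d^*]=-d^*$, $[H,(d^c)^*]=-(d^c)^*$, $[\Lambda,d^c]=d^*$, $[\Lambda,d]=-(d^c)^*$, $[L,d^*]=d^c$, $[L,(d^c)^*]=-d$, $\{d,d^*\}=\{d^c,(d^c)^*\}=\Delta$. -/

import Mathlib

open scoped Manifold ContDiff Quaternion

noncomputable section

/-! ### Lie superalgebras over `ℂ` -/

/-- A complex Lie superalgebra: a `ℤ/2`-graded complex vector space with a graded
anticommutative bracket, compatible with the grading and satisfying the graded Jacobi identity. -/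
class LieSuperalgebra (A : Type*) [AddCommGroup A] [Module ℂ A] where
  /-- the even part `part 0` and the odd part `part 1` -/
  part : ZMod 2 → Submodule ℂ A
  isCompl : IsCompl (part 0) (part 1)
  /-- the supercommutator -/
  sbracket : A →ₗ[ℂ] A →ₗ[ℂ] A
  sbracket_mem : ∀ {i j : ZMod 2} {a b : A}, a ∈ part i → b ∈ part j →
    sbracket a b ∈ part (i + j)
  sbracket_skew : ∀ {i j : ZMod 2} {a b : A}, a ∈ part i → b ∈ part j →
    sbracket a b = -((-1 : ℂ) ^ (i.val * j.val) • sbracket b a)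
  jacobi : ∀ {i j k : ZMod 2} {a b c : A}, a ∈ part i → b ∈ part j → c ∈ part k →
    sbracket a (sbracket b c) =
      sbracket (sbracket a b) c + (-1 : ℂ) ^ (i.val * j.val) • sbracket b (sbracket a c)

namespace LieSuperalgebra

variable {A : Type*} [AddCommGroup A] [Module ℂ A] [LieSuperalgebra A]

/-- Sub-superalgebras: graded subspaces that are closed under the supercommutator. -/
structure IsSubalgebra (N : Submodule ℂ A) : Prop where
  graded : N ≤ (N ⊓ part 0) ⊔ (N ⊓ part 1)
  sbracket_mem : ∀ a ∈ N, ∀ b ∈ N, sbracket a b ∈ N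

/-- The Lie superalgebra generated by a set: the smallest sub-superalgebra that contains it. -/
def generated (S : Set A) : Submodule ℂ A :=
  sInf {N : Submodule ℂ A | S ⊆ N ∧ IsSubalgebra N}

end LieSuperalgebra

section SuperEnd

variable {V : Type*} [AddCommGroup V] [Module ℂ V]

/-- The endomorphisms of parity `i` of the graded space whose even and odd parts are the
eigenspaces of the involution `P` for the eigenvalues `1` and `-1`. -/
def superEndPart (P : Module.End ℂ V) (i : ZMod 2) : Submodule ℂ (Module.End ℂ V) where
  carrier := {T | P * T = (-1 : ℂ) ^ i.val • (T * P)}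
  add_mem' := by
    intro a b ha hb
    simp only [Set.mem_ofPred_eq] at ha hb ⊢
    rw [mul_add, ha, hb, add_mul, smul_add]
  zero_mem' := by simp
  smul_mem' := by
    intro c a ha
    simp only [Set.mem_ofPred_eq] at ha ⊢
    rw [mul_smul_comm, ha, smul_mul_assoc, smul_comm]

/-- The odd component `(T - P T P) / 2` of an endomorphism `T`. -/
def oddComponent (P : Module.End ℂ V) : Module.End ℂ V →ₗ[ℂ] Module.End ℂ V where
  toFun T := (1 / 2 : ℂ) • (T - P * T * P)
  map_add' a b := by rw [mul_add, add_mul]; module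
  map_smul' c a := by
    simp only [mul_smul_comm, smul_mul_assoc, RingHom.id_apply]; module

/-- The supercommutator of endomorphisms: the bilinear map that is `a b - (-1)^{ij} b a` for
`a`, `b` of parities `i`, `j` (see `superComm_apply_of_mem`). -/
def superComm (P : Module.End ℂ V) :
    Module.End ℂ V →ₗ[ℂ] Module.End ℂ V →ₗ[ℂ] Module.End ℂ V :=
  LinearMap.mk₂ ℂ (fun a b => a * b - b * a + (2 : ℂ) • (oddComponent P b * oddComponent P a))
    (by intro a a' b; simp only [map_add, mul_add, add_mul]; module)
    (by intro c a b; simp only [map_smul, mul_smul_comm, smul_mul_assoc]; module)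
    (by intro a b b'; simp only [map_add, mul_add, add_mul]; module)
    (by intro c a b; simp only [map_smul, mul_smul_comm, smul_mul_assoc]; module)

theorem zmodTwo_cases (i : ZMod 2) : i = 0 ∨ i = 1 := by
  revert i; decide

theorem oddComponent_even {P : Module.End ℂ V} (hP : P * P = 1) {a : Module.End ℂ V}
    (ha : a ∈ superEndPart P 0) : oddComponent P a = 0 := by
  have h : P * a = a * P := by simpa [superEndPart] using ha
  have h2 : P * a * P = a := by rw [h, mul_assoc, hP, mul_one]
  simp [oddComponent, h2]

theorem oddComponent_odd {P : Module.End ℂ V} (hP : P * P = 1) {a : Module.End ℂ V}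
    (ha : a ∈ superEndPart P 1) : oddComponent P a = a := by
  have h : P * a = -(a * P) := by
    have h' : P * a = (-1 : ℂ) ^ (1 : ZMod 2).val • (a * P) := ha
    simpa [ZMod.val_one] using h'
  have h2 : P * a * P = -a := by rw [h, neg_mul, mul_assoc, hP, mul_one]
  simp only [oddComponent, LinearMap.coe_mk, AddHom.coe_mk, h2]
  module

theorem superComm_apply_of_mem {P : Module.End ℂ V} (hP : P * P = 1) {i j : ZMod 2}
    {a b : Module.End ℂ V} (ha : a ∈ superEndPart P i) (hb : b ∈ superEndPart P j) :
    superComm P a b = a * b - (-1 : ℂ) ^ (i.val * j.val) • (b * a) := by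
  have h1 : (1 : ZMod 2).val = 1 := rfl
  have h0 : (0 : ZMod 2).val = 0 := rfl
  rcases zmodTwo_cases i with rfl | rfl <;> rcases zmodTwo_cases j with rfl | rfl
  · simp [superComm, oddComponent_even hP ha, h0]
  · simp [superComm, oddComponent_even hP ha, h0]
  · simp [superComm, oddComponent_even hP hb, h0]
  · simp only [superComm, LinearMap.mk₂_apply, oddComponent_odd hP ha, oddComponent_odd hP hb, h1]
    module

theorem superEndPart_mul {P : Module.End ℂ V} {i j : ZMod 2}
    {a b : Module.End ℂ V} (ha : a ∈ superEndPart P i) (hb : b ∈ superEndPart P j) :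
    a * b ∈ superEndPart P (i + j) := by
  have ha' : P * a = (-1 : ℂ) ^ i.val • (a * P) := ha
  have hb' : P * b = (-1 : ℂ) ^ j.val • (b * P) := hb
  change P * (a * b) = (-1 : ℂ) ^ (i + j).val • (a * b * P)
  rw [← mul_assoc, ha', smul_mul_assoc, mul_assoc, hb', mul_smul_comm, smul_smul, mul_assoc]
  congr 1
  rcases zmodTwo_cases i with rfl | rfl <;> rcases zmodTwo_cases j with rfl | rfl
  · simp
  · simp
  · simp
  · change (-1 : ℂ) ^ 1 * (-1) ^ 1 = (-1) ^ 0
    norm_num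

/-- The endomorphisms of a graded vector space form a Lie superalgebra. -/
abbrev superEnd (P : Module.End ℂ V) (hP : P * P = 1) : LieSuperalgebra (Module.End ℂ V) where
  part := superEndPart P
  isCompl := by
    constructor
    · rw [Submodule.disjoint_def]
      intro a h0 h1
      rw [← oddComponent_odd hP h1, oddComponent_even hP h0]
    · rw [codisjoint_iff, eq_top_iff]
      intro a _
      have key : a = (1 / 2 : ℂ) • (a + P * a * P) + oddComponent P a := by
        simp only [oddComponent, LinearMap.coe_mk, AddHom.coe_mk]; module
      rw [key]
      have e1 : P * (P * a * P) = a * P := by rw [← mul_assoc, ← mul_assoc, hP, one_mul]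
      have e2 : P * a * P * P = P * a := by rw [mul_assoc, hP, mul_one]
      refine Submodule.add_mem_sup ?_ ?_
      · change P * _ = (-1 : ℂ) ^ 0 • _
        rw [mul_smul_comm, mul_add, e1, smul_mul_assoc, add_mul, e2]
        module
      · change P * ((1 / 2 : ℂ) • (a - P * a * P)) =
          (-1 : ℂ) ^ 1 • (((1 / 2 : ℂ) • (a - P * a * P)) * P)
        rw [mul_smul_comm, mul_sub, e1, smul_mul_assoc, sub_mul, e2]
        module
  sbracket := superComm P
  sbracket_mem := by
    intro i j a b ha hb
    rw [superComm_apply_of_mem hP ha hb]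
    refine Submodule.sub_mem _ (superEndPart_mul ha hb) (Submodule.smul_mem _ _ ?_)
    rw [add_comm]
    exact superEndPart_mul hb ha
  sbracket_skew := by
    intro i j a b ha hb
    rw [superComm_apply_of_mem hP ha hb, superComm_apply_of_mem hP hb ha, mul_comm j.val, smul_sub,
      smul_smul, ← pow_add, ← two_mul, pow_mul]
    simp
  jacobi := by
    intro i j k a b c ha hb hc
    have mem : ∀ {i j : ZMod 2} {a b : Module.End ℂ V}, a ∈ superEndPart P i →
        b ∈ superEndPart P j → superComm P a b ∈ superEndPart P (i + j) := by
      intro i j a b ha hb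
      rw [superComm_apply_of_mem hP ha hb]
      refine Submodule.sub_mem _ (superEndPart_mul ha hb) (Submodule.smul_mem _ _ ?_)
      rw [add_comm]
      exact superEndPart_mul hb ha
    rw [superComm_apply_of_mem hP ha (mem hb hc), superComm_apply_of_mem hP (mem ha hb) hc,
      superComm_apply_of_mem hP hb (mem ha hc), superComm_apply_of_mem hP hb hc,
      superComm_apply_of_mem hP ha hb, superComm_apply_of_mem hP ha hc]
    have h00 : ((0 : ZMod 2) + 0).val = 0 := rfl
    have h01 : ((0 : ZMod 2) + 1).val = 1 := rfl
    have h10 : ((1 : ZMod 2) + 0).val = 1 := rfl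
    have h11 : ((1 : ZMod 2) + 1).val = 0 := rfl
    have h0 : (0 : ZMod 2).val = 0 := rfl
    have h1 : (1 : ZMod 2).val = 1 := rfl
    rcases zmodTwo_cases i with rfl | rfl <;> rcases zmodTwo_cases j with rfl | rfl <;>
      rcases zmodTwo_cases k with rfl | rfl <;>
      simp only [h00, h01, h10, h11, h0, h1, mul_zero, mul_one, pow_zero, pow_one,
        one_smul, neg_smul, sub_neg_eq_add] <;> noncomm_ring

end SuperEnd

/-! ### The Kähler-de Rham superalgebra -/

/-- The underlying 8-dimensional space of the Kähler-de Rham superalgebra, with the basis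
`L, Λ, H, d, d^c, d^*, (d^c)^*, Δ` (in this order). -/
abbrev KahlerDeRham : Type := Fin 8 → ℂ

namespace KahlerDeRham

/-- The bracket. The nonzero brackets of basis vectors are
`[L, Λ] = H`, `[H, L] = 2 L`, `[H, Λ] = -2 Λ`, `[H, d] = d`, `[H, d^c] = d^c`, `[H, d^*] = -d^*`,
`[H, (d^c)^*] = -(d^c)^*`, `[Λ, d^c] = d^*`, `[Λ, d] = -(d^c)^*`, `[L, d^*] = d^c`,
`[L, (d^c)^*] = -d`, `{d, d^*} = {d^c, (d^c)^*} = Δ`, and those that follow from them by graded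
anticommutativity. -/
def bracketFun (a b : KahlerDeRham) : KahlerDeRham :=
  ![2 * (a 2 * b 0 - a 0 * b 2),
    -2 * (a 2 * b 1 - a 1 * b 2),
    a 0 * b 1 - a 1 * b 0,
    (a 2 * b 3 - a 3 * b 2) - (a 0 * b 6 - a 6 * b 0),
    (a 2 * b 4 - a 4 * b 2) + (a 0 * b 5 - a 5 * b 0),
    -(a 2 * b 5 - a 5 * b 2) + (a 1 * b 4 - a 4 * b 1),
    -(a 2 * b 6 - a 6 * b 2) - (a 1 * b 3 - a 3 * b 1),
    a 3 * b 5 + a 5 * b 3 + a 4 * b 6 + a 6 * b 4]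

/-- The bracket as a bilinear map. -/
def bracket : KahlerDeRham →ₗ[ℂ] KahlerDeRham →ₗ[ℂ] KahlerDeRham :=
  LinearMap.mk₂ ℂ bracketFun
    (by intro a a' b; ext i; fin_cases i <;> simp [bracketFun] <;> ring)
    (by intro c a b; ext i; fin_cases i <;> simp [bracketFun] <;> ring)
    (by intro a b b'; ext i; fin_cases i <;> simp [bracketFun] <;> ring)
    (by intro c a b; ext i; fin_cases i <;> simp [bracketFun] <;> ring)

/-- `L, Λ, H, Δ` span the even part, `d, d^c, d^*, (d^c)^*` the odd part. -/
def parity : Fin 8 → ZMod 2 := ![0, 0, 0, 1, 1, 1, 1, 0]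

/-- The vectors of parity `i`. -/
def gradedPart (i : ZMod 2) : Submodule ℂ KahlerDeRham where
  carrier := {a | ∀ k, parity k ≠ i → a k = 0}
  add_mem' := by
    intro a b ha hb k hk
    simp [ha k hk, hb k hk]
  zero_mem' := by intro k _; rfl
  smul_mem' := by
    intro c a ha k hk
    simp [ha k hk]

theorem mem_gradedPart_cases {i : ZMod 2} {a : KahlerDeRham} (ha : a ∈ gradedPart i) :
    (i = 0 ∧ a 3 = 0 ∧ a 4 = 0 ∧ a 5 = 0 ∧ a 6 = 0) ∨
    (i = 1 ∧ a 0 = 0 ∧ a 1 = 0 ∧ a 2 = 0 ∧ a 7 = 0) := by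
  rcases zmodTwo_cases i with rfl | rfl
  · exact Or.inl ⟨rfl, ha 3 (by decide), ha 4 (by decide), ha 5 (by decide), ha 6 (by decide)⟩
  · exact Or.inr ⟨rfl, ha 0 (by decide), ha 1 (by decide), ha 2 (by decide), ha 7 (by decide)⟩

instance : LieSuperalgebra KahlerDeRham where
  part := gradedPart
  isCompl := by
    constructor
    · rw [Submodule.disjoint_def]
      intro a h0 h1
      funext k
      rcases zmodTwo_cases (parity k) with h | h
      · exact h1 k (by rw [h]; decide)
      · exact h0 k (by rw [h]; decide)
    · rw [codisjoint_iff, eq_top_iff]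
      intro a _
      have key : a = (fun k => if parity k = 0 then a k else 0) +
          (fun k => if parity k = 0 then 0 else a k) := by
        funext k
        simp only [Pi.add_apply]
        split_ifs <;> simp
      rw [key]
      refine Submodule.add_mem_sup ?_ ?_
      · intro k hk
        exact if_neg hk
      · intro k hk
        rcases zmodTwo_cases (parity k) with h | h
        · exact if_pos h
        · exact absurd h hk
  sbracket := bracket
  sbracket_mem := by
    intro i j a b ha hb k hk
    rcases mem_gradedPart_cases ha with ⟨rfl, a1, a2, a3, a4⟩ | ⟨rfl, a1, a2, a3, a4⟩ <;>
      rcases mem_gradedPart_cases hb with ⟨rfl, b1, b2, b3, b4⟩ | ⟨rfl, b1, b2, b3, b4⟩ <;>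
      fin_cases k <;>
      first
      | exact absurd (by decide) hk
      | simp [bracket, bracketFun, a1, a2, a3, a4, b1, b2, b3, b4]
  sbracket_skew := by
    intro i j a b ha hb
    have h0 : (0 : ZMod 2).val = 0 := rfl
    have h1 : (1 : ZMod 2).val = 1 := rfl
    rcases mem_gradedPart_cases ha with ⟨rfl, a1, a2, a3, a4⟩ | ⟨rfl, a1, a2, a3, a4⟩ <;>
      rcases mem_gradedPart_cases hb with ⟨rfl, b1, b2, b3, b4⟩ | ⟨rfl, b1, b2, b3, b4⟩ <;>
      funext k <;> fin_cases k <;>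
      simp [bracket, bracketFun, a1, a2, a3, a4, b1, b2, b3, b4, h0, h1] <;> ring
  jacobi := by
    intro i j k a b c ha hb hc
    have h0 : (0 : ZMod 2).val = 0 := rfl
    have h1 : (1 : ZMod 2).val = 1 := rfl
    rcases mem_gradedPart_cases ha with ⟨rfl, a1, a2, a3, a4⟩ | ⟨rfl, a1, a2, a3, a4⟩ <;>
      rcases mem_gradedPart_cases hb with ⟨rfl, b1, b2, b3, b4⟩ | ⟨rfl, b1, b2, b3, b4⟩ <;>
      rcases mem_gradedPart_cases hc with ⟨rfl, c1, c2, c3, c4⟩ | ⟨rfl, c1, c2, c3, c4⟩ <;>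
      funext k <;> fin_cases k <;>
      simp [bracket, bracketFun, a1, a2, a3, a4, b1, b2, b3, b4, c1, c2, c3, c4, h0, h1] <;> ring

end KahlerDeRham

/-! ### Complex-valued differential forms on a smooth manifold -/

section Forms

variable (E : Type*) [NormedAddCommGroup E] [NormedSpace ℝ E]
  (M : Type*) [TopologicalSpace M] [ChartedSpace E M]

/-- Complex-valued differential `k`-forms (without a smoothness condition). -/
abbrev DiffForm (k : ℕ) : Type _ :=
  ∀ x : M, TangentSpace 𝓘(ℝ, E) x [⋀^Fin k]→L[ℝ] ℂ

variable {E M}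

/-- The expression of a form in the chart at `x₀`: its pullback along the inverse chart. -/
def DiffForm.inChart {k : ℕ} (η : DiffForm E M k) (x₀ : M) (y : E) : E [⋀^Fin k]→L[ℝ] ℂ :=
  (η ((extChartAt 𝓘(ℝ, E) x₀).symm y)).compContinuousLinearMap
    (mfderiv 𝓘(ℝ, E) 𝓘(ℝ, E) (extChartAt 𝓘(ℝ, E) x₀).symm y)

/-- Smoothness of a form: all its chart expressions are smooth. -/
def DiffForm.IsSmooth {k : ℕ} (η : DiffForm E M k) : Prop :=
  ∀ x₀ : M, ContDiffOn ℝ ∞ (η.inChart x₀) (extChartAt 𝓘(ℝ, E) x₀).target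

/-- The exterior derivative, computed at `x` in the chart at `x`. -/
def DiffForm.d {k : ℕ} (η : DiffForm E M k) : DiffForm E M (k + 1) := fun x =>
  (extDeriv (η.inChart x) (extChartAt 𝓘(ℝ, E) x x)).compContinuousLinearMap
    (mfderiv 𝓘(ℝ, E) 𝓘(ℝ, E) (extChartAt 𝓘(ℝ, E) x) x)

/-- The complex conjugate of a form. -/
def DiffForm.conj {k : ℕ} (η : DiffForm E M k) : DiffForm E M k := fun x =>
  (Complex.conjCLE : ℂ →L[ℝ] ℂ).compContinuousAlternatingMap (η x)

theorem DiffForm.inChart_add {k : ℕ} (α β : DiffForm E M k) (x₀ : M) :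
    (α + β).inChart x₀ = α.inChart x₀ + β.inChart x₀ := rfl

theorem DiffForm.inChart_smul {k : ℕ} (c : ℂ) (α : DiffForm E M k) (x₀ : M) :
    (c • α).inChart x₀ = c • α.inChart x₀ := rfl

end Forms

section Wedge

theorem update_left {T : Type*} {p q : ℕ} (v : Fin (p + q) → T) (i : Fin p) (x : T) :
    (fun i' => Function.update v (Fin.castAdd q i) x (Fin.castAdd q i')) =
      Function.update (fun i' => v (Fin.castAdd q i')) i x :=
  Function.update_comp_eq_of_injective v (Fin.castAdd_injective p q) i x

theorem update_left' {T : Type*} {p q : ℕ} (v : Fin (p + q) → T) (i : Fin p) (x : T) :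
    (fun j => Function.update v (Fin.castAdd q i) x (Fin.natAdd p j)) =
      fun j => v (Fin.natAdd p j) := by
  funext j
  refine Function.update_of_ne (fun h => ?_) x v
  have := congrArg Fin.val h
  simp at this
  omega

theorem update_right {T : Type*} {p q : ℕ} (v : Fin (p + q) → T) (j : Fin q) (x : T) :
    (fun j' => Function.update v (Fin.natAdd p j) x (Fin.natAdd p j')) =
      Function.update (fun j' => v (Fin.natAdd p j')) j x :=
  Function.update_comp_eq_of_injective v (Fin.natAdd_injective q p) j x

theorem update_right' {T : Type*} {p q : ℕ} (v : Fin (p + q) → T) (j : Fin q) (x : T) :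
    (fun i => Function.update v (Fin.natAdd p j) x (Fin.castAdd q i)) =
      fun i => v (Fin.castAdd q i) := by
  funext i
  refine Function.update_of_ne (fun h => ?_) x v
  have := congrArg Fin.val h
  simp at this
  omega

variable {T : Type*} [AddCommGroup T] [Module ℝ T] [TopologicalSpace T]

/-- The tensor product `(v_1, …, v_k) ↦ α(v_1, …, v_p) β(v_{p+1}, …, v_k)`, where `p + q = k`. -/
def altTensor {p q k : ℕ} (h : p + q = k) (α : T [⋀^Fin p]→L[ℝ] ℂ) (β : T [⋀^Fin q]→L[ℝ] ℂ) :
    ContinuousMultilinearMap ℝ (fun _ : Fin k => T) ℂ where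
  toFun v := α (fun i => v (Fin.cast h (Fin.castAdd q i))) *
    β (fun j => v (Fin.cast h (Fin.natAdd p j)))
  map_update_add' := by
    subst h
    intro inst v i x y
    rw [Subsingleton.elim inst (instDecidableEqFin _)]
    induction i using Fin.addCases with
    | left i => simp only [Fin.cast_refl, id, update_left, update_left', α.map_update_add, add_mul]
    | right i =>
      simp only [Fin.cast_refl, id, update_right, update_right', β.map_update_add, mul_add]
  map_update_smul' := by
    subst h
    intro inst v i c x
    rw [Subsingleton.elim inst (instDecidableEqFin _)]
    induction i using Fin.addCases with
    | left i =>
      simp only [Fin.cast_refl, id, update_left, update_left', α.map_update_smul, smul_mul_assoc]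
    | right i =>
      simp only [Fin.cast_refl, id, update_right, update_right', β.map_update_smul, mul_smul_comm]
  cont := by
    refine Continuous.mul (α.cont.comp ?_) (β.cont.comp ?_) <;> fun_prop

/-- The exterior product, normalized so that
`α ∧ β = (1 / (p! q!)) ∑_σ sign(σ) (α ⊗ β) ∘ σ`. -/
def altWedge {p q k : ℕ} (h : p + q = k) (α : T [⋀^Fin p]→L[ℝ] ℂ) (β : T [⋀^Fin q]→L[ℝ] ℂ) :
    T [⋀^Fin k]→L[ℝ] ℂ :=
  ((p.factorial * q.factorial : ℂ)⁻¹) • ContinuousMultilinearMap.alternatization (altTensor h α β)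

/-- The exterior product of differential forms. -/
def DiffForm.wedge {E : Type*} [NormedAddCommGroup E] [NormedSpace ℝ E]
    {M : Type*} [TopologicalSpace M] [ChartedSpace E M] {p q k : ℕ} (h : p + q = k)
    (α : DiffForm E M p) (β : DiffForm E M q) : DiffForm E M k :=
  fun x => altWedge h (α x) (β x)

/-- The powers `η^m` of a 2-form under the exterior product. -/
def DiffForm.wedgePow {E : Type*} [NormedAddCommGroup E] [NormedSpace ℝ E]
    {M : Type*} [TopologicalSpace M] [ChartedSpace E M] (η : DiffForm E M 2) :
    ∀ m : ℕ, DiffForm E M (2 * m)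
  | 0 => fun _ => ContinuousAlternatingMap.constOfIsEmpty ℝ _ (Fin 0) 1
  | m + 1 => DiffForm.wedge (by ring) (DiffForm.wedgePow η m) η

end Wedge

/-! ### Hypercomplex Hermitian manifolds -/

section Hypercomplex

variable (E : Type*) [NormedAddCommGroup E] [NormedSpace ℝ E]
  (M : Type*) [TopologicalSpace M] [ChartedSpace E M] [IsManifold 𝓘(ℝ, E) ∞ M]

/-- A hypercomplex structure: a smooth action of the quaternions on the tangent bundle such that
every almost complex structure `L` in `ℍ`, `L² = -1`, is integrable, that is, its Nijenhuis tensor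
`N(X, Y) = [LX, LY] - L[LX, Y] - L[X, LY] - [X, Y]` vanishes. -/
structure HypercomplexStructure where
  act : ∀ x : M, ℍ[ℝ] →ₐ[ℝ] (TangentSpace 𝓘(ℝ, E) x →L[ℝ] TangentSpace 𝓘(ℝ, E) x)
  contMDiff_act : ∀ q : ℍ[ℝ], ContMDiff 𝓘(ℝ, E) (𝓘(ℝ, E).prod 𝓘(ℝ, E →L[ℝ] E)) ∞
    (fun x => Bundle.TotalSpace.mk' (E →L[ℝ] E)
      (E := fun x : M => TangentSpace 𝓘(ℝ, E) x →L[ℝ] TangentSpace 𝓘(ℝ, E) x) x (act x q))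
  integrable : ∀ L : ℍ[ℝ], L * L = -1 → ∀ (X Y : ∀ x : M, TangentSpace 𝓘(ℝ, E) x) (x : M),
    ContMDiffAt 𝓘(ℝ, E) 𝓘(ℝ, E).tangent ∞ (fun x => (⟨x, X x⟩ : TangentBundle 𝓘(ℝ, E) M)) x →
    ContMDiffAt 𝓘(ℝ, E) 𝓘(ℝ, E).tangent ∞ (fun x => (⟨x, Y x⟩ : TangentBundle 𝓘(ℝ, E) M)) x →
    VectorField.mlieBracket 𝓘(ℝ, E) (fun x => act x L (X x)) (fun x => act x L (Y x)) x
      - act x L (VectorField.mlieBracket 𝓘(ℝ, E) (fun x => act x L (X x)) Y x)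
      - act x L (VectorField.mlieBracket 𝓘(ℝ, E) X (fun x => act x L (Y x)) x)
      - VectorField.mlieBracket 𝓘(ℝ, E) X Y x = 0

/-- A hypercomplex Hermitian structure: a hypercomplex structure together with a Riemannian metric
that is invariant under the unit quaternions. -/
structure HypercomplexHermitian extends HypercomplexStructure E M where
  metric : Bundle.ContMDiffRiemannianMetric 𝓘(ℝ, E) ∞ E (fun x : M => TangentSpace 𝓘(ℝ, E) x)
  invariant : ∀ q : ℍ[ℝ], ‖q‖ = 1 → ∀ (x : M) (v w : TangentSpace 𝓘(ℝ, E) x),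
    metric.inner x (act x q v) (act x q w) = metric.inner x v w

end Hypercomplex

/-- The standard quaternion `J`. -/
def quatJ : ℍ[ℝ] := ⟨0, 0, 1, 0⟩

/-- The standard quaternion `K = I J`. -/
def quatK : ℍ[ℝ] := ⟨0, 0, 0, 1⟩

theorem quatJ_sq : quatJ * quatJ = -1 := by
  have h0 : quatJ.re = 0 := rfl
  have h1 : quatJ.imI = 0 := rfl
  have h2 : quatJ.imJ = 1 := rfl
  have h3 : quatJ.imK = 0 := rfl
  ext <;> simp [h0, h1, h2, h3]

theorem quatK_sq : quatK * quatK = -1 := by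
  have h0 : quatK.re = 0 := rfl
  have h1 : quatK.imI = 0 := rfl
  have h2 : quatK.imJ = 0 := rfl
  have h3 : quatK.imK = 1 := rfl
  ext <;> simp [h0, h1, h2, h3]

theorem norm_eq_one_of_sq {L : ℍ[ℝ]} (hL : L * L = -1) : ‖L‖ = 1 := by
  have h : ‖L‖ * ‖L‖ = 1 := by rw [← norm_mul, hL, norm_neg, norm_one]
  nlinarith [norm_nonneg L]

section Types

variable {E : Type*} [NormedAddCommGroup E] [NormedSpace ℝ E]
  {M : Type*} [TopologicalSpace M] [ChartedSpace E M] [IsManifold 𝓘(ℝ, E) ∞ M]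

/-- A form has type `(p, q)` with respect to the complex structure `I` if
`η(z v_1, …, z v_k) = z^p \bar z^q η(v_1, …, v_k)` for all complex numbers `z`; here
`z = a + b √-1` acts on tangent vectors as `a + b I`. -/
def HypercomplexStructure.IsType (X : HypercomplexStructure E M) {k : ℕ} (p q : ℕ)
    (η : DiffForm E M k) : Prop :=
  ∀ (x : M) (z : ℂ) (v : Fin k → TangentSpace 𝓘(ℝ, E) x),
    η x (fun i => X.act x (z : ℍ[ℝ]) (v i)) = z ^ p * (starRingEnd ℂ z) ^ q * η x v

/-- `β = ∂η` for a form `η` of type `(p, q)`: the form `β` is the `(p + 1, q)`-part of `dη`, the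
rest `dη - β = \bar∂η` having type `(p, q + 1)`. -/
def HypercomplexStructure.IsDel (X : HypercomplexStructure E M) {k : ℕ} (p q : ℕ)
    (η : DiffForm E M k) (β : DiffForm E M (k + 1)) : Prop :=
  X.IsType (p + 1) q β ∧ X.IsType p (q + 1) (η.d - β)

/-- The multiplicative action of `J` on forms, `(Jη)(v_1, …, v_k) = η(J v_1, …, J v_k)`. -/
def HypercomplexStructure.actJ (X : HypercomplexStructure E M) {k : ℕ} (η : DiffForm E M k) :
    DiffForm E M k :=
  fun x => (η x).compContinuousLinearMap (X.act x quatJ)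

/-- The space `Λ^{p,0}(M, I)` of smooth forms of type `(p, 0)`. -/
def HypercomplexStructure.formsP0 (X : HypercomplexStructure E M) (p : ℕ) :
    Submodule ℂ (DiffForm E M p) where
  carrier := {η | η.IsSmooth ∧ X.IsType p 0 η}
  add_mem' := by
    rintro α β ⟨hα, hα'⟩ ⟨hβ, hβ'⟩
    refine ⟨fun x₀ => ?_, fun x z v => ?_⟩
    · rw [DiffForm.inChart_add]
      exact (hα x₀).add (hβ x₀)
    · have h1 := hα' x z v
      have h2 := hβ' x z v
      simp only [Pi.add_apply, ContinuousAlternatingMap.add_apply, h1, h2]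
      ring
  zero_mem' := by
    refine ⟨fun x₀ => ?_, fun x z v => by simp⟩
    exact (contDiffOn_const (c := (0 : E [⋀^Fin p]→L[ℝ] ℂ)))
  smul_mem' := by
    rintro c α ⟨hα, hα'⟩
    refine ⟨fun x₀ => ?_, fun x z v => ?_⟩
    · rw [DiffForm.inChart_smul]
      exact (hα x₀).const_smul c
    · have h1 := hα' x z v
      simp only [Pi.smul_apply, ContinuousAlternatingMap.smul_apply, h1, smul_eq_mul]
      ring

/-- The space `Λ^{*,0}(M, I) = ⨁_p Λ^{p,0}(M, I)`; since `Λ^{p,0} = 0` for large `p`, the product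
is the direct sum. It is also the space of half-forms, i.e. of smooth sections of
`Λ^{*,0}(M, I) ⊗ K^{1/2}`: the bundle `K^{1/2}` is the trivial smooth line bundle, trivialized by
the square root of the section `Ω^n` of the canonical bundle `K`, and only the differential of the
half-forms depends on its connection. -/
def HypercomplexStructure.HalfForms (X : HypercomplexStructure E M) : Type _ :=
  ∀ p : ℕ, X.formsP0 p

instance (X : HypercomplexStructure E M) : AddCommGroup X.HalfForms :=
  inferInstanceAs (AddCommGroup (∀ p : ℕ, X.formsP0 p))

instance (X : HypercomplexStructure E M) : Module ℂ X.HalfForms :=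
  inferInstanceAs (Module ℂ (∀ p : ℕ, X.formsP0 p))

/-- The involution that is `(-1)^p` on `p`-forms. -/
def HypercomplexStructure.degreeParity (X : HypercomplexStructure E M) :
    Module.End ℂ X.HalfForms where
  toFun η p := (-1 : ℂ) ^ p • η p
  map_add' α β := by funext p; exact smul_add _ (α p) (β p)
  map_smul' c α := by funext p; exact smul_comm ((-1 : ℂ) ^ p) c (α p)

theorem HypercomplexStructure.degreeParity_sq (X : HypercomplexStructure E M) :
    X.degreeParity * X.degreeParity = 1 := by
  ext1 η
  funext p
  change (-1 : ℂ) ^ p • ((-1 : ℂ) ^ p • η p) = η p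
  rw [smul_smul, ← mul_pow]
  simp

/-- `End(Λ^{*,0}(M, I))` as a Lie superalgebra, for the parity of the degree of forms. -/
instance (X : HypercomplexStructure E M) : LieSuperalgebra (Module.End ℂ X.HalfForms) :=
  superEnd X.degreeParity X.degreeParity_sq

end Types

section HKT

variable {E : Type*} [NormedAddCommGroup E] [NormedSpace ℝ E]
  {M : Type*} [TopologicalSpace M] [ChartedSpace E M] [IsManifold 𝓘(ℝ, E) ∞ M]

namespace HypercomplexHermitian

/-- The 2-form `ω_L(v, w) = g(v, L w)` of an induced complex structure `L`. -/
def omega (X : HypercomplexHermitian E M) (L : ℍ[ℝ]) (hL : L * L = -1) (x : M) :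
    TangentSpace 𝓘(ℝ, E) x [⋀^Fin 2]→L[ℝ] ℝ where
  toFun v := X.metric.inner x (v 0) (X.act x L (v 1))
  map_update_add' := by
    intro inst v i a b
    rw [Subsingleton.elim inst (instDecidableEqFin _)]
    fin_cases i <;> simp
  map_update_smul' := by
    intro inst v i c a
    rw [Subsingleton.elim inst (instDecidableEqFin _)]
    fin_cases i <;> simp
  cont := by
    have h : ∀ (g : E →L[ℝ] E →L[ℝ] ℝ) (A : E →L[ℝ] E),
        Continuous fun v : Fin 2 → E => g (v 0) (A (v 1)) := by
      intro g A
      fun_prop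
    exact h (X.metric.inner x) (X.act x L)
  map_eq_zero_of_eq' := by
    intro v i j hv hij
    have key : ∀ w : TangentSpace 𝓘(ℝ, E) x, X.metric.inner x w (X.act x L w) = 0 := by
      intro w
      have h1 := X.invariant L (norm_eq_one_of_sq hL) x w (X.act x L w)
      have h2 : X.act x L (X.act x L w) = -w := by
        rw [← mul_apply_eq_comp, ← map_mul, hL, map_neg, map_one]
        rfl
      rw [h2, map_neg, X.metric.symm] at h1
      linarith
    have h01 : v 0 = v 1 := by
      fin_cases i <;> fin_cases j <;> first | exact hv | exact hv.symm | exact absurd rfl hij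
    change X.metric.inner x (v 0) (X.act x L (v 1)) = 0
    rw [h01]
    exact key _

/-- The form `Ω = (ω_J + √-1 ω_K) / 2`. -/
def Omega (X : HypercomplexHermitian E M) : DiffForm E M 2 := fun x =>
  (1 / 2 : ℂ) • (Complex.ofRealCLM.compContinuousAlternatingMap (X.omega quatJ quatJ_sq x) +
    Complex.I • Complex.ofRealCLM.compContinuousAlternatingMap (X.omega quatK quatK_sq x))

/-- The HKT condition `∂Ω = 0`. -/
def IsHKT (X : HypercomplexHermitian E M) : Prop := X.IsDel 2 0 X.Omega 0

/-- The pointwise Hermitian product of two half-forms, computed in a family `e` of tangent vectors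
at `x`, which is meant to be an orthonormal basis: it is
`∑_k (1 / k!) ∑_{i_1, …, i_k} α_k(e_{i_1}, …, e_{i_k}) \overline{β_k(e_{i_1}, …, e_{i_k})}`. -/
def hermProd (X : HypercomplexHermitian E M) {m : ℕ} {x : M}
    (e : Fin m → TangentSpace 𝓘(ℝ, E) x) (α β : X.HalfForms) : ℂ :=
  ∑ k ∈ Finset.range (m + 1), ((k.factorial : ℂ)⁻¹) *
    ∑ i : Fin k → Fin m, (α k).1 x (fun j => e (i j)) * starRingEnd ℂ ((β k).1 x (fun j => e (i j)))

/-- `S` is the (pointwise) Hermitian adjoint of `T`. -/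
def IsHermitianAdjoint (X : HypercomplexHermitian E M) (T S : Module.End ℂ X.HalfForms) : Prop :=
  ∀ (x : M) (e : Fin (Module.finrank ℝ E) → TangentSpace 𝓘(ℝ, E) x),
    (∀ i j, X.metric.inner x (e i) (e j) = if i = j then 1 else 0) →
    ∀ α β : X.HalfForms, X.hermProd e (T α) β = X.hermProd e α (S β)

/-- The operators on the half-forms of a hypercomplex Hermitian manifold of quaternionic
dimension `n`. Each of them is determined by its defining property. -/
structure Operators (X : HypercomplexHermitian E M) (n : ℕ) where
  /-- the form `θ` of type `(1, 0)` with `∂(\bar Ω^n) = θ ∧ \bar Ω^n` -/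
  theta : X.formsP0 1
  theta_spec : X.IsDel 0 (2 * n) (X.Omega.conj.wedgePow n)
    (DiffForm.wedge (Nat.add_comm 1 (2 * n)) theta.1 (X.Omega.conj.wedgePow n))
  /-- the antilinear operator `J_c(η) = J(\bar η)` -/
  Jc : X.HalfForms ≃ₛₗ[starRingEnd ℂ] X.HalfForms
  Jc_spec : ∀ η p, (Jc η p).1 = X.actJ (η p).1.conj
  /-- the operator `L_Ω` of multiplication by `Ω` -/
  L : Module.End ℂ X.HalfForms
  L_spec : ∀ η, L η 0 = 0 ∧ L η 1 = 0 ∧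
    ∀ p, (L η (p + 2)).1 = DiffForm.wedge (Nat.add_comm 2 p) X.Omega (η p).1
  /-- the operator `Λ_Ω`, the Hermitian adjoint of `L_Ω` -/
  Lam : Module.End ℂ X.HalfForms
  Lam_spec : X.IsHermitianAdjoint L Lam
  /-- the operator `H_Ω = [L_Ω, Λ_Ω]` -/
  H : Module.End ℂ X.HalfForms
  H_spec : H = L * Lam - Lam * L
  /-- the differential `ⁿ∂ = ∂ + θ/2` -/
  del : Module.End ℂ X.HalfForms
  del_spec : ∀ η, del η 0 = 0 ∧ ∀ p, ∃ β : DiffForm E M (p + 1), X.IsDel p 0 (η p).1 β ∧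
    (del η (p + 1)).1 =
      β + (1 / 2 : ℂ) • DiffForm.wedge (Nat.add_comm 1 p) theta.1 (η p).1
  /-- the twisted differential `ⁿ∂_J = J_c ∘ ⁿ∂ ∘ J_c⁻¹` -/
  delJ : Module.End ℂ X.HalfForms
  delJ_spec : ∀ η, delJ η = Jc (del (Jc.symm η))

end HypercomplexHermitian

end HKT

end

noncomputable section

set_option linter.unusedSectionVars false
set_option linter.unusedSimpArgs false
set_option linter.unusedVariables false
/-! ### The graded algebra of alternating forms on a vector space -/

/-! The half-forms embed, by `emb`, into the space of all smooth complex forms, where `∂`, `∂_J`,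
`Λ_Ω` and the products with `Ω` and `θ` are restrictions of globally defined operators. Identities
are proved there and brought back by injectivity of the embedding. The operators in `Operators` are
known only through their defining properties, so each is first identified with a concrete one: `∂`
by uniqueness of the type decomposition (`IsDel.unique`), `Λ_Ω` by nondegeneracy of the Hermitian
product.

The `sl₂`-relations are linear algebra. With an orthonormal basis `e_j`, the adjoint of `Ω ∧ ·` on
forms of type `(*, 0)` is `½ ∑ ι_{e_j} ι_{J e_j}`, and its commutator with `Ω ∧ ·` is `n` minus the
degree (`lam_wedge`). Hence `H_Ω` is the degree minus `n`. The `sl₂`-strings also show that `Ω^n` is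
nonzero and spans the forms of type `(2n, 0)`, and that there are no forms of type `(p, 0)` with `p
> 2n`.

For the differentials, integrability of a complex structure `L` is used in operator form: `d L^* =
-L^* [δ_L, d]`, where `δ_L` is the derivation of the exterior algebra induced by `L`
(`altz_pullDeriv`, `d_pull`). For `L = I` this gives `[δ_I, [δ_I, d]] = -d`, so that `∂ = ½ (d - √-1
[δ_I, d])` is the part of `d` of weight `√-1` (`holPart`). For `L = J` it identifies `J d J⁻¹` with
`[δ_J, d]`, which anticommutes with `d` because `d² = 0`. Projecting to the weight `√-1` parts
yields `∂² = ∂_J² = {∂, ∂_J} = 0` (`anticomm_holPart`).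

For the twist by `θ`, let `Φ = \bar Ω^n`. Then `∂Φ = θ ∧ Φ` and, since `Φ` is fixed by `J_c`, also
`∂_J Φ = J_c θ ∧ Φ`. The anticommutators of `∂` and `∂_J` kill `Φ`; written out, this says that the
products of `∂θ`, `∂_J J_c θ` and `∂ J_c θ + ∂_J θ` with `Φ` vanish (`twist_curvature`).
Multiplication by `Φ` is injective on forms of type `(*, 0)`, so these curvature terms vanish, and
the twisted differentials square to zero and anticommute (`twist_anticomm`). The HKT condition makes
them commute with `L_Ω`.

Everything else is algebra. Under the adjoint action of `sl₂` the operators `ⁿ∂` and `ⁿ∂_J` have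
weight `1` and are annihilated by `L`. As `Λ` is nilpotent, this forces `[Λ, [Λ, ·]]` to vanish on
them (`adL_adL_eq_zero`): the result would be a vector of weight `-3` annihilated by `L`. Applying
`ad Λ` repeatedly to the known relations produces all remaining brackets of the Kähler-de Rham
superalgebra; no Kähler identity has to be computed for `Λ` and a first order operator.

This gives a representation whose range is the generated superalgebra. Iterated brackets carry each
coordinate of an element of the kernel into a multiple of `Δ`, so the representation is faithful
once the Laplacian is nonzero. For that, take a real function `f` with `f(x) = 0` and `df(x) ≠ 0`:
at `x` the Laplacian of `f²` is `2 Λ(∂_J f ∧ ∂f)`, minus a nonzero sum of squares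
(`lam_wedge_one_forms`, `lap_ne_zero`).

Existence of the operators also needs the form `θ`: the form `∂(\bar Ω^n)` has type `(1, 2n)`, hence
is divisible by `\bar Ω^n`, with a smooth quotient. -/

section Alternatization

open ContinuousAlternatingMap

/-- Permutations of `Fin (k + 1)`, by the image of `0` and a permutation of the rest. -/
theorem sum_perm_succ {A : Type*} [AddCommMonoid A] {k : ℕ}
    (f : Equiv.Perm (Fin (k + 1)) → A) :
    ∑ σ, f σ = ∑ i : Fin (k + 1), ∑ τ : Equiv.Perm (Fin k),
      f (i.cycleRange.symm * Equiv.Perm.decomposeFin.symm (0, τ)) := by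
  rw [← Fintype.sum_prod_type']
  symm
  refine Fintype.sum_bijective
    (fun x : Fin (k + 1) × Equiv.Perm (Fin k) =>
      x.1.cycleRange.symm * Equiv.Perm.decomposeFin.symm (0, x.2)) ?_ _ _ (fun _ => rfl)
  rw [Fintype.bijective_iff_injective_and_card]
  constructor
  · rintro ⟨i, τ⟩ ⟨j, ρ⟩ h
    have h0 : i = j := by
      have := congrArg (fun s : Equiv.Perm (Fin (k + 1)) => s 0) h
      simpa using this
    subst h0
    have h1 := mul_left_cancel h
    have h2 := Equiv.Perm.decomposeFin.symm.injective h1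
    simpa using h2
  · exact (Fintype.card_congr Equiv.Perm.decomposeFin).symm

variable {E : Type*} [NormedAddCommGroup E] [NormedSpace ℝ E]

/-- Laplace expansion along the first slot: the permutations are sorted by the image `i` of `0`, and
the cycle that carries `0` to `i` has sign `(-1)^i`. -/
theorem alternatization_apply_succ {k : ℕ}
    (m : ContinuousMultilinearMap ℝ (fun _ : Fin (k + 1) => E) ℂ) (v : Fin (k + 1) → E) :
    ContinuousMultilinearMap.alternatization m v =
      ∑ i : Fin (k + 1), (-1 : ℤ) ^ (i : ℕ) •
        ContinuousMultilinearMap.alternatization (m.curryLeft (v i)) (i.removeNth v) := by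
  rw [ContinuousMultilinearMap.alternatization_apply_apply, sum_perm_succ]
  refine Finset.sum_congr rfl fun i _ => ?_
  rw [ContinuousMultilinearMap.alternatization_apply_apply, Finset.smul_sum]
  refine Finset.sum_congr rfl fun τ _ => ?_
  have hs : Equiv.Perm.sign (i.cycleRange.symm * Equiv.Perm.decomposeFin.symm (0, τ)) =
      (-1) ^ (i : ℕ) * Equiv.Perm.sign τ := by
    rw [Equiv.Perm.sign_mul, Equiv.Perm.sign_symm, Fin.sign_cycleRange,
      Equiv.Perm.decomposeFin.symm_sign]
    simp
  have hv : v ∘ (i.cycleRange.symm * Equiv.Perm.decomposeFin.symm (0, τ)) =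
      Fin.cons (v i) (i.removeNth v ∘ τ) := by
    funext j
    refine Fin.cases ?_ (fun j => ?_) j
    · simp
    · simp [Fin.removeNth]
  rw [hs, hv, mul_smul, ContinuousMultilinearMap.curryLeft_apply]
  rw [Units.smul_def, Units.val_pow_eq_pow_val, Units.val_neg, Units.val_one]

end Alternatization

section Wedge

variable {E : Type*} [NormedAddCommGroup E] [NormedSpace ℝ E]

theorem altWedge_apply {p q k : ℕ} (h : p + q = k) (α : E [⋀^Fin p]→L[ℝ] ℂ)
    (β : E [⋀^Fin q]→L[ℝ] ℂ) (v : Fin k → E) :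
    altWedge h α β v = ((p.factorial * q.factorial : ℂ)⁻¹) *
      ∑ σ : Equiv.Perm (Fin k), ((Equiv.Perm.sign σ : ℤ) : ℂ) *
        (α (fun i => v (σ (Fin.cast h (Fin.castAdd q i)))) *
          β (fun j => v (σ (Fin.cast h (Fin.natAdd p j))))) := by
  rw [altWedge, ContinuousAlternatingMap.smul_apply,
    ContinuousMultilinearMap.alternatization_apply_apply, smul_eq_mul]
  congr 1
  refine Finset.sum_congr rfl fun σ _ => ?_
  rw [Units.smul_def, zsmul_eq_mul]
  rfl

/-- All `q!` permutations contribute the same term, because `β` is alternating; this cancels the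
normalizing factor. -/
theorem altWedge_zero_left {q k : ℕ} (h : 0 + q = k) (α : E [⋀^Fin 0]→L[ℝ] ℂ)
    (β : E [⋀^Fin q]→L[ℝ] ℂ) (v : Fin k → E) :
    altWedge h α β v = α 0 * β (fun j => v (Fin.cast (by omega) j)) := by
  obtain rfl : q = k := by omega
  rw [altWedge_apply]
  have key : ∀ σ : Equiv.Perm (Fin q), ((Equiv.Perm.sign σ : ℤ) : ℂ) *
        (α (fun i => v (σ (Fin.cast h (Fin.castAdd q i)))) *
          β (fun j => v (σ (Fin.cast h (Fin.natAdd 0 j))))) = α 0 * β v := by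
    intro σ
    have h1 : (fun i => v (σ (Fin.cast h (Fin.castAdd q i)))) = (0 : Fin 0 → E) :=
      Subsingleton.elim _ _
    have h2 : (fun j => v (σ (Fin.cast h (Fin.natAdd 0 j)))) = v ∘ σ := by
      funext j
      congr 2
      ext
      simp
    rw [h1, h2]
    have h3 := β.toAlternatingMap.map_perm v σ
    simp only [ContinuousAlternatingMap.coe_toAlternatingMap] at h3
    rw [h3, Units.smul_def, zsmul_eq_mul]
    rcases Int.units_eq_one_or (Equiv.Perm.sign σ) with h | h <;> simp [h]
  rw [Finset.sum_congr rfl fun σ _ => key σ, Finset.sum_const, Finset.card_univ, Fintype.card_perm,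
    Fintype.card_fin, nsmul_eq_mul]
  have : (q.factorial : ℂ) ≠ 0 := by exact_mod_cast q.factorial_ne_zero
  simp only [Nat.factorial_zero, Nat.cast_one, one_mul, Fin.cast_refl]
  field_simp
  rfl

/-- `(p + 1) α ∧ β` is the alternatization of `v ↦ (ι_v α) ∧ β`. -/
theorem altWedge_succ_left {p q k : ℕ} (h : p + 1 + q = k + 1) (α : E [⋀^Fin (p + 1)]→L[ℝ] ℂ)
    (β : E [⋀^Fin q]→L[ℝ] ℂ) (v : Fin (k + 1) → E) :
    ((p : ℂ) + 1) * altWedge h α β v =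
      ∑ i : Fin (k + 1), (-1 : ℤ) ^ (i : ℕ) •
        altWedge (k := k) (by omega) (α.curryLeft (v i)) β (i.removeNth v) := by
  rw [altWedge, ContinuousAlternatingMap.smul_apply, alternatization_apply_succ, smul_eq_mul,
    Finset.mul_sum, Finset.mul_sum]
  refine Finset.sum_congr rfl fun i _ => ?_
  rw [altWedge, ContinuousAlternatingMap.smul_apply, smul_eq_mul]
  have h1 : (altTensor h α β).curryLeft (v i) =
      altTensor (k := k) (by omega) (α.curryLeft (v i)) β := by
    ext w
    change α _ * β _ = α _ * β _
    congr 2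
    · funext j
      refine Fin.cases ?_ (fun j => ?_) j
      · rfl
      · have : Fin.cast h (Fin.castAdd q j.succ) =
          Fin.succ (Fin.cast (by omega : p + q = k) (Fin.castAdd q j)) := rfl
        rw [this, Fin.cons_succ]
        rfl
    · funext j
      have : Fin.cast h (Fin.natAdd (p + 1) j) =
          Fin.succ (Fin.cast (by omega : p + q = k) (Fin.natAdd p j)) := by
        ext; simp; omega
      rw [this, Fin.cons_succ]
  rw [h1, Nat.factorial_succ]
  have hp : (p.factorial : ℂ) ≠ 0 := by exact_mod_cast p.factorial_ne_zero
  have hq : (q.factorial : ℂ) ≠ 0 := by exact_mod_cast q.factorial_ne_zero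
  have hp1 : (p : ℂ) + 1 ≠ 0 := by exact_mod_cast p.succ_ne_zero
  push_cast
  simp only [zsmul_eq_mul]
  field_simp

theorem altWedge_add_left {p q k : ℕ} (h : p + q = k) (α α' : E [⋀^Fin p]→L[ℝ] ℂ)
    (β : E [⋀^Fin q]→L[ℝ] ℂ) : altWedge h (α + α') β = altWedge h α β + altWedge h α' β := by
  ext v
  simp only [altWedge_apply, ContinuousAlternatingMap.add_apply, ← mul_add,
    ← Finset.sum_add_distrib, add_mul]

theorem altWedge_add_right {p q k : ℕ} (h : p + q = k) (α : E [⋀^Fin p]→L[ℝ] ℂ)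
    (β β' : E [⋀^Fin q]→L[ℝ] ℂ) : altWedge h α (β + β') = altWedge h α β + altWedge h α β' := by
  ext v
  simp only [altWedge_apply, ContinuousAlternatingMap.add_apply, ← mul_add,
    ← Finset.sum_add_distrib]

theorem altWedge_zero_form_left {p q k : ℕ} (h : p + q = k) (β : E [⋀^Fin q]→L[ℝ] ℂ) :
    altWedge h (0 : E [⋀^Fin p]→L[ℝ] ℂ) β = 0 := by
  ext v
  simp [altWedge_apply]

theorem altWedge_smul_left {p q k : ℕ} (h : p + q = k) (c : ℂ) (α : E [⋀^Fin p]→L[ℝ] ℂ)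
    (β : E [⋀^Fin q]→L[ℝ] ℂ) : altWedge h (c • α) β = c • altWedge h α β := by
  ext v
  simp only [altWedge_apply, ContinuousAlternatingMap.smul_apply, smul_eq_mul, Finset.mul_sum]
  exact Finset.sum_congr rfl fun _ _ => by ring

theorem altWedge_smul_right {p q k : ℕ} (h : p + q = k) (c : ℂ) (α : E [⋀^Fin p]→L[ℝ] ℂ)
    (β : E [⋀^Fin q]→L[ℝ] ℂ) : altWedge h α (c • β) = c • altWedge h α β := by
  ext v
  simp only [altWedge_apply, ContinuousAlternatingMap.smul_apply, smul_eq_mul, Finset.mul_sum]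
  exact Finset.sum_congr rfl fun _ _ => by ring

end Wedge

/-! ### Total forms -/

section Total

variable (E : Type*) [NormedAddCommGroup E] [NormedSpace ℝ E]

/-- Families of complex-valued alternating forms, one in each degree. -/
abbrev Tot : Type _ := ∀ k : ℕ, E [⋀^Fin k]→L[ℝ] ℂ

variable {E}

namespace Tot

theorem smul_zero' (c : ℂ) : c • (0 : Tot E) = 0 := by module

theorem zero_smul' (x : Tot E) : (0 : ℂ) • x = 0 := by module

theorem add_smul' (c d : ℂ) (x : Tot E) : (c + d) • x = c • x + d • x := by module

theorem sum_smul' {κ : Type*} [Fintype κ] (c : κ → ℂ) (x : Tot E) :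
    (∑ i, c i) • x = ∑ i, c i • x := by
  funext k
  ext v
  simp [Finset.sum_mul]

theorem real_smul (c : ℝ) (x : Tot E) : c • x = (c : ℂ) • x := rfl

/-- The interior product with a vector, as a bilinear map. -/
def contr : E →ₗ[ℝ] Tot E →ₗ[ℂ] Tot E where
  toFun v :=
    { toFun := fun x k => (x (k + 1)).curryLeft v
      map_add' := fun x y => by funext k; rfl
      map_smul' := fun c x => by funext k; rfl }
  map_add' v w := by
    ext1 x; funext k; exact (x (k + 1)).curryLeft.map_add v w
  map_smul' c v := by
    ext1 x; funext k; exact (x (k + 1)).curryLeft.map_smul c v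

theorem contr_apply (v : E) (x : Tot E) (k : ℕ) : contr v x k = (x (k + 1)).curryLeft v := rfl

theorem contr_apply_apply (v : E) (x : Tot E) (k : ℕ) (w : Fin k → E) :
    contr v x k w = x (k + 1) (Matrix.vecCons v w) := rfl

/-- The engine of the inductions on the degree: an identity is checked after one interior product,
which lowers the degree. The inductions start with `zero_ext`. -/
theorem succ_ext {x y : Tot E} {k : ℕ} (h : ∀ v, contr v x k = contr v y k) :
    x (k + 1) = y (k + 1) := by
  ext v
  have := congrArg (fun a => a (Fin.tail v)) (h (v 0))
  simp only [contr_apply_apply] at this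
  rw [← Fin.cons_self_tail v]
  exact this

/-- A form of degree zero has a single value. -/
theorem zero_ext {x y : Tot E} (h : x 0 0 = y 0 0) : x 0 = y 0 := by
  ext v
  rw [Subsingleton.elim v 0]
  exact h

/-- Polarization of `ι_u ι_u = 0`. -/
theorem contr_contr (v w : E) (x : Tot E) : contr v (contr w x) = -contr w (contr v x) := by
  have h : ∀ u, contr u (contr u x) = 0 := by
    intro u
    funext k
    exact ContinuousAlternatingMap.curryLeft_same (x (k + 2)) u
  have h1 := h (w + v)
  simp only [map_add, LinearMap.add_apply, h, zero_add, add_zero] at h1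
  exact eq_neg_of_add_eq_zero_left h1

/-- The interior products of a fixed form. -/
def contrAt (x : Tot E) : E →ₗ[ℝ] Tot E where
  toFun v := contr v x
  map_add' v w := by rw [map_add]; rfl
  map_smul' c v := by rw [map_smul]; rfl

@[simp] theorem contrAt_apply (x : Tot E) (v : E) : contrAt x v = contr v x := rfl

/-- The form concentrated in degree `k`. -/
def single (k : ℕ) (α : E [⋀^Fin k]→L[ℝ] ℂ) : Tot E := Pi.single k α

theorem single_same (k : ℕ) (α : E [⋀^Fin k]→L[ℝ] ℂ) : single k α k = α := Pi.single_eq_same _ _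

theorem single_of_ne {k l : ℕ} (h : l ≠ k) (α : E [⋀^Fin k]→L[ℝ] ℂ) : single k α l = 0 :=
  Pi.single_eq_of_ne h _

/-- The total form equal to `1` in degree zero. -/
def one : Tot E := single 0 (ContinuousAlternatingMap.constOfIsEmpty ℝ E (Fin 0) 1)

/-- The parity involution. -/
def par : Tot E →ₗ[ℂ] Tot E where
  toFun x k := (-1 : ℂ) ^ k • x k
  map_add' x y := by funext k; exact smul_add _ _ _
  map_smul' c x := by funext k; exact smul_comm ((-1 : ℂ) ^ k) c (x k)

theorem par_apply (x : Tot E) (k : ℕ) : par x k = (-1 : ℂ) ^ k • x k := rfl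

theorem par_zero_deg (x : Tot E) : par x 0 0 = x 0 0 := by
  rw [par_apply, pow_zero, one_smul]

@[simp] theorem par_par (x : Tot E) : par (par x) = x := by
  funext k
  rw [par_apply, par_apply, smul_smul, ← mul_pow]
  simp

theorem contr_par (v : E) (x : Tot E) : contr v (par x) = -par (contr v x) := by
  funext k
  rw [Pi.neg_apply, par_apply, contr_apply, contr_apply, par_apply, pow_succ]
  ext w
  simp

/-- The number operator, multiplication by the degree. -/
def deg : Tot E →ₗ[ℂ] Tot E where
  toFun x k := (k : ℂ) • x k
  map_add' x y := by funext k; exact smul_add _ _ _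
  map_smul' c x := by funext k; exact smul_comm (k : ℂ) c (x k)

theorem deg_apply (x : Tot E) (k : ℕ) : deg x k = (k : ℂ) • x k := rfl

/-- The components of a product live in degrees written `k - i`; this moves between propositionally
equal degrees without casts. -/
theorem altWedge_congr {p q q' k : ℕ} (h : p + q = k) (h' : p + q' = k)
    (α : E [⋀^Fin p]→L[ℝ] ℂ) (y : Tot E) : altWedge h α (y q) = altWedge h' α (y q') := by
  obtain rfl : q = q' := by omega
  rfl

/-- The exterior product of total forms. -/
def wedge : Tot E →ₗ[ℂ] Tot E →ₗ[ℂ] Tot E :=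
  LinearMap.mk₂ ℂ (fun x y k => ∑ i : Fin (k + 1),
      altWedge (by omega : (i : ℕ) + (k - i) = k) (x i) (y (k - i)))
    (by
      intro x x' y; funext k
      simp only [Pi.add_apply, altWedge_add_left, Finset.sum_add_distrib])
    (by
      intro c x y; funext k
      simp only [Pi.smul_apply, altWedge_smul_left, Finset.smul_sum])
    (by
      intro x y y'; funext k
      simp only [Pi.add_apply, altWedge_add_right, Finset.sum_add_distrib])
    (by
      intro c x y; funext k
      simp only [Pi.smul_apply, altWedge_smul_right, Finset.smul_sum])

/-- The exterior product of total forms. -/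
notation:70 x:70 "⋏" y:71 => Tot.wedge x y

theorem wedge_apply (x y : Tot E) (k : ℕ) : (x ⋏ y) k = ∑ i : Fin (k + 1),
    altWedge (by omega : (i : ℕ) + (k - i) = k) (x i) (y (k - i)) := rfl

theorem single_wedge {a b k : ℕ} (h : a + b = k) (α : E [⋀^Fin a]→L[ℝ] ℂ) (y : Tot E) :
    (single a α ⋏ y) k = altWedge h α (y b) := by
  rw [wedge_apply, Finset.sum_eq_single (⟨a, by omega⟩ : Fin (k + 1))]
  · simp only
    rw [altWedge_congr _ h]
    rw [single_same]
  · intro i _ hi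
    have : (i : ℕ) ≠ a := fun hh => hi (Fin.ext hh)
    rw [single_of_ne this]
    ext v
    simp [altWedge_apply]
  · simp

theorem single_wedge_of_lt {a k : ℕ} (h : k < a) (α : E [⋀^Fin a]→L[ℝ] ℂ) (y : Tot E) :
    (single a α ⋏ y) k = 0 := by
  rw [wedge_apply]
  refine Finset.sum_eq_zero fun i _ => ?_
  have : (i : ℕ) ≠ a := by have := i.2; omega
  rw [single_of_ne this]
  ext v
  simp [altWedge_apply]

theorem single_zero_wedge (f : E [⋀^Fin 0]→L[ℝ] ℂ) (y : Tot E) :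
    single 0 f ⋏ y = f 0 • y := by
  funext k
  rw [single_wedge (zero_add k)]
  ext v
  rw [altWedge_zero_left]
  rfl

@[simp] theorem one_wedge (y : Tot E) : one ⋏ y = y := by
  rw [one, single_zero_wedge]
  simp

@[simp] theorem deg_single_zero (f : E [⋀^Fin 0]→L[ℝ] ℂ) : deg (single 0 f) = 0 := by
  funext k
  rw [deg_apply]
  cases k with
  | zero => rw [Nat.cast_zero]; exact zero_smul ℂ (single 0 f 0)
  | succ k => rw [single_of_ne (by omega)]; ext v; simp

/-- Division by the degree. Through Euler's identity it presents a form, up to its function part, as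
an alternatization of contractions; `contr_wedge` rests on this. -/
theorem eq_single_zero_add_deg (x : Tot E) : ∃ y : Tot E, x = single 0 (x 0) + deg y := by
  -- In degree zero the scalar is `0⁻¹ = 0`; that component is carried by `single 0 (x 0)`.
  refine ⟨fun k => (k : ℂ)⁻¹ • x k, ?_⟩
  funext k
  rw [Pi.add_apply, deg_apply]
  cases k with
  | zero =>
    rw [single_same, Nat.cast_zero]
    ext v
    simp
  | succ k =>
    rw [single_of_ne (by omega), zero_add, smul_smul, mul_inv_cancel₀, one_smul]
    exact_mod_cast k.succ_ne_zero

theorem contr_deg (v : E) (x : Tot E) : contr v (deg x) = deg (contr v x) + contr v x := by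
  funext k
  rw [Pi.add_apply, deg_apply, contr_apply, contr_apply, deg_apply]
  ext w
  simp
  ring

theorem par_deg (x : Tot E) : par (deg x) = deg (par x) := by
  funext k
  exact smul_comm ((-1 : ℂ) ^ k) (k : ℂ) (x k)

theorem contr_single_zero (v : E) (f : E [⋀^Fin 0]→L[ℝ] ℂ) : contr v (single 0 f) = 0 := by
  funext k
  rw [contr_apply, single_of_ne (by omega)]
  rfl

theorem par_single (k : ℕ) (α : E [⋀^Fin k]→L[ℝ] ℂ) :
    par (single k α) = (-1 : ℂ) ^ k • single k α := by
  funext l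
  rw [par_apply, Pi.smul_apply]
  rcases eq_or_ne l k with rfl | h
  · rfl
  · rw [single_of_ne h]; ext v; simp

/-- The forms `T v ∧ y`. -/
def wedgeRight (T : E →ₗ[ℝ] Tot E) (y : Tot E) : E →ₗ[ℝ] Tot E :=
  (wedge.flip y).restrictScalars ℝ ∘ₗ T

/-- The forms `x ∧ T v`. -/
def wedgeLeft (x : Tot E) (T : E →ₗ[ℝ] Tot E) : E →ₗ[ℝ] Tot E :=
  (wedge x).restrictScalars ℝ ∘ₗ T

@[simp] theorem wedgeRight_apply (T : E →ₗ[ℝ] Tot E) (y : Tot E) (v : E) :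
    wedgeRight T y v = T v ⋏ y := rfl

@[simp] theorem wedgeLeft_apply (T : E →ₗ[ℝ] Tot E) (y : Tot E) (v : E) :
    wedgeLeft y T v = y ⋏ T v := rfl

section Finite

variable [FiniteDimensional ℝ E]

/-- The alternatization of a linear family of forms, of degree `1`. -/
def altz : (E →ₗ[ℝ] Tot E) →ₗ[ℂ] Tot E where
  toFun T k := match k with
    | 0 => 0
    | k + 1 => ContinuousAlternatingMap.alternatizeUncurryFin
        (LinearMap.toContinuousLinearMap (LinearMap.proj k ∘ₗ T))
  map_add' T S := by
    funext k
    cases k with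
    | zero => exact (add_zero _).symm
    | succ k =>
      ext v
      simp [ContinuousAlternatingMap.alternatizeUncurryFin_apply, Finset.sum_add_distrib]
  map_smul' c T := by
    funext k
    cases k with
    | zero => exact (smul_zero (A := E [⋀^Fin 0]→L[ℝ] ℂ) c).symm
    | succ k =>
      ext v
      simp [ContinuousAlternatingMap.alternatizeUncurryFin_apply, Finset.mul_sum,
        mul_left_comm]

@[simp] theorem altz_zero_deg (T : E →ₗ[ℝ] Tot E) : altz T 0 = 0 := rfl

theorem altz_succ (T : E →ₗ[ℝ] Tot E) (k : ℕ) : altz T (k + 1) =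
    ContinuousAlternatingMap.alternatizeUncurryFin
        (LinearMap.toContinuousLinearMap (LinearMap.proj k ∘ₗ T)) := rfl

theorem altz_succ_apply (T : E →ₗ[ℝ] Tot E) (k : ℕ) (v : Fin (k + 1) → E) :
    altz T (k + 1) v = ∑ i : Fin (k + 1), (-1 : ℤ) ^ (i : ℕ) • T (v i) k (i.removeNth v) := by
  rw [altz_succ, ContinuousAlternatingMap.alternatizeUncurryFin_apply]
  rfl

theorem altz_congr {T S : E →ₗ[ℝ] Tot E} (h : ∀ v, T v = S v) : altz T = altz S := by
  rw [LinearMap.ext h]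

theorem altz_congr_succ {T S : E →ₗ[ℝ] Tot E} {k : ℕ} (h : ∀ v, T v k = S v k) :
    altz T (k + 1) = altz S (k + 1) := by
  ext v
  simp only [altz_succ_apply, h]

/-- In a basis, `altz T` is `∑ e^j ∧ T e_j`, and this is the antiderivation rule for it. The summand
`i = 0` is `T w`; in the others `w` sits one slot later, whence the sign. -/
theorem contr_altz (T : E →ₗ[ℝ] Tot E) (w : E) :
    contr w (altz T) = T w - altz ((contr w).restrictScalars ℝ ∘ₗ T) := by
  funext k
  cases k with
  | zero =>
    ext v
    simp [contr_apply_apply, altz_succ_apply]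
  | succ k =>
    ext v
    rw [contr_apply_apply, altz_succ_apply, Fin.sum_univ_succ, Pi.sub_apply,
      ContinuousAlternatingMap.sub_apply, altz_succ_apply, sub_eq_add_neg, ← Finset.sum_neg_distrib]
    congr 1
    · simp [Matrix.vecCons]
    · refine Finset.sum_congr rfl fun i _ => ?_
      have h1 : (Fin.succ i).removeNth (Matrix.vecCons w v) =
          Matrix.vecCons w (i.removeNth v) := by
        funext j
        refine Fin.cases ?_ (fun j => ?_) j
        · simp [Fin.removeNth]
        · simp [Fin.removeNth]
      rw [h1, Matrix.cons_val_succ, Fin.val_succ, pow_succ, mul_neg_one, neg_smul]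
      rfl

/-- The Euler identity: the alternatization of `v ↦ ι_v x` is the degree times `x`. -/
theorem altz_contrAt (x : Tot E) (k : ℕ) : altz (contrAt x) k = (k : ℂ) • x k := by
  cases k with
  | zero => rw [altz_zero_deg, Nat.cast_zero]; exact (zero_smul ℂ (x 0)).symm
  | succ k =>
    ext v
    rw [altz_succ_apply]
    have : ∀ i : Fin (k + 1), (-1 : ℤ) ^ (i : ℕ) • contrAt x (v i) k (i.removeNth v) =
        x (k + 1) v := by
      intro i
      have := (x (k + 1)).neg_one_pow_smul_map_insertNth i (v i) (i.removeNth v)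
      rw [contrAt_apply, contr_apply_apply, ← this, smul_smul, ← mul_pow]
      simp
    rw [Finset.sum_congr rfl fun i _ => this i]
    simp

theorem altz_contrAt_eq_deg (x : Tot E) : altz (contrAt x) = deg x :=
  funext fun k => altz_contrAt x k

/-- In each degree this is `altWedge_succ_left`, the factor `p + 1` there becoming `deg`. It
expresses a product through products whose left factor has smaller degree. -/
theorem altz_contr_wedge (x y : Tot E) : altz (wedgeRight (contrAt x) y) = deg x ⋏ y := by
  funext k
  cases k with
  | zero =>
    rw [altz_zero_deg, wedge_apply]
    ext v
    simp [altWedge_apply, deg_apply]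
  | succ k =>
    ext v
    rw [altz_succ_apply, wedge_apply, Fin.sum_univ_succ (n := k + 1)]
    have h0 : altWedge (by omega : ((0 : Fin (k + 2)) : ℕ) + (k + 1 - (0 : Fin (k + 2))) = k + 1)
        (deg x ((0 : Fin (k + 2)) : ℕ)) (y (k + 1 - ((0 : Fin (k + 2)) : ℕ))) = 0 := by
      have : deg x ((0 : Fin (k + 2)) : ℕ) = 0 := by
        change ((0 : ℕ) : ℂ) • x 0 = 0
        rw [Nat.cast_zero]
        exact zero_smul ℂ (x 0)
      rw [this, altWedge_zero_form_left]
    rw [h0, zero_add]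
    simp only [wedgeRight_apply, wedge_apply, ContinuousAlternatingMap.sum_apply, Finset.smul_sum]
    rw [Finset.sum_comm]
    refine Finset.sum_congr rfl fun j _ => ?_
    have h1 : altWedge (by have := j.2; simp; omega :
          ((Fin.succ j : Fin (k + 2)) : ℕ) + (k + 1 - (Fin.succ j : Fin (k + 2))) = k + 1)
        (deg x ((Fin.succ j : Fin (k + 2)) : ℕ)) (y (k + 1 - ((Fin.succ j : Fin (k + 2)) : ℕ))) =
        altWedge (by have := j.2; omega : ((j : ℕ) + 1) + (k - j) = k + 1)
          (deg x ((j : ℕ) + 1)) (y (k - j)) := altWedge_congr _ _ _ _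
    rw [h1, deg_apply, altWedge_smul_left, ContinuousAlternatingMap.smul_apply, smul_eq_mul,
      Nat.cast_add, Nat.cast_one, altWedge_succ_left]
    rfl

/-- Strong induction on the degree of the result. A degree zero part of `x` acts as a scalar; the
rest is `deg z`, so its product with `y` is the alternatization of `v ↦ ι_v z ∧ y`. Contracting with
`contr_altz` leaves products of smaller degree under the alternatization, where the rule is already
known. -/
theorem contr_wedge (w : E) (x y : Tot E) :
    contr w (x ⋏ y) = contr w x ⋏ y + par x ⋏ contr w y := by
  funext k
  induction k using Nat.strong_induction_on generalizing x y w with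
  | _ k ih =>
    obtain ⟨z, hz⟩ := eq_single_zero_add_deg x
    rw [hz]
    simp only [map_add, LinearMap.add_apply, contr_single_zero, single_zero_wedge, par_single,
      map_zero, LinearMap.zero_apply, map_smul, pow_zero, one_smul]
    rw [← altz_contr_wedge, contr_altz, contr_deg, par_deg, ← altz_contr_wedge (par z)]
    simp only [map_add, LinearMap.add_apply]
    rw [← altz_contr_wedge (contr w z)]
    -- The inductive hypothesis is applied to `ι_v z ∧ y` under the alternatization. Both signs come
    -- from exchanging `ι_v`: with `ι_w`, and with the parity involution.
    have key : altz ((contr w).restrictScalars ℝ ∘ₗ wedgeRight (contrAt z) y) k =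
        - altz (wedgeRight (contrAt (contr w z)) y) k
        - altz (wedgeRight (contrAt (par z)) (contr w y)) k := by
      cases k with
      | zero => simp
      | succ k =>
        rw [← Pi.neg_apply, ← Pi.sub_apply, ← map_neg, ← map_sub]
        refine altz_congr_succ fun v => ?_
        have h := ih k (Nat.lt_succ_self k) w (contr v z) y
        simp only [LinearMap.comp_apply, LinearMap.restrictScalars_apply, wedgeRight_apply,
          contrAt_apply, LinearMap.sub_apply, LinearMap.neg_apply]
        rw [h, contr_contr w v, contr_par]
        simp only [map_neg, LinearMap.neg_apply, Pi.add_apply, Pi.neg_apply, Pi.sub_apply]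
        abel
    simp only [Pi.add_apply, Pi.sub_apply, key, wedgeRight_apply, contrAt_apply, Pi.zero_apply]
    abel

theorem wedge_zero_deg (x y : Tot E) : (x ⋏ y) 0 0 = x 0 0 * y 0 0 := by
  rw [wedge_apply, Fin.sum_univ_one]
  exact altWedge_zero_left rfl (x 0) (y 0) 0

theorem altz_par (T : E →ₗ[ℝ] Tot E) :
    altz (par.restrictScalars ℝ ∘ₗ T) = -par (altz T) := by
  funext k
  cases k with
  | zero =>
    rw [Pi.neg_apply, par_apply, altz_zero_deg, altz_zero_deg]
    ext v
    simp
  | succ k =>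
    ext v
    rw [Pi.neg_apply, par_apply]
    simp only [ContinuousAlternatingMap.neg_apply, ContinuousAlternatingMap.smul_apply,
      altz_succ_apply, LinearMap.comp_apply, LinearMap.restrictScalars_apply, par_apply,
      smul_eq_mul, Finset.mul_sum, ← Finset.sum_neg_distrib]
    refine Finset.sum_congr rfl fun i _ => ?_
    simp only [zsmul_eq_mul]
    ring

theorem altz_wedgeRight (T : E →ₗ[ℝ] Tot E) (y : Tot E) :
    altz (wedgeRight T y) = altz T ⋏ y := by
  funext k
  induction k generalizing T y with
  | zero => exact zero_ext (by rw [wedge_zero_deg]; simp)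
  | succ k ih =>
    refine succ_ext fun w => ?_
    have h : altz ((contr w).restrictScalars ℝ ∘ₗ wedgeRight T y) =
        altz (wedgeRight ((contr w).restrictScalars ℝ ∘ₗ T) y) +
        altz (wedgeRight (par.restrictScalars ℝ ∘ₗ T) (contr w y)) := by
      rw [← map_add]
      exact altz_congr fun v => contr_wedge w (T v) y
    rw [contr_altz, contr_wedge, contr_altz, h, Pi.sub_apply, Pi.add_apply, ih, ih, altz_par]
    simp only [map_sub, map_neg, LinearMap.sub_apply, LinearMap.neg_apply, Pi.add_apply,
      Pi.sub_apply, Pi.neg_apply, wedgeRight_apply]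
    abel

/-- In `∑ e^j ∧ x ∧ T e_j` the odd factor `e^j` has to pass `x`, which produces the parity
involution. -/
theorem altz_wedgeLeft (x : Tot E) (T : E →ₗ[ℝ] Tot E) :
    altz (wedgeLeft x T) = par x ⋏ altz T := by
  funext k
  induction k generalizing x T with
  | zero => exact zero_ext (by rw [wedge_zero_deg]; simp)
  | succ k ih =>
    refine succ_ext fun w => ?_
    have h : altz ((contr w).restrictScalars ℝ ∘ₗ wedgeLeft x T) =
        altz (wedgeLeft (contr w x) T) +
        altz (wedgeLeft (par x) ((contr w).restrictScalars ℝ ∘ₗ T)) := by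
      rw [← map_add]
      exact altz_congr fun v => contr_wedge w x (T v)
    rw [contr_altz, contr_wedge, contr_altz, h, Pi.sub_apply, Pi.add_apply, ih, ih, contr_par]
    simp only [map_sub, map_neg, LinearMap.sub_apply, LinearMap.neg_apply, Pi.add_apply,
      Pi.sub_apply, Pi.neg_apply, wedgeLeft_apply, par_par]
    abel

theorem par_wedge (x y : Tot E) : par (x ⋏ y) = par x ⋏ par y := by
  funext k
  induction k generalizing x y with
  | zero => exact zero_ext (by simp only [par_zero_deg, wedge_zero_deg])
  | succ k ih =>
    refine succ_ext fun w => ?_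
    rw [contr_par, contr_wedge, contr_wedge, contr_par, contr_par, map_add, Pi.neg_apply,
      Pi.add_apply, ih, ih]
    simp only [map_neg, LinearMap.neg_apply, Pi.add_apply, Pi.neg_apply, par_par]
    abel

theorem wedge_assoc (x y z : Tot E) : x ⋏ y ⋏ z = x ⋏ (y ⋏ z) := by
  funext k
  induction k generalizing x y z with
  | zero => exact zero_ext (by simp only [wedge_zero_deg, mul_assoc])
  | succ k ih =>
    refine succ_ext fun w => ?_
    simp only [contr_wedge, map_add, LinearMap.add_apply, Pi.add_apply, ih, par_wedge]
    abel

/-- The even and the odd case are proved together: contracting `x` changes its parity, so each case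
of the induction calls the other. -/
theorem wedge_comm_aux (k : ℕ) : ∀ x y : Tot E, (par x = x → (x ⋏ y) k = (y ⋏ x) k) ∧
    (par x = -x → (x ⋏ y) k = (par y ⋏ x) k) := by
  induction k with
  | zero =>
    intro x y
    constructor <;> intro _ <;> refine zero_ext ?_ <;>
      simp only [wedge_zero_deg, par_zero_deg, mul_comm]
  | succ k ih =>
    intro x y
    constructor
    · intro hx
      refine succ_ext fun w => ?_
      have h1 : par (contr w x) = -contr w x := by
        rw [← neg_eq_iff_eq_neg, ← contr_par, hx]
      rw [contr_wedge, contr_wedge, hx, Pi.add_apply, Pi.add_apply, (ih _ _).2 h1, (ih _ _).1 hx]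
      abel
    · intro hx
      refine succ_ext fun w => ?_
      have h1 : par (contr w x) = contr w x := by
        rw [← neg_inj, ← contr_par, hx, map_neg]
      rw [contr_wedge, contr_wedge, hx, contr_par, par_par]
      simp only [map_neg, LinearMap.neg_apply, Pi.add_apply, Pi.neg_apply]
      rw [(ih _ _).1 h1, (ih x _).2 hx]
      abel

theorem wedge_comm_of_even {x : Tot E} (hx : par x = x) (y : Tot E) : x ⋏ y = y ⋏ x :=
  funext fun k => (wedge_comm_aux k x y).1 hx

theorem wedge_comm_of_odd {x : Tot E} (hx : par x = -x) (y : Tot E) : x ⋏ y = par y ⋏ x :=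
  funext fun k => (wedge_comm_aux k x y).2 hx

theorem wedge_one (x : Tot E) : x ⋏ one = x := by
  have h : par (one : Tot E) = one := by rw [one, par_single]; simp
  rw [← wedge_comm_of_even h, one_wedge]

/-! #### Derivations and pullbacks -/

/-- The derivation of the algebra of forms induced by an endomorphism `B`:
`(v_1, …, v_k) ↦ ∑_j x(v_1, …, B v_j, …, v_k)`. -/
def derv (B : E →ₗ[ℝ] E) : Tot E →ₗ[ℂ] Tot E where
  toFun x := altz (contrAt x ∘ₗ B)
  map_add' x y := by
    rw [← map_add]; exact altz_congr fun v => map_add (contr (B v)) x y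
  map_smul' c x := by
    rw [RingHom.id_apply, ← map_smul]; exact altz_congr fun v => map_smul (contr (B v)) c x

theorem derv_apply (B : E →ₗ[ℝ] E) (x : Tot E) : derv B x = altz (contrAt x ∘ₗ B) := rfl

theorem derv_add (B C : E →ₗ[ℝ] E) (x : Tot E) : derv (B + C) x = derv B x + derv C x := by
  simp only [derv_apply, LinearMap.comp_add, map_add]

theorem derv_neg (B : E →ₗ[ℝ] E) (x : Tot E) : derv (-B) x = -derv B x := by
  rw [derv_apply, LinearMap.comp_neg]
  exact map_neg (altz (E := E)) _

theorem derv_smul (c : ℝ) (B : E →ₗ[ℝ] E) (x : Tot E) : derv (c • B) x = (c : ℂ) • derv B x := by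
  rw [derv_apply, derv_apply, ← map_smul]
  refine altz_congr fun v => ?_
  simp only [LinearMap.comp_apply, LinearMap.smul_apply, map_smul]
  rfl

theorem derv_id (x : Tot E) : derv LinearMap.id x = deg x := altz_contrAt_eq_deg x

theorem derv_zero_deg (B : E →ₗ[ℝ] E) (x : Tot E) : derv B x 0 = 0 := rfl

theorem contr_derv (B : E →ₗ[ℝ] E) (x : Tot E) (w : E) :
    contr w (derv B x) = contr (B w) x + derv B (contr w x) := by
  rw [derv_apply, contr_altz, derv_apply, sub_eq_add_neg, ← map_neg]
  congr 1
  exact altz_congr fun v => by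
    simp only [LinearMap.comp_apply, LinearMap.restrictScalars_apply, contrAt_apply,
      LinearMap.neg_apply]
    rw [contr_contr, neg_neg]

theorem derv_wedge (B : E →ₗ[ℝ] E) (x y : Tot E) :
    derv B (x ⋏ y) = derv B x ⋏ y + x ⋏ derv B y := by
  have h : derv B (x ⋏ y) = altz (wedgeRight (contrAt x ∘ₗ B) y) +
      altz (wedgeLeft (par x) (contrAt y ∘ₗ B)) := by
    rw [← map_add]
    exact altz_congr fun v => contr_wedge (B v) x y
  rw [h, altz_wedgeRight, altz_wedgeLeft, par_par]
  rfl

/-- The forms `δ_{B v} x`, linear in `v`. -/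
def dervAt (B : E →ₗ[ℝ] E →ₗ[ℝ] E) (x : Tot E) : E →ₗ[ℝ] Tot E where
  toFun v := derv (B v) x
  map_add' v w := by rw [map_add, derv_add]
  map_smul' c v := by rw [map_smul, derv_smul]; rfl

@[simp] theorem dervAt_apply (B : E →ₗ[ℝ] E →ₗ[ℝ] E) (x : Tot E) (v : E) :
    dervAt B x v = derv (B v) x := rfl

/-- The alternatization of `v ↦ δ_{B v} x` vanishes for a symmetric `B`. -/
theorem altz_dervAt_of_symm {B : E →ₗ[ℝ] E →ₗ[ℝ] E} (hB : ∀ v w, B v w = B w v) (x : Tot E) :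
    altz (dervAt B x) = 0 := by
  funext k
  induction k generalizing x with
  | zero => rfl
  | succ k ih =>
    refine succ_ext fun w => ?_
    -- By symmetry of `B`, contracting `δ_{B v} x` with `w` splits off `ι_{(B w) v} x`, whose
    -- alternatization in `v` is `δ_{B w} x`. This cancels the first term of `contr_altz`; what is
    -- left has smaller degree.
    have h : altz ((contr w).restrictScalars ℝ ∘ₗ dervAt B x) =
        altz (contrAt x ∘ₗ B w) + altz (dervAt B (contr w x)) := by
      rw [← map_add]
      exact altz_congr fun v => by
        simp only [LinearMap.comp_apply, LinearMap.restrictScalars_apply, dervAt_apply,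
          contr_derv, LinearMap.add_apply, contrAt_apply, hB v w]
    rw [contr_altz, h, Pi.sub_apply, Pi.add_apply, ih, dervAt_apply, derv_apply, map_zero]
    simp

/-- The pullback of forms along an endomorphism. -/
def pull (P : E →L[ℝ] E) : Tot E →ₗ[ℂ] Tot E where
  toFun x k := (x k).compContinuousLinearMap P
  map_add' x y := rfl
  map_smul' c x := rfl

theorem pull_apply (P : E →L[ℝ] E) (x : Tot E) (k : ℕ) :
    pull P x k = (x k).compContinuousLinearMap P := rfl

theorem contr_pull (P : E →L[ℝ] E) (x : Tot E) (w : E) :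
    contr w (pull P x) = pull P (contr (P w) x) := by
  funext k
  exact ContinuousAlternatingMap.curryLeft_compContinuousLinearMap (x (k + 1)) P w

theorem pull_pull (P Q : E →L[ℝ] E) (x : Tot E) : pull P (pull Q x) = pull (Q ∘L P) x := rfl

theorem pull_id (x : Tot E) : pull (ContinuousLinearMap.id ℝ E) x = x := by
  funext k
  ext v
  rfl

theorem pull_neg_id (x : Tot E) : pull (-ContinuousLinearMap.id ℝ E) x = par x := by
  funext k
  induction k generalizing x with
  | zero => exact zero_ext (by
      rw [par_zero_deg, pull_apply, ContinuousAlternatingMap.compContinuousLinearMap_apply]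
      congr 1
      exact Subsingleton.elim _ _)
  | succ k ih =>
    refine succ_ext fun w => ?_
    rw [contr_pull, contr_par, ih, _root_.neg_apply, map_neg, LinearMap.neg_apply,
      map_neg]
    rfl

theorem pull_altz (P : E →L[ℝ] E) (T : E →ₗ[ℝ] Tot E) :
    pull P (altz T) = altz ((pull P).restrictScalars ℝ ∘ₗ T ∘ₗ P.toLinearMap) := by
  funext k
  cases k with
  | zero => ext v; rfl
  | succ k =>
    ext v
    simp only [pull_apply, ContinuousAlternatingMap.compContinuousLinearMap_apply,
      altz_succ_apply]
    rfl

theorem pull_wedge (P : E →L[ℝ] E) (x y : Tot E) : pull P (x ⋏ y) = pull P x ⋏ pull P y := by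
  funext k
  ext v
  simp only [pull_apply, wedge_apply, ContinuousAlternatingMap.compContinuousLinearMap_apply,
    ContinuousAlternatingMap.sum_apply, altWedge_apply]
  rfl

theorem pull_derv (P Q : E →L[ℝ] E) (B C : E →ₗ[ℝ] E) (h : ∀ v, B (P v) = Q (C v)) (x : Tot E)
    (hPQ : P = Q) : pull P (derv B x) = derv C (pull P x) := by
  subst hPQ
  rw [derv_apply, pull_altz, derv_apply]
  refine altz_congr fun v => ?_
  simp only [LinearMap.comp_apply, LinearMap.restrictScalars_apply, contrAt_apply, contr_pull,
    ← h]
  rfl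

/-- The complex conjugation of forms. -/
def conj : Tot E →ₛₗ[starRingEnd ℂ] Tot E where
  toFun x k := (Complex.conjCLE : ℂ →L[ℝ] ℂ).compContinuousAlternatingMap (x k)
  map_add' x y := by funext k; ext v; simp
  map_smul' c x := by funext k; ext v; simp

theorem conj_apply (x : Tot E) (k : ℕ) :
    conj x k = (Complex.conjCLE : ℂ →L[ℝ] ℂ).compContinuousAlternatingMap (x k) := rfl

theorem conj_apply_apply (x : Tot E) (k : ℕ) (v : Fin k → E) :
    conj x k v = starRingEnd ℂ (x k v) := rfl

@[simp] theorem conj_conj (x : Tot E) : conj (conj x) = x := by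
  funext k
  ext v
  simp [conj_apply_apply]

theorem contr_conj (x : Tot E) (w : E) : contr w (conj x) = conj (contr w x) := by
  funext k
  ext v
  rfl

theorem conj_pull (P : E →L[ℝ] E) (x : Tot E) : conj (pull P x) = pull P (conj x) := by
  funext k
  ext v
  rfl

theorem conj_derv (B : E →ₗ[ℝ] E) (x : Tot E) : conj (derv B x) = derv B (conj x) := by
  funext k
  induction k generalizing x with
  | zero => ext v; simp [conj_apply_apply, derv_zero_deg]
  | succ k ih =>
    refine succ_ext fun w => ?_
    rw [contr_conj, contr_derv, contr_derv, map_add, Pi.add_apply, Pi.add_apply, contr_conj,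
      contr_conj, ih]

theorem conj_wedge (x y : Tot E) : conj (x ⋏ y) = conj x ⋏ conj y := by
  funext k
  ext v
  simp only [conj_apply_apply, wedge_apply, ContinuousAlternatingMap.sum_apply, altWedge_apply,
    map_sum, map_mul, map_inv₀, map_natCast, map_intCast]

end Finite

end Tot

end Total

/-! ### Types of forms on a complex vector space -/

namespace Tot

section Weights

variable {E : Type*} [NormedAddCommGroup E] [NormedSpace ℝ E] [FiniteDimensional ℝ E]

/-- The variation of a pullback puts `B` in one slot and `P` in all others; sorting the terms by
that slot gives an alternatization. -/
theorem fderivComp_eq_altz (P B : E →L[ℝ] E) (x : Tot E) (k : ℕ) :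
    (x k).fderivCompContinuousLinearMap P B =
      altz ((pull P).restrictScalars ℝ ∘ₗ contrAt x ∘ₗ B.toLinearMap) k := by
  cases k with
  | zero => ext v; simp
  | succ k =>
    rw [ContinuousAlternatingMap.fderivCompContinuousLinearMap_eq_alternatizeUncurryFin]
    ext v
    rw [altz_succ_apply]
    simp only [ContinuousLinearMap.comp_apply,
      ContinuousAlternatingMap.alternatizeUncurryFinCLM_apply,
      ContinuousAlternatingMap.alternatizeUncurryFin_apply]
    rfl

theorem fderivComp_id_eq_derv (B : E →L[ℝ] E) (x : Tot E) (k : ℕ) :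
    (x k).fderivCompContinuousLinearMap (ContinuousLinearMap.id ℝ E) B =
      derv B.toLinearMap x k := by
  rw [fderivComp_eq_altz, derv_apply]
  congr 1

variable {I : E →L[ℝ] E}

/-- The vector `v - √-1 I v` is twice the `(1, 0)`-part of `v`; contraction with it removes one
holomorphic slot, so `p - q` drops by one. -/
theorem derv_contr_sub (hI : ∀ v, I (I v) = -v) (x : Tot E) (k : ℕ)
    {l : ℂ}
    (h : derv I.toLinearMap x (k + 1) = (Complex.I * l) • x (k + 1)) (v : E) :
    derv I.toLinearMap (contr v x - Complex.I • contr (I v) x) k =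
      (Complex.I * (l - 1)) • (contr v x - Complex.I • contr (I v) x) k := by
  have h' : ∀ w, derv I.toLinearMap (contr w x) k =
      (Complex.I * l) • contr w x k - contr (I w) x k := by
    intro w
    have h1 := congrArg (fun y : Tot E => y k) (contr_derv I.toLinearMap x w)
    have h2 : contr w (derv I.toLinearMap x) k = (Complex.I * l) • contr w x k := by
      rw [contr_apply, h]; rfl
    simp only [Pi.add_apply, h2] at h1
    rw [h1]
    exact (add_sub_cancel_left _ _).symm
  rw [map_sub, map_smul, Pi.sub_apply, Pi.smul_apply, h', h', hI, map_neg, Pi.sub_apply,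
    Pi.smul_apply, LinearMap.neg_apply, Pi.neg_apply]
  have hII : Complex.I * Complex.I = -1 := Complex.I_mul_I
  match_scalars
  · ring
  · linear_combination (-1 : ℂ) * hII

/-- The counterpart for the `(0, 1)`-part of `v`: one antiholomorphic slot is removed, and `p - q`
grows by one. -/
theorem derv_contr_add (hI : ∀ v, I (I v) = -v) (x : Tot E) (k : ℕ)
    {l : ℂ}
    (h : derv I.toLinearMap x (k + 1) = (Complex.I * l) • x (k + 1)) (v : E) :
    derv I.toLinearMap (contr v x + Complex.I • contr (I v) x) k =
      (Complex.I * (l + 1)) • (contr v x + Complex.I • contr (I v) x) k := by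
  have h' : ∀ w, derv I.toLinearMap (contr w x) k =
      (Complex.I * l) • contr w x k - contr (I w) x k := by
    intro w
    have h1 := congrArg (fun y : Tot E => y k) (contr_derv I.toLinearMap x w)
    have h2 : contr w (derv I.toLinearMap x) k = (Complex.I * l) • contr w x k := by
      rw [contr_apply, h]; rfl
    simp only [Pi.add_apply, h2] at h1
    rw [h1]
    exact (add_sub_cancel_left _ _).symm
  rw [map_add, map_smul, Pi.add_apply, Pi.smul_apply, h', h', hI, map_neg, Pi.add_apply,
    Pi.smul_apply, LinearMap.neg_apply, Pi.neg_apply]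
  have hII : Complex.I * Complex.I = -1 := Complex.I_mul_I
  match_scalars
  · ring
  · linear_combination (-1 : ℂ) * hII

theorem contr_eq_half (I : E →L[ℝ] E) (x : Tot E) (v : E) : contr v x =
    (1 / 2 : ℂ) • ((contr v x - Complex.I • contr (I v) x) +
      (contr v x + Complex.I • contr (I v) x)) := by
  module

/-- The weights of the derivation `δ_I` on `k`-forms are bounded by `k`. -/
theorem eq_zero_of_weight (hI : ∀ v, I (I v) = -v) (k : ℕ) :
    ∀ (x : Tot E) (l : ℤ), (k : ℤ) < |l| →
    derv I.toLinearMap x k = (Complex.I * (l : ℂ)) • x k → x k = 0 := by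
  induction k with
  | zero =>
    intro x l hl h
    rw [derv_zero_deg] at h
    have hl' : (l : ℂ) ≠ 0 := by
      have : l ≠ 0 := by rintro rfl; simp at hl
      exact_mod_cast this
    have hne := mul_ne_zero Complex.I_ne_zero hl'
    rw [← one_smul ℂ (x 0), ← inv_mul_cancel₀ hne, mul_smul, ← h]
    ext v
    simp
  | succ k ih =>
    intro x l hl h
    refine succ_ext (y := 0) fun v => ?_
    have h1 := derv_contr_sub hI x k h v
    have h2 := derv_contr_add hI x k h v
    -- Both parts of a contraction have weight `l ∓ 1`, which still exceeds the new degree in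
    -- absolute value.
    have e1 := ih _ (l - 1) (by push_cast at hl; rw [lt_abs] at hl ⊢; omega) (by push_cast; exact h1)
    have e2 := ih _ (l + 1) (by push_cast at hl; rw [lt_abs] at hl ⊢; omega) (by push_cast; exact h2)
    rw [contr_eq_half I, Pi.smul_apply, Pi.add_apply, e1, e2, map_zero]
    ext w
    simp

/-- A form with weight `p - q` and degree `p + q` is homogeneous of bidegree `(p, q)` under the
action of the complex numbers. -/
theorem type_of_weight (hI : ∀ v, I (I v) = -v) (k : ℕ) :
    ∀ (p q : ℕ) (x : Tot E), p + q = k →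
    derv I.toLinearMap x k = (Complex.I * ((p : ℂ) - q)) • x k →
    ∀ (z : ℂ) (v : Fin k → E), x k (fun i => z.re • v i + z.im • I (v i)) =
      z ^ p * (starRingEnd ℂ z) ^ q * x k v := by
  induction k with
  | zero =>
    intro p q x hpq h z v
    obtain ⟨rfl, rfl⟩ : p = 0 ∧ q = 0 := by omega
    simp only [pow_zero, one_mul]
    congr 1
    exact Subsingleton.elim _ _
  | succ k ih =>
    intro p q x hpq h z v
    set v₀ := v 0 with hv₀
    set u : Fin k → E := Fin.tail v with hu
    have hv : v = Matrix.vecCons v₀ u := (Fin.cons_self_tail v).symm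
    have e1 : (fun i => z.re • v i + z.im • I (v i)) =
        Matrix.vecCons (z.re • v₀ + z.im • I v₀) (fun i => z.re • u i + z.im • I (u i)) := by
      funext i
      refine Fin.cases ?_ (fun i => ?_) i
      · rfl
      · rfl
    have h1 := derv_contr_sub hI x k h v₀
    have h2 := derv_contr_add hI x k h v₀
    set ψ := contr v₀ x - Complex.I • contr (I v₀) x with hψ
    set χ := contr v₀ x + Complex.I • contr (I v₀) x with hχ
    have key : contr (z.re • v₀ + z.im • I v₀) x =
        (1 / 2 : ℂ) • (z • ψ + starRingEnd ℂ z • χ) := by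
      rw [map_add, map_smul, map_smul, LinearMap.add_apply, LinearMap.smul_apply,
        LinearMap.smul_apply, hψ, hχ]
      have hz : z = z.re + z.im * Complex.I := (Complex.re_add_im z).symm
      have hz' : starRingEnd ℂ z = z.re - z.im * Complex.I := by
        apply Complex.ext <;> simp
      have r1 : z.re • contr v₀ x = (z.re : ℂ) • contr v₀ x := rfl
      have r2 : z.im • contr (I v₀) x = (z.im : ℂ) • contr (I v₀) x := rfl
      rw [hz', r1, r2]
      conv_rhs => rw [hz]
      simp only [Complex.add_re, Complex.ofReal_re, Complex.mul_re, Complex.I_re, mul_zero,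
        Complex.ofReal_im, Complex.I_im, mul_one, sub_self, add_zero, Complex.add_im,
        Complex.mul_im, zero_add]
      have hII : Complex.I * Complex.I = -1 := Complex.I_mul_I
      match_scalars
      · ring
      · linear_combination (z.im : ℂ) * hII
    -- `ψ` has bidegree `(p - 1, q)`. For `p = 0` its weight `-q - 1` exceeds its degree in absolute
    -- value, so it vanishes; otherwise the inductive hypothesis applies and the missing factor `z`
    -- comes from the first slot. The same is done for `χ` and `\bar z`.
    have eψ : ψ k (fun i => z.re • u i + z.im • I (u i)) * z =
        z ^ p * (starRingEnd ℂ z) ^ q * ψ k u := by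
      cases p with
      | zero =>
        have : ψ k = 0 := by
          refine eq_zero_of_weight hI k ψ (-(q : ℤ) - 1) ?_ ?_
          · rw [abs_of_neg (by omega)]; omega
          · rw [h1]; push_cast; congr 2; ring
        rw [this]; simp
      | succ p =>
        rw [ih p q ψ (by omega) (by rw [h1]; push_cast; congr 2; ring) z u]
        ring
    have eχ : χ k (fun i => z.re • u i + z.im • I (u i)) * starRingEnd ℂ z =
        z ^ p * (starRingEnd ℂ z) ^ q * χ k u := by
      cases q with
      | zero =>
        have : χ k = 0 := by
          refine eq_zero_of_weight hI k χ ((p : ℤ) + 1) ?_ ?_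
          · rw [abs_of_pos (by omega)]; omega
          · rw [h2]; push_cast; congr 2; ring
        rw [this]; simp
      | succ q =>
        rw [ih p q χ (by omega) (by rw [h2]; push_cast; congr 2; ring) z u]
        ring
    rw [e1, ← contr_apply_apply, key]
    conv_rhs => rw [hv, ← contr_apply_apply, contr_eq_half I, ← hψ, ← hχ]
    simp only [Pi.smul_apply, Pi.add_apply, ContinuousAlternatingMap.smul_apply,
      ContinuousAlternatingMap.add_apply, smul_eq_mul]
    linear_combination (1 / 2 : ℂ) * eψ + (1 / 2 : ℂ) * eχ

/-- Differentiate the action of `z = 1 + t √-1` at `t = 0`: as a pullback it gives the derivation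
induced by `I`, as the scalar `(1 + t √-1)^p (1 - t √-1)^q` it gives the weight. -/
theorem weight_of_type {k p q : ℕ} (x : Tot E)
    (h : ∀ (z : ℂ) (v : Fin k → E), x k (fun i => z.re • v i + z.im • I (v i)) =
      z ^ p * (starRingEnd ℂ z) ^ q * x k v) :
    derv I.toLinearMap x k = (Complex.I * ((p : ℂ) - q)) • x k := by
  have h1 : HasDerivAt (fun t : ℝ => (x k).compContinuousLinearMap
      (ContinuousLinearMap.id ℝ E + t • I)) (derv I.toLinearMap x k) 0 := by
    have hg : HasFDerivAt (fun t : ℝ => ContinuousLinearMap.id ℝ E + t • I)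
        ((1 : ℝ →L[ℝ] ℝ).smulRight I) 0 := by
      exact ((hasFDerivAt_id (𝕜 := ℝ) (0 : ℝ)).smul_const I).const_add _
    have hc : HasFDerivAt (fun _ : ℝ => x k) (0 : ℝ →L[ℝ] _) 0 := hasFDerivAt_const _ _
    have := (hc.continuousAlternatingMapCompContinuousLinearMap hg).hasDerivAt
    convert! this using 1
    rw [← fderivComp_id_eq_derv]
    simp
  have h2 : HasDerivAt (fun t : ℝ => ((1 : ℂ) + t * Complex.I) ^ p * (1 - t * Complex.I) ^ q)
      (Complex.I * ((p : ℂ) - q)) 0 := by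
    have ha : HasDerivAt (fun t : ℝ => (1 : ℂ) + t * Complex.I) Complex.I 0 := by
      simpa using ((Complex.ofRealCLM.hasDerivAt (x := (0 : ℝ))).mul_const Complex.I).const_add 1
    have hb : HasDerivAt (fun t : ℝ => (1 : ℂ) - t * Complex.I) (-Complex.I) 0 := by
      simpa using ((Complex.ofRealCLM.hasDerivAt (x := (0 : ℝ))).mul_const Complex.I).const_sub 1
    convert! (ha.pow p).mul (hb.pow q) using 1
    simp
    ring
  ext v
  have h3 : HasDerivAt (fun t : ℝ => (x k).compContinuousLinearMap
      (ContinuousLinearMap.id ℝ E + t • I) v) (derv I.toLinearMap x k v) 0 := by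
    have := (ContinuousAlternatingMap.apply ℝ E ℂ v).hasFDerivAt.comp_hasDerivAt
      (0 : ℝ) h1
    exact this
  have h4 := h2.mul_const (x k v)
  have h5 : (fun t : ℝ => (x k).compContinuousLinearMap
      (ContinuousLinearMap.id ℝ E + t • I) v) =
      fun t : ℝ => ((1 : ℂ) + t * Complex.I) ^ p * (1 - t * Complex.I) ^ q * x k v := by
    funext t
    have := h (1 + t * Complex.I) v
    have hc : starRingEnd ℂ (1 + t * Complex.I) = 1 - t * Complex.I := by
      apply Complex.ext <;> simp
    rw [hc] at this
    rw [← this]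
    rw [ContinuousAlternatingMap.compContinuousLinearMap_apply]
    congr 1
    funext i
    simp
  rw [h5] at h3
  rw [h3.unique h4]
  rfl

end Weights

end Tot

/-! ### Quaternionic Hermitian linear algebra -/

namespace Tot

variable {E : Type*} [NormedAddCommGroup E] [NormedSpace ℝ E] [FiniteDimensional ℝ E]

/-- The forms of type `(*, 0)` with respect to a complex structure. -/
def IsHol (I : E →L[ℝ] E) (x : Tot E) : Prop := ∀ v, contr (I v) x = Complex.I • contr v x

theorem IsHol.derv_eq {I : E →L[ℝ] E} {x : Tot E} (h : IsHol I x) :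
    derv I.toLinearMap x = Complex.I • deg x := by
  rw [derv_apply, ← altz_contrAt_eq_deg, ← map_smul]
  exact altz_congr h

/-- Contraction of a `(k + 1)`-form of weight `k + 1` with the `(0, 1)`-part of `v` would have
degree `k` and weight `k + 2`, so it is zero by `eq_zero_of_weight`. -/
theorem isHol_of_derv {I : E →L[ℝ] E} (hI : ∀ v, I (I v) = -v) {x : Tot E}
    (h : derv I.toLinearMap x = Complex.I • deg x) : IsHol I x := by
  intro v
  funext k
  have h0 : derv I.toLinearMap x (k + 1) = (Complex.I * ((k : ℂ) + 1)) • x (k + 1) := by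
    rw [h, Pi.smul_apply, deg_apply, smul_smul]
    push_cast
    rfl
  have h1 := derv_contr_add hI x k h0 v
  have h2 := eq_zero_of_weight hI k _ ((k : ℤ) + 2) (by rw [abs_of_nonneg (by omega)]; omega)
    (by rw [h1]; push_cast; congr 2; ring)
  ext w
  have h3 : contr v x k w + Complex.I * contr (I v) x k w = 0 := congrArg (fun a => a w) h2
  simp only [Pi.smul_apply, ContinuousAlternatingMap.smul_apply, smul_eq_mul]
  linear_combination (-Complex.I) * h3 + (contr (I v) x k w) * Complex.I_mul_I

theorem IsHol.wedge {I : E →L[ℝ] E} {x y : Tot E} (hx : IsHol I x) (hy : IsHol I y) :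
    IsHol I (x ⋏ y) := by
  intro v
  rw [contr_wedge, contr_wedge, hx, hy, map_smul, map_smul, LinearMap.smul_apply, smul_add]

theorem IsHol.contr {I : E →L[ℝ] E} {x : Tot E} (hx : IsHol I x) (u : E) :
    IsHol I (Tot.contr u x) := by
  intro v
  rw [contr_contr, hx, map_smul, contr_contr u v, smul_neg, neg_neg]

theorem IsHol.smul {I : E →L[ℝ] E} {x : Tot E} (c : ℂ) (hx : IsHol I x) : IsHol I (c • x) := by
  intro v
  rw [map_smul, map_smul, hx, smul_comm]

theorem IsHol.one (I : E →L[ℝ] E) : IsHol I (one : Tot E) := by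
  intro v
  rw [Tot.one, contr_single_zero, contr_single_zero, smul_zero']

/-- The linear algebra of the tangent spaces of a hypercomplex Hermitian manifold. -/
structure QuatHerm (g : E →L[ℝ] E →L[ℝ] ℝ) (I J : E →L[ℝ] E) (Om : E [⋀^Fin 2]→L[ℝ] ℂ) :
    Prop where
  symm : ∀ v w, g v w = g w v
  pos : ∀ v, v ≠ 0 → 0 < g v v
  II : ∀ v, I (I v) = -v
  JJ : ∀ v, J (J v) = -v
  JI : ∀ v, J (I v) = -I (J v)
  gI : ∀ v w, g (I v) (I w) = g v w
  gJ : ∀ v w, g (J v) (J w) = g v w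
  om : ∀ v w, Om ![v, w] = (1 / 2 : ℂ) * (g v (J w) + Complex.I * g v (I (J w)))

/-- Orthonormal bases, given as families that satisfy the Parseval identity. -/
structure IsON (g : E →L[ℝ] E →L[ℝ] ℝ) {m : ℕ} (e : Fin m → E) : Prop where
  orth : ∀ i j, g (e i) (e j) = if i = j then 1 else 0
  expand : ∀ w, ∑ j, g (e j) w • e j = w

theorem isON_of_orth {g : E →L[ℝ] E →L[ℝ] ℝ} {m : ℕ} (hm : Module.finrank ℝ E = m)
    {e : Fin m → E} (h : ∀ i j, g (e i) (e j) = if i = j then 1 else 0) : IsON g e := by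
  refine ⟨h, fun w => ?_⟩
  have hli : LinearIndependent ℝ e := by
    rw [Fintype.linearIndependent_iff]
    intro c hc i
    have h1 := congrArg (g (e i)) hc
    simpa [h] using h1
  let b := basisOfLinearIndependentOfCardEqFinrank' e hli (by simp [hm])
  have hb : ∀ j, b j = e j := fun j => by simp [b]
  have key : ∀ i, ∑ j, g (e j) (e i) • e j = e i := by
    intro i
    simp [h]
  have h2 : w = ∑ i, b.repr w i • e i := by
    conv_lhs => rw [← b.sum_repr w]
    simp [hb]
  rw [h2]
  simp only [map_sum, map_smul, smul_eq_mul, Finset.sum_smul]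
  rw [Finset.sum_comm]
  refine Finset.sum_congr rfl fun i _ => ?_
  conv_rhs => rw [← key i]
  rw [Finset.smul_sum]
  exact Finset.sum_congr rfl fun j _ => mul_smul _ _ _

theorem exists_isON {g : E →L[ℝ] E →L[ℝ] ℝ} (hs : ∀ v w, g v w = g w v)
    (hp : ∀ v, v ≠ 0 → 0 < g v v) : ∃ e : Fin (Module.finrank ℝ E) → E, IsON g e := by
  let B : LinearMap.BilinForm ℝ E := LinearMap.mk₂ ℝ (fun v w => g v w)
    (by simp) (by simp) (by simp) (by simp)
  have hB : LinearMap.IsSymm B := ⟨fun v w => hs v w⟩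
  obtain ⟨v, hv⟩ := LinearMap.BilinForm.exists_orthogonal_basis hB
  have hv0 : ∀ i, 0 < g (v i) (v i) := fun i => hp _ (v.ne_zero i)
  refine ⟨fun i => (Real.sqrt (g (v i) (v i)))⁻¹ • v i, isON_of_orth rfl fun i j => ?_⟩
  simp only [map_smul, smul_apply, smul_eq_mul]
  split_ifs with hij
  · subst hij
    have := Real.mul_self_sqrt (hv0 i).le
    have h0 : Real.sqrt (g (v i) (v i)) ≠ 0 := (Real.sqrt_pos.2 (hv0 i)).ne'
    field_simp
    rw [sq, this]
  · have h0 : g (v i) (v j) = 0 := hv hij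
    rw [h0]
    simp

/-- The trace of a bilinear map does not depend on the choice of dual families. -/
theorem sum_trace {g : E →L[ℝ] E →L[ℝ] ℝ} {m : ℕ} {e : Fin m → E} (he : IsON g e)
    {X : Type*} [AddCommGroup X] [Module ℝ X] (F : E →ₗ[ℝ] E →ₗ[ℝ] X) {κ : Type*} [Fintype κ]
    (u v : κ → E) (huv : ∀ w, ∑ a, g w (u a) • v a = w) :
    ∑ a, F (u a) (v a) = ∑ j, F (e j) (e j) := by
  have h1 : ∀ a, F (u a) (v a) = ∑ j, F (e j) (g (e j) (u a) • v a) := by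
    intro a
    conv_lhs => rw [← he.expand (u a)]
    simp [map_sum, LinearMap.sum_apply]
  rw [Finset.sum_congr rfl fun a _ => h1 a, Finset.sum_comm]
  refine Finset.sum_congr rfl fun j _ => ?_
  rw [← map_sum, huv]

/-- The contraction with the dual of the form `Ω`. -/
def lam {m : ℕ} (J : E →L[ℝ] E) (e : Fin m → E) : Tot E →ₗ[ℂ] Tot E :=
  (1 / 2 : ℂ) • ∑ j, contr (e j) ∘ₗ contr (J (e j))

theorem lam_apply {m : ℕ} (J : E →L[ℝ] E) (e : Fin m → E) (x : Tot E) :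
    lam J e x = (1 / 2 : ℂ) • ∑ j, contr (e j) (contr (J (e j)) x) := by
  simp [lam, LinearMap.sum_apply]

theorem IsHol.lam {I : E →L[ℝ] E} {x : Tot E} (hx : IsHol I x) {m : ℕ} (J : E →L[ℝ] E)
    (e : Fin m → E) : IsHol I (lam J e x) := by
  rw [lam_apply]
  refine IsHol.smul _ ?_
  intro v
  rw [map_sum, map_sum, Finset.smul_sum]
  exact Finset.sum_congr rfl fun j _ => ((hx.contr _).contr _) v

namespace QuatHerm

variable {g : E →L[ℝ] E →L[ℝ] ℝ} {I J : E →L[ℝ] E} {Om : E [⋀^Fin 2]→L[ℝ] ℂ}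

theorem contr_contr_single (v w : E) :
    contr w (contr v (single 2 Om)) = Om ![v, w] • one := by
  funext k
  cases k with
  | zero =>
    refine zero_ext ?_
    rw [contr_apply_apply, contr_apply_apply, single_same, Pi.smul_apply,
      ContinuousAlternatingMap.smul_apply, one, single_same]
    simp
  | succ k =>
    ext u
    rw [contr_apply_apply, contr_apply_apply, single_of_ne (by omega), Pi.smul_apply,
      ContinuousAlternatingMap.smul_apply, one, single_of_ne (by omega)]
    simp

theorem par_totOm : par (single 2 Om) = single 2 Om := by rw [par_single]; simp

theorem contr_wedge_totOm (v : E) (x : Tot E) :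
    contr v (single 2 Om ⋏ x) = contr v (single 2 Om) ⋏ x + single 2 Om ⋏ contr v x := by
  rw [contr_wedge, par_totOm]

/-- The form `ι_u Ω` has degree one, hence equals its own `deg`, and Euler's identity turns the
product into an alternatization. -/
theorem contr_totOm_wedge (u : E) (x : Tot E) (T : E →ₗ[ℝ] Tot E)
    (hT : ∀ v, T v = Om ![u, v] • x) : contr u (single 2 Om) ⋏ x = altz T := by
  have h1 : deg (contr u (single 2 Om)) = contr u (single 2 Om) := by
    funext k
    rw [deg_apply]
    by_cases hk : k = 1
    · subst hk; simp
    · rw [contr_apply, single_of_ne (by omega)]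
      ext w
      simp
  rw [← h1, ← altz_contr_wedge]
  refine altz_congr fun v => ?_
  rw [wedgeRight_apply, contrAt_apply, contr_contr_single, map_smul, LinearMap.smul_apply,
    one_wedge, hT]

theorem contr_contr_wedge_totOm (v w : E) (x : Tot E) :
    contr w (contr v (single 2 Om ⋏ x)) = Om ![v, w] • x - contr v (single 2 Om) ⋏ contr w x +
      contr w (single 2 Om) ⋏ contr v x + single 2 Om ⋏ contr w (contr v x) := by
  rw [contr_wedge_totOm, map_add, contr_wedge, contr_wedge_totOm, contr_contr_single, map_smul,
    LinearMap.smul_apply, one_wedge]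
  have : par (contr v (single 2 Om)) = -contr v (single 2 Om) := by
    rw [← neg_eq_iff_eq_neg, ← contr_par, par_totOm]
  rw [this, map_neg, LinearMap.neg_apply]
  abel

theorem g_self_I (h : QuatHerm g I J Om) (v : E) : g v (I v) = 0 := by
  have h1 := h.gI v (I v)
  rw [h.II, map_neg, h.symm] at h1
  linarith

theorem g_J_left (h : QuatHerm g I J Om) (v w : E) : g (J v) w = -g v (J w) := by
  have h1 := h.gJ v (J w)
  rw [h.JJ, map_neg] at h1
  linarith

theorem g_I_left (h : QuatHerm g I J Om) (v w : E) : g (I v) w = -g v (I w) := by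
  have h1 := h.gI v (I w)
  rw [h.II, map_neg] at h1
  linarith

theorem isHol_totOm (h : QuatHerm g I J Om) : IsHol I (single 2 Om) := by
  intro v
  have key : ∀ w, contr w (contr (I v) (single 2 Om)) = contr w (Complex.I • contr v (single 2 Om)) := by
    intro w
    rw [map_smul, contr_contr_single, contr_contr_single, smul_smul]
    congr 1
    rw [h.om, h.om, h.g_I_left, h.gI]
    have hII : Complex.I * Complex.I = -1 := Complex.I_mul_I
    push_cast
    linear_combination (-(1 / 2 : ℂ)) * (g v (I (J w)) : ℂ) * hII
  funext k
  cases k with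
  | zero =>
    refine zero_ext ?_
    rw [contr_apply_apply, single_of_ne (by omega), Pi.smul_apply,
      ContinuousAlternatingMap.smul_apply, contr_apply_apply, single_of_ne (by omega)]
    simp
  | succ k => exact succ_ext fun w => by rw [key w]

theorem isON_J (h : QuatHerm g I J Om) {m : ℕ} {e : Fin m → E} (he : IsON g e) (w : E) :
    ∑ j, g w (J (e j)) • J (e j) = w := by
  have h1 : ∀ j, g w (J (e j)) = g (e j) (-J w) := fun j => by
    rw [h.symm, h.g_J_left, map_neg]
  simp only [h1, ← map_smul]
  rw [← map_sum, he.expand, map_neg, h.JJ, neg_neg]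

/-- The commutator of `Λ_Ω` and `L_Ω` on forms of type `(*, 0)`. -/
theorem lam_wedge (h : QuatHerm g I J Om) {n : ℕ} {m : ℕ} (hm : m = 4 * n) {e : Fin m → E} (he : IsON g e) {x : Tot E}
    (hx : IsHol I x) :
    lam J e (single 2 Om ⋏ x) = single 2 Om ⋏ lam J e x + (n : ℂ) • x - deg x := by
  -- Each of the `4 n` basis vectors contributes `½ g(e_j, e_j)`; the imaginary part vanishes
  -- because `e_j` is orthogonal to `I e_j`.
  have s1 : ∑ j, Om ![J (e j), e j] = 2 * n := by
    have : ∀ j, Om ![J (e j), e j] = 1 / 2 := by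
      intro j
      rw [h.om, h.gJ, he.orth, if_pos rfl, h.g_self_I]
      simp
    rw [Finset.sum_congr rfl fun j _ => this j]
    simp [hm]
    ring
  -- The vector `∑_j Ω(J e_j, v) e_j` is `½ (v - √-1 I v)`, and contraction of a form of type `(*,
  -- 0)` with it is `ι_v`. Euler's identity then gives the degree.
  have s2 : ∑ j, contr (J (e j)) (single 2 Om) ⋏ contr (e j) x = deg x := by
    let T : Fin m → E →ₗ[ℝ] Tot E := fun j =>
      { toFun := fun v => Om ![J (e j), v] • contr (e j) x
        map_add' := fun v w => by
          rw [h.om, h.om, h.om, ← add_smul']; congr 1; simp only [map_add]; push_cast; ring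
        map_smul' := fun c v => by
          rw [h.om, h.om, RingHom.id_apply]
          rw [real_smul, smul_smul]; congr 1
          simp only [map_smul, smul_eq_mul]; push_cast; ring }
    have hT : ∀ j, contr (J (e j)) (single 2 Om) ⋏ contr (e j) x = altz (T j) :=
      fun j => contr_totOm_wedge _ _ _ fun v => rfl
    rw [Finset.sum_congr rfl fun j _ => hT j, ← map_sum, ← altz_contrAt_eq_deg]
    refine altz_congr fun v => ?_
    rw [LinearMap.sum_apply]
    have h2 : ∀ j, T j v = (1 / 2 : ℂ) • (contr (g (e j) v • e j) x -
        Complex.I • contr (g (e j) (I v) • e j) x) := by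
      intro j
      change Om ![J (e j), v] • contr (e j) x = _
      have e1 : g (J (e j)) (I (J v)) = -g (e j) (I v) := by
        rw [h.g_J_left, h.JI, h.JJ, map_neg, neg_neg, map_neg, map_neg]
      rw [h.om, h.gJ, e1, map_smul, map_smul, LinearMap.smul_apply, LinearMap.smul_apply]
      change _ = (1 / 2 : ℂ) • (((g (e j) v : ℝ) : ℂ) • contr (e j) x -
        Complex.I • ((g (e j) (I v) : ℝ) : ℂ) • contr (e j) x)
      push_cast
      module
    rw [Finset.sum_congr rfl fun j _ => h2 j, ← Finset.smul_sum, Finset.sum_sub_distrib,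
      ← Finset.smul_sum]
    simp only [← LinearMap.sum_apply, ← map_sum]
    rw [he.expand, he.expand, hx v, contrAt_apply, smul_smul, Complex.I_mul_I]
    module
  -- The sum is a trace, so the basis `e_j` may be replaced by the basis `J e_j`; as `J² = -1`, it
  -- becomes minus the preceding sum.
  have s3 : ∑ j, contr (e j) (single 2 Om) ⋏ contr (J (e j)) x = -deg x := by
    let F : E →ₗ[ℝ] E →ₗ[ℝ] Tot E := LinearMap.mk₂ ℝ
      (fun u v => contr u (single 2 Om) ⋏ contr (J v) x)
      (fun u u' v => by simp only [map_add, LinearMap.add_apply])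
      (fun c u v => by
        rw [map_smul]
        change ((c : ℂ) • contr u (single 2 Om)) ⋏ _ = (c : ℂ) • _
        rw [map_smul]; rfl)
      (fun u v v' => by simp only [map_add, LinearMap.add_apply])
      (fun c u v => by
        rw [map_smul, map_smul]
        change _ ⋏ ((c : ℂ) • contr (J v) x) = (c : ℂ) • _
        rw [map_smul])
    have h1 := sum_trace he F (fun j => J (e j)) (fun j => J (e j)) (h.isON_J he)
    change ∑ j, F (e j) (e j) = _
    rw [← h1, ← s2, ← Finset.sum_neg_distrib]
    refine Finset.sum_congr rfl fun j _ => ?_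
    change contr (J (e j)) (single 2 Om) ⋏ contr (J (J (e j))) x = _
    rw [h.JJ, map_neg, LinearMap.neg_apply, map_neg]
  rw [lam_apply, lam_apply]
  simp only [contr_contr_wedge_totOm]
  rw [Finset.sum_add_distrib, Finset.sum_add_distrib, Finset.sum_sub_distrib, s2, s3,
    ← sum_smul', s1, map_smul, map_sum]
  module

end QuatHerm

end Tot

namespace Tot

variable {E : Type*} [NormedAddCommGroup E] [NormedSpace ℝ E] [FiniteDimensional ℝ E]

theorem deg_single (k : ℕ) (α : E [⋀^Fin k]→L[ℝ] ℂ) :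
    deg (single k α) = (k : ℂ) • single k α := by
  funext l
  rw [deg_apply, Pi.smul_apply]
  rcases eq_or_ne l k with rfl | h
  · rfl
  · rw [single_of_ne h]; ext v; simp

theorem deg_wedge (x y : Tot E) : deg (x ⋏ y) = deg x ⋏ y + x ⋏ deg y := by
  rw [← derv_id, ← derv_id, ← derv_id, derv_wedge]

theorem eq_single_of_deg {k : ℕ} {x : Tot E} (h : deg x = (k : ℂ) • x) : x = single k (x k) := by
  funext l
  by_cases hl : l = k
  · subst hl; rw [single_same]
  · rw [single_of_ne hl]
    ext v
    have h1 : (l : ℂ) * x l v = k * x l v := congrArg (fun y : Tot E => y l v) h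
    have h2 : ((l : ℂ) - k) * x l v = 0 := by rw [sub_mul, h1, sub_self]
    rcases mul_eq_zero.1 h2 with h3 | h3
    · exact absurd (by exact_mod_cast sub_eq_zero.1 h3) hl
    · exact h3

theorem eq_zero_of_finrank_lt {k : ℕ} (h : Module.finrank ℝ E < k) (α : E [⋀^Fin k]→L[ℝ] ℂ) :
    α = 0 := by
  ext v
  refine α.toAlternatingMap.map_linearDependent v fun hv => ?_
  have := hv.fintype_card_le_finrank
  rw [Fintype.card_fin] at this
  omega

theorem deg_lam {m : ℕ} (J : E →L[ℝ] E) (e : Fin m → E) {c : ℂ} {x : Tot E}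
    (h : deg x = c • x) : deg (lam J e x) = (c - 2) • lam J e x := by
  have h1 : ∀ (v : E) (y : Tot E), deg (contr v y) = contr v (deg y) - contr v y := by
    intro v y
    rw [contr_deg]
    abel
  rw [lam_apply, map_smul, map_sum]
  simp only [h1, map_sub, h, map_smul]
  rw [Finset.sum_sub_distrib, Finset.sum_sub_distrib, ← Finset.smul_sum]
  module

theorem deg_lam_pow {m : ℕ} (J : E →L[ℝ] E) (e : Fin m → E) {c : ℂ} {x : Tot E}
    (h : deg x = c • x) (k : ℕ) :
    deg (((lam J e) ^ k) x) = (c - 2 * k) • ((lam J e) ^ k) x := by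
  induction k with
  | zero => simpa using h
  | succ k ih =>
    rw [pow_succ', Module.End.mul_apply, deg_lam J e ih]
    congr 1
    push_cast
    ring

theorem IsHol.lam_pow {I : E →L[ℝ] E} {x : Tot E} (hx : IsHol I x) {m : ℕ} (J : E →L[ℝ] E)
    (e : Fin m → E) (k : ℕ) : IsHol I (((Tot.lam J e) ^ k) x) := by
  induction k with
  | zero => exact hx
  | succ k ih => rw [pow_succ', Module.End.mul_apply]; exact ih.lam J e

/-- The powers of a form of degree two. -/
def powOm (Om : E [⋀^Fin 2]→L[ℝ] ℂ) (k : ℕ) : Tot E := ((wedge (single 2 Om)) ^ k) one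

theorem powOm_succ (Om : E [⋀^Fin 2]→L[ℝ] ℂ) (k : ℕ) :
    powOm Om (k + 1) = single 2 Om ⋏ powOm Om k := by
  rw [powOm, pow_succ', Module.End.mul_apply, powOm]

theorem powOm_zero (Om : E [⋀^Fin 2]→L[ℝ] ℂ) : powOm Om 0 = one := by simp [powOm]

theorem deg_powOm (Om : E [⋀^Fin 2]→L[ℝ] ℂ) (k : ℕ) :
    deg (powOm Om k) = ((2 * k : ℕ) : ℂ) • powOm Om k := by
  induction k with
  | zero => rw [powOm_zero, one, deg_single_zero]; simp [zero_smul']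
  | succ k ih =>
    rw [powOm_succ, deg_wedge, ih, deg_single, map_smul, map_smul, LinearMap.smul_apply]
    push_cast
    module

theorem single_powOm (Om : E [⋀^Fin 2]→L[ℝ] ℂ) (k : ℕ) :
    single (2 * k) (powOm Om k (2 * k)) = powOm Om k := (eq_single_of_deg (deg_powOm Om k)).symm

theorem par_single_two (Om : E [⋀^Fin 2]→L[ℝ] ℂ) : par (single 2 Om) = single 2 Om := by
  rw [par_single]; simp

theorem powOm_succ' (Om : E [⋀^Fin 2]→L[ℝ] ℂ) (k : ℕ) :
    powOm Om (k + 1) = powOm Om k ⋏ single 2 Om := by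
  rw [powOm_succ, wedge_comm_of_even (par_single_two Om)]

theorem conj_single (k : ℕ) (α : E [⋀^Fin k]→L[ℝ] ℂ) :
    conj (single k α) =
      single k ((Complex.conjCLE : ℂ →L[ℝ] ℂ).compContinuousAlternatingMap α) := by
  funext l
  rw [conj_apply]
  rcases eq_or_ne l k with rfl | h
  · rw [single_same, single_same]
  · rw [single_of_ne h, single_of_ne h]; ext v; simp

theorem conj_one : conj (one : Tot E) = one := by
  rw [one, conj_single]
  congr 1
  ext v
  simp

theorem conj_powOm (Om : E [⋀^Fin 2]→L[ℝ] ℂ) (k : ℕ) :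
    conj (powOm Om k) =
      powOm ((Complex.conjCLE : ℂ →L[ℝ] ℂ).compContinuousAlternatingMap Om) k := by
  induction k with
  | zero => rw [powOm_zero, powOm_zero, conj_one]
  | succ k ih => rw [powOm_succ, conj_wedge, ih, conj_single, powOm_succ]

theorem pull_one (P : E →L[ℝ] E) : pull P (one : Tot E) = one := by
  funext k
  rw [pull_apply]
  cases k with
  | zero => refine zero_ext (x := fun k => (one k).compContinuousLinearMap P) ?_; rfl
  | succ k => rw [one, single_of_ne (by omega)]; rfl

theorem pull_single (P : E →L[ℝ] E) (k : ℕ) (α : E [⋀^Fin k]→L[ℝ] ℂ) :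
    pull P (single k α) = single k (α.compContinuousLinearMap P) := by
  funext l
  rw [pull_apply]
  rcases eq_or_ne l k with rfl | h
  · rw [single_same, single_same]
  · rw [single_of_ne h, single_of_ne h]; rfl

namespace QuatHerm

variable {g : E →L[ℝ] E →L[ℝ] ℝ} {I J : E →L[ℝ] E} {Om : E [⋀^Fin 2]→L[ℝ] ℂ}

theorem isHol_powOm (h : QuatHerm g I J Om) (k : ℕ) : IsHol I (powOm Om k) := by
  induction k with
  | zero => rw [powOm_zero]; exact IsHol.one I
  | succ k ih => rw [powOm_succ]; exact h.isHol_totOm.wedge ih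

/-- The `sl₂`-string through the constant `1`. The commutator acts on `Ω^j` as `n - 2j`, and the sum
of these numbers over `j ≤ k` is `(k + 1)(n - k)`. -/
theorem lam_powOm (h : QuatHerm g I J Om) {n m : ℕ} (hm : m = 4 * n) {e : Fin m → E}
    (he : IsON g e) (k : ℕ) :
    lam J e (powOm Om (k + 1)) = (((k : ℂ) + 1) * (n - k)) • powOm Om k := by
  induction k with
  | zero =>
    have h0 : lam J e (one : Tot E) = 0 := by
      rw [lam_apply]
      simp [one, contr_single_zero, smul_zero']
    rw [powOm_succ, h.lam_wedge hm he (h.isHol_powOm 0), deg_powOm, powOm_zero, h0, map_zero]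
    push_cast
    module
  | succ k ih =>
    rw [powOm_succ, h.lam_wedge hm he (h.isHol_powOm (k + 1)), deg_powOm, ih, map_smul,
      ← powOm_succ]
    push_cast
    module

/-- For `k < n` the coefficient in `lam_powOm` is nonzero, so `Ω^{k+1} = 0` would force `Ω^k = 0`,
and in the end `1 = 0`. -/
theorem powOm_ne_zero (h : QuatHerm g I J Om) {n m : ℕ} (hm : m = 4 * n) {e : Fin m → E}
    (he : IsON g e) (k : ℕ) (hk : k ≤ n) : powOm Om k ≠ 0 := by
  induction k with
  | zero =>
    intro h0
    have h1 := congrArg (fun y : Tot E => y 0 0) h0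
    simp [powOm_zero, one, single_same] at h1
  | succ k ih =>
    intro h0
    have h1 := h.lam_powOm hm he k
    rw [h0, map_zero] at h1
    have hc : ((k : ℂ) + 1) * (n - k) ≠ 0 := by
      refine mul_ne_zero (by exact_mod_cast k.succ_ne_zero) (sub_ne_zero.2 ?_)
      exact_mod_cast (by omega : n ≠ k)
    exact ih (by omega) ((smul_eq_zero_iff_right hc).1 h1.symm)

/-- The action of `L_Ω` on the `Λ_Ω`-string through a form annihilated by `L_Ω`. -/
theorem wedge_lam_pow (h : QuatHerm g I J Om) {n m : ℕ} (hm : m = 4 * n) {e : Fin m → E}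
    (he : IsON g e) {x : Tot E} (hx : IsHol I x) {c : ℂ} (hc : deg x = c • x)
    (h0 : single 2 Om ⋏ x = 0) (k : ℕ) :
    single 2 Om ⋏ ((lam J e) ^ (k + 1)) x = (((k : ℂ) + 1) * (c - n - k)) • ((lam J e) ^ k) x := by
  have key : ∀ k : ℕ, single 2 Om ⋏ ((lam J e) ^ (k + 1)) x =
      lam J e (single 2 Om ⋏ ((lam J e) ^ k) x) + (c - 2 * k - n) • ((lam J e) ^ k) x := by
    intro k
    rw [h.lam_wedge hm he (hx.lam_pow J e k), deg_lam_pow J e hc, pow_succ', Module.End.mul_apply]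
    module
  induction k with
  | zero => rw [key, pow_zero, Module.End.one_apply, h0, map_zero]; push_cast; module
  | succ k ih =>
    rw [key, ih, map_smul, ← Module.End.mul_apply, ← pow_succ']
    push_cast
    module

/-- Downward induction on `p`, starting above the real dimension. Since `Ω ∧ x` vanishes by
induction, `x` is the top of a `Λ`-string. For `p > 2n` the coefficients `(k + 1)(p - n - k)` are
nonzero as long as `2k ≤ p`, so the string, which ends in zero once the degree would be negative, is
zero from the start. -/
theorem eq_zero_of_deg (h : QuatHerm g I J Om) {n : ℕ} (hm : Module.finrank ℝ E = 4 * n) (p : ℕ)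
    (hp : 2 * n < p) {x : Tot E} (hx : IsHol I x) (hc : deg x = (p : ℂ) • x) : x = 0 := by
  obtain ⟨e, he⟩ := exists_isON h.symm h.pos
  by_cases hbig : 4 * n < p
  · rw [eq_single_of_deg hc, eq_zero_of_finrank_lt (by omega) (x p)]
    exact Pi.single_zero p
  · have h0 : single 2 Om ⋏ x = 0 := by
      refine eq_zero_of_deg h hm (p + 2) (by omega) (h.isHol_totOm.wedge hx) ?_
      rw [deg_wedge, deg_single, hc, map_smul, map_smul, LinearMap.smul_apply]
      push_cast
      module
    have hk : ∀ k, 2 * k ≤ p → ((lam J e) ^ (k + 1)) x = 0 → ((lam J e) ^ k) x = 0 := by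
      intro k hkp hz
      have h1 := h.wedge_lam_pow hm he hx hc h0 k
      rw [hz, map_zero] at h1
      have hne : ((k : ℂ) + 1) * ((p : ℂ) - n - k) ≠ 0 := by
        refine mul_ne_zero (by exact_mod_cast k.succ_ne_zero) ?_
        rw [sub_sub]
        refine sub_ne_zero.2 ?_
        exact_mod_cast (by omega : p ≠ n + k)
      exact (smul_eq_zero_iff_right hne).1 h1.symm
    have hz : ∀ k, p < 2 * k → ((lam J e) ^ k) x = 0 := by
      intro k hkp
      have h1 := deg_lam_pow J e hc k
      funext l
      ext v
      have h2 : (l : ℂ) * ((lam J e) ^ k) x l v = ((p : ℂ) - 2 * k) * ((lam J e) ^ k) x l v :=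
        congrArg (fun y : Tot E => y l v) h1
      have h3 : ((l : ℂ) + 2 * k - p) * ((lam J e) ^ k) x l v = 0 := by linear_combination h2
      rcases mul_eq_zero.1 h3 with h4 | h4
      · have : l + 2 * k = p := by exact_mod_cast sub_eq_zero.1 h4
        omega
      · exact h4
    have hall : ∀ j k, k + j = p + 1 → ((lam J e) ^ k) x = 0 := by
      intro j
      induction j with
      | zero => intro k hk'; exact hz k (by omega)
      | succ j ih =>
        intro k hk'
        by_cases hkp : p < 2 * k
        · exact hz k hkp
        · exact hk k (by omega) (ih (k + 1) (by omega))
    simpa using hall (p + 1) 0 (by omega)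
termination_by 4 * n + 1 - p

/-- A form of type `(2n, 0)` is annihilated by `Ω ∧ ·`, since nothing lies above it. Hence `x` is a
multiple of `L^n Λ^n x`, and `Λ^n x` is a scalar, being of degree zero. -/
theorem exists_smul_powOm (h : QuatHerm g I J Om) {n : ℕ} (hm : Module.finrank ℝ E = 4 * n)
    {x : Tot E} (hx : IsHol I x) (hc : deg x = ((2 * n : ℕ) : ℂ) • x) :
    ∃ c : ℂ, x = c • powOm Om n := by
  obtain ⟨e, he⟩ := exists_isON h.symm h.pos
  have h0 : single 2 Om ⋏ x = 0 := by
    refine h.eq_zero_of_deg hm (2 * n + 2) (by omega) (h.isHol_totOm.wedge hx) ?_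
    rw [deg_wedge, deg_single, hc, map_smul, map_smul, LinearMap.smul_apply]
    push_cast
    module
  have hk : ∀ k, k ≤ n → ∃ a : ℂ, x = a • (((wedge (single 2 Om)) ^ k) (((lam J e) ^ k) x)) := by
    intro k
    induction k with
    | zero => intro _; exact ⟨1, by simp⟩
    | succ k ih =>
      intro hkn
      obtain ⟨a, ha⟩ := ih (by omega)
      have h1 := h.wedge_lam_pow hm he hx hc h0 k
      have hne : ((k : ℂ) + 1) * (((2 * n : ℕ) : ℂ) - n - k) ≠ 0 := by
        refine mul_ne_zero (by exact_mod_cast k.succ_ne_zero) ?_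
        rw [sub_sub]
        refine sub_ne_zero.2 ?_
        exact_mod_cast (by omega : 2 * n ≠ n + k)
      refine ⟨a * (((k : ℂ) + 1) * (((2 * n : ℕ) : ℂ) - n - k))⁻¹, ?_⟩
      rw [pow_succ, Module.End.mul_apply, h1, map_smul, smul_smul, mul_assoc,
        inv_mul_cancel₀ hne, mul_one]
      exact ha
  obtain ⟨a, ha⟩ := hk n le_rfl
  have h1 := deg_lam_pow J e hc n
  have h2 := eq_single_of_deg (k := 0) (x := ((lam J e) ^ n) x)
    (by rw [h1]; congr 1; push_cast; ring)
  refine ⟨a * ((lam J e) ^ n) x 0 0, ?_⟩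
  conv_lhs => rw [ha, h2]
  have h3 : single 0 (((lam J e) ^ n) x 0) = (((lam J e) ^ n) x 0 0) • (one : Tot E) := by
    rw [← wedge_one (single 0 _), single_zero_wedge]
  rw [h3, map_smul, smul_smul]
  rfl

/-- Writes `Λ` with the conjugate coefficients of `Ω`, the shape in which it is visibly adjoint to
multiplication by `Ω`. The type `(*, 0)` of `x` turns the contraction with an `I`-rotated vector
into a factor `√-1`. -/
theorem conj_om (h : QuatHerm g I J Om) {m : ℕ} {e : Fin m → E} (he : IsON g e) {x : Tot E}
    (hx : IsHol I x) :
    lam J e x = (1 / 2 : ℂ) • ∑ a, ∑ b, starRingEnd ℂ (Om ![e a, e b]) •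
      contr (e b) (contr (e a) x) := by
  rw [lam_apply, Finset.sum_comm]
  congr 1
  refine Finset.sum_congr rfl fun b _ => ?_
  have h1 : ∀ a, starRingEnd ℂ (Om ![e a, e b]) • contr (e b) (contr (e a) x) =
      (1 / 2 : ℂ) • (contr (e b) (contr (g (e a) (J (e b)) • e a) x) -
        Complex.I • contr (e b) (contr (g (e a) (I (J (e b))) • e a) x)) := by
    intro a
    rw [h.om, map_smul, map_smul, LinearMap.smul_apply, LinearMap.smul_apply, real_smul,
      real_smul, map_smul, map_smul]
    simp only [map_mul, map_add, Complex.conj_ofReal, Complex.conj_I, map_div₀, map_one, map_ofNat]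
    module
  rw [Finset.sum_congr rfl fun a _ => h1 a, ← Finset.smul_sum, Finset.sum_sub_distrib,
      ← Finset.smul_sum]
  simp only [← LinearMap.sum_apply, ← map_sum]
  rw [he.expand, he.expand, hx, map_smul, smul_smul, Complex.I_mul_I]
  module

end QuatHerm

end Tot

namespace Tot

variable {E : Type*} [NormedAddCommGroup E] [NormedSpace ℝ E] [FiniteDimensional ℝ E]

/-- Permuting the summation indices moves each permutation of the slots onto `β`, whose sign cancels
the one in the product. All `(k + 2)!` permutations therefore contribute equally. -/
theorem sum_altWedge_mul {m k : ℕ} (e : Fin m → E) (Om : E [⋀^Fin 2]→L[ℝ] ℂ)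
    (α : E [⋀^Fin k]→L[ℝ] ℂ) (β : E [⋀^Fin (k + 2)]→L[ℝ] ℂ) :
    ∑ i : Fin (k + 2) → Fin m, altWedge (Nat.add_comm 2 k) Om α (fun j => e (i j)) *
        starRingEnd ℂ (β (fun j => e (i j))) =
      ((k + 2).factorial / (2 * k.factorial) : ℂ) * ∑ i : Fin (k + 2) → Fin m,
        Om ![e (i 0), e (i 1)] * α (fun j => e (i j.succ.succ)) *
          starRingEnd ℂ (β (fun j => e (i j))) := by
  have hσ : ∀ σ : Equiv.Perm (Fin (k + 2)), ∑ i : Fin (k + 2) → Fin m,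
      ((Equiv.Perm.sign σ : ℤ) : ℂ) * (Om (fun j => e (i (σ (Fin.cast (Nat.add_comm 2 k)
        (Fin.castAdd k j))))) * α (fun j => e (i (σ (Fin.cast (Nat.add_comm 2 k)
        (Fin.natAdd 2 j)))))) * starRingEnd ℂ (β (fun j => e (i j))) =
      ∑ i : Fin (k + 2) → Fin m,
        Om ![e (i 0), e (i 1)] * α (fun j => e (i j.succ.succ)) *
          starRingEnd ℂ (β (fun j => e (i j))) := by
    intro σ
    refine Fintype.sum_equiv (Equiv.arrowCongr σ.symm (Equiv.refl (Fin m))) _ _ fun i => ?_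
    have h1 := β.toAlternatingMap.map_perm (fun j => e (i j)) σ
    simp only [ContinuousAlternatingMap.coe_toAlternatingMap] at h1
    have h2 : β (fun j => e (Equiv.arrowCongr σ.symm (Equiv.refl (Fin m)) i j)) =
        ((Equiv.Perm.sign σ : ℤ) : ℂ) * β (fun j => e (i j)) := by
      rw [← zsmul_eq_mul, ← Units.smul_def, ← h1]
      rfl
    have h3 : (fun j => e (i (σ (Fin.cast (Nat.add_comm 2 k) (Fin.castAdd k j))))) =
        ![e (i (σ 0)), e (i (σ 1))] := by
      funext j
      fin_cases j <;> rfl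
    have h4 : ∀ j : Fin k, Fin.cast (Nat.add_comm 2 k) (Fin.natAdd 2 j) = j.succ.succ := by
      intro j
      ext
      simp
    rw [h2, h3]
    simp only [h4, map_mul, map_intCast]
    simp only [Equiv.arrowCongr_apply, Equiv.coe_refl, Function.comp_apply, id, Equiv.symm_symm]
    ring
  simp only [altWedge_apply, Finset.mul_sum, Finset.sum_mul]
  rw [Finset.sum_comm]
  have h5 : ∀ σ : Equiv.Perm (Fin (k + 2)), ∑ i : Fin (k + 2) → Fin m,
      ((Nat.factorial 2 * k.factorial : ℂ)⁻¹) * (((Equiv.Perm.sign σ : ℤ) : ℂ) *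
        (Om (fun j => e (i (σ (Fin.cast (Nat.add_comm 2 k)
        (Fin.castAdd k j))))) * α (fun j => e (i (σ (Fin.cast (Nat.add_comm 2 k)
        (Fin.natAdd 2 j))))))) * starRingEnd ℂ (β (fun j => e (i j))) =
      ((Nat.factorial 2 * k.factorial : ℂ)⁻¹) * ∑ i : Fin (k + 2) → Fin m,
        Om ![e (i 0), e (i 1)] * α (fun j => e (i j.succ.succ)) *
          starRingEnd ℂ (β (fun j => e (i j))) := by
    intro σ
    rw [← hσ σ, Finset.mul_sum]
    exact Finset.sum_congr rfl fun i _ => by ring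
  rw [Finset.sum_congr rfl fun σ _ => h5 σ, Finset.sum_const, Finset.card_univ, Fintype.card_perm,
    Fintype.card_fin, nsmul_eq_mul, ← mul_assoc, Finset.mul_sum]
  refine Finset.sum_congr rfl fun i _ => ?_
  rw [Nat.factorial_two]
  push_cast
  ring

theorem sum_fin_succ_succ {m k : ℕ} (F : (Fin (k + 2) → Fin m) → ℂ) :
    ∑ i, F i = ∑ a, ∑ b, ∑ i : Fin k → Fin m, F (Matrix.vecCons a (Matrix.vecCons b i)) := by
  have key : ∀ (k : ℕ) (G : (Fin (k + 1) → Fin m) → ℂ),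
      ∑ i, G i = ∑ a, ∑ i : Fin k → Fin m, G (Matrix.vecCons a i) := by
    intro k G
    rw [← (Fin.consEquiv (fun _ : Fin (k + 1) => Fin m)).sum_comp, Fintype.sum_prod_type]
    rfl
  rw [key]
  exact Finset.sum_congr rfl fun a _ => key _ _

namespace QuatHerm

variable {g : E →L[ℝ] E →L[ℝ] ℝ} {I J : E →L[ℝ] E} {Om : E [⋀^Fin 2]→L[ℝ] ℂ}

/-- The adjointness of `L_Ω` and `Λ_Ω`, in one degree. -/
theorem adjoint_lam (h : QuatHerm g I J Om) {m : ℕ} {e : Fin m → E} (he : IsON g e) {x : Tot E}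
    (hx : IsHol I x) {k : ℕ} (α : E [⋀^Fin k]→L[ℝ] ℂ) :
    (((k + 2).factorial : ℂ)⁻¹) * ∑ i : Fin (k + 2) → Fin m,
        altWedge (Nat.add_comm 2 k) Om α (fun j => e (i j)) *
        starRingEnd ℂ (x (k + 2) (fun j => e (i j))) =
      ((k.factorial : ℂ)⁻¹) * ∑ i : Fin k → Fin m, α (fun j => e (i j)) *
        starRingEnd ℂ (lam J e x k (fun j => e (i j))) := by
  have h1 : ∀ i : Fin k → Fin m, α (fun j => e (i j)) *
        starRingEnd ℂ (lam J e x k (fun j => e (i j))) =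
      (1 / 2 : ℂ) * ∑ a, ∑ b, Om ![e a, e b] * α (fun j => e (i j)) *
        starRingEnd ℂ (x (k + 2)
          (fun j => e (Matrix.vecCons a (Matrix.vecCons b i) j))) := by
    intro i
    have h2 : lam J e x k (fun j => e (i j)) = (1 / 2 : ℂ) * ∑ a, ∑ b,
        starRingEnd ℂ (Om ![e a, e b]) *
          x (k + 2) (fun j => e (Matrix.vecCons a (Matrix.vecCons b i) j)) := by
      rw [h.conj_om he hx]
      simp only [Pi.smul_apply, ContinuousAlternatingMap.smul_apply, Finset.sum_apply,
        ContinuousAlternatingMap.sum_apply, smul_eq_mul, contr_apply_apply]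
      congr 1
      refine Finset.sum_congr rfl fun a _ => Finset.sum_congr rfl fun b _ => ?_
      congr 2
      funext j
      refine Fin.cases rfl (fun j => ?_) j
      exact Fin.cases rfl (fun j => rfl) j
    rw [h2]
    simp only [map_mul, map_sum, Complex.conj_conj, map_div₀, map_one, map_ofNat, Finset.mul_sum]
    refine Finset.sum_congr rfl fun a _ => Finset.sum_congr rfl fun b _ => ?_
    ring
  rw [sum_altWedge_mul, sum_fin_succ_succ, Finset.sum_congr rfl fun i _ => h1 i, ← Finset.mul_sum]
  have h3 : ∀ F : (Fin k → Fin m) → Fin m → Fin m → ℂ,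
      ∑ i, ∑ a, ∑ b, F i a b = ∑ a, ∑ b, ∑ i, F i a b := by
    intro F
    rw [Finset.sum_comm]
    exact Finset.sum_congr rfl fun a _ => Finset.sum_comm
  rw [h3, ← mul_assoc, ← mul_assoc]
  have hk : (k.factorial : ℂ) ≠ 0 := by exact_mod_cast k.factorial_ne_zero
  have hk2 : ((k + 2).factorial : ℂ) ≠ 0 := by exact_mod_cast (k + 2).factorial_ne_zero
  congr 1
  · field_simp

/-- Here `β` plays the role of `J_c α`. The value is minus a sum of squares, which is the positivity
that keeps the Laplacian from vanishing. -/
theorem lam_wedge_one_forms {m : ℕ} {e : Fin m → E} (hJJ : ∀ v, J (J v) = -v)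
    (α β : E [⋀^Fin 1]→L[ℝ] ℂ) (hβ : ∀ v, β ![v] = starRingEnd ℂ (α ![J v])) :
    lam J e (single 1 β ⋏ single 1 α) 0 0 =
      -((1 / 2 : ℝ) * ∑ j, (‖α ![e j]‖ ^ 2 + ‖α ![J (e j)]‖ ^ 2) : ℝ) := by
  have h1 : ∀ (v : E) (γ : E [⋀^Fin 1]→L[ℝ] ℂ), contr v (single 1 γ) = γ ![v] • one := by
    intro v γ
    funext k
    cases k with
    | zero =>
      refine zero_ext ?_
      rw [contr_apply_apply, single_same, Pi.smul_apply, ContinuousAlternatingMap.smul_apply, one,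
        single_same]
      simp
    | succ k =>
      ext u
      rw [contr_apply_apply, single_of_ne (by omega), Pi.smul_apply,
        ContinuousAlternatingMap.smul_apply, one, single_of_ne (by omega)]
      simp
  have h2 : ∀ j, contr (e j) (contr (J (e j)) (single 1 β ⋏ single 1 α)) =
      (-((‖α ![e j]‖ ^ 2 + ‖α ![J (e j)]‖ ^ 2 : ℝ) : ℂ)) • one := by
    intro j
    rw [contr_wedge, par_single, h1, h1, map_smul, LinearMap.smul_apply, one_wedge, map_add,
      map_smul, h1, map_smul, map_smul, wedge_one, map_smul, h1, hβ, hβ, hJJ]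
    have h3 : α ![-e j] = -α ![e j] := by
      have := congrArg (fun y : Tot E => y 0 0) (h1 (-e j) α)
      rw [map_neg, LinearMap.neg_apply, h1] at this
      simpa [one, single_same] using this.symm
    rw [h3, smul_smul, smul_smul, smul_smul, ← add_smul']
    congr 1
    push_cast
    rw [← Complex.mul_conj', ← Complex.mul_conj', map_neg]
    ring
  rw [lam_apply, Finset.sum_congr rfl fun j _ => h2 j, ← sum_smul']
  simp only [one, Pi.smul_apply, ContinuousAlternatingMap.smul_apply, single_same,
    ContinuousAlternatingMap.constOfIsEmpty_apply, smul_eq_mul, mul_one, Finset.sum_neg_distrib]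
  push_cast
  ring

end QuatHerm

theorem eq_zero_of_isON {g : E →L[ℝ] E →L[ℝ] ℝ} {m k : ℕ} {e : Fin m → E} (he : IsON g e)
    {α : E [⋀^Fin k]→L[ℝ] ℂ} (h : ∀ i : Fin k → Fin m, α (fun j => e (i j)) = 0) : α = 0 := by
  have hs : Submodule.span ℝ (Set.range e) = ⊤ := by
    rw [eq_top_iff]
    intro w _
    rw [← he.expand w]
    exact Submodule.sum_mem _ fun j _ =>
      Submodule.smul_mem _ _ (Submodule.subset_span ⟨j, rfl⟩)
  have hli : LinearIndependent ℝ e := by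
    rw [Fintype.linearIndependent_iff]
    intro c hc i
    have h1 := congrArg (g (e i)) hc
    simpa [he.orth] using h1
  let b := Module.Basis.mk hli hs.ge
  have : α.toAlternatingMap = 0 := by
    refine Module.Basis.ext_alternating b fun v _ => ?_
    have hb : ∀ i, b i = e i := fun i => by simp [b]
    simp only [hb]
    exact h v
  ext v
  exact congrArg (fun a => a v) this

theorem eq_zero_of_finrank_isON {g : E →L[ℝ] E →L[ℝ] ℝ} {m k : ℕ} {e : Fin m → E} (he : IsON g e)
    (hk : m < k) (α : E [⋀^Fin k]→L[ℝ] ℂ) : α = 0 := by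
  refine eq_zero_of_isON he fun i => ?_
  obtain ⟨a, b, hab, h⟩ := Fintype.exists_ne_map_eq_of_card_lt i (by simpa using hk)
  exact α.map_eq_zero_of_eq _ (congrArg e h) hab

end Tot

/-! ### Calculus of families of forms on a vector space -/

namespace Tot

variable {E : Type*} [NormedAddCommGroup E] [NormedSpace ℝ E] [FiniteDimensional ℝ E]

/-- Evaluation on tuples of basis vectors is injective. Finite dimension in each degree makes the
linear and bilinear operations on forms continuous, and so smooth. -/
instance finiteDimensional_alternating (k : ℕ) : FiniteDimensional ℝ (E [⋀^Fin k]→L[ℝ] ℂ) := by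
  let b := Module.finBasis ℝ E
  let f : (E [⋀^Fin k]→L[ℝ] ℂ) →ₗ[ℝ] ((Fin k → Fin (Module.finrank ℝ E)) → ℂ) :=
    { toFun := fun α i => α fun j => b (i j)
      map_add' := fun α β => rfl
      map_smul' := fun c α => rfl }
  refine FiniteDimensional.of_injective f ((injective_iff_map_eq_zero f).2 fun α h => ?_)
  have : α.toAlternatingMap = 0 := by
    refine Module.Basis.ext_alternating b fun v _ => ?_
    exact congrFun h v
  ext v
  exact congrArg (fun a => a v) this

/-! #### The algebraic part of the integrability lemma -/

theorem derv_altz (B : E →ₗ[ℝ] E) (T : E →ₗ[ℝ] Tot E) :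
    derv B (altz T) = altz ((derv B).restrictScalars ℝ ∘ₗ T) + altz (T ∘ₗ B) := by
  funext k
  induction k generalizing T with
  | zero => simp [derv_zero_deg]
  | succ k ih =>
    refine succ_ext fun w => ?_
    have h1 : altz ((contr w).restrictScalars ℝ ∘ₗ ((derv B).restrictScalars ℝ ∘ₗ T)) =
        altz ((contr (B w)).restrictScalars ℝ ∘ₗ T) +
        altz ((derv B).restrictScalars ℝ ∘ₗ ((contr w).restrictScalars ℝ ∘ₗ T)) := by
      rw [← map_add]
      exact altz_congr fun v => contr_derv B (T v) w
    have h2 := ih ((contr w).restrictScalars ℝ ∘ₗ T)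
    rw [contr_derv, contr_altz, contr_altz, map_sub, map_add, contr_altz, contr_altz, h1]
    simp only [Pi.add_apply, Pi.sub_apply] at h2 ⊢
    rw [h2]
    simp only [LinearMap.comp_apply, LinearMap.restrictScalars_apply, LinearMap.comp_assoc]
    abel

/-- The derivative of `pull L σ`, where `L`, `σ` have the value `L`, `x` and the derivative
`A`, `T`. -/
def pullDeriv (L : E →L[ℝ] E) (x : Tot E) (A : E →ₗ[ℝ] E →ₗ[ℝ] E) (T : E →ₗ[ℝ] Tot E) :
    E →ₗ[ℝ] Tot E :=
  (pull L).restrictScalars ℝ ∘ₗ T +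
    (altz (E := E)).restrictScalars ℝ ∘ₗ A.compr₂ ((pull L).restrictScalars ℝ ∘ₗ contrAt x)

/-- The derivative of `derv L σ`, where `L`, `σ` have the value `L`, `x` and the derivative
`A`, `T`. -/
def dervDeriv (L : E →ₗ[ℝ] E) (x : Tot E) (A : E →ₗ[ℝ] E →ₗ[ℝ] E) (T : E →ₗ[ℝ] Tot E) :
    E →ₗ[ℝ] Tot E :=
  (derv L).restrictScalars ℝ ∘ₗ T + dervAt A x

/-- The pointwise form of `d L^* = -L^* [δ_L, d]`. The terms with the derivative of the form match
because `L² = -1`. The terms with the derivative `A` of `L` differ by the alternatization of `v ↦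
δ_{B v}(L^* x)` with `B v w = -L (A v w - A (L v) (L w))`. Integrability, in the form `hA`, makes
`B` symmetric, and then `altz_dervAt_of_symm` applies. -/
theorem altz_pullDeriv {L : E →L[ℝ] E} (hL : ∀ v, L (L v) = -v) {A : E →ₗ[ℝ] E →ₗ[ℝ] E}
    (hA : ∀ v w, A v w - A (L v) (L w) = A w v - A (L w) (L v)) (x : Tot E)
    (T : E →ₗ[ℝ] Tot E) :
    altz (pullDeriv L x A T) =
      -pull L (derv L.toLinearMap (altz T) - altz (dervDeriv L.toLinearMap x A T)) := by
  have h1 : pull L (altz (T ∘ₗ L.toLinearMap)) = -altz ((pull L).restrictScalars ℝ ∘ₗ T) := by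
    rw [pull_altz, ← map_neg]
    refine altz_congr fun v => ?_
    simp only [LinearMap.comp_apply, LinearMap.restrictScalars_apply, ContinuousLinearMap.coe_coe,
      hL, map_neg, LinearMap.neg_apply]
  let C : E →ₗ[ℝ] E →ₗ[ℝ] E := A - A.compl₁₂ L.toLinearMap L.toLinearMap
  have h2 : altz ((altz (E := E)).restrictScalars ℝ ∘ₗ
      A.compr₂ ((pull L).restrictScalars ℝ ∘ₗ contrAt x)) - pull L (altz (dervAt A x)) =
      altz (dervAt (C.compr₂ (-L.toLinearMap)) (pull L x)) := by
    rw [pull_altz, ← map_sub]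
    refine altz_congr fun v => ?_
    simp only [LinearMap.sub_apply, LinearMap.comp_apply, LinearMap.restrictScalars_apply,
      dervAt_apply, ContinuousLinearMap.coe_coe, derv_apply]
    rw [pull_altz, ← map_sub]
    refine altz_congr fun w => ?_
    simp only [LinearMap.sub_apply, LinearMap.comp_apply, LinearMap.restrictScalars_apply,
      contrAt_apply, ContinuousLinearMap.coe_coe, LinearMap.compr₂_apply, LinearMap.neg_apply,
      contr_pull, map_neg, hL, neg_neg, C, LinearMap.compl₁₂_apply, map_sub]
  rw [altz_dervAt_of_symm (B := C.compr₂ (-L.toLinearMap))] at h2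
  · rw [pullDeriv, map_add, dervDeriv, map_add, derv_altz, sub_eq_zero.1 h2]
    simp only [map_add, map_sub, h1]
    abel
  · intro v w
    simp only [LinearMap.compr₂_apply, C, LinearMap.sub_apply, LinearMap.compl₁₂_apply,
      ContinuousLinearMap.coe_coe, hA v w]

/-! #### Derivatives -/

/-- The degreewise derivative of a family of forms. -/
def HasTotD (σ : E → Tot E) (T : E →ₗ[ℝ] Tot E) (y : E) : Prop :=
  ∀ k, HasFDerivAt (fun z => σ z k) (LinearMap.toContinuousLinearMap (LinearMap.proj k ∘ₗ T)) y

theorem exists_hasTotD {σ : E → Tot E} {y : E} (h : ∀ k, DifferentiableAt ℝ (fun z => σ z k) y) :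
    ∃ T, HasTotD σ T y := by
  refine ⟨LinearMap.pi fun k => (fderiv ℝ (fun z => σ z k) y).toLinearMap, fun k => ?_⟩
  exact (h k).hasFDerivAt

theorem HasTotD.extDeriv_eq {σ : E → Tot E} {T : E →ₗ[ℝ] Tot E} {y : E} (h : HasTotD σ T y)
    (k : ℕ) : extDeriv (fun z => σ z k) y = altz T (k + 1) := by
  rw [extDeriv, (h k).fderiv, altz_succ]

theorem HasTotD.bilinear {V W : Type*} [NormedAddCommGroup V] [NormedSpace ℝ V]
    [FiniteDimensional ℝ V] [NormedAddCommGroup W] [NormedSpace ℝ W] [FiniteDimensional ℝ W]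
    {U : Type*} [NormedAddCommGroup U] [NormedSpace ℝ U] (B : V →ₗ[ℝ] W →ₗ[ℝ] U)
    {f : E → V} {f' : E →L[ℝ] V} {g : E → W} {g' : E →L[ℝ] W} {y : E} (hf : HasFDerivAt f f' y)
    (hg : HasFDerivAt g g' y) {D : E →L[ℝ] U} (hD : ∀ v, D v = B (f' v) (g y) + B (f y) (g' v)) :
    HasFDerivAt (fun z => B (f z) (g z)) D y := by
  have h := (LinearMap.toContinuousBilinearMap B).hasFDerivAt_of_bilinear hf hg
  refine h.congr_fderiv ?_
  ext v
  rw [hD]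
  simp [add_comm]

/-- The exterior product in fixed degrees, as a bilinear map. -/
def altWedgeₗ {p q k : ℕ} (h : p + q = k) :
    (E [⋀^Fin p]→L[ℝ] ℂ) →ₗ[ℝ] (E [⋀^Fin q]→L[ℝ] ℂ) →ₗ[ℝ] (E [⋀^Fin k]→L[ℝ] ℂ) :=
  LinearMap.mk₂ ℝ (fun α β => altWedge h α β) (fun α α' β => altWedge_add_left h α α' β)
    (fun c α β => altWedge_smul_left h (c : ℂ) α β) (fun α β β' => altWedge_add_right h α β β')
    (fun c α β => altWedge_smul_right h (c : ℂ) α β)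

theorem HasTotD.wedge {σ η : E → Tot E} {T S : E →ₗ[ℝ] Tot E} {y : E} (hσ : HasTotD σ T y)
    (hη : HasTotD η S y) :
    HasTotD (fun z => σ z ⋏ η z) (wedgeRight T (η y) + wedgeLeft (σ y) S) y := by
  intro k
  have h : ∀ i ∈ (Finset.univ : Finset (Fin (k + 1))), HasFDerivAt (fun z =>
      altWedgeₗ (by omega : (i : ℕ) + (k - i) = k) (σ z i) (η z (k - i)))
      (LinearMap.toContinuousLinearMap
        ((altWedgeₗ (by omega : (i : ℕ) + (k - i) = k)).flip (η y (k - i)) ∘ₗ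
          LinearMap.proj (i : ℕ) ∘ₗ T +
        altWedgeₗ (by omega : (i : ℕ) + (k - i) = k) (σ y i) ∘ₗ
          LinearMap.proj (k - (i : ℕ)) ∘ₗ S)) y :=
    fun i _ => HasTotD.bilinear _ (hσ i) (hη (k - i)) fun v => rfl
  have h1 := HasFDerivAt.fun_sum h
  refine h1.congr_fderiv ?_
  ext1 v
  simp only [_root_.sum_apply, LinearMap.coe_toContinuousLinearMap']
  simp only [LinearMap.add_apply, Finset.sum_add_distrib, LinearMap.comp_apply,
    wedgeRight_apply, wedgeLeft_apply, map_add]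
  rfl

theorem derv_congr (B : E →ₗ[ℝ] E) {x y : Tot E} {k : ℕ} (h : x k = y k) :
    derv B x k = derv B y k := by
  cases k with
  | zero => rfl
  | succ k =>
    refine altz_congr_succ fun v => ?_
    simp only [LinearMap.comp_apply, contrAt_apply, contr_apply, h]

/-- The derivation induced by an endomorphism in a fixed degree, as a bilinear map. -/
def dervₗ (k : ℕ) : (E →L[ℝ] E) →ₗ[ℝ] (E [⋀^Fin k]→L[ℝ] ℂ) →ₗ[ℝ] (E [⋀^Fin k]→L[ℝ] ℂ) :=
  LinearMap.mk₂ ℝ (fun B α => derv B.toLinearMap (single k α) k)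
    (fun B B' α => by
      rw [ContinuousLinearMap.toLinearMap_add, derv_add]; rfl)
    (fun c B α => by
      rw [ContinuousLinearMap.toLinearMap_smul, derv_smul]; rfl)
    (fun B α β => by
      rw [← Pi.add_apply, ← map_add, single, Pi.single_add]; rfl)
    (fun c B α => by
      have : single k (c • α) = (c : ℂ) • single k α := by
        funext l
        by_cases hl : l = k
        · subst hl; rw [Pi.smul_apply, single_same, single_same]; rfl
        · rw [Pi.smul_apply, single_of_ne hl, single_of_ne hl]; ext v; simp
      rw [this, map_smul]; rfl)

theorem dervₗ_apply (k : ℕ) (B : E →L[ℝ] E) (x : Tot E) :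
    dervₗ k B (x k) = derv B.toLinearMap x k := derv_congr _ (single_same k (x k))

/-- A derivative of an endomorphism, as a bilinear map. -/
def endDeriv (A : E →L[ℝ] E →L[ℝ] E) : E →ₗ[ℝ] E →ₗ[ℝ] E :=
  LinearMap.mk₂ ℝ (fun v w => A v w) (by simp) (by simp) (by simp) (by simp)

theorem HasTotD.derv {σ : E → Tot E} {T : E →ₗ[ℝ] Tot E} {y : E} (hσ : HasTotD σ T y)
    {L : E → E →L[ℝ] E} {A : E →L[ℝ] E →L[ℝ] E} (hL : HasFDerivAt L A y) :
    HasTotD (fun z => derv (L z).toLinearMap (σ z))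
      (dervDeriv (L y).toLinearMap (σ y) (endDeriv A) T) y := by
  intro k
  have h := HasTotD.bilinear (dervₗ k) hL (hσ k)
    (D := LinearMap.toContinuousLinearMap (LinearMap.proj k ∘ₗ
      dervDeriv (L y).toLinearMap (σ y) (endDeriv A) T)) (fun v => by
      simp only [LinearMap.coe_toContinuousLinearMap', LinearMap.comp_apply, dervDeriv,
        LinearMap.proj_apply, LinearMap.add_apply, Pi.add_apply, LinearMap.restrictScalars_apply]
      rw [dervₗ_apply, dervₗ_apply, add_comm]
      rfl)
  simpa only [dervₗ_apply] using h

theorem HasTotD.pull {σ : E → Tot E} {T : E →ₗ[ℝ] Tot E} {y : E} (hσ : HasTotD σ T y)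
    {L : E → E →L[ℝ] E} {A : E →L[ℝ] E →L[ℝ] E} (hL : HasFDerivAt L A y) :
    HasTotD (fun z => pull (L z) (σ z)) (pullDeriv (L y) (σ y) (endDeriv A) T) y := by
  intro k
  have h := (hσ k).continuousAlternatingMapCompContinuousLinearMap hL
  refine h.congr_fderiv ?_
  ext1 v
  simp only [add_apply, ContinuousLinearMap.comp_apply,
    LinearMap.coe_toContinuousLinearMap']
  rw [fderivComp_eq_altz]
  rfl

/-! #### Smoothness -/

/-- Smoothness of a family of forms, degree by degree. -/
def SmoothFam (s : Set E) (σ : E → Tot E) : Prop := ∀ k, ContDiffOn ℝ ∞ (fun z => σ z k) s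

theorem contDiffOn_bilinear {V W : Type*} [NormedAddCommGroup V] [NormedSpace ℝ V]
    [FiniteDimensional ℝ V] [NormedAddCommGroup W] [NormedSpace ℝ W] [FiniteDimensional ℝ W]
    {U : Type*} [NormedAddCommGroup U] [NormedSpace ℝ U] (B : V →ₗ[ℝ] W →ₗ[ℝ] U)
    {f : E → V} {g : E → W} {s : Set E} (hf : ContDiffOn ℝ ∞ f s) (hg : ContDiffOn ℝ ∞ g s) :
    ContDiffOn ℝ ∞ (fun z => B (f z) (g z)) s := by
  have h := (LinearMap.toContinuousBilinearMap B).isBoundedBilinearMap.contDiff (n := ∞)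
  exact h.comp_contDiffOn (hf.prodMk hg)

theorem contDiffOn_linear {V : Type*} [NormedAddCommGroup V] [NormedSpace ℝ V]
    [FiniteDimensional ℝ V] {U : Type*} [NormedAddCommGroup U] [NormedSpace ℝ U] (B : V →ₗ[ℝ] U)
    {f : E → V} {s : Set E} (hf : ContDiffOn ℝ ∞ f s) :
    ContDiffOn ℝ ∞ (fun z => B (f z)) s :=
  (LinearMap.toContinuousLinearMap B).contDiff.comp_contDiffOn hf

theorem SmoothFam.wedge {s : Set E} {σ η : E → Tot E} (hσ : SmoothFam s σ) (hη : SmoothFam s η) :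
    SmoothFam s (fun z => σ z ⋏ η z) := by
  intro k
  have h : ContDiffOn ℝ ∞ (fun z => ∑ i : Fin (k + 1),
      altWedgeₗ (by omega : (i : ℕ) + (k - i) = k) (σ z i) (η z (k - i))) s :=
    ContDiffOn.sum fun i _ => contDiffOn_bilinear _ (hσ i) (hη (k - i))
  exact h

theorem SmoothFam.derv {s : Set E} {σ : E → Tot E} (hσ : SmoothFam s σ) {L : E → E →L[ℝ] E}
    (hL : ContDiffOn ℝ ∞ L s) : SmoothFam s (fun z => Tot.derv (L z).toLinearMap (σ z)) := by
  intro k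
  have h := contDiffOn_bilinear (dervₗ k) hL (hσ k)
  simpa only [dervₗ_apply] using h

/-- The interior product in a fixed degree, as a bilinear map. -/
def contrₗ (k : ℕ) : E →ₗ[ℝ] (E [⋀^Fin (k + 1)]→L[ℝ] ℂ) →ₗ[ℝ] (E [⋀^Fin k]→L[ℝ] ℂ) :=
  LinearMap.mk₂ ℝ (fun v α => α.curryLeft v) (fun v w α => α.curryLeft.map_add v w)
    (fun c v α => α.curryLeft.map_smul c v) (fun v α β => rfl) (fun c v α => rfl)

theorem SmoothFam.contr {s : Set E} {σ : E → Tot E} (hσ : SmoothFam s σ) {u : E → E}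
    (hu : ContDiffOn ℝ ∞ u s) : SmoothFam s (fun z => Tot.contr (u z) (σ z)) :=
  fun k => contDiffOn_bilinear (contrₗ k) hu (hσ (k + 1))

/-- The coefficient map in a finite basis is linear and injective, so a linear left inverse
reconstructs the form from its coefficients. -/
theorem contDiffOn_of_eval {k : ℕ} {f : E → E [⋀^Fin k]→L[ℝ] ℂ} {s : Set E}
    (h : ∀ v, ContDiffOn ℝ ∞ (fun z => f z v) s) : ContDiffOn ℝ ∞ f s := by
  let b := Module.finBasis ℝ E
  let F : (E [⋀^Fin k]→L[ℝ] ℂ) →ₗ[ℝ] ((Fin k → Fin (Module.finrank ℝ E)) → ℂ) :=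
    { toFun := fun α i => α fun j => b (i j)
      map_add' := fun α β => rfl
      map_smul' := fun c α => rfl }
  have hF : LinearMap.ker F = ⊥ := by
    refine LinearMap.ker_eq_bot'.2 fun α h => ?_
    have : α.toAlternatingMap = 0 := by
      refine Module.Basis.ext_alternating b fun v _ => ?_
      exact congrFun h v
    ext v
    exact congrArg (fun a => a v) this
  obtain ⟨G, hG⟩ := F.exists_leftInverse_of_injective hF
  have h1 : ContDiffOn ℝ ∞ (fun z => F (f z)) s := contDiffOn_pi.2 fun i => h _
  have h2 := contDiffOn_linear G h1
  have h3 : ∀ α, G (F α) = α := fun α => LinearMap.congr_fun hG α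
  simpa only [h3] using h2

theorem contDiffOn_eval {k : ℕ} {f : E → E [⋀^Fin k]→L[ℝ] ℂ} {s : Set E}
    (h : ContDiffOn ℝ ∞ f s) (v : Fin k → E) : ContDiffOn ℝ ∞ (fun z => f z v) s :=
  (ContinuousAlternatingMap.apply ℝ E ℂ v).contDiff.comp_contDiffOn h

theorem smoothFam_of_contr {s : Set E} {σ : E → Tot E} {k : ℕ}
    (h : ∀ w, ContDiffOn ℝ ∞ (fun z => Tot.contr w (σ z) k) s) :
    ContDiffOn ℝ ∞ (fun z => σ z (k + 1)) s := by
  refine contDiffOn_of_eval fun v => ?_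
  have h1 := contDiffOn_eval (h (v 0)) (Fin.tail v)
  simp only [contr_apply_apply] at h1
  have h2 : Matrix.vecCons (v 0) (Fin.tail v) = v := Fin.cons_self_tail v
  rwa [h2] at h1

/-- A contraction of a pullback is the pullback of a contraction with `L w`. Induction on the degree
thus avoids treating the pullback as a polynomial in `L`. -/
theorem SmoothFam.pull {s : Set E} {σ : E → Tot E} (hσ : SmoothFam s σ) {L : E → E →L[ℝ] E}
    (hL : ContDiffOn ℝ ∞ L s) : SmoothFam s (fun z => Tot.pull (L z) (σ z)) := by
  intro k
  induction k generalizing σ with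
  | zero =>
    refine contDiffOn_of_eval fun v => ?_
    have h1 := contDiffOn_eval (hσ 0) 0
    have h2 : ∀ z, Tot.pull (L z) (σ z) 0 v = σ z 0 0 := fun z => by
      rw [Subsingleton.elim v 0, pull_apply,
        ContinuousAlternatingMap.compContinuousLinearMap_apply]
      congr 1
      exact Subsingleton.elim _ _
    simpa only [h2] using h1
  | succ k ih =>
    refine smoothFam_of_contr fun w => ?_
    simp only [contr_pull]
    exact ih (hσ.contr (hL.clm_apply contDiffOn_const))

theorem SmoothFam.conj {s : Set E} {σ : E → Tot E} (hσ : SmoothFam s σ) :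
    SmoothFam s (fun z => Tot.conj (σ z)) := by
  intro k
  refine contDiffOn_of_eval fun v => ?_
  exact (Complex.conjCLE : ℂ →L[ℝ] ℂ).contDiff.comp_contDiffOn (contDiffOn_eval (hσ k) v)

theorem SmoothFam.hasTotD {s : Set E} (hs : IsOpen s) {σ : E → Tot E} (hσ : SmoothFam s σ) {y : E}
    (hy : y ∈ s) : ∃ T, HasTotD σ T y :=
  exists_hasTotD fun k => ((hσ k).contDiffAt (hs.mem_nhds hy)).differentiableAt (by simp)

theorem contDiffOn_extDeriv {s : Set E} (hs : IsOpen s) {k : ℕ} {σ : E → E [⋀^Fin k]→L[ℝ] ℂ}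
    (hσ : ContDiffOn ℝ ∞ σ s) : ContDiffOn ℝ ∞ (extDeriv σ) s := by
  have h1 : ContDiffOn ℝ ∞ (fun z => fderiv ℝ σ z) s := hσ.fderiv_of_isOpen hs (by simp)
  exact (ContinuousAlternatingMap.alternatizeUncurryFinCLM ℝ E ℂ).contDiff.comp_contDiffOn h1

end Tot

/-! ### Total forms on a manifold, in charts -/

namespace TotForm

open Tot

variable {E : Type*} [NormedAddCommGroup E] [NormedSpace ℝ E] [FiniteDimensional ℝ E]
  {M : Type*} [TopologicalSpace M] [ChartedSpace E M]

/-- The derivative of the inverse of the chart at `x₀`. -/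
def chartInv (x₀ : M) (y : E) : E →L[ℝ] E :=
  mfderiv 𝓘(ℝ, E) 𝓘(ℝ, E) (extChartAt 𝓘(ℝ, E) x₀).symm y

/-- The derivative of the chart at `x₀`. -/
def chartDer (x₀ : M) (x : M) : E →L[ℝ] E :=
  mfderiv 𝓘(ℝ, E) 𝓘(ℝ, E) (extChartAt 𝓘(ℝ, E) x₀) x

/-- The model chart at `x₀`. -/
abbrev ch (x₀ : M) : PartialEquiv M E := extChartAt 𝓘(ℝ, E) x₀

theorem isOpen_target (x₀ : M) : IsOpen (ch (E := E) x₀).target := isOpen_extChartAt_target x₀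

variable [IsManifold 𝓘(ℝ, E) ∞ M]

theorem chartDer_comp {x₀ : M} {y : E} (hy : y ∈ (ch x₀).target) :
    chartDer x₀ ((ch x₀).symm y) ∘L chartInv x₀ y = ContinuousLinearMap.id ℝ E := by
  have : IsManifold 𝓘(ℝ, E) 1 M := IsManifold.of_le (n := ∞) (by simp)
  have h := mfderiv_extChartAt_comp_mfderivWithin_extChartAt_symm (I := 𝓘(ℝ, E)) hy
  rw [ModelWithCorners.range_eq_univ, mfderivWithin_univ] at h
  exact h

theorem chartInv_comp {x₀ : M} {y : E} (hy : y ∈ (ch x₀).target) :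
    chartInv x₀ y ∘L chartDer x₀ ((ch x₀).symm y) = ContinuousLinearMap.id ℝ E := by
  have : IsManifold 𝓘(ℝ, E) 1 M := IsManifold.of_le (n := ∞) (by simp)
  have h := mfderivWithin_extChartAt_symm_comp_mfderiv_extChartAt (I := 𝓘(ℝ, E)) hy
  rw [ModelWithCorners.range_eq_univ, mfderivWithin_univ] at h
  exact h

theorem chartDer_chartInv {x₀ : M} {y : E} (hy : y ∈ (ch x₀).target) (v : E) :
    chartDer x₀ ((ch x₀).symm y) (chartInv x₀ y v) = v :=
  DFunLike.congr_fun (chartDer_comp hy) v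

theorem chartInv_chartDer {x₀ : M} {y : E} (hy : y ∈ (ch x₀).target) (v : E) :
    chartInv x₀ y (chartDer x₀ ((ch x₀).symm y) v) = v :=
  DFunLike.congr_fun (chartInv_comp hy) v

theorem mdifferentiableAt_symm {x₀ : M} {y : E} (hy : y ∈ (ch x₀).target) :
    MDifferentiableAt 𝓘(ℝ, E) 𝓘(ℝ, E) (extChartAt 𝓘(ℝ, E) x₀).symm y :=
  ((contMDiffOn_extChartAt_symm (n := ∞) x₀).contMDiffAt
    ((isOpen_target x₀).mem_nhds hy)).mdifferentiableAt (by simp)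

theorem mdifferentiableAt_chart {x₀ x : M} (hx : x ∈ (ch (E := E) x₀).source) :
    MDifferentiableAt 𝓘(ℝ, E) 𝓘(ℝ, E) (extChartAt 𝓘(ℝ, E) x₀) x :=
  (contMDiffAt_extChartAt' (n := ∞) (by simpa using hx)).mdifferentiableAt (by simp)

theorem fderiv_coordChange {x₀ x₁ : M} {y : E} (hy : y ∈ (ch x₀).target)
    (hy' : (ch x₀).symm y ∈ (ch (E := E) x₁).source) :
    fderiv ℝ (ch x₁ ∘ (ch x₀).symm) y = chartDer x₁ ((ch x₀).symm y) ∘L chartInv x₀ y := by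
  rw [← mfderiv_eq_fderiv]
  exact mfderiv_comp y (mdifferentiableAt_chart hy') (mdifferentiableAt_symm hy)

theorem contDiffAt_coordChange {x₀ x₁ : M} {y : E} (hy : y ∈ (ch x₀).target)
    (hy' : (ch x₀).symm y ∈ (ch (E := E) x₁).source) :
    ContDiffAt ℝ ∞ (ch (E := E) x₁ ∘ (ch x₀).symm) y := by
  have h := contDiffWithinAt_ext_coord_change (n := ∞) (I := 𝓘(ℝ, E)) x₁ x₀
    (y := y) (by simp only [PartialEquiv.trans_source, PartialEquiv.symm_source]; exact ⟨hy, hy'⟩)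
  rwa [ModelWithCorners.range_eq_univ, contDiffWithinAt_univ] at h

theorem eventually_source {x₀ x₁ : M} {y : E} (hy : y ∈ (ch x₀).target)
    (hy' : (ch x₀).symm y ∈ (ch (E := E) x₁).source) :
    ∀ᶠ z in nhds y, z ∈ (ch x₀).target ∧ (ch x₀).symm z ∈ (ch (E := E) x₁).source := by
  have h1 : ContinuousAt (ch (E := E) x₀).symm y :=
    (continuousOn_extChartAt_symm x₀).continuousAt ((isOpen_target x₀).mem_nhds hy)
  exact ((isOpen_target x₀).eventually_mem hy).and
    (h1.eventually ((isOpen_extChartAt_source x₁).eventually_mem hy'))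

/-- Total forms on `M`, i.e. families of forms in all degrees. -/
abbrev _root_.TotForm (E M : Type*) [NormedAddCommGroup E] [NormedSpace ℝ E] : Type _ := M → Tot E

/-- The component of a total form in degree `k`. -/
def comp (η : TotForm E M) (k : ℕ) : DiffForm E M k := fun x => η x k

/-- The chart expression of a total form. -/
def inC (η : TotForm E M) (x₀ : M) (y : E) : Tot E :=
  Tot.pull (chartInv x₀ y) (η ((ch x₀).symm y))

theorem inC_apply (η : TotForm E M) (x₀ : M) (y : E) (k : ℕ) :
    inC η x₀ y k = (comp η k).inChart x₀ y := rfl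

theorem eq_of_inC {η η' : TotForm E M} {x₀ : M} {y : E} (hy : y ∈ (ch x₀).target)
    (h : inC η x₀ y = inC η' x₀ y) : η ((ch x₀).symm y) = η' ((ch x₀).symm y) := by
  have h1 := congrArg (Tot.pull (chartDer x₀ ((ch x₀).symm y))) h
  rwa [inC, inC, pull_pull, pull_pull, chartInv_comp hy, pull_id, pull_id] at h1

theorem ext_inC {η η' : TotForm E M}
    (h : ∀ (x₀ : M), ∀ y ∈ (ch x₀).target, inC η x₀ y = inC η' x₀ y) : η = η' := by
  funext x
  have h1 := eq_of_inC (mem_extChartAt_target x) (h x _ (mem_extChartAt_target x))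
  rwa [extChartAt_to_inv] at h1

theorem inC_coordChange (η : TotForm E M) {x₀ x₁ : M} {y : E} (hy : y ∈ (ch x₀).target)
    (hy' : (ch x₀).symm y ∈ (ch (E := E) x₁).source) :
    inC η x₀ y = Tot.pull (fderiv ℝ (ch x₁ ∘ (ch x₀).symm) y)
      (inC η x₁ ((ch x₁ ∘ (ch x₀).symm) y)) := by
  have h1 : (ch x₁).symm (ch x₁ ((ch x₀).symm y)) = (ch x₀).symm y := (ch x₁).left_inv hy'
  have h2 := chartInv_comp ((ch x₁).map_source hy')
  rw [h1] at h2
  rw [inC, inC, Function.comp_apply, h1, fderiv_coordChange hy hy', pull_pull,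
    ← ContinuousLinearMap.comp_assoc, h2, ContinuousLinearMap.id_comp]

theorem two_le_infty : minSmoothness ℝ 2 ≤ ∞ := by
  rw [minSmoothness_of_isRCLikeNormedField]
  exact WithTop.coe_le_coe.2 (le_top : (2 : ℕ∞) ≤ ⊤)

/-- The total exterior derivative. -/
def d (η : TotForm E M) : TotForm E M := fun x k => match k with
  | 0 => 0
  | k + 1 => (comp η k).d x

/-- Smooth total forms. -/
def IsSmooth (η : TotForm E M) : Prop := ∀ x₀, SmoothFam (ch x₀).target (inC η x₀)

theorem isSmooth_iff (η : TotForm E M) : IsSmooth η ↔ ∀ k, (comp η k).IsSmooth :=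
  ⟨fun h k x₀ => h x₀ k, fun h x₀ k => h k x₀⟩

/-- The exterior derivative at a point is defined in the chart of that very point. Its compatibility
with pullback along the coordinate change allows it to be computed near `y` in one fixed chart. -/
theorem inC_d_succ {η : TotForm E M} (hη : IsSmooth η) {x₀ : M} {y : E} (hy : y ∈ (ch x₀).target)
    (k : ℕ) : inC (d η) x₀ y (k + 1) = extDeriv (fun z => inC η x₀ z k) y := by
  set x : M := (ch x₀).symm y with hx
  have hxs : (ch x₀).symm y ∈ (ch (E := E) x).source := mem_extChartAt_source x
  have e1 : extDeriv (fun z => inC η x₀ z k) y =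
      extDeriv (fun z => (inC η x ((ch x ∘ (ch x₀).symm) z) k).compContinuousLinearMap
        (fderiv ℝ (ch x ∘ (ch x₀).symm) z)) y := by
    refine Filter.EventuallyEq.extDeriv_eq ?_
    filter_upwards [eventually_source hy hxs] with z hz
    rw [inC_coordChange η hz.1 hz.2]
    rfl
  have e3 : DifferentiableAt ℝ (fun z => inC η x z k) ((ch x ∘ (ch x₀).symm) y) :=
    ((hη x k).contDiffAt ((isOpen_target x).mem_nhds
      (mem_extChartAt_target x))).differentiableAt (by simp)
  have e2 := extDeriv_pullback e3 (contDiffAt_coordChange hy hxs) two_le_infty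
  rw [e1, e2, fderiv_coordChange hy hxs]
  rfl

theorem inC_d_zero (η : TotForm E M) (x₀ : M) (y : E) : inC (d η) x₀ y 0 = 0 := by
  rw [inC, pull_apply]
  rfl

theorem inC_d {η : TotForm E M} (hη : IsSmooth η) {x₀ : M} {y : E} (hy : y ∈ (ch x₀).target)
    {T : E →ₗ[ℝ] Tot E} (hT : HasTotD (inC η x₀) T y) : inC (d η) x₀ y = altz T := by
  funext k
  cases k with
  | zero => rw [inC_d_zero, altz_zero_deg]
  | succ k => rw [inC_d_succ hη hy, hT.extDeriv_eq]

theorem isSmooth_d {η : TotForm E M} (hη : IsSmooth η) : IsSmooth (d η) := by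
  intro x₀ k
  cases k with
  | zero =>
    simp only [inC_d_zero]
    exact contDiffOn_const
  | succ k =>
    refine (contDiffOn_extDeriv (isOpen_target x₀) (hη x₀ k)).congr fun y hy => ?_
    exact inC_d_succ hη hy k

theorem d_d {η : TotForm E M} (hη : IsSmooth η) : d (d η) = 0 := by
  refine ext_inC fun x₀ y hy => ?_
  funext k
  have h0 : inC (0 : TotForm E M) x₀ y k = 0 := by rw [inC, Pi.zero_apply, map_zero]; rfl
  rw [h0]
  cases k with
  | zero => exact inC_d_zero _ _ _
  | succ k =>
    rw [inC_d_succ (isSmooth_d hη) hy]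
    cases k with
    | zero =>
      have h1 : (fun z => inC (d η) x₀ z 0) = fun _ => 0 := funext fun z => inC_d_zero _ _ _
      rw [h1]
      simp only [extDeriv, fderiv_fun_const, Pi.zero_apply]
      ext v
      simp [ContinuousAlternatingMap.alternatizeUncurryFin_apply]
    | succ k =>
      have h1 : (fun z => inC (d η) x₀ z (k + 1)) =ᶠ[nhds y]
          extDeriv (fun z => inC η x₀ z k) := by
        filter_upwards [(isOpen_target x₀).mem_nhds hy] with z hz
        exact inC_d_succ hη hz k
      rw [h1.extDeriv_eq]
      exact extDeriv_extDeriv_apply ((hη x₀ k).contDiffAt ((isOpen_target x₀).mem_nhds hy))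
        two_le_infty

end TotForm

/-! ### Naturality of the operations in charts, and integrable fields of endomorphisms -/

namespace TotForm

open Tot

variable {E : Type*} [NormedAddCommGroup E] [NormedSpace ℝ E] [FiniteDimensional ℝ E]
  {M : Type*} [TopologicalSpace M] [ChartedSpace E M] [IsManifold 𝓘(ℝ, E) ∞ M]

/-- The chart expression of a vector field. -/
def vecC (V : M → E) (x₀ : M) (y : E) : E := chartDer x₀ ((ch x₀).symm y) (V ((ch x₀).symm y))

/-- The chart expression of a field of endomorphisms. -/
def endC (B : M → E →L[ℝ] E) (x₀ : M) (y : E) : E →L[ℝ] E :=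
  chartDer x₀ ((ch x₀).symm y) ∘L B ((ch x₀).symm y) ∘L chartInv x₀ y

/-- Smooth fields of endomorphisms. -/
def SmoothEnd (B : M → E →L[ℝ] E) : Prop := ∀ x₀, ContDiffOn ℝ ∞ (endC B x₀) (ch x₀).target

theorem chartInv_endC (B : M → E →L[ℝ] E) {x₀ : M} {y : E} (hy : y ∈ (ch x₀).target) (v : E) :
    chartInv x₀ y (endC B x₀ y v) = B ((ch x₀).symm y) (chartInv x₀ y v) :=
  chartInv_chartDer hy _

theorem inC_wedge (η ξ : TotForm E M) (x₀ : M) (y : E) :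
    inC (fun x => η x ⋏ ξ x) x₀ y = inC η x₀ y ⋏ inC ξ x₀ y := pull_wedge _ _ _

theorem inC_conj (η : TotForm E M) (x₀ : M) (y : E) :
    inC (fun x => Tot.conj (η x)) x₀ y = Tot.conj (inC η x₀ y) := (conj_pull _ _).symm

theorem inC_derv (B : M → E →L[ℝ] E) (η : TotForm E M) {x₀ : M} {y : E}
    (hy : y ∈ (ch x₀).target) :
    inC (fun x => Tot.derv (B x).toLinearMap (η x)) x₀ y =
      Tot.derv (endC B x₀ y).toLinearMap (inC η x₀ y) :=
  pull_derv _ _ _ _ (fun v => (chartInv_endC B hy v).symm) _ rfl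

theorem inC_pull (B : M → E →L[ℝ] E) (η : TotForm E M) {x₀ : M} {y : E}
    (hy : y ∈ (ch x₀).target) :
    inC (fun x => Tot.pull (B x) (η x)) x₀ y = Tot.pull (endC B x₀ y) (inC η x₀ y) := by
  rw [inC, inC, pull_pull, pull_pull]
  congr 2
  ext v
  exact (chartInv_endC B hy v).symm

theorem inC_add (η ξ : TotForm E M) (x₀ : M) (y : E) :
    inC (η + ξ) x₀ y = inC η x₀ y + inC ξ x₀ y := by
  rw [inC, Pi.add_apply, map_add]; rfl

theorem inC_smul (c : ℂ) (η : TotForm E M) (x₀ : M) (y : E) :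
    inC (c • η) x₀ y = c • inC η x₀ y := by
  rw [inC, Pi.smul_apply, map_smul]; rfl

theorem IsSmooth.congr_inC {η : TotForm E M} {F : M → E → Tot E}
    (h : ∀ x₀, ∀ y ∈ (ch x₀).target, inC η x₀ y = F x₀ y)
    (hF : ∀ x₀, SmoothFam (ch x₀).target (F x₀)) : IsSmooth η :=
  fun x₀ k => (hF x₀ k).congr fun y hy => by rw [h x₀ y hy]

theorem IsSmooth.add {η ξ : TotForm E M} (hη : IsSmooth η) (hξ : IsSmooth ξ) : IsSmooth (η + ξ) :=
  fun x₀ k => (((hη x₀ k).add (hξ x₀ k))).congr fun y hy => by rw [inC_add]; rfl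

theorem IsSmooth.smul {η : TotForm E M} (c : ℂ) (hη : IsSmooth η) : IsSmooth (c • η) :=
  fun x₀ k => ((hη x₀ k).const_smul c).congr fun y hy => by rw [inC_smul]; rfl

theorem IsSmooth.zero : IsSmooth (0 : TotForm E M) := by
  intro x₀ k
  have h0 : ∀ y, inC (0 : TotForm E M) x₀ y k = 0 := fun y => by
    rw [inC, Pi.zero_apply, map_zero]; rfl
  simp only [h0]
  exact contDiffOn_const

theorem IsSmooth.wedge {η ξ : TotForm E M} (hη : IsSmooth η) (hξ : IsSmooth ξ) :
    IsSmooth (fun x => η x ⋏ ξ x) :=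
  IsSmooth.congr_inC (fun x₀ y hy => inC_wedge η ξ x₀ y) fun x₀ => (hη x₀).wedge (hξ x₀)

theorem IsSmooth.conj {η : TotForm E M} (hη : IsSmooth η) : IsSmooth (fun x => Tot.conj (η x)) :=
  IsSmooth.congr_inC (fun x₀ y hy => inC_conj η x₀ y) fun x₀ => (hη x₀).conj

theorem IsSmooth.derv {η : TotForm E M} (hη : IsSmooth η) {B : M → E →L[ℝ] E}
    (hB : SmoothEnd B) : IsSmooth (fun x => Tot.derv (B x).toLinearMap (η x)) :=
  IsSmooth.congr_inC (fun x₀ y hy => inC_derv B η hy) fun x₀ => (hη x₀).derv (hB x₀)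

theorem IsSmooth.pull {η : TotForm E M} (hη : IsSmooth η) {B : M → E →L[ℝ] E}
    (hB : SmoothEnd B) : IsSmooth (fun x => Tot.pull (B x) (η x)) :=
  IsSmooth.congr_inC (fun x₀ y hy => inC_pull B η hy) fun x₀ => (hη x₀).pull (hB x₀)

theorem inC_par (η : TotForm E M) (x₀ : M) (y : E) :
    inC (fun x => Tot.par (η x)) x₀ y = Tot.par (inC η x₀ y) := by
  simp only [← pull_neg_id]
  rw [inC, inC, pull_pull, pull_pull]
  congr 2
  ext v
  simp

theorem IsSmooth.single {k : ℕ} {α : DiffForm E M k} (h : α.IsSmooth) :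
    IsSmooth (fun x => Tot.single k (α x) : TotForm E M) := by
  rw [isSmooth_iff]
  intro l
  by_cases hl : l = k
  · subst hl
    have h1 : comp (fun x => Tot.single l (α x) : TotForm E M) l = α :=
      funext fun x => single_same (E := E) l (α x)
    rw [h1]
    exact h
  · have h1 : comp (fun x => Tot.single k (α x) : TotForm E M) l = comp (0 : TotForm E M) l :=
      funext fun x => single_of_ne (E := E) hl (α x)
    rw [h1]
    exact (isSmooth_iff _).1 IsSmooth.zero l

theorem d_add {η ξ : TotForm E M} (hη : IsSmooth η) (hξ : IsSmooth ξ) : d (η + ξ) = d η + d ξ := by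
  refine ext_inC fun x₀ y hy => ?_
  obtain ⟨T, hT⟩ := (hη x₀).hasTotD (isOpen_target x₀) hy
  obtain ⟨S, hS⟩ := (hξ x₀).hasTotD (isOpen_target x₀) hy
  have h : HasTotD (inC (η + ξ) x₀) (T + S) y := fun k => by
    simp only [inC_add]
    exact (hT k).add (hS k)
  rw [inC_add, inC_d hη hy hT, inC_d hξ hy hS, inC_d (hη.add hξ) hy h, map_add]

theorem d_smul (c : ℂ) {η : TotForm E M} (hη : IsSmooth η) : d (c • η) = c • d η := by
  refine ext_inC fun x₀ y hy => ?_
  obtain ⟨T, hT⟩ := (hη x₀).hasTotD (isOpen_target x₀) hy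
  have h : HasTotD (inC (c • η) x₀) (c • T) y := fun k => by
    simp only [inC_smul]
    exact (hT k).const_smul c
  rw [inC_smul, inC_d hη hy hT, inC_d (hη.smul c) hy h, map_smul]

theorem d_wedge {η ξ : TotForm E M} (hη : IsSmooth η) (hξ : IsSmooth ξ) :
    d (fun x => η x ⋏ ξ x) = (fun x => d η x ⋏ ξ x) + fun x => Tot.par (η x) ⋏ d ξ x := by
  refine ext_inC fun x₀ y hy => ?_
  obtain ⟨T, hT⟩ := (hη x₀).hasTotD (isOpen_target x₀) hy
  obtain ⟨S, hS⟩ := (hξ x₀).hasTotD (isOpen_target x₀) hy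
  have h : HasTotD (inC (fun x => η x ⋏ ξ x) x₀)
      (wedgeRight T (inC ξ x₀ y) + wedgeLeft (inC η x₀ y) S) y := by
    have := hT.wedge hS
    simpa only [← inC_wedge] using this
  rw [inC_add, inC_wedge, inC_wedge, inC_par, inC_d hη hy hT, inC_d hξ hy hS,
    inC_d (hη.wedge hξ) hy h, map_add, altz_wedgeRight, altz_wedgeLeft]

theorem d_conj {η : TotForm E M} (hη : IsSmooth η) :
    d (fun x => Tot.conj (η x)) = fun x => Tot.conj (d η x) := by
  refine ext_inC fun x₀ y hy => ?_
  obtain ⟨T, hT⟩ := (hη x₀).hasTotD (isOpen_target x₀) hy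
  let S : E →ₗ[ℝ] Tot E :=
    { toFun := fun v => Tot.conj (T v)
      map_add' := fun v w => by rw [map_add, map_add]
      map_smul' := fun c v => by
        rw [map_smul, real_smul, LinearMap.map_smulₛₗ, Complex.conj_ofReal]; rfl }
  have h : HasTotD (inC (fun x => Tot.conj (η x)) x₀) S y := fun k => by
    simp only [inC_conj]
    let C : (E [⋀^Fin k]→L[ℝ] ℂ) →ₗ[ℝ] (E [⋀^Fin k]→L[ℝ] ℂ) :=
      { toFun := fun α => (Complex.conjCLE : ℂ →L[ℝ] ℂ).compContinuousAlternatingMap α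
        map_add' := fun α β => by ext v; simp
        map_smul' := fun c α => by ext v; simp }
    exact (LinearMap.toContinuousLinearMap C).hasFDerivAt.comp y (hT k)
  rw [inC_conj, inC_d hη hy hT, inC_d hη.conj hy h]
  funext k
  cases k with
  | zero => ext v; simp [conj_apply_apply]
  | succ k =>
    ext v
    simp only [conj_apply_apply, altz_succ_apply, map_sum, zsmul_eq_mul, map_mul, map_intCast]
    rfl

/-- The infinitesimal form of integrability of a field of complex structures. -/
def IsIntegrable (B : M → E →L[ℝ] E) : Prop := ∀ (x : M) (v w : E),
  fderiv ℝ (endC B x) (ch x x) v w -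
    fderiv ℝ (endC B x) (ch x x) (endC B x (ch x x) v) (endC B x (ch x x) w) =
  fderiv ℝ (endC B x) (ch x x) w v -
    fderiv ℝ (endC B x) (ch x x) (endC B x (ch x x) w) (endC B x (ch x x) v)

theorem endC_endC {B : M → E →L[ℝ] E} (hBB : ∀ x v, B x (B x v) = -v) {x₀ : M} {y : E}
    (hy : y ∈ (ch x₀).target) (v : E) : endC B x₀ y (endC B x₀ y v) = -v := by
  change chartDer x₀ _ (B _ (chartInv x₀ y (endC B x₀ y v))) = _
  rw [chartInv_endC B hy, hBB, map_neg, chartDer_chartInv hy]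

theorem SmoothEnd.hasFDerivAt {B : M → E →L[ℝ] E} (hB : SmoothEnd B) {x₀ : M} {y : E}
    (hy : y ∈ (ch x₀).target) : HasFDerivAt (endC B x₀) (fderiv ℝ (endC B x₀) y) y :=
  (((hB x₀).contDiffAt ((isOpen_target x₀).mem_nhds hy)).differentiableAt (by simp)).hasFDerivAt

/-- This is `altz_pullDeriv` in the chart at `x`, with the derivatives of the chart expressions of
`B` and `η` inserted. -/
theorem d_pull {B : M → E →L[ℝ] E} (hB : SmoothEnd B) (hBB : ∀ x v, B x (B x v) = -v)
    (hInt : IsIntegrable B) {η : TotForm E M} (hη : IsSmooth η) (x : M) :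
    d (fun x => Tot.pull (B x) (η x)) x = -Tot.pull (B x) (Tot.derv (B x).toLinearMap (d η x) -
      d (fun x => Tot.derv (B x).toLinearMap (η x)) x) := by
  have hy := mem_extChartAt_target (I := 𝓘(ℝ, E)) x
  obtain ⟨T, hT⟩ := (hη x).hasTotD (isOpen_target x) hy
  have hL := hB.hasFDerivAt hy
  have ev : ∀ᶠ z in nhds (ch (E := E) x x), z ∈ (ch x).target := (isOpen_target x).eventually_mem hy
  have h1 : HasTotD (inC (fun x => Tot.pull (B x) (η x)) x) _ _ := fun k =>
    ((hT.pull hL) k).congr_of_eventuallyEq (by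
      filter_upwards [ev] with z hz
      rw [inC_pull B η hz])
  have h2 : HasTotD (inC (fun x => Tot.derv (B x).toLinearMap (η x)) x) _ _ := fun k =>
    ((hT.derv hL) k).congr_of_eventuallyEq (by
      filter_upwards [ev] with z hz
      rw [inC_derv B η hz])
  have key : inC (d (fun x => Tot.pull (B x) (η x))) x (ch x x) =
      inC (fun x => -Tot.pull (B x) (Tot.derv (B x).toLinearMap (d η x) -
        d (fun x => Tot.derv (B x).toLinearMap (η x)) x)) x (ch x x) := by
    rw [inC_d (hη.pull hB) hy h1, altz_pullDeriv (endC_endC hBB hy) (hInt x),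
      ← inC_d (hη.derv hB) hy h2, ← inC_d hη hy hT]
    have e1 := inC_pull B (fun x => Tot.derv (B x).toLinearMap (d η x) -
        d (fun x => Tot.derv (B x).toLinearMap (η x)) x) hy
    have e2 : inC (fun x => Tot.derv (B x).toLinearMap (d η x) -
        d (fun x => Tot.derv (B x).toLinearMap (η x)) x) x (ch x x) =
        inC (fun x => Tot.derv (B x).toLinearMap (d η x)) x (ch x x) -
        inC (d (fun x => Tot.derv (B x).toLinearMap (η x))) x (ch x x) := by
      rw [inC, map_sub]; rfl
    rw [e2, inC_derv B _ hy] at e1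
    rw [← e1, inC, inC, map_neg]
  have h3 := eq_of_inC hy key
  rwa [extChartAt_to_inv] at h3

end TotForm

/-! ### Vector fields in charts and the Nijenhuis tensor -/

namespace TotForm

open Tot Bundle

variable {E : Type*} [NormedAddCommGroup E] [NormedSpace ℝ E] [FiniteDimensional ℝ E]
  {M : Type*} [TopologicalSpace M] [ChartedSpace E M] [IsManifold 𝓘(ℝ, E) ∞ M]

theorem trivializationAt_snd {x₀ x : M} (hx : x ∈ (ch (E := E) x₀).source)
    (v : TangentSpace 𝓘(ℝ, E) x) :
    (trivializationAt E (TangentSpace 𝓘(ℝ, E)) x₀ ⟨x, v⟩).2 = chartDer (E := E) x₀ x v := by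
  have : IsManifold 𝓘(ℝ, E) 1 M := IsManifold.of_le (n := ∞) (by simp)
  have hx' : x ∈ (chartAt E x₀).source := by simpa using hx
  have h := TangentBundle.continuousLinearMapAt_trivializationAt (𝕜 := ℝ) (I := 𝓘(ℝ, E)) hx'
  have h1 := DFunLike.congr_fun h v
  rw [Trivialization.continuousLinearMapAt_apply, Trivialization.linearMapAt_apply,
    if_pos (by simpa using hx')] at h1
  exact h1

/-- Translates smoothness of sections of the tangent bundle into smoothness in coordinates. The
quaternionic action and the metric are then tested on the coordinate fields `constField`. -/
theorem contMDiffOn_section_iff (V : ∀ x : M, TangentSpace 𝓘(ℝ, E) x) (x₀ : M) :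
    ContMDiffOn 𝓘(ℝ, E) (𝓘(ℝ, E).prod 𝓘(ℝ, E)) ∞
      (fun x => TotalSpace.mk' E (E := fun x : M => TangentSpace 𝓘(ℝ, E) x) x (V x))
      (ch (E := E) x₀).source ↔ ContDiffOn ℝ ∞ (vecC (E := E) V x₀) (ch x₀).target := by
  rw [Trivialization.contMDiffOn_section_iff (trivializationAt E (TangentSpace 𝓘(ℝ, E)) x₀)
    (isOpen_extChartAt_source x₀) (by simp [extChartAt_source])]
  have hcongr : ∀ x ∈ (ch (E := E) x₀).source,
      (trivializationAt E (TangentSpace 𝓘(ℝ, E)) x₀ ⟨x, V x⟩).2 = chartDer (E := E) x₀ x (V x) :=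
    fun x hx => trivializationAt_snd hx (V x)
  rw [contMDiffOn_congr hcongr, ← contMDiffOn_iff_contDiffOn]
  constructor
  · intro h
    exact h.comp (contMDiffOn_extChartAt_symm x₀) fun y hy => (ch x₀).map_target hy
  · intro h
    have h1 : ContMDiffOn 𝓘(ℝ, E) 𝓘(ℝ, E) ∞ (vecC (E := E) V x₀ ∘ ch x₀) (ch (E := E) x₀).source :=
      h.comp (by simpa [extChartAt_source] using contMDiffOn_extChartAt (I := 𝓘(ℝ, E)) (x := x₀))
        fun x hx => (ch x₀).map_source hx
    refine h1.congr fun x hx => ?_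
    exact congrArg (fun z => chartDer (E := E) x₀ x ((V : M → E) z)) ((ch x₀).left_inv hx).symm |>.trans
      (congrArg (fun z => chartDer (E := E) x₀ z ((V : M → E) ((ch x₀).symm (ch x₀ x))))
        ((ch x₀).left_inv hx).symm)

/-- The vector field that is constant in the chart at `x₀`. -/
def constField (x₀ : M) (v : E) (x : M) : E := chartInv x₀ (ch x₀ x) v

theorem vecC_constField (x₀ : M) (v : E) {y : E} (hy : y ∈ (ch x₀).target) :
    vecC (constField x₀ v) x₀ y = v := by
  rw [vecC, constField, (ch x₀).right_inv hy, chartDer_chartInv hy]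

theorem vecC_end_constField (B : M → E →L[ℝ] E) (x₀ : M) (v : E) {y : E}
    (hy : y ∈ (ch x₀).target) :
    vecC (fun x => B x (constField x₀ v x)) x₀ y = endC B x₀ y v := by
  rw [vecC, constField, (ch x₀).right_inv hy]
  rfl

theorem contMDiffOn_constField (x₀ : M) (v : E) :
    ContMDiffOn 𝓘(ℝ, E) (𝓘(ℝ, E).prod 𝓘(ℝ, E)) ∞
      (fun x => TotalSpace.mk' E (E := fun x : M => TangentSpace 𝓘(ℝ, E) x) x
        (constField (E := E) x₀ v x))
      (ch (E := E) x₀).source :=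
  (contMDiffOn_section_iff (constField (E := E) x₀ v) x₀).2 (contDiffOn_const.congr fun y hy => vecC_constField x₀ v hy)

theorem contDiffOn_clm_of_eval {V : Type*} [NormedAddCommGroup V] [NormedSpace ℝ V]
    {f : E → E →L[ℝ] V} {s : Set E}
    (h : ∀ v, ContDiffOn ℝ ∞ (fun z => f z v) s) : ContDiffOn ℝ ∞ f s :=
  contDiffOn_clm_apply.2 h

/-- The Lie bracket of vector fields. -/
def brk (V W : M → E) (x : M) : E := VectorField.mlieBracket (M := M) 𝓘(ℝ, E) V W x

/-- The bracket on a manifold is by definition the bracket in the chart at the point; it remains to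
see that the inverse derivatives used in that definition agree with `chartDer` near the point. -/
theorem chartDer_brk (V W : M → E) (x : M) :
    chartDer x x (brk V W x) = VectorField.lieBracket ℝ (vecC V x) (vecC W x) (ch x x) := by
  have hy := mem_extChartAt_target (I := 𝓘(ℝ, E)) x
  have hinv : ∀ (x₀ : M), ∀ y ∈ (ch (E := E) x₀).target,
      (chartInv x₀ y).inverse = chartDer x₀ ((ch x₀).symm y) := fun x₀ y hy' =>
    ContinuousLinearMap.inverse_eq (chartInv_comp hy') (chartDer_comp hy')
  have hinv' : (chartDer x x : E →L[ℝ] E).inverse = chartInv x (ch x x) := by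
    have h1 := chartInv_comp hy
    have h2 := chartDer_comp hy
    rw [extChartAt_to_inv] at h1 h2
    exact ContinuousLinearMap.inverse_eq h2 h1
  let Q : E → E →L[ℝ] E := fun z =>
    mfderivWithin 𝓘(ℝ, E) 𝓘(ℝ, E) (extChartAt 𝓘(ℝ, E) x).symm (Set.range 𝓘(ℝ, E)) z
  have hQ : ∀ z, Q z = chartInv x z := fun z => by
    change mfderivWithin 𝓘(ℝ, E) 𝓘(ℝ, E) (extChartAt 𝓘(ℝ, E) x).symm (Set.range 𝓘(ℝ, E)) z = _
    rw [ModelWithCorners.range_eq_univ, mfderivWithin_univ]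
    rfl
  let P : (M → E) → E → E := fun U z => (Q z).inverse (U ((ch x).symm z))
  have hp : ∀ U : M → E, P U =ᶠ[nhds (ch (E := E) x x)] vecC U x := by
    intro U
    filter_upwards [(isOpen_target x).mem_nhds hy] with z hz
    change (Q z).inverse (U ((ch x).symm z)) = _
    rw [hQ, hinv x z hz]
    rfl
  have h1 : brk V W x = (chartDer x x : E →L[ℝ] E).inverse
      (VectorField.lieBracketWithin ℝ (P V) (P W)
        ((extChartAt 𝓘(ℝ, E) x).symm ⁻¹' Set.univ ∩ Set.range 𝓘(ℝ, E)) (ch x x)) := rfl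
  have hu : (extChartAt 𝓘(ℝ, E) x).symm ⁻¹' (Set.univ : Set M) ∩ Set.range 𝓘(ℝ, E) = Set.univ := by
    simp
  rw [h1, hu, VectorField.lieBracketWithin_univ, hinv',
    Filter.EventuallyEq.lieBracket_vectorField_eq (hp V) (hp W)]
  have h2 := chartDer_chartInv hy (VectorField.lieBracket ℝ (vecC V x) (vecC W x) (ch x x))
  rwa [extChartAt_to_inv] at h2

end TotForm

namespace HypercomplexStructure

open Tot TotForm Bundle

variable {E : Type*} [NormedAddCommGroup E] [NormedSpace ℝ E] [FiniteDimensional ℝ E]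
  {M : Type*} [TopologicalSpace M] [ChartedSpace E M] [IsManifold 𝓘(ℝ, E) ∞ M]

/-- The field of endomorphisms given by a quaternion. -/
def fld (X : HypercomplexStructure E M) (q : ℍ[ℝ]) (x : M) : E →L[ℝ] E := X.act x q

theorem fld_mul (X : HypercomplexStructure E M) (q r : ℍ[ℝ]) (x : M) (v : E) :
    X.fld (q * r) x v = X.fld q x (X.fld r x v) := by
  have h : X.act x (q * r) = X.act x q * X.act x r := map_mul _ _ _
  exact DFunLike.congr_fun h v

theorem fld_sq (X : HypercomplexStructure E M) {q : ℍ[ℝ]} (hq : q * q = -1) (x : M) (v : E) :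
    X.fld q x (X.fld q x v) = -v := by
  rw [← fld_mul, hq]
  have h : X.act x (-1) = -1 := by rw [map_neg, map_one]
  exact DFunLike.congr_fun h v

theorem smoothEnd_fld (X : HypercomplexStructure E M) (q : ℍ[ℝ]) : SmoothEnd (X.fld q) := by
  intro x₀
  refine contDiffOn_clm_of_eval fun v => ?_
  have h1 := ContMDiffOn.clm_bundle_apply (X.contMDiff_act q).contMDiffOn
    (contMDiffOn_constField (M := M) x₀ v)
  refine ((contMDiffOn_section_iff _ x₀).1 h1).congr fun y hy => ?_
  exact (vecC_end_constField (X.fld q) x₀ v hy).symm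

/-- On coordinate fields all brackets in the Nijenhuis tensor are expressed by the derivative `A` of
the matrix `L` of the complex structure. Differentiating `L² = -1` gives `A_t L = -L A_t`; applying
`L` to the vanishing tensor and using this rule yields the symmetric expression in `IsIntegrable`.
-/
theorem isIntegrable_fld (X : HypercomplexStructure E M) {q : ℍ[ℝ]} (hq : q * q = -1) :
    IsIntegrable (X.fld q) := by
  intro x v w
  have hy := mem_extChartAt_target (I := 𝓘(ℝ, E)) x
  have hsrc := mem_extChartAt_source (I := 𝓘(ℝ, E)) x
  have hn := (isOpen_target x).mem_nhds hy
  set y := ch (E := E) x x with hydef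
  set L := endC (X.fld q) x with hL
  set A := fderiv ℝ L y with hA
  have hLd : HasFDerivAt L A y := (X.smoothEnd_fld q).hasFDerivAt hy
  have hc : ∀ u : E, ContMDiffAt 𝓘(ℝ, E) (𝓘(ℝ, E).prod 𝓘(ℝ, E)) ∞
      (fun x' => TotalSpace.mk' E (E := fun x : M => TangentSpace 𝓘(ℝ, E) x) x'
        (constField (E := E) x u x')) x := fun u =>
    (contMDiffOn_constField x u).contMDiffAt ((isOpen_extChartAt_source x).mem_nhds hsrc)
  have hN : brk (fun x' => X.fld q x' (constField x v x'))
        (fun x' => X.fld q x' (constField x w x')) x -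
      X.fld q x (brk (fun x' => X.fld q x' (constField x v x')) (constField x w) x) -
      X.fld q x (brk (constField x v) (fun x' => X.fld q x' (constField x w x')) x) -
      brk (constField x v) (constField x w) x = 0 :=
    X.integrable q hq (constField (E := E) x v) (constField (E := E) x w) x (hc v) (hc w)
  have hD : ∀ u, HasFDerivAt (fun z => L z u) (A.flip u) y := fun u => by
    have h := hLd.clm_apply (hasFDerivAt_const u y)
    refine h.congr_fderiv ?_
    ext t
    simp
  have e1 : ∀ u, vecC (constField x u) x =ᶠ[nhds y] fun _ => u := fun u => by
    filter_upwards [hn] with z hz using vecC_constField x u hz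
  have e2 : ∀ u, vecC (fun x' => X.fld q x' (constField x u x')) x =ᶠ[nhds y]
      fun z => L z u := fun u => by
    filter_upwards [hn] with z hz using vecC_end_constField (X.fld q) x u hz
  have b1 : chartDer x x (brk (fun x' => X.fld q x' (constField x v x')) (fun x' => X.fld q x' (constField x w x')) x) =
      A (L y v) w - A (L y w) v := by
    rw [chartDer_brk]
    refine (Filter.EventuallyEq.lieBracket_vectorField_eq (e2 v) (e2 w)).trans ?_
    rw [VectorField.lieBracket, (hD v).fderiv, (hD w).fderiv]
    rfl
  have b2 : chartDer x x (brk (fun x' => X.fld q x' (constField x v x')) (constField x w) x) =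
      -A w v := by
    rw [chartDer_brk]
    refine (Filter.EventuallyEq.lieBracket_vectorField_eq (e2 v) (e1 w)).trans ?_
    rw [VectorField.lieBracket, (hD v).fderiv, (hasFDerivAt_const w y).fderiv]
    simp
  have b3 : chartDer x x (brk (constField x v) (fun x' => X.fld q x' (constField x w x')) x) =
      A v w := by
    rw [chartDer_brk]
    refine (Filter.EventuallyEq.lieBracket_vectorField_eq (e1 v) (e2 w)).trans ?_
    rw [VectorField.lieBracket, (hD w).fderiv, (hasFDerivAt_const v y).fderiv]
    simp
  have b4 : chartDer x x (brk (constField x v) (constField x w) x) =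
      0 := by
    rw [chartDer_brk]
    refine (Filter.EventuallyEq.lieBracket_vectorField_eq (e1 v) (e1 w)).trans ?_
    rw [VectorField.lieBracket, (hasFDerivAt_const w y).fderiv, (hasFDerivAt_const v y).fderiv]
    simp
  have hact : ∀ u : E, chartDer x x (X.fld q x u) = L y (chartDer x x u) := by
    intro u
    have h1 := chartInv_chartDer hy u
    rw [extChartAt_to_inv] at h1
    have h2 : L y (chartDer x x u) = chartDer x ((ch x).symm y) (X.fld q ((ch x).symm y)
      (chartInv x y (chartDer x x u))) := rfl
    rw [h2, h1, hydef, extChartAt_to_inv]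
  have hN' := congrArg (chartDer (E := E) x x) hN
  rw [map_sub, map_sub, map_sub, map_zero, b1, b4, hact, hact, b2, b3] at hN'
  have hLL : ∀ z ∈ (ch (E := E) x).target, ∀ u, L z (L z u) = -u := fun z hz u =>
    endC_endC (fun x' u' => X.fld_sq hq x' u') hz u
  have hanti : ∀ t u, A t (L y u) + L y (A t u) = 0 := by
    intro t u
    have h1 : HasFDerivAt (fun z => L z (L z u)) _ y := hLd.clm_apply (hD u)
    have h2 : HasFDerivAt (fun z => L z (L z u)) (0 : E →L[ℝ] E) y :=
      (hasFDerivAt_const (-u) y).congr_of_eventuallyEq (by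
        filter_upwards [hn] with z hz using hLL z hz u)
    have h3 := DFunLike.congr_fun (h1.unique h2) t
    simpa [add_comm] using h3
  have h5 := congrArg (L y) hN'
  simp only [map_sub, map_neg, map_zero, hLL y hy, sub_zero] at h5
  have h6 : L y (A (L y v) w) = -A (L y v) (L y w) :=
    eq_neg_of_add_eq_zero_right (hanti _ _)
  have h7 : L y (A (L y w) v) = -A (L y w) (L y v) :=
    eq_neg_of_add_eq_zero_right (hanti _ _)
  rw [h6, h7] at h5
  rw [← sub_eq_zero, ← h5]
  abel

end HypercomplexStructure

/-- The standard quaternion `I`. -/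
def quatI : ℍ[ℝ] := ((Complex.I : ℂ) : ℍ[ℝ])

theorem quatI_sq : quatI * quatI = -1 := by
  rw [quatI, ← Quaternion.coeComplex_mul, Complex.I_mul_I]
  ext <;> simp

theorem quatI_mul_quatJ : quatI * quatJ = quatK := by
  have h0 : quatJ.re = 0 := rfl
  have h1 : quatJ.imI = 0 := rfl
  have h2 : quatJ.imJ = 1 := rfl
  have h3 : quatJ.imK = 0 := rfl
  have k0 : quatK.re = 0 := rfl
  have k1 : quatK.imI = 0 := rfl
  have k2 : quatK.imJ = 0 := rfl
  have k3 : quatK.imK = 1 := rfl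
  ext <;> simp [quatI, h0, h1, h2, h3, k0, k1, k2, k3]

theorem quatJ_mul_quatI : quatJ * quatI = -quatK := by
  have h0 : quatJ.re = 0 := rfl
  have h1 : quatJ.imI = 0 := rfl
  have h2 : quatJ.imJ = 1 := rfl
  have h3 : quatJ.imK = 0 := rfl
  have k0 : quatK.re = 0 := rfl
  have k1 : quatK.imI = 0 := rfl
  have k2 : quatK.imJ = 0 := rfl
  have k3 : quatK.imK = 1 := rfl
  ext <;> simp [quatI, h0, h1, h2, h3, k0, k1, k2, k3]

theorem coeComplex_eq (z : ℂ) :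
    (z : ℍ[ℝ]) = algebraMap ℝ ℍ[ℝ] z.re + z.im • quatI := by
  rw [Quaternion.algebraMap_def]
  ext <;> simp [quatI]

namespace HypercomplexStructure

open Tot TotForm Bundle

variable {E : Type*} [NormedAddCommGroup E] [NormedSpace ℝ E] [FiniteDimensional ℝ E]
  {M : Type*} [TopologicalSpace M] [ChartedSpace E M] [IsManifold 𝓘(ℝ, E) ∞ M]

theorem fld_neg (X : HypercomplexStructure E M) (q : ℍ[ℝ]) (x : M) (v : E) :
    X.fld (-q) x v = -X.fld q x v := by
  have h : X.act x (-q) = -X.act x q := map_neg _ _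
  exact DFunLike.congr_fun h v

theorem fld_J_I (X : HypercomplexStructure E M) (x : M) (v : E) :
    X.fld quatJ x (X.fld quatI x v) = -X.fld quatI x (X.fld quatJ x v) := by
  rw [← fld_mul, ← fld_mul, quatJ_mul_quatI, quatI_mul_quatJ, fld_neg]

theorem fld_coeComplex (X : HypercomplexStructure E M) (z : ℂ) (x : M) (v : E) :
    X.fld (z : ℍ[ℝ]) x v = z.re • v + z.im • X.fld quatI x v := by
  have h : X.act x (z : ℍ[ℝ]) = z.re • 1 + z.im • X.act x quatI := by
    rw [coeComplex_eq, map_add, map_smul, AlgHomClass.commutes, Algebra.algebraMap_eq_smul_one]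
  exact DFunLike.congr_fun h v

/-- Types of forms are the weights of the derivation induced by `I`. -/
theorem isType_comp_iff (X : HypercomplexStructure E M) (η : TotForm E M) {k p q : ℕ}
    (h : p + q = k) : X.IsType p q (comp η k) ↔ ∀ x,
      derv (X.fld quatI x).toLinearMap (η x) k = (Complex.I * ((p : ℂ) - q)) • η x k := by
  constructor
  · intro ht x
    refine weight_of_type (η x) fun z v => ?_
    have h1 := ht x z v
    have h2 : ∀ i, X.act x (z : ℍ[ℝ]) (v i) = z.re • v i + z.im • X.fld quatI x (v i) :=
      fun i => X.fld_coeComplex z x (v i)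
    have h3 : (fun i => X.act x (z : ℍ[ℝ]) (v i)) =
        fun i => z.re • v i + z.im • X.fld quatI x (v i) := funext h2
    exact (congrArg (fun w => η x k w) h3).symm.trans h1
  · intro hw x z (v : Fin k → E)
    have h1 := type_of_weight (fun v => X.fld_sq quatI_sq x v) k p q (η x) h (hw x) z v
    have h2 : ∀ i, X.act x (z : ℍ[ℝ]) (v i) = z.re • v i + z.im • X.fld quatI x (v i) :=
      fun i => X.fld_coeComplex z x (v i)
    have h3 : (fun i => X.act x (z : ℍ[ℝ]) (v i)) =
        fun i => z.re • v i + z.im • X.fld quatI x (v i) := funext h2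
    exact (congrArg (fun w => η x k w) h3).trans h1

end HypercomplexStructure

/-! ### The metric, the form `Ω` and the operator `Λ_Ω` on the manifold -/

namespace HypercomplexHermitian

open Tot TotForm Bundle

variable {E : Type*} [NormedAddCommGroup E] [NormedSpace ℝ E] [FiniteDimensional ℝ E]
  {M : Type*} [TopologicalSpace M] [ChartedSpace E M] [IsManifold 𝓘(ℝ, E) ∞ M]

/-- The metric. -/
def met (X : HypercomplexHermitian E M) (x : M) : E →L[ℝ] E →L[ℝ] ℝ := X.metric.inner x

/-- The form `Ω`. -/
def om (X : HypercomplexHermitian E M) (x : M) : E [⋀^Fin 2]→L[ℝ] ℂ := X.Omega x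

theorem met_fld (X : HypercomplexHermitian E M) {q : ℍ[ℝ]} (hq : q * q = -1) (x : M) (v w : E) :
    X.met x (X.fld q x v) (X.fld q x w) = X.met x v w :=
  X.invariant q (norm_eq_one_of_sq hq) x v w

theorem om_apply (X : HypercomplexHermitian E M) (x : M) (v : Fin 2 → E) :
    X.om x v = (1 / 2 : ℂ) * (X.met x (v 0) (X.fld quatJ x (v 1)) +
      Complex.I * X.met x (v 0) (X.fld quatI x (X.fld quatJ x (v 1)))) := by
  rw [← HypercomplexStructure.fld_mul, quatI_mul_quatJ]
  rfl

theorem quatHerm (X : HypercomplexHermitian E M) (x : M) :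
    QuatHerm (X.met x) (X.fld quatI x) (X.fld quatJ x) (X.om x) where
  symm v w := X.metric.symm x v w
  pos v hv := X.metric.pos x v hv
  II v := X.fld_sq quatI_sq x v
  JJ v := X.fld_sq quatJ_sq x v
  JI v := X.fld_J_I x v
  gI v w := X.met_fld quatI_sq x v w
  gJ v w := X.met_fld quatJ_sq x v w
  om v w := X.om_apply x ![v, w]

/-- The chart expression of the metric. -/
def metC (X : HypercomplexHermitian E M) (x₀ : M) (y : E) : E →L[ℝ] E →L[ℝ] ℝ :=
  (X.met ((ch x₀).symm y)).bilinearComp (chartInv x₀ y) (chartInv x₀ y)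

theorem metC_apply (X : HypercomplexHermitian E M) (x₀ : M) (y v w : E) :
    X.metC x₀ y v w = X.met ((ch x₀).symm y) (chartInv x₀ y v) (chartInv x₀ y w) := rfl

theorem contDiffOn_metC (X : HypercomplexHermitian E M) (x₀ : M) :
    ContDiffOn ℝ ∞ (X.metC x₀) (ch x₀).target := by
  refine contDiffOn_clm_of_eval fun v => contDiffOn_clm_of_eval fun w => ?_
  have h1 := ContMDiffOn.clm_bundle_apply₂ X.metric.contMDiff.contMDiffOn
    (contMDiffOn_constField (M := M) x₀ v) (contMDiffOn_constField (M := M) x₀ w)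
  have h2 : ContMDiffOn 𝓘(ℝ, E) 𝓘(ℝ, ℝ) ∞
      (fun x => X.met x (constField x₀ v x) (constField x₀ w x)) (ch (E := E) x₀).source := by
    intro x hx
    have h3 := h1 x hx
    rw [contMDiffWithinAt_totalSpace] at h3
    exact h3.2
  have h4 := h2.comp (contMDiffOn_extChartAt_symm x₀) fun y hy => (ch x₀).map_target hy
  refine (contMDiffOn_iff_contDiffOn.1 h4).congr fun y hy => ?_
  simp only [Function.comp_apply, constField, (ch x₀).right_inv hy]
  rfl

/-- The form `Ω` as a total form. -/
def totOm (X : HypercomplexHermitian E M) : TotForm E M := fun x => single 2 (X.om x)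

theorem isSmooth_totOm (X : HypercomplexHermitian E M) : IsSmooth X.totOm := by
  refine IsSmooth.single (α := X.Omega) fun x₀ => ?_
  refine contDiffOn_of_eval fun v => ?_
  have hJ := ((X.smoothEnd_fld quatJ) x₀).clm_apply (contDiffOn_const (c := v 1))
  have hIJ := ((X.smoothEnd_fld quatI) x₀).clm_apply hJ
  have hg := (X.contDiffOn_metC x₀).clm_apply (contDiffOn_const (c := v 0))
  have h1 := Complex.ofRealCLM.contDiff.comp_contDiffOn (hg.clm_apply hJ)
  have h2 := Complex.ofRealCLM.contDiff.comp_contDiffOn (hg.clm_apply hIJ)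
  have h3 := (contDiffOn_const (c := (1 / 2 : ℂ))).mul
    (h1.add ((contDiffOn_const (c := Complex.I)).mul h2))
  refine h3.congr fun y hy => ?_
  refine (X.om_apply ((ch x₀).symm y) (fun i => chartInv x₀ y (v i))).trans ?_
  simp only [Function.comp_apply, Complex.ofRealCLM_apply, metC_apply, chartInv_endC _ hy]

theorem metC_symm (X : HypercomplexHermitian E M) (x₀ : M) (y v w : E) :
    X.metC x₀ y v w = X.metC x₀ y w v := by
  rw [metC_apply, metC_apply]
  exact (X.quatHerm _).symm _ _

theorem metC_pos (X : HypercomplexHermitian E M) {x₀ : M} {y : E} (hy : y ∈ (ch x₀).target) {v : E}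
    (hv : v ≠ 0) : 0 < X.metC x₀ y v v := by
  rw [metC_apply]
  refine (X.quatHerm _).pos _ fun h => hv ?_
  have h' : chartInv x₀ y v = 0 := h
  rw [← chartDer_chartInv hy v, h', map_zero]

/-- The inverse of the metric in a chart. -/
theorem exists_sharp (X : HypercomplexHermitian E M) (x₀ : M) : ∃ S : E → (E →L[ℝ] ℝ) →L[ℝ] E,
    ContDiffOn ℝ ∞ S (ch x₀).target ∧
    ∀ y ∈ (ch x₀).target, ∀ f w, X.metC x₀ y w (S y f) = f w := by
  have hfin : Module.finrank ℝ E = Module.finrank ℝ (E →L[ℝ] ℝ) := by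
    rw [← (LinearMap.toContinuousLinearMap : (E →ₗ[ℝ] ℝ) ≃ₗ[ℝ] E →L[ℝ] ℝ).finrank_eq]
    exact Subspace.dual_finrank_eq.symm
  have he : ∀ y ∈ (ch (E := E) x₀).target, ∃ e : E ≃L[ℝ] (E →L[ℝ] ℝ), X.metC x₀ y = e := by
    intro y hy
    have hinj : Function.Injective (X.metC x₀ y).toLinearMap := by
      rw [injective_iff_map_eq_zero]
      intro v hv
      by_contra h0
      have h1 := X.metC_pos hy h0
      have h2 : X.metC x₀ y v v = 0 := DFunLike.congr_fun (f := X.metC x₀ y v) (g := 0) hv v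
      linarith
    exact ⟨(LinearEquiv.ofInjectiveOfFinrankEq _ hinj hfin).toContinuousLinearEquiv, by
      ext v w; rfl⟩
  refine ⟨fun y => (X.metC x₀ y).inverse, fun y hy => ?_, fun y hy f w => ?_⟩
  · obtain ⟨e, hee⟩ := he y hy
    have h1 : ContDiffAt ℝ ∞ ContinuousLinearMap.inverse (X.metC x₀ y) := by
      rw [hee]; exact contDiffAt_map_inverse e
    exact h1.comp_contDiffWithinAt y (X.contDiffOn_metC x₀ y hy)
  · obtain ⟨e, hee⟩ := he y hy
    change X.metC x₀ y w ((X.metC x₀ y).inverse f) = f w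
    rw [metC_symm, hee, ContinuousLinearMap.inverse_equiv]
    exact DFunLike.congr_fun (e.apply_symm_apply f) w

/-- A choice of orthonormal bases. -/
def onb (X : HypercomplexHermitian E M) (x : M) : Fin (Module.finrank ℝ E) → E :=
  (exists_isON (X.quatHerm x).symm (X.quatHerm x).pos).choose

theorem isON_onb (X : HypercomplexHermitian E M) (x : M) : IsON (X.met x) (X.onb x) :=
  (exists_isON (X.quatHerm x).symm (X.quatHerm x).pos).choose_spec

/-- The operator `Λ_Ω` on total forms. -/
def lamM (X : HypercomplexHermitian E M) (η : TotForm E M) : TotForm E M :=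
  fun x => lam (X.fld quatJ x) (X.onb x) (η x)

/-- The bilinear map whose trace is `2 Λ_Ω`. -/
def contr₂ (J : E →L[ℝ] E) (x : Tot E) : E →ₗ[ℝ] E →ₗ[ℝ] Tot E :=
  LinearMap.mk₂ ℝ (fun u v => contr v (contr (J u) x))
    (fun u u' v => by simp only [map_add, LinearMap.add_apply])
    (fun c u v => by
      rw [map_smul, map_smul, LinearMap.smul_apply, real_smul, map_smul, ← real_smul])
    (fun u v v' => by simp only [map_add, LinearMap.add_apply])
    (fun c u v => by rw [map_smul]; rfl)

/-- The chosen orthonormal bases need not vary smoothly. As `Λ_Ω` is a trace, `sum_trace` replaces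
them in a chart by a fixed basis and its metric dual, which does vary smoothly. -/
theorem isSmooth_lamM (X : HypercomplexHermitian E M) {η : TotForm E M} (hη : IsSmooth η) :
    IsSmooth (X.lamM η) := by
  let b := Module.finBasis ℝ E
  choose S hS hS' using X.exists_sharp
  let c : Fin (Module.finrank ℝ E) → E →L[ℝ] ℝ := fun a =>
    LinearMap.toContinuousLinearMap (b.coord a)
  refine IsSmooth.congr_inC (F := fun x₀ y => (1 / 2 : ℂ) • ∑ a,
    contr (b a) (contr (endC (X.fld quatJ) x₀ y (S x₀ y (c a))) (inC η x₀ y)))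
    (fun x₀ y hy => ?_) fun x₀ => ?_
  · set x : M := (ch x₀).symm y with hx
    have hON : IsON (X.metC x₀ y) (fun j => chartDer x₀ x (X.onb x j)) := by
      refine ⟨fun i j => ?_, fun w => ?_⟩
      · rw [metC_apply, chartInv_chartDer hy, chartInv_chartDer hy, ← hx]
        exact (X.isON_onb x).orth i j
      · have h0 : ∀ j, chartInv x₀ y (chartDer x₀ x (X.onb x j)) = X.onb x j :=
          fun j => chartInv_chartDer hy _
        have h1 := (X.isON_onb x).expand (chartInv x₀ y w)
        simp only [metC_apply, h0, ← map_smul, ← map_sum]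
        rw [← hx, h1]
        exact chartDer_chartInv hy w
    have h1 := sum_trace hON (contr₂ (endC (X.fld quatJ) x₀ y) (inC η x₀ y))
      (fun a => S x₀ y (c a)) (fun a => b a) (fun w => by
        simp only [hS' x₀ y hy]
        exact b.sum_repr w)
    change _ = (1 / 2 : ℂ) • ∑ a,
      contr₂ (endC (X.fld quatJ) x₀ y) (inC η x₀ y) (S x₀ y (c a)) (b a)
    rw [h1, inC, lamM, lam_apply, map_smul, map_sum]
    congr 1
    refine Finset.sum_congr rfl fun j _ => ?_
    change _ = contr (chartDer x₀ x (X.onb x j)) (contr (endC (X.fld quatJ) x₀ y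
      (chartDer x₀ x (X.onb x j))) (inC η x₀ y))
    rw [inC, contr_pull, chartInv_endC _ hy, contr_pull, chartInv_chartDer hy]
  · intro k
    have h1 : ContDiffOn ℝ ∞ (fun y => ∑ a, contr (b a) (contr (endC (X.fld quatJ) x₀ y
        (S x₀ y (c a))) (inC η x₀ y)) k) (ch x₀).target := by
      refine ContDiffOn.sum fun a _ => ?_
      exact ((hη x₀).contr (((X.smoothEnd_fld quatJ) x₀).clm_apply
        ((hS x₀).clm_apply contDiffOn_const))).contr contDiffOn_const k
    refine (h1.const_smul (1 / 2 : ℂ)).congr fun y hy => ?_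
    change ((1 / 2 : ℂ) • ∑ a, contr (b a) (contr (endC (X.fld quatJ) x₀ y
        (S x₀ y (c a))) (inC η x₀ y))) k = _
    rw [Pi.smul_apply, Finset.sum_apply]

end HypercomplexHermitian

/-! ### The `(1, 0)`-part of an operator -/

section Algebra

variable {A : Type*} [Ring A] [Algebra ℂ A]

/-- The `(1, 0)`-part of an operator, for the operator `δ` that is `√-1 (p - q)` on forms of type
`(p, q)`. -/
def holPart (δ u : A) : A := (1 / 2 : ℂ) • (u - Complex.I • (δ * u - u * δ))

/-- On the span of `u` and `[δ, u]` the map `ad δ` squares to `-1`, and `½ (1 - √-1 ad δ)` is the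
projection to its eigenvalue `√-1`. -/
theorem holPart_weight {δ u : A} (hu : δ * (δ * u - u * δ) - (δ * u - u * δ) * δ = -u) :
    δ * holPart δ u = holPart δ u * δ + Complex.I • holPart δ u := by
  have h0 : δ * u = u * δ + (δ * u - u * δ) := by abel
  rw [holPart]
  generalize δ * u - u * δ = a at *
  have h1 : δ * a = a * δ - u := by
    rw [sub_eq_iff_eq_add] at hu; rw [hu]; abel
  have hI : ∀ x : A, Complex.I • Complex.I • x = -x := fun x => by
    rw [smul_smul, Complex.I_mul_I, neg_one_smul]
  simp only [mul_smul_comm, smul_mul_assoc, mul_sub, sub_mul, h0, h1, smul_sub,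
    smul_comm Complex.I (1 / 2 : ℂ), hI]
  module

/-- The anticommutator of the two parts is the component of `u v + v u` of weight `2 √-1`. It is
expressed through `u v + v u` and the two relations `h1`, `h2`, which arise by applying `ad δ` to `u
v + v u = 0` once and twice. -/
theorem anticomm_holPart {δ u v : A} (hu : δ * (δ * u - u * δ) - (δ * u - u * δ) * δ = -u)
    (hv : δ * (δ * v - v * δ) - (δ * v - v * δ) * δ = -v) (huv : u * v + v * u = 0) :
    holPart δ u * holPart δ v + holPart δ v * holPart δ u = 0 := by
  rw [holPart, holPart]
  have h1 : u * (δ * v - v * δ) + (δ * v - v * δ) * u + (δ * u - u * δ) * v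
      + v * (δ * u - u * δ) = 0 := by
    have : u * (δ * v - v * δ) + (δ * v - v * δ) * u + (δ * u - u * δ) * v
      + v * (δ * u - u * δ) = δ * (u * v + v * u) - (u * v + v * u) * δ := by noncomm_ring
    rw [this, huv]; simp
  have h2 : (δ * u - u * δ) * (δ * v - v * δ) + (δ * v - v * δ) * (δ * u - u * δ) = 0 := by
    have h3 : (2 : ℂ) • ((δ * u - u * δ) * (δ * v - v * δ) + (δ * v - v * δ) * (δ * u - u * δ)) =
        δ * (u * (δ * v - v * δ) + (δ * v - v * δ) * u + (δ * u - u * δ) * v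
          + v * (δ * u - u * δ)) - (u * (δ * v - v * δ) + (δ * v - v * δ) * u +
          (δ * u - u * δ) * v + v * (δ * u - u * δ)) * δ
        - u * (δ * (δ * v - v * δ) - (δ * v - v * δ) * δ)
        - (δ * (δ * v - v * δ) - (δ * v - v * δ) * δ) * u
        - (δ * (δ * u - u * δ) - (δ * u - u * δ) * δ) * v
        - v * (δ * (δ * u - u * δ) - (δ * u - u * δ) * δ) := by
      rw [two_smul]; noncomm_ring
    rw [h1, hu, hv] at h3
    have h4 : (2 : ℂ) • ((δ * u - u * δ) * (δ * v - v * δ) +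
        (δ * v - v * δ) * (δ * u - u * δ)) = 0 := by
      rw [h3]
      have : δ * 0 - 0 * δ - u * -v - -v * u - -u * v - v * -u = (u * v + v * u) + (u * v + v * u) := by
        noncomm_ring
      rw [this, huv, add_zero]
    exact (smul_eq_zero.1 h4).resolve_left two_ne_zero
  generalize δ * u - u * δ = a at *
  generalize δ * v - v * δ = b at *
  have h5 : b * a = -(a * b) := by rw [← add_eq_zero_iff_eq_neg, add_comm]; exact h2
  have h6 : v * u = -(u * v) := by rw [← add_eq_zero_iff_eq_neg, add_comm]; exact huv
  have h7 : v * a = -(u * b + b * u + a * v) := by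
    rw [← add_eq_zero_iff_eq_neg, add_comm]; exact h1
  simp only [mul_smul_comm, smul_mul_assoc, mul_sub, sub_mul, h5, h6, h7]
  module

end Algebra

/-! ### Operators on the space of smooth forms -/

namespace TotForm

open Tot

variable (E : Type*) [NormedAddCommGroup E] [NormedSpace ℝ E] [FiniteDimensional ℝ E]
  (M : Type*) [TopologicalSpace M] [ChartedSpace E M] [IsManifold 𝓘(ℝ, E) ∞ M]

/-- The subspace of smooth forms. -/
def smoothSubmodule : Submodule ℂ (TotForm E M) where
  carrier := {η | IsSmooth η}
  add_mem' ha hb := ha.add hb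
  zero_mem' := IsSmooth.zero
  smul_mem' c _ ha := ha.smul c

/-- The space of smooth forms, of all degrees. -/
def _root_.SmoothForm : Type _ := smoothSubmodule E M

instance : AddCommGroup (SmoothForm E M) := inferInstanceAs (AddCommGroup (smoothSubmodule E M))

instance : Module ℂ (SmoothForm E M) := inferInstanceAs (Module ℂ (smoothSubmodule E M))

end TotForm

namespace SmoothForm

open Tot TotForm

variable {E : Type*} [NormedAddCommGroup E] [NormedSpace ℝ E] [FiniteDimensional ℝ E]
  {M : Type*} [TopologicalSpace M] [ChartedSpace E M] [IsManifold 𝓘(ℝ, E) ∞ M]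

/-- A smooth form from its values. -/
def mk (η : TotForm E M) (h : IsSmooth η) : SmoothForm E M := ⟨η, h⟩

/-- The value of a form at a point. -/
def at' (η : SmoothForm E M) (x : M) : Tot E := η.1 x

theorem isSmooth (η : SmoothForm E M) : IsSmooth η.at' := η.2

@[ext]
theorem ext {η ξ : SmoothForm E M} (h : ∀ x, η.at' x = ξ.at' x) : η = ξ :=
  Subtype.ext (funext h)

theorem at_add (η ξ : SmoothForm E M) (x : M) : (η + ξ).at' x = η.at' x + ξ.at' x := rfl

theorem at_sub (η ξ : SmoothForm E M) (x : M) : (η - ξ).at' x = η.at' x - ξ.at' x := rfl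

theorem at_zero (x : M) : (0 : SmoothForm E M).at' x = 0 := rfl

theorem at_smul (c : ℂ) (η : SmoothForm E M) (x : M) : (c • η).at' x = c • η.at' x := rfl

/-- The operator given by a smooth family of linear maps. -/
def ofPointwise (T : M → Tot E →ₗ[ℂ] Tot E)
    (h : ∀ η : TotForm E M, IsSmooth η → IsSmooth (fun x => T x (η x))) :
    Module.End ℂ (SmoothForm E M) where
  toFun η := mk (fun x => T x (η.at' x)) (h _ η.2)
  map_add' a b := by ext1 x; exact map_add (T x) _ _
  map_smul' c a := by ext1 x; exact map_smul (T x) _ _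

/-- The exterior derivative. -/
def dS : Module.End ℂ (SmoothForm E M) where
  toFun η := mk (d η.at') (isSmooth_d η.2)
  map_add' a b := by ext1 x; exact congrFun (d_add a.2 b.2) x
  map_smul' c a := by ext1 x; exact congrFun (d_smul c a.2) x

theorem isSmooth_par {η : TotForm E M} (hη : IsSmooth η) : IsSmooth (fun x => par (η x)) :=
  IsSmooth.congr_inC (fun x₀ y _ => inC_par η x₀ y) fun x₀ k =>
    (hη x₀ k).const_smul ((-1 : ℂ) ^ k)

theorem inC_deg (η : TotForm E M) (x₀ : M) (y : E) :
    inC (fun x => deg (η x)) x₀ y = deg (inC η x₀ y) := by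
  funext k; ext v; rfl

theorem isSmooth_deg {η : TotForm E M} (hη : IsSmooth η) : IsSmooth (fun x => deg (η x)) :=
  IsSmooth.congr_inC (fun x₀ y _ => inC_deg η x₀ y) fun x₀ k =>
    (hη x₀ k).const_smul (k : ℂ)

/-- The parity involution. -/
def parS : Module.End ℂ (SmoothForm E M) := ofPointwise (fun _ => par) fun _ => isSmooth_par

/-- The operator of multiplication by the degree. -/
def degS : Module.End ℂ (SmoothForm E M) := ofPointwise (fun _ => deg) fun _ => isSmooth_deg

/-- The derivation induced by a smooth field of endomorphisms. -/
def dervS {B : M → E →L[ℝ] E} (hB : SmoothEnd B) : Module.End ℂ (SmoothForm E M) :=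
  ofPointwise (fun x => derv (B x).toLinearMap) fun _ h => h.derv hB

/-- The multiplicative action of a smooth field of endomorphisms. -/
def pullS {B : M → E →L[ℝ] E} (hB : SmoothEnd B) : Module.End ℂ (SmoothForm E M) :=
  ofPointwise (fun x => pull (B x)) fun _ h => h.pull hB

/-- Left multiplication by a form. -/
def wedS : SmoothForm E M →ₗ[ℂ] Module.End ℂ (SmoothForm E M) where
  toFun α := 
    { toFun := fun η => mk (fun x => α.at' x ⋏ η.at' x) (IsSmooth.wedge α.2 η.2)
      map_add' := fun a b => by ext1 x; exact map_add (wedge (α.at' x)) _ _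
      map_smul' := fun c a => by ext1 x; exact map_smul (wedge (α.at' x)) _ _ }
  map_add' α β := by
    ext1 η; ext1 x
    exact congrArg (fun T : Tot E →ₗ[ℂ] Tot E => T (η.at' x)) (map_add wedge (α.at' x) (β.at' x))
  map_smul' c α := by
    ext1 η; ext1 x
    exact congrArg (fun T : Tot E →ₗ[ℂ] Tot E => T (η.at' x)) (map_smul wedge c (α.at' x))

/-- Complex conjugation. -/
def conjS : SmoothForm E M →ₛₗ[starRingEnd ℂ] SmoothForm E M where
  toFun η := mk (fun x => Tot.conj (η.at' x)) (IsSmooth.conj η.2)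
  map_add' a b := by ext1 x; exact map_add Tot.conj _ _
  map_smul' c a := by ext1 x; exact map_smulₛₗ Tot.conj _ _

theorem dS_mul_dS : (dS : Module.End ℂ (SmoothForm E M)) * dS = 0 := by
  ext1 η; ext1 x; exact congrFun (d_d η.2) x

/-- Since `d` is defined degree by degree, operators that scale each degree by a constant can be
moved through it; this is applied to the parity and to the degree. -/
theorem d_succ_of_comp {η ξ : TotForm E M} {k : ℕ} {c : ℂ} (hη : IsSmooth η)
    (h : ∀ x, ξ x k = c • η x k) (x : M) : d ξ x (k + 1) = c • d η x (k + 1) := by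
  have h1 : comp ξ k = comp (c • η) k := funext h
  have h2 : d ξ x (k + 1) = d (c • η) x (k + 1) := by
    change (comp ξ k).d x = (comp (c • η) k).d x
    rw [h1]
  rw [h2, d_smul c hη]
  rfl

theorem parS_mul_dS : (parS : Module.End ℂ (SmoothForm E M)) * dS = -(dS * parS) := by
  ext1 η; ext1 x
  change par (d η.at' x) = -d (fun x => par (η.at' x)) x
  funext k
  cases k with
  | zero =>
    change (-1 : ℂ) ^ 0 • (0 : E [⋀^Fin 0]→L[ℝ] ℂ) = -0
    simp
  | succ k =>
    change (-1 : ℂ) ^ (k + 1) • d η.at' x (k + 1) = -d (fun x => par (η.at' x)) x (k + 1)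
    have h := d_succ_of_comp (ξ := fun x => par (η.at' x)) η.isSmooth (c := (-1) ^ k)
      (fun x => rfl) x
    rw [h, pow_succ]
    module

theorem degS_mul_dS : (degS : Module.End ℂ (SmoothForm E M)) * dS = dS * degS + dS := by
  ext1 η; ext1 x
  change deg (d η.at' x) = d (fun x => deg (η.at' x)) x + d η.at' x
  funext k
  cases k with
  | zero =>
    change ((0 : ℕ) : ℂ) • (0 : E [⋀^Fin 0]→L[ℝ] ℂ) = 0 + 0
    ext v; simp
  | succ k =>
    change ((k + 1 : ℕ) : ℂ) • d η.at' x (k + 1) =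
      d (fun x => deg (η.at' x)) x (k + 1) + d η.at' x (k + 1)
    have h := d_succ_of_comp (ξ := fun x => deg (η.at' x)) η.isSmooth (c := (k : ℂ))
      (fun x => rfl) x
    rw [h]
    push_cast
    module

theorem parS_mul_parS : (parS : Module.End ℂ (SmoothForm E M)) * parS = 1 := by
  ext1 η; ext1 x
  change par (par (η.at' x)) = η.at' x
  funext k
  change (-1 : ℂ) ^ k • (-1 : ℂ) ^ k • η.at' x k = η.at' x k
  rw [smul_smul, ← mul_pow]; simp

theorem wedS_apply (α η : SmoothForm E M) (x : M) : (wedS α η).at' x = α.at' x ⋏ η.at' x := rfl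

theorem wedS_mul (α β : SmoothForm E M) : wedS α * wedS β = wedS (wedS α β) := by
  ext1 η; ext1 x; exact (wedge_assoc _ _ _).symm

theorem wedS_comm_of_even {α : SmoothForm E M} (h : parS α = α) (β : SmoothForm E M) :
    wedS α β = wedS β α := by
  ext1 x
  exact wedge_comm_of_even (congrArg (fun η : SmoothForm E M => η.at' x) h) _

theorem wedS_comm_of_odd {α : SmoothForm E M} (h : parS α = -α) (β : SmoothForm E M) :
    wedS α β = wedS (parS β) α := by
  ext1 x
  exact wedge_comm_of_odd (congrArg (fun η : SmoothForm E M => η.at' x) h) _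

/-- Odd derivations of the exterior product. -/
def IsOddDer (T : Module.End ℂ (SmoothForm E M)) : Prop :=
  ∀ α, T * wedS α = wedS (T α) + wedS (parS α) * T

/-- Even derivations of the exterior product. -/
def IsEvenDer (T : Module.End ℂ (SmoothForm E M)) : Prop :=
  ∀ α, T * wedS α = wedS (T α) + wedS α * T

theorem IsOddDer.smul {T : Module.End ℂ (SmoothForm E M)} (h : IsOddDer T) (c : ℂ) :
    IsOddDer (c • T) := fun α => by
  rw [smul_mul_assoc, h, LinearMap.smul_apply, map_smul, mul_smul_comm, smul_add]

theorem IsOddDer.sub {T S : Module.End ℂ (SmoothForm E M)} (h : IsOddDer T) (h' : IsOddDer S) :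
    IsOddDer (T - S) := fun α => by
  rw [sub_mul, h, h', LinearMap.sub_apply, map_sub, mul_sub]; abel

theorem IsEvenDer.comm {T δ : Module.End ℂ (SmoothForm E M)} (h : IsOddDer T) (h' : IsEvenDer δ)
    (hp : ∀ α, δ (parS α) = parS (δ α)) : IsOddDer (δ * T - T * δ) := fun α => by
  have h1 : (δ * T - T * δ) * wedS α = δ * (T * wedS α) - T * (δ * wedS α) := by noncomm_ring
  have h2 : ∀ β, δ * (wedS β * T) = wedS (δ β) * T + wedS β * (δ * T) := fun β => by
    rw [← mul_assoc, h', add_mul, mul_assoc]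
  have h3 : ∀ β, T * (wedS β * δ) = wedS (T β) * δ + wedS (parS β) * (T * δ) := fun β => by
    rw [← mul_assoc, h, add_mul, mul_assoc]
  rw [h1, h, h', mul_add, mul_add, h', h, h2, h3, hp]
  simp only [LinearMap.sub_apply, Module.End.mul_apply, map_sub, mul_sub]
  abel

theorem isOddDer_dS : IsOddDer (dS : Module.End ℂ (SmoothForm E M)) := fun α => by
  ext1 η; ext1 x; exact congrFun (d_wedge α.2 η.2) x

theorem isEvenDer_dervS {B : M → E →L[ℝ] E} (hB : SmoothEnd B) : IsEvenDer (dervS hB) :=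
  fun α => by ext1 η; ext1 x; exact derv_wedge _ _ _

theorem dervS_par {B : M → E →L[ℝ] E} (hB : SmoothEnd B) (α : SmoothForm E M) :
    dervS hB (parS α) = parS (dervS hB α) := by
  ext1 x
  change derv _ (par _) = par (derv _ _)
  rw [← pull_neg_id, ← pull_neg_id]
  exact (pull_derv _ _ _ _ (fun v => by simp) _ rfl).symm

theorem dervS_deg {B : M → E →L[ℝ] E} (hB : SmoothEnd B) :
    dervS hB * degS = (degS : Module.End ℂ (SmoothForm E M)) * dervS hB := by
  ext1 α; ext1 x
  change derv _ (deg _) = deg (derv _ _)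
  funext k
  cases k with
  | zero => 
    change (0 : E [⋀^Fin 0]→L[ℝ] ℂ) = ((0 : ℕ) : ℂ) • (0 : E [⋀^Fin 0]→L[ℝ] ℂ)
    ext v; simp
  | succ k =>
    rw [deg_apply, derv_apply, derv_apply]
    have := altz_congr_succ (k := k) (T := contrAt (deg (α.at' x)) ∘ₗ (B x).toLinearMap)
      (S := ((k + 1 : ℕ) : ℂ) • (contrAt (α.at' x) ∘ₗ (B x).toLinearMap)) (fun v => rfl)
    rw [this, map_smul]
    rfl

section Complex

variable {B : M → E →L[ℝ] E} (hB : SmoothEnd B)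

theorem pullS_sq (hBB : ∀ x v, B x (B x v) = -v) : pullS hB * pullS hB = parS := by
  ext1 η; ext1 x
  change pull _ (pull _ _) = par _
  rw [pull_pull, ← pull_neg_id]
  congr 2
  ext v; exact hBB x v

/-- The inverse of the action of a complex structure on forms. -/
def pullInv : Module.End ℂ (SmoothForm E M) := parS * pullS hB

theorem par_pullS : parS * pullS hB = pullS hB * parS := by
  ext1 η; ext1 x
  change par (pull _ _) = pull _ (par _)
  funext k; ext v; rfl

theorem dS_mul_pullS (hBB : ∀ x v, B x (B x v) = -v) (hInt : IsIntegrable B) :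
    dS * pullS hB = -(pullS hB * (dervS hB * dS - dS * dervS hB)) := by
  ext1 η; ext1 x
  exact d_pull hB hBB hInt η.2 x

theorem pullInv_mul (hBB : ∀ x v, B x (B x v) = -v) : pullInv hB * pullS hB = 1 := by
  rw [pullInv, mul_assoc, pullS_sq hB hBB, parS_mul_parS]

theorem mul_pullInv (hBB : ∀ x v, B x (B x v) = -v) : pullS hB * pullInv hB = 1 := by
  rw [pullInv, par_pullS, ← mul_assoc, pullS_sq hB hBB, parS_mul_parS]

/-- The companion of `dS_mul_pullS`. After multiplication by `B^*` on the left both sides reduce to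
the square of `B^*`, which is the parity and anticommutes with `d`; then `B^*` is cancelled. -/
theorem pullS_dS (hBB : ∀ x v, B x (B x v) = -v) (hInt : IsIntegrable B) :
    pullS hB * dS = (dervS hB * dS - dS * dervS hB) * pullS hB := by
  have h : pullS hB * (pullS hB * dS) =
      pullS hB * ((dervS hB * dS - dS * dervS hB) * pullS hB) := by
    rw [← mul_assoc, ← mul_assoc, ← neg_neg (pullS hB * (dervS hB * dS - dS * dervS hB)),
      ← dS_mul_pullS hB hBB hInt, neg_mul, mul_assoc dS, pullS_sq hB hBB, parS_mul_dS]
  have h2 := congrArg (fun T => pullInv hB * T) h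
  simpa only [← mul_assoc, pullInv_mul hB hBB, one_mul] using h2

end Complex

end SmoothForm

section Algebra

variable {A : Type*} [Ring A] [Algebra ℂ A]

theorem comm_degree {k u δ : A} (h : k * u = u * k + u) (hδ : δ * k = k * δ) :
    k * (δ * u - u * δ) = (δ * u - u * δ) * k + (δ * u - u * δ) := by
  have h1 : k * (δ * u - u * δ) = δ * (k * u) - (k * u) * δ := by
    rw [mul_sub, ← mul_assoc, ← hδ, mul_assoc, mul_assoc]
  rw [h1, h, mul_add, add_mul, sub_mul, mul_assoc u k, ← hδ, ← mul_assoc, mul_assoc u δ k]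
  abel

theorem holPart_degree {k u δ : A} (h : k * u = u * k + u) (hδ : δ * k = k * δ) :
    k * holPart δ u = holPart δ u * k + holPart δ u := by
  rw [holPart, mul_smul_comm, mul_sub, mul_smul_comm, comm_degree h hδ, h]
  generalize δ * u - u * δ = a
  rw [smul_mul_assoc, sub_mul, smul_mul_assoc]
  module

/-- The weight identity `[δ, [δ, d]] = -d`, from an automorphism `R` that commutes with `δ`. -/
theorem weight_of_conj {d δ R S : A} (hRS : R * S = 1) (hδ : δ * R = R * δ)
    (h1 : R * d = (δ * d - d * δ) * R) (h2 : d * R = -(R * (δ * d - d * δ))) :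
    δ * (δ * d - d * δ) - (δ * d - d * δ) * δ = -d := by
  have h : (δ * (δ * d - d * δ) - (δ * d - d * δ) * δ) * R = -d * R := by
    have e : (δ * (δ * d - d * δ) - (δ * d - d * δ) * δ) * R =
        δ * ((δ * d - d * δ) * R) - (δ * d - d * δ) * (δ * R) := by noncomm_ring
    rw [e, hδ, ← h1, ← mul_assoc (δ * d - d * δ), ← h1, neg_mul, h2, ← mul_assoc, hδ]
    noncomm_ring
  have h' := congrArg (· * S) h
  simpa only [mul_assoc, hRS, mul_one] using h'

/-- Here `e = R d R⁻¹`, and conjugation by `R` reverses `δ`. The sign appears in the single bracket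
and cancels in the double one. -/
theorem weight_of_anticonj {d e δ R S : A} (hRS : R * S = 1) (hδ : δ * R = -(R * δ))
    (h1 : R * d = e * R) (h2 : δ * (δ * d - d * δ) - (δ * d - d * δ) * δ = -d) :
    (δ * e - e * δ) * R = -(R * (δ * d - d * δ)) ∧
    δ * (δ * e - e * δ) - (δ * e - e * δ) * δ = -e := by
  have h3 : (δ * e - e * δ) * R = -(R * (δ * d - d * δ)) := by
    rw [sub_mul, mul_assoc, ← h1, mul_assoc, hδ, ← mul_assoc, hδ, mul_neg, ← mul_assoc, ← h1]
    noncomm_ring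
  refine ⟨h3, ?_⟩
  have h : (δ * (δ * e - e * δ) - (δ * e - e * δ) * δ) * R = -e * R := by
    have e' : (δ * (δ * e - e * δ) - (δ * e - e * δ) * δ) * R =
        δ * ((δ * e - e * δ) * R) - (δ * e - e * δ) * (δ * R) := by noncomm_ring
    rw [e', h3, hδ, mul_neg, mul_neg, ← mul_assoc (δ * e - e * δ), h3, ← mul_assoc, hδ, neg_mul,
      neg_mul e, ← h1]
    have e2 : R * d = -(R * (δ * (δ * d - d * δ) - (δ * d - d * δ) * δ)) := by
      rw [h2, mul_neg, neg_neg]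
    rw [e2]
    noncomm_ring
  have h' := congrArg (· * S) h
  simpa only [mul_assoc, hRS, mul_one] using h'

end Algebra

namespace SmoothForm

open Tot TotForm

variable {E : Type*} [NormedAddCommGroup E] [NormedSpace ℝ E] [FiniteDimensional ℝ E]
  {M : Type*} [TopologicalSpace M] [ChartedSpace E M] [IsManifold 𝓘(ℝ, E) ∞ M]

theorem isOddDer_holPart {T δ : Module.End ℂ (SmoothForm E M)} (h : IsOddDer T) (h' : IsEvenDer δ)
    (hp : ∀ α, δ (parS α) = parS (δ α)) : IsOddDer (holPart δ T) :=
  (h.sub ((IsEvenDer.comm h h' hp).smul Complex.I)).smul _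

theorem conjS_dS (η : SmoothForm E M) : conjS (dS η) = dS (conjS η) := by
  ext1 x; exact (congrFun (d_conj η.2) x).symm

theorem conjS_dervS {B : M → E →L[ℝ] E} (hB : SmoothEnd B) (η : SmoothForm E M) :
    conjS (dervS hB η) = dervS hB (conjS η) := by
  ext1 x; exact conj_derv _ _

theorem conjS_degS (η : SmoothForm E M) : conjS (degS η) = degS (conjS η) := by
  ext1 x
  funext k; ext v
  change starRingEnd ℂ ((k : ℂ) * _) = (k : ℂ) * starRingEnd ℂ _
  rw [map_mul, Complex.conj_natCast]

theorem conjS_pullS {B : M → E →L[ℝ] E} (hB : SmoothEnd B) (η : SmoothForm E M) :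
    conjS (pullS hB η) = pullS hB (conjS η) := by
  ext1 x; exact conj_pull _ _

theorem conjS_conjS (η : SmoothForm E M) : conjS (conjS η) = η := by
  ext1 x
  funext k; ext v
  exact Complex.conj_conj _

theorem conjS_wedS (α η : SmoothForm E M) : conjS (wedS α η) = wedS (conjS α) (conjS η) := by
  ext1 x; exact conj_wedge _ _

theorem pullS_wedS {B : M → E →L[ℝ] E} (hB : SmoothEnd B) (α η : SmoothForm E M) :
    pullS hB (wedS α η) = wedS (pullS hB α) (pullS hB η) := by
  ext1 x; exact pull_wedge _ _ _

theorem pullS_degS {B : M → E →L[ℝ] E} (hB : SmoothEnd B) (η : SmoothForm E M) :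
    pullS hB (degS η) = degS (pullS hB η) := by
  ext1 x
  funext k; ext v; rfl

end SmoothForm

/-! ### The operators `∂`, `∂_J` and `J_c` -/

namespace HypercomplexStructure

open Tot TotForm SmoothForm

variable {E : Type*} [NormedAddCommGroup E] [NormedSpace ℝ E] [FiniteDimensional ℝ E]
  {M : Type*} [TopologicalSpace M] [ChartedSpace E M] [IsManifold 𝓘(ℝ, E) ∞ M]
  (X : HypercomplexStructure E M)

/-- The operator that is `√-1 (p - q)` on forms of type `(p, q)`. -/
def wt : Module.End ℂ (SmoothForm E M) := dervS (X.smoothEnd_fld quatI)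

/-- The multiplicative action of `J` on smooth forms. -/
def RJ : Module.End ℂ (SmoothForm E M) := pullS (X.smoothEnd_fld quatJ)

/-- The conjugate `J d J⁻¹` of the exterior derivative. -/
def dJ : Module.End ℂ (SmoothForm E M) :=
  dervS (X.smoothEnd_fld quatJ) * dS - dS * dervS (X.smoothEnd_fld quatJ)

/-- The operator `∂`. -/
def pd : Module.End ℂ (SmoothForm E M) := holPart X.wt dS

/-- The operator `∂_J`. -/
def pdJ : Module.End ℂ (SmoothForm E M) := holPart X.wt X.dJ

theorem RJ_dS : X.RJ * dS = X.dJ * X.RJ :=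
  pullS_dS _ (fun x v => X.fld_sq quatJ_sq x v) (X.isIntegrable_fld quatJ_sq)

theorem RJ_inv : X.RJ * pullInv (X.smoothEnd_fld quatJ) = 1 :=
  mul_pullInv _ (fun x v => X.fld_sq quatJ_sq x v)

theorem wt_RJ : X.wt * X.RJ = -(X.RJ * X.wt) := by
  ext1 η; ext1 x
  change derv (X.fld quatI x).toLinearMap (pull (X.fld quatJ x) (η.at' x)) =
    -pull (X.fld quatJ x) (derv (X.fld quatI x).toLinearMap (η.at' x))
  rw [pull_derv (X.fld quatJ x) (X.fld quatJ x) _ (-(X.fld quatI x).toLinearMap)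
    (fun v => ?_) _ rfl, derv_neg, neg_neg]
  have h := X.fld_J_I x v
  change X.fld quatI x (X.fld quatJ x v) = X.fld quatJ x (-X.fld quatI x v)
  rw [map_neg, h, neg_neg]

/-- In terms of types: `d` has only components of bidegree `(1, 0)` and `(0, 1)`. Integrability of
`I` enters through the two commutation rules of `d` with `I^*`. -/
theorem wt_dS : X.wt * (X.wt * dS - dS * X.wt) - (X.wt * dS - dS * X.wt) * X.wt = -dS := by
  have hI : ∀ x v, X.fld quatI x (X.fld quatI x v) = -v := fun x v => X.fld_sq quatI_sq x v
  refine weight_of_conj (mul_pullInv (X.smoothEnd_fld quatI) hI) ?_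
    (pullS_dS _ hI (X.isIntegrable_fld quatI_sq)) (dS_mul_pullS _ hI (X.isIntegrable_fld quatI_sq))
  ext1 η; ext1 x
  exact (pull_derv (X.fld quatI x) (X.fld quatI x) _ (X.fld quatI x).toLinearMap
    (fun v => rfl) _ rfl).symm

theorem wt_dJ_aux : (X.wt * X.dJ - X.dJ * X.wt) * X.RJ = -(X.RJ * (X.wt * dS - dS * X.wt)) ∧
    X.wt * (X.wt * X.dJ - X.dJ * X.wt) - (X.wt * X.dJ - X.dJ * X.wt) * X.wt = -X.dJ :=
  weight_of_anticonj X.RJ_inv X.wt_RJ X.RJ_dS X.wt_dS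

theorem dJ_sq : X.dJ * X.dJ = 0 := by
  have h : X.dJ * X.dJ * X.RJ = 0 := by
    rw [mul_assoc, ← RJ_dS, ← mul_assoc, ← RJ_dS, mul_assoc, dS_mul_dS, mul_zero]
  have h' := congrArg (· * pullInv (X.smoothEnd_fld quatJ)) h
  simpa only [mul_assoc, X.RJ_inv, mul_one, zero_mul] using h'

theorem dS_dJ : dS * X.dJ + X.dJ * dS = 0 := by
  rw [dJ, mul_sub, sub_mul, ← mul_assoc dS dS, mul_assoc _ dS dS, dS_mul_dS]
  noncomm_ring

theorem pd_pd : X.pd * X.pd = 0 := by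
  have h := anticomm_holPart X.wt_dS X.wt_dS (by rw [dS_mul_dS, add_zero])
  rw [← two_smul ℂ] at h
  exact (smul_eq_zero.1 h).resolve_left two_ne_zero

theorem pdJ_pdJ : X.pdJ * X.pdJ = 0 := by
  have h := anticomm_holPart X.wt_dJ_aux.2 X.wt_dJ_aux.2 (by rw [dJ_sq, add_zero])
  rw [← two_smul ℂ] at h
  exact (smul_eq_zero.1 h).resolve_left two_ne_zero

theorem pd_pdJ : X.pd * X.pdJ + X.pdJ * X.pd = 0 :=
  anticomm_holPart X.wt_dS X.wt_dJ_aux.2 X.dS_dJ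

theorem wt_degS : X.wt * degS = degS * X.wt := dervS_deg _

theorem wt_pd : X.wt * X.pd = X.pd * X.wt + Complex.I • X.pd := holPart_weight X.wt_dS

theorem wt_pdJ : X.wt * X.pdJ = X.pdJ * X.wt + Complex.I • X.pdJ := holPart_weight X.wt_dJ_aux.2

theorem degS_pd : degS * X.pd = X.pd * degS + X.pd := holPart_degree degS_mul_dS X.wt_degS

theorem degS_pdJ : degS * X.pdJ = X.pdJ * degS + X.pdJ :=
  holPart_degree (comm_degree degS_mul_dS (dervS_deg _)) X.wt_degS

theorem isOddDer_pd : IsOddDer X.pd :=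
  isOddDer_holPart isOddDer_dS (isEvenDer_dervS _) (dervS_par _)

theorem isOddDer_pdJ : IsOddDer X.pdJ :=
  isOddDer_holPart (IsEvenDer.comm isOddDer_dS (isEvenDer_dervS _) (dervS_par _))
    (isEvenDer_dervS _) (dervS_par _)

/-- The operator `J_c`. -/
def jc : SmoothForm E M →ₛₗ[starRingEnd ℂ] SmoothForm E M := X.RJ.comp conjS

theorem jc_apply (η : SmoothForm E M) : X.jc η = X.RJ (conjS η) := rfl

theorem jc_wedS (α η : SmoothForm E M) : X.jc (wedS α η) = wedS (X.jc α) (X.jc η) := by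
  rw [jc_apply, conjS_wedS, RJ, pullS_wedS]; rfl

theorem jc_jc (η : SmoothForm E M) : X.jc (X.jc η) = parS η := by
  rw [jc_apply, jc_apply, RJ, conjS_pullS, conjS_conjS]
  exact congrArg (fun T : Module.End ℂ (SmoothForm E M) => T η)
    (pullS_sq (X.smoothEnd_fld quatJ) (fun x v => X.fld_sq quatJ_sq x v))

theorem jc_degS (η : SmoothForm E M) : X.jc (degS η) = degS (X.jc η) := by
  rw [jc_apply, conjS_degS, RJ, pullS_degS]; rfl

theorem jc_wt (η : SmoothForm E M) : X.jc (X.wt η) = -X.wt (X.jc η) := by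
  have h := congrArg (fun T : Module.End ℂ (SmoothForm E M) => T (conjS η)) X.wt_RJ
  simp only [Module.End.mul_apply, LinearMap.neg_apply] at h
  rw [jc_apply, jc_apply, h, neg_neg, wt, conjS_dervS]

/-- `J_c` reverses the weight and is antilinear. In `½ (u - √-1 [δ, u])` the two sign changes
cancel, so `(1, 0)`-parts go to `(1, 0)`-parts, while `d` becomes `J d J⁻¹`. -/
theorem jc_pd (η : SmoothForm E M) : X.jc (X.pd η) = X.pdJ (X.jc η) := by
  have h1 : ∀ ξ, X.RJ (dS ξ) = X.dJ (X.RJ ξ) := fun ξ =>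
    congrArg (fun T : Module.End ℂ (SmoothForm E M) => T ξ) X.RJ_dS
  have h2 : ∀ ξ, X.wt (X.dJ (X.RJ ξ)) - X.dJ (X.wt (X.RJ ξ)) = 
      -X.RJ (X.wt (dS ξ) - dS (X.wt ξ)) := fun ξ =>
    congrArg (fun T : Module.End ℂ (SmoothForm E M) => T ξ) X.wt_dJ_aux.1
  have h3 : ∀ ξ, conjS (X.wt ξ) = X.wt (conjS ξ) := fun ξ => conjS_dervS _ ξ
  rw [jc_apply, jc_apply, pd, pdJ, holPart, holPart]
  simp only [LinearMap.smul_apply, LinearMap.sub_apply, Module.End.mul_apply, map_smulₛₗ, h2]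
  simp only [map_sub, map_smulₛₗ, conjS_dS, h3, h1]
  simp only [map_smul, map_sub, h1, map_div₀, map_one, Complex.conj_I, map_ofNat, RingHom.id_apply]
  module

end HypercomplexStructure

namespace SmoothForm

open Tot TotForm

variable {E : Type*} [NormedAddCommGroup E] [NormedSpace ℝ E] [FiniteDimensional ℝ E]
  {M : Type*} [TopologicalSpace M] [ChartedSpace E M] [IsManifold 𝓘(ℝ, E) ∞ M]

/-- The form with the components `c k • η k`. -/
def scale (c : ℕ → ℂ) (η : SmoothForm E M) : SmoothForm E M :=
  mk (fun x k => c k • η.at' x k) (by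
    rw [isSmooth_iff]
    intro k x₀
    exact (((isSmooth_iff _).1 η.isSmooth) k x₀).const_smul (c k))

theorem degS_apply (η : SmoothForm E M) (x : M) (k : ℕ) :
    (degS η).at' x k = (k : ℂ) • η.at' x k := rfl

theorem end_congr {T S : Module.End ℂ (SmoothForm E M)} (h : T = S) (η : SmoothForm E M) :
    T η = S η := by rw [h]

/-- An operator of degree `1` is determined in degree `k + 1` by the component of degree `k`. -/
theorem apply_succ_congr {T : Module.End ℂ (SmoothForm E M)} (hT : degS * T = T * degS + T)
    {η ξ : SmoothForm E M} {k : ℕ} (h : ∀ x, η.at' x k = ξ.at' x k) (x : M) :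
    (T η).at' x (k + 1) = (T ξ).at' x (k + 1) := by
  -- The difference has no component in degree `k`, so it is `(deg - k) ζ`; the value `0⁻¹ = 0` at
  -- `j = k` is harmless. Then `T (deg - k) ζ = (deg - k - 1) T ζ`, which has no component in degree
  -- `k + 1`.
  let ζ := scale (fun j => ((j : ℂ) - k)⁻¹) (η - ξ)
  have h1 : η - ξ = degS ζ - (k : ℂ) • ζ := by
    ext1 y
    funext j
    change (η - ξ).at' y j = (j : ℂ) • ((j : ℂ) - k)⁻¹ • (η - ξ).at' y j -
      (k : ℂ) • ((j : ℂ) - k)⁻¹ • (η - ξ).at' y j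
    have e : ∀ a : E [⋀^Fin j]→L[ℝ] ℂ, (j : ℂ) • ((j : ℂ) - k)⁻¹ • a -
        (k : ℂ) • ((j : ℂ) - k)⁻¹ • a = (((j : ℂ) - k) * ((j : ℂ) - k)⁻¹) • a := fun a => by module
    rw [e]
    by_cases hj : j = k
    · subst hj
      rw [at_sub, Pi.sub_apply, h y, sub_self]
      module
    · rw [mul_inv_cancel₀ (sub_ne_zero.2 (by exact_mod_cast hj))]
      module
  have h2 := end_congr hT ζ
  rw [Module.End.mul_apply, LinearMap.add_apply, Module.End.mul_apply] at h2
  have h3 : T η - T ξ = degS (T ζ) - T ζ - (k : ℂ) • T ζ := by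
    rw [← map_sub, h1, map_sub, map_smul, h2]; abel
  have h4 := congrArg (fun ω' : SmoothForm E M => ω'.at' x (k + 1)) h3
  simp only [at_sub, at_smul, Pi.sub_apply, Pi.smul_apply, degS_apply] at h4
  rw [← sub_eq_zero, h4]
  push_cast
  module

/-- Every form is `(deg + 1) ζ`, and `T (deg + 1) = deg T` has no component in degree zero. -/
theorem apply_zero_of_degree {T : Module.End ℂ (SmoothForm E M)} (hT : degS * T = T * degS + T)
    (η : SmoothForm E M) (x : M) : (T η).at' x 0 = 0 := by
  let ζ := scale (fun j => ((j : ℂ) + 1)⁻¹) η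
  have h1 : η = degS ζ + ζ := by
    ext1 y
    funext j
    change η.at' y j = (j : ℂ) • ((j : ℂ) + 1)⁻¹ • η.at' y j + ((j : ℂ) + 1)⁻¹ • η.at' y j
    have e : ∀ a : E [⋀^Fin j]→L[ℝ] ℂ, (j : ℂ) • ((j : ℂ) + 1)⁻¹ • a +
        ((j : ℂ) + 1)⁻¹ • a = (((j : ℂ) + 1) * ((j : ℂ) + 1)⁻¹) • a := fun a => by module
    have : (j : ℂ) + 1 ≠ 0 := by exact_mod_cast Nat.succ_ne_zero j
    rw [e, mul_inv_cancel₀ this]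
    module
  have h2 := end_congr hT ζ
  rw [Module.End.mul_apply, LinearMap.add_apply, Module.End.mul_apply, ← map_add, ← h1] at h2
  rw [← h2, degS_apply, Nat.cast_zero]
  module

end SmoothForm

/-! ### Type decomposition of the differential, and half-forms as smooth forms -/

namespace HypercomplexStructure

open Tot TotForm SmoothForm

variable {E : Type*} [NormedAddCommGroup E] [NormedSpace ℝ E] [FiniteDimensional ℝ E]
  {M : Type*} [TopologicalSpace M] [ChartedSpace E M] [IsManifold 𝓘(ℝ, E) ∞ M]
  (X : HypercomplexStructure E M)

theorem degS_dbar : degS * (dS - X.pd) = (dS - X.pd) * degS + (dS - X.pd) := by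
  rw [mul_sub, degS_mul_dS, degS_pd, sub_mul]; abel

theorem wt_dbar : X.wt * (dS - X.pd) = (dS - X.pd) * X.wt - Complex.I • (dS - X.pd) := by
  have h : X.wt * dS = dS * X.wt + (X.wt * dS - dS * X.wt) := by abel
  have h2 : X.wt * dS - dS * X.wt = Complex.I • ((2 : ℂ) • X.pd - dS) := by
    rw [pd, holPart]
    generalize X.wt * dS - dS * X.wt = a
    have hI : ∀ x : Module.End ℂ (SmoothForm E M), Complex.I • Complex.I • x = -x := fun x => by
      rw [smul_smul, Complex.I_mul_I, neg_one_smul]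
    have e : (2 : ℂ) • (1 / 2 : ℂ) • (dS - Complex.I • a) - dS = -(Complex.I • a) := by module
    rw [e, smul_neg, hI, neg_neg]
  rw [mul_sub, h, h2, wt_pd, sub_mul]
  module

/-- Identifies the algebraically defined `∂` with the one given by types: `∂` and `d - ∂` shift the
weight by `√-1` and `-√-1`, and in a given degree the weight determines the type. -/
theorem isDel_pd {k p q : ℕ} (h : p + q = k) {η : SmoothForm E M}
    (hη : X.IsType p q (comp η.at' k)) :
    X.IsDel p q (comp η.at' k) (comp (X.pd η).at' (k + 1)) := by
  rw [isType_comp_iff X _ h] at hη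
  have key : ∀ (T : Module.End ℂ (SmoothForm E M)) (c : ℂ), degS * T = T * degS + T →
      X.wt * T = T * X.wt + c • T → ∀ x, (X.wt (T η)).at' x (k + 1) =
        (Complex.I * ((p : ℂ) - q) + c) • (T η).at' x (k + 1) := by
    intro T c h1 h2 x
    have h3 := end_congr h2 η
    simp only [Module.End.mul_apply, LinearMap.add_apply, LinearMap.smul_apply] at h3
    have h4 := apply_succ_congr h1 (η := X.wt η) (ξ := (Complex.I * ((p : ℂ) - q)) • η) hη x
    rw [h3, at_add, Pi.add_apply, h4, map_smul, at_smul, at_smul, Pi.smul_apply, Pi.smul_apply]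
    module
  constructor
  · rw [isType_comp_iff X _ (by omega)]
    intro x
    refine (key X.pd Complex.I X.degS_pd X.wt_pd x).trans ?_
    congr 1
    push_cast
    ring
  · have h1 : (comp η.at' k).d - comp (X.pd η).at' (k + 1) =
        comp ((dS - X.pd : Module.End ℂ (SmoothForm E M)) η).at' (k + 1) := rfl
    rw [h1, isType_comp_iff X _ (by omega)]
    intro x
    refine (key (dS - X.pd) (-Complex.I) X.degS_dbar (by rw [wt_dbar]; module) x).trans ?_
    congr 1
    push_cast
    ring

/-- The difference `β - γ` has both types `(p + 1, q)` and `(p, q + 1)`; under `z = √-1` these scale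
by opposite nonzero numbers. This pins down the operators that are known only through `IsDel`. -/
theorem IsDel.unique {X : HypercomplexStructure E M} {k p q : ℕ} {η : DiffForm E M k}
    {β γ : DiffForm E M (k + 1)} (hβ : X.IsDel p q η β) (hγ : X.IsDel p q η γ) : β = γ := by
  funext x
  ext v
  have h1 := hβ.1 x Complex.I v
  have h2 := hβ.2 x Complex.I v
  have h3 := hγ.1 x Complex.I v
  have h4 := hγ.2 x Complex.I v
  simp only [Pi.sub_apply, ContinuousAlternatingMap.sub_apply] at h2 h4
  rw [h1] at h2
  rw [h3] at h4
  have h5 : (β x v - γ x v) * (2 * (Complex.I ^ (p + 1) * (starRingEnd ℂ Complex.I) ^ q)) = 0 := by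
    have e : Complex.I ^ p * (starRingEnd ℂ Complex.I) ^ (q + 1) =
        -(Complex.I ^ (p + 1) * (starRingEnd ℂ Complex.I) ^ q) := by
      rw [pow_succ, pow_succ, Complex.conj_I]; ring
    rw [e] at h2 h4
    linear_combination h4 - h2
  have h6 : (2 * (Complex.I ^ (p + 1) * (starRingEnd ℂ Complex.I) ^ q)) ≠ 0 := by
    simp [Complex.I_ne_zero]
  exact sub_eq_zero.1 ((mul_eq_zero.1 h5).resolve_right h6)

/-- Half-forms as smooth forms. -/
def emb : X.HalfForms →ₗ[ℂ] SmoothForm E M where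
  toFun η := SmoothForm.mk (fun x k => (η k).1 x) ((isSmooth_iff _).2 fun k => (η k).2.1)
  map_add' a b := rfl
  map_smul' c a := rfl

theorem emb_apply (η : X.HalfForms) (x : M) (k : ℕ) : (X.emb η).at' x k = (η k).1 x := rfl

theorem emb_injective : Function.Injective X.emb := by
  intro a b h
  funext k
  refine Subtype.ext (funext fun x => ?_)
  exact congrArg (fun ω' : SmoothForm E M => ω'.at' x k) h

/-- The forms of type `(*, 0)`. -/
def IsHolS (η : SmoothForm E M) : Prop := X.wt η = Complex.I • degS η

theorem isHolS_iff (η : SmoothForm E M) : X.IsHolS η ↔ ∀ k, X.IsType k 0 (comp η.at' k) := by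
  constructor
  · intro h k
    rw [isType_comp_iff X _ (by omega)]
    intro x
    have h1 := congrArg (fun ω' : SmoothForm E M => ω'.at' x k) h
    refine h1.trans ?_
    change Complex.I • ((k : ℂ) • η.at' x k) = _
    rw [smul_smul]; simp
  · intro h
    ext1 x
    funext k
    refine ((isType_comp_iff X _ (by omega)).1 (h k) x).trans ?_
    change _ = Complex.I • ((k : ℂ) • η.at' x k)
    rw [smul_smul]; simp

theorem isHolS_emb (η : X.HalfForms) : X.IsHolS (X.emb η) :=
  (X.isHolS_iff _).2 fun k => (η k).2.2

/-- The half-form with a given underlying form. -/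
def ofHol (η : SmoothForm E M) (h : X.IsHolS η) : X.HalfForms := fun k =>
  ⟨comp η.at' k, (isSmooth_iff _).1 η.isSmooth k, (X.isHolS_iff η).1 h k⟩

theorem emb_ofHol (η : SmoothForm E M) (h : X.IsHolS η) : X.emb (X.ofHol η h) = η := rfl

theorem IsHolS.isHol {X : HypercomplexStructure E M} {η : SmoothForm E M} (h : X.IsHolS η)
    (x : M) : IsHol (X.fld quatI x) (η.at' x) :=
  isHol_of_derv (fun v => X.fld_sq quatI_sq x v)
    (congrArg (fun ω' : SmoothForm E M => ω'.at' x) h)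

theorem isHolS_of_isHol {η : SmoothForm E M} (h : ∀ x, IsHol (X.fld quatI x) (η.at' x)) :
    X.IsHolS η := by
  ext1 x; exact (h x).derv_eq

theorem IsHolS.of_degree {X : HypercomplexStructure E M} {η : SmoothForm E M} (h : X.IsHolS η)
    {T : Module.End ℂ (SmoothForm E M)} (h1 : degS * T = T * degS + T)
    (h2 : X.wt * T = T * X.wt + Complex.I • T) : X.IsHolS (T η) := by
  have h3 := end_congr h1 η
  have h4 := end_congr h2 η
  simp only [Module.End.mul_apply, LinearMap.add_apply, LinearMap.smul_apply] at h3 h4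
  rw [IsHolS, h4, h3, h, map_smul, smul_add]

theorem IsHolS.pd {X : HypercomplexStructure E M} {η : SmoothForm E M} (h : X.IsHolS η) :
    X.IsHolS (X.pd η) := h.of_degree X.degS_pd X.wt_pd

theorem IsHolS.pdJ {X : HypercomplexStructure E M} {η : SmoothForm E M} (h : X.IsHolS η) :
    X.IsHolS (X.pdJ η) := h.of_degree X.degS_pdJ X.wt_pdJ

theorem IsHolS.jc {X : HypercomplexStructure E M} {η : SmoothForm E M} (h : X.IsHolS η) :
    X.IsHolS (X.jc η) := by
  have h1 := X.jc_wt η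
  rw [h, map_smulₛₗ, Complex.conj_I, jc_degS] at h1
  rw [IsHolS, ← neg_neg (X.wt (X.jc η)), ← h1]
  module

theorem IsHolS.wedS {X : HypercomplexStructure E M} {η ξ : SmoothForm E M} (h : X.IsHolS η)
    (h' : X.IsHolS ξ) : X.IsHolS (SmoothForm.wedS η ξ) :=
  X.isHolS_of_isHol fun x => (h.isHol x).wedge (h'.isHol x)

theorem IsHolS.add {X : HypercomplexStructure E M} {η ξ : SmoothForm E M} (h : X.IsHolS η)
    (h' : X.IsHolS ξ) : X.IsHolS (η + ξ) := by
  rw [IsHolS, map_add, map_add, h, h', smul_add]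

theorem IsHolS.smul {X : HypercomplexStructure E M} {η : SmoothForm E M} (c : ℂ) (h : X.IsHolS η) :
    X.IsHolS (c • η) := by
  rw [IsHolS, map_smul, map_smul, h, smul_comm]

end HypercomplexStructure

/-! ### Products with forms of type `(0, m)`, and the form `\bar Ω^n` -/

namespace Tot

variable {E : Type*} [NormedAddCommGroup E] [NormedSpace ℝ E] [FiniteDimensional ℝ E]

theorem wedge_single_deg {m : ℕ} (x : Tot E) (β : E [⋀^Fin m]→L[ℝ] ℂ) :
    (x ⋏ single m β) m = x 0 0 • β := by
  rw [wedge_apply, Finset.sum_eq_single (0 : Fin (m + 1))]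
  · ext v
    refine (altWedge_zero_left (by simp) _ _ _).trans ?_
    change x 0 0 * single m β (m - 0) _ = x 0 0 * β v
    congr 1
    change single m β m v = β v
    rw [single_same]
  · intro i _ hi
    have hi' : (i : ℕ) ≠ 0 := fun h => hi (Fin.ext h)
    have : m - (i : ℕ) ≠ m := by omega
    rw [single_of_ne this]
    ext v
    rw [altWedge_apply]; simp
  · simp

/-- The `(1, 0)`-part of `v` annihilates the antiholomorphic factor `y` and acts on the holomorphic
factor `x` as `v` itself. -/
theorem half_contr_wedge {I : E →L[ℝ] E} {x y : Tot E} (hx : IsHol I x)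
    (hy : ∀ v, contr (I v) y = -Complex.I • contr v y) (v : E) :
    (1 / 2 : ℂ) • (contr v (x ⋏ y) - Complex.I • contr (I v) (x ⋏ y)) = contr v x ⋏ y := by
  rw [contr_wedge, contr_wedge, hx v, hy v, map_smul, map_smul, LinearMap.smul_apply]
  match_scalars
  · linear_combination (-1 / 2 : ℂ) * Complex.I_mul_I
  · linear_combination (1 / 2 : ℂ) * Complex.I_mul_I

/-- Multiplication of forms of type `(*, 0)` by a nonzero form of type `(0, m)` is injective. -/
theorem eq_zero_of_wedge_single {I : E →L[ℝ] E} {m : ℕ} {β : E [⋀^Fin m]→L[ℝ] ℂ} (hβ : β ≠ 0)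
    (hy : ∀ v, contr (I v) (single m β) = -Complex.I • contr v (single m β)) (k : ℕ) :
    ∀ x : Tot E, IsHol I x → x ⋏ single m β = 0 → x k = 0 := by
  induction k with
  | zero =>
    intro x _ h
    have h1 := congrFun h m
    rw [wedge_single_deg] at h1
    refine zero_ext (y := 0) ?_
    exact (smul_eq_zero.1 h1).resolve_right hβ
  | succ k ih =>
    intro x hx h
    refine succ_ext (y := 0) fun v => ?_
    rw [map_zero]
    refine ih _ (hx.contr v) ?_
    have h1 := half_contr_wedge hx hy v
    rw [← h1, h, map_zero, map_zero]
    module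

theorem lam_eq_of_isON {g : E →L[ℝ] E →L[ℝ] ℝ} (hs : ∀ v w, g v w = g w v) {m m' : ℕ}
    {e : Fin m → E} {e' : Fin m' → E} (he : IsON g e) (he' : IsON g e') (J : E →L[ℝ] E) (x : Tot E) :
    lam J e x = lam J e' x := by
  rw [lam_apply, lam_apply]
  congr 1
  exact (sum_trace he' (HypercomplexHermitian.contr₂ J x) e e (fun w => by
    simp only [hs w]; exact he.expand w))

end Tot

namespace SmoothForm

open Tot TotForm

variable {E : Type*} [NormedAddCommGroup E] [NormedSpace ℝ E] [FiniteDimensional ℝ E]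
  {M : Type*} [TopologicalSpace M] [ChartedSpace E M] [IsManifold 𝓘(ℝ, E) ∞ M]

theorem parS_of_deg {η : SmoothForm E M} {k : ℕ} (h : degS η = (k : ℂ) • η) :
    parS η = (-1 : ℂ) ^ k • η := by
  ext1 x
  have h1 := eq_single_of_deg (congrArg (fun ω' : SmoothForm E M => ω'.at' x) h)
  change par (η.at' x) = (-1 : ℂ) ^ k • η.at' x
  change η.at' x = single k (η.at' x k) at h1
  rw [h1, par_single]

theorem eq_of_deg {η ξ : SmoothForm E M} {k : ℕ} (h : degS η = (k : ℂ) • η)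
    (h' : degS ξ = (k : ℂ) • ξ) (he : ∀ x, η.at' x k = ξ.at' x k) : η = ξ := by
  ext1 x
  have h1 := eq_single_of_deg (congrArg (fun ω' : SmoothForm E M => ω'.at' x) h)
  have h2 := eq_single_of_deg (congrArg (fun ω' : SmoothForm E M => ω'.at' x) h')
  change η.at' x = single k (η.at' x k) at h1
  change ξ.at' x = single k (ξ.at' x k) at h2
  rw [h1, h2, he]

theorem degS_wedS {η ξ : SmoothForm E M} {k l : ℕ} (h : degS η = (k : ℂ) • η)
    (h' : degS ξ = (l : ℂ) • ξ) : degS (wedS η ξ) = ((k + l : ℕ) : ℂ) • wedS η ξ := by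
  have e : degS (wedS η ξ) = wedS (degS η) ξ + wedS η (degS ξ) := by
    ext1 x; exact deg_wedge _ _
  rw [e, h, h', map_smul, map_smul, LinearMap.smul_apply]
  push_cast
  module

theorem degS_apply_of_degree {T : Module.End ℂ (SmoothForm E M)} (hT : degS * T = T * degS + T)
    {η : SmoothForm E M} {k : ℕ} (h : degS η = (k : ℂ) • η) :
    degS (T η) = ((k + 1 : ℕ) : ℂ) • T η := by
  have h1 := end_congr hT η
  rw [Module.End.mul_apply, LinearMap.add_apply, Module.End.mul_apply, h, map_smul] at h1
  rw [h1]; push_cast; module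

/-- The smooth form given by a form of one degree. -/
def homog {k : ℕ} (α : DiffForm E M k) (h : α.IsSmooth) : SmoothForm E M :=
  mk (fun x => single k (α x)) (IsSmooth.single h)

theorem degS_homog {k : ℕ} (α : DiffForm E M k) (h : α.IsSmooth) :
    degS (homog α h) = (k : ℂ) • homog α h := by
  ext1 x; exact deg_single _ _

theorem isSmooth_one : IsSmooth (fun _ : M => (one : Tot E)) := by
  refine IsSmooth.single (α := fun _ => ContinuousAlternatingMap.constOfIsEmpty ℝ E (Fin 0) 1)
    fun x₀ => ?_
  refine contDiffOn_of_eval fun v => ?_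
  exact contDiffOn_const (c := (1 : ℂ))

/-- The constant function `1`. -/
def oneS : SmoothForm E M := mk (fun _ => one) isSmooth_one

end SmoothForm

namespace HypercomplexHermitian

open Tot TotForm SmoothForm HypercomplexStructure

variable {E : Type*} [NormedAddCommGroup E] [NormedSpace ℝ E] [FiniteDimensional ℝ E]
  {M : Type*} [TopologicalSpace M] [ChartedSpace E M] [IsManifold 𝓘(ℝ, E) ∞ M]
  (X : HypercomplexHermitian E M)

/-- The form `Ω` as a smooth form. -/
def OmS : SmoothForm E M := SmoothForm.mk X.totOm X.isSmooth_totOm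

theorem degS_OmS : degS X.OmS = ((2 : ℕ) : ℂ) • X.OmS := by
  ext1 x; exact deg_single _ _

theorem parS_OmS : parS X.OmS = X.OmS := by
  rw [parS_of_deg X.degS_OmS]; simp

theorem isHolS_OmS : X.IsHolS X.OmS := X.isHolS_of_isHol fun x => (X.quatHerm x).isHol_totOm

/-- `Ω` is real for the quaternionic real structure `J_c`. Together with `jc_pd` this transfers `∂Ω
= 0` to `∂_J`. -/
theorem jc_OmS : X.jc X.OmS = X.OmS := by
  ext1 x
  change pull (X.fld quatJ x) (Tot.conj (single 2 (X.om x))) = single 2 (X.om x)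
  rw [conj_single, pull_single]
  congr 1
  ext v
  change starRingEnd ℂ (X.om x (fun i => X.fld quatJ x (v i))) = X.om x v
  rw [om_apply, om_apply]
  have h := X.quatHerm x
  rw [h.gJ, h.JJ, map_neg, map_neg, h.g_J_left, h.JI]
  simp only [map_neg, neg_neg, map_mul, map_add, Complex.conj_ofReal, Complex.conj_I, map_div₀,
    map_one, map_ofNat, Complex.ofReal_neg]
  ring

theorem pd_OmS (hX : X.IsHKT) : X.pd X.OmS = 0 := by
  have h1 : comp X.OmS.at' 2 = X.Omega := by
    funext x; exact single_same 2 _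
  have h2 := X.isDel_pd (k := 2) (p := 2) (q := 0) rfl (η := X.OmS)
    ((X.isHolS_iff _).1 X.isHolS_OmS 2)
  rw [h1] at h2
  have h3 := IsDel.unique h2 hX
  refine eq_of_deg (degS_apply_of_degree X.degS_pd X.degS_OmS) (by rw [map_zero, smul_zero])
    fun x => congrFun h3 x

theorem pdJ_OmS (hX : X.IsHKT) : X.pdJ X.OmS = 0 := by
  rw [← X.jc_OmS, ← X.jc_pd, X.pd_OmS hX, map_zero]

/-- The form `\bar Ω^k`. -/
def barPow (k : ℕ) : SmoothForm E M := ((wedS (conjS X.OmS)) ^ k) oneS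

theorem barPow_succ (k : ℕ) : X.barPow (k + 1) = wedS (conjS X.OmS) (X.barPow k) := by
  rw [barPow, pow_succ']; rfl

theorem barPow_at (k : ℕ) (x : M) : (X.barPow k).at' x = Tot.conj (powOm (X.om x) k) := by
  induction k with
  | zero => rw [powOm_zero, conj_one]; rfl
  | succ k ih => rw [barPow_succ, wedS_apply, ih, powOm_succ, conj_wedge]; rfl

theorem degS_barPow (k : ℕ) : degS (X.barPow k) = ((2 * k : ℕ) : ℂ) • X.barPow k := by
  ext1 x
  change deg ((X.barPow k).at' x) = ((2 * k : ℕ) : ℂ) • (X.barPow k).at' x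
  rw [barPow_at, conj_powOm, deg_powOm]

theorem comp_barPow (k : ℕ) : comp (X.barPow k).at' (2 * k) = X.Omega.conj.wedgePow k := by
  induction k with
  | zero => rfl
  | succ k ih =>
    funext x
    have h1 : (X.barPow (k + 1)).at' x = (X.barPow k).at' x ⋏ (conjS X.OmS).at' x := by
      rw [barPow_at, powOm_succ', conj_wedge, barPow_at]; rfl
    have h2 : (X.barPow k).at' x = single (E := E) (2 * k) ((X.Omega.conj.wedgePow k) x) := by
      rw [← ih]
      exact eq_single_of_deg (congrArg (fun ω' : SmoothForm E M => ω'.at' x) (X.degS_barPow k))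
    change (X.barPow (k + 1)).at' x (2 * (k + 1)) = altWedge _ _ _
    have h3 : (conjS X.OmS).at' x = single (E := E) 2 (X.Omega.conj x) := conj_single _ _
    rw [h1, h2, h3]
    refine (single_wedge (b := 2) (by ring) _ _).trans ?_
    exact congrArg (fun β : E [⋀^Fin 2]→L[ℝ] ℂ => altWedge (T := E) (by ring)
      (X.Omega.conj.wedgePow k x) β) (single_same (E := E) 2 (X.Omega.conj x))

/-- `\bar Ω` is `J_c`-real as well, so the same form `\bar Ω^n` computes the connection form for `∂`
and for `∂_J`. -/
theorem jc_barPow (k : ℕ) : X.jc (X.barPow k) = X.barPow k := by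
  have h0 : X.jc (conjS X.OmS) = conjS X.OmS := by
    have h1 : X.RJ (conjS X.OmS) = X.OmS := X.jc_OmS
    have h2 : conjS (X.RJ (conjS X.OmS)) = conjS X.OmS := by rw [h1]
    rw [RJ, conjS_pullS, conjS_conjS] at h2
    rw [jc_apply, conjS_conjS]
    exact h2
  induction k with
  | zero =>
    ext1 x
    change pull _ (Tot.conj one) = one
    rw [conj_one, pull_one]
  | succ k ih => rw [barPow_succ, jc_wedS, ih, h0]

theorem isType_barPow (k : ℕ) : X.IsType 0 (2 * k) (comp (X.barPow k).at' (2 * k)) := by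
  rw [isType_comp_iff _ _ (by omega)]
  intro x
  have h1 := ((X.quatHerm x).isHol_powOm k).derv_eq
  have h2 := congrArg Tot.conj h1
  rw [conj_derv, ← barPow_at, map_smulₛₗ, deg_powOm, map_smulₛₗ, ← barPow_at] at h2
  rw [h2, Complex.conj_I, Complex.conj_natCast]
  change -Complex.I • (((2 * k : ℕ) : ℂ) • (X.barPow k).at' x (2 * k)) = _
  rw [smul_smul]
  congr 1
  push_cast; ring

/-- The cancellation that turns identities for `θ ∧ \bar Ω^n`, the only data about `θ`, into
identities for `θ`. Pointwise it needs `Ω^n ≠ 0`, which holds by `powOm_ne_zero`. -/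
theorem eq_zero_of_wedS_barPow {n : ℕ} (hm : Module.finrank ℝ E = 4 * n) {η : SmoothForm E M}
    (hη : X.IsHolS η) (h : wedS η (X.barPow n) = 0) : η = 0 := by
  ext1 x
  funext k
  have h1 : (X.barPow n).at' x = single (2 * n) ((X.barPow n).at' x (2 * n)) :=
    eq_single_of_deg (congrArg (fun ω' : SmoothForm E M => ω'.at' x) (X.degS_barPow n))
  have h2 : (X.barPow n).at' x ≠ 0 := by
    rw [barPow_at]
    intro h0
    refine (X.quatHerm x).powOm_ne_zero hm (X.isON_onb x) n le_rfl ?_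
    have h3 := congrArg Tot.conj h0
    rw [map_zero] at h3
    rw [← h3]
    funext j; ext v
    exact (Complex.conj_conj _).symm
  refine eq_zero_of_wedge_single (I := X.fld quatI x) (β := (X.barPow n).at' x (2 * n)) ?_ ?_ k _
    (hη.isHol x) ?_
  · intro h0
    rw [h0] at h1
    exact h2 (by rw [h1]; exact Pi.single_zero _)
  · intro v
    rw [← h1, barPow_at, contr_conj, (X.quatHerm x).isHol_powOm n v, map_smulₛₗ, Complex.conj_I,
      contr_conj]
  · rw [← h1]
    exact congrArg (fun ω' : SmoothForm E M => ω'.at' x) h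

end HypercomplexHermitian

/-! ### Twisting the differentials by the connection form `θ` -/

namespace SmoothForm

open Tot TotForm

variable {E : Type*} [NormedAddCommGroup E] [NormedSpace ℝ E] [FiniteDimensional ℝ E]
  {M : Type*} [TopologicalSpace M] [ChartedSpace E M] [IsManifold 𝓘(ℝ, E) ∞ M]

theorem IsOddDer.anticomm_wedS {T : Module.End ℂ (SmoothForm E M)} (hT : IsOddDer T)
    {θ : SmoothForm E M} (hθ : parS θ = -θ) : T * wedS θ = wedS (T θ) - wedS θ * T := by
  rw [hT, hθ, map_neg, neg_mul, sub_eq_add_neg]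

theorem wedS_anticomm {θ θ' : SmoothForm E M} (hθ : parS θ = -θ) (hθ' : parS θ' = -θ') :
    wedS θ * wedS θ' = -(wedS θ' * wedS θ) := by
  rw [wedS_mul, wedS_mul, wedS_comm_of_odd hθ, hθ', map_neg, LinearMap.neg_apply, map_neg]

/-- The anticommutator of the twisted operators is `{D, D'} + ½ (D θ' + D' θ) ∧ + ¼ {θ ∧, θ' ∧}`,
and each of the three terms vanishes. -/
theorem twist_anticomm {D D' : Module.End ℂ (SmoothForm E M)} (hD : IsOddDer D) (hD' : IsOddDer D')
    (h : D * D' + D' * D = 0) {θ θ' : SmoothForm E M} (hθ : parS θ = -θ) (hθ' : parS θ' = -θ')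
    (hθθ' : D θ' + D' θ = 0) :
    (D + (1 / 2 : ℂ) • wedS θ) * (D' + (1 / 2 : ℂ) • wedS θ') +
      (D' + (1 / 2 : ℂ) • wedS θ') * (D + (1 / 2 : ℂ) • wedS θ) = 0 := by
  have h1 := hD.anticomm_wedS hθ'
  have h2 := hD'.anticomm_wedS hθ
  have h3 := wedS_anticomm hθ hθ'
  have h4 : wedS (D θ') = -wedS (D' θ) := by
    rw [← map_neg, eq_neg_of_add_eq_zero_left hθθ']
  have h5 : D * D' = -(D' * D) := eq_neg_of_add_eq_zero_left h
  simp only [mul_add, add_mul, mul_smul_comm, smul_mul_assoc, h1, h2, h3, h4, h5]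
  module

/-- Flatness of the connection: apply `{D, D'} = 0` to the section `Φ`. The terms quadratic in `θ,
θ'` cancel because these forms are odd. -/
theorem twist_curvature {D D' : Module.End ℂ (SmoothForm E M)} (hD : IsOddDer D)
    (hD' : IsOddDer D') (h : D * D' + D' * D = 0) {θ θ' Φ : SmoothForm E M} (hθ : parS θ = -θ)
    (hθ' : parS θ' = -θ') (hΦ : D Φ = wedS θ Φ) (hΦ' : D' Φ = wedS θ' Φ) :
    wedS (D θ' + D' θ) Φ = 0 := by
  have h1 := end_congr (hD.anticomm_wedS hθ') Φ
  have h2 := end_congr (hD'.anticomm_wedS hθ) Φ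
  have h3 := end_congr (wedS_anticomm hθ hθ') Φ
  have h4 := end_congr h Φ
  simp only [Module.End.mul_apply, LinearMap.add_apply, LinearMap.sub_apply, LinearMap.neg_apply,
    LinearMap.zero_apply, hΦ, hΦ'] at h1 h2 h3 h4
  rw [h1, h2, h3] at h4
  rw [map_add, LinearMap.add_apply, ← h4]
  abel

end SmoothForm

namespace HypercomplexHermitian

open Tot TotForm SmoothForm HypercomplexStructure

variable {E : Type*} [NormedAddCommGroup E] [NormedSpace ℝ E] [FiniteDimensional ℝ E]
  {M : Type*} [TopologicalSpace M] [ChartedSpace E M] [IsManifold 𝓘(ℝ, E) ∞ M]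
  (X : HypercomplexHermitian E M)

/-- The connection form of the canonical bundle. -/
structure IsTheta (n : ℕ) (θ : SmoothForm E M) : Prop where
  hol : X.IsHolS θ
  deg : degS θ = ((1 : ℕ) : ℂ) • θ
  eq : X.pd (X.barPow n) = wedS θ (X.barPow n)

/-- The operator `ⁿ∂`. -/
def twPd (θ : SmoothForm E M) : Module.End ℂ (SmoothForm E M) := X.pd + (1 / 2 : ℂ) • wedS θ

/-- The operator `ⁿ∂_J`. -/
def twPdJ (θ : SmoothForm E M) : Module.End ℂ (SmoothForm E M) :=
  X.pdJ + (1 / 2 : ℂ) • wedS (X.jc θ)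

namespace IsTheta

variable {X} {n : ℕ} {θ : SmoothForm E M}

theorem par (h : X.IsTheta n θ) : parS θ = -θ := by rw [parS_of_deg h.deg]; module

theorem deg_jc (h : X.IsTheta n θ) : degS (X.jc θ) = ((1 : ℕ) : ℂ) • X.jc θ := by
  rw [← jc_degS, h.deg, map_smulₛₗ, Complex.conj_natCast]

theorem par_jc (h : X.IsTheta n θ) : parS (X.jc θ) = -X.jc θ := by
  rw [parS_of_deg h.deg_jc]; module

theorem eq_jc (h : X.IsTheta n θ) : X.pdJ (X.barPow n) = wedS (X.jc θ) (X.barPow n) := by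
  have h1 := X.jc_pd (X.barPow n)
  rw [h.eq, jc_wedS, jc_barPow] at h1
  exact h1.symm

theorem twPd_sq (h : X.IsTheta n θ) (hm : Module.finrank ℝ E = 4 * n) :
    X.twPd θ * X.twPd θ = 0 := by
  have h0 : X.pd * X.pd + X.pd * X.pd = 0 := by rw [pd_pd, add_zero]
  have h1 := twist_curvature X.isOddDer_pd X.isOddDer_pd h0 h.par h.par h.eq h.eq
  have h2 := X.eq_zero_of_wedS_barPow hm (h.hol.pd.add h.hol.pd) h1
  have h3 := twist_anticomm X.isOddDer_pd X.isOddDer_pd h0 h.par h.par h2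
  rw [← two_smul ℂ] at h3
  exact (smul_eq_zero.1 h3).resolve_left two_ne_zero

theorem twPdJ_sq (h : X.IsTheta n θ) (hm : Module.finrank ℝ E = 4 * n) :
    X.twPdJ θ * X.twPdJ θ = 0 := by
  have h0 : X.pdJ * X.pdJ + X.pdJ * X.pdJ = 0 := by rw [pdJ_pdJ, add_zero]
  have h1 := twist_curvature X.isOddDer_pdJ X.isOddDer_pdJ h0 h.par_jc h.par_jc h.eq_jc h.eq_jc
  have h2 := X.eq_zero_of_wedS_barPow hm (h.hol.jc.pdJ.add h.hol.jc.pdJ) h1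
  have h3 := twist_anticomm X.isOddDer_pdJ X.isOddDer_pdJ h0 h.par_jc h.par_jc h2
  rw [← two_smul ℂ] at h3
  exact (smul_eq_zero.1 h3).resolve_left two_ne_zero

theorem twPd_twPdJ (h : X.IsTheta n θ) (hm : Module.finrank ℝ E = 4 * n) :
    X.twPd θ * X.twPdJ θ + X.twPdJ θ * X.twPd θ = 0 := by
  have h1 := twist_curvature X.isOddDer_pd X.isOddDer_pdJ X.pd_pdJ h.par h.par_jc h.eq h.eq_jc
  have h2 := X.eq_zero_of_wedS_barPow hm (h.hol.jc.pd.add h.hol.pdJ) h1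
  exact twist_anticomm X.isOddDer_pd X.isOddDer_pdJ X.pd_pdJ h.par h.par_jc h2

/-- The HKT condition enters here, and in the counterpart for `∂_J`: with `∂Ω = 0` the derivation
`∂` commutes with `Ω ∧ ·`, and the twist does so because `Ω` is even. -/
theorem twPd_OmS (h : X.IsTheta n θ) (hX : X.IsHKT) :
    X.twPd θ * wedS X.OmS = wedS X.OmS * X.twPd θ := by
  rw [twPd, add_mul, mul_add, X.isOddDer_pd, X.pd_OmS hX, map_zero, zero_add, parS_OmS,
    smul_mul_assoc, mul_smul_comm, wedS_mul, wedS_mul, wedS_comm_of_even X.parS_OmS]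

theorem twPdJ_OmS (h : X.IsTheta n θ) (hX : X.IsHKT) :
    X.twPdJ θ * wedS X.OmS = wedS X.OmS * X.twPdJ θ := by
  rw [twPdJ, add_mul, mul_add, X.isOddDer_pdJ, X.pdJ_OmS hX, map_zero, zero_add, parS_OmS,
    smul_mul_assoc, mul_smul_comm, wedS_mul, wedS_mul, wedS_comm_of_even X.parS_OmS]

theorem degS_wed {θ : SmoothForm E M} (h : degS θ = ((1 : ℕ) : ℂ) • θ) :
    degS * wedS θ = wedS θ * degS + wedS θ := by
  ext1 η
  have e : degS (wedS θ η) = wedS (degS θ) η + wedS θ (degS η) := by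
    ext1 x; exact deg_wedge _ _
  rw [Module.End.mul_apply, e, h, map_smul, LinearMap.smul_apply, Nat.cast_one, one_smul, add_comm]
  rfl

theorem degS_twPd (h : X.IsTheta n θ) : degS * X.twPd θ = X.twPd θ * degS + X.twPd θ := by
  rw [twPd, mul_add, add_mul, mul_smul_comm, smul_mul_assoc, degS_pd, degS_wed h.deg]
  module

theorem degS_twPdJ (h : X.IsTheta n θ) : degS * X.twPdJ θ = X.twPdJ θ * degS + X.twPdJ θ := by
  rw [twPdJ, mul_add, add_mul, mul_smul_comm, smul_mul_assoc, degS_pdJ, degS_wed h.deg_jc]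
  module

theorem isHolS_twPd (h : X.IsTheta n θ) {η : SmoothForm E M} (hη : X.IsHolS η) :
    X.IsHolS (X.twPd θ η) := hη.pd.add ((h.hol.wedS hη).smul _)

theorem jc_twPd (h : X.IsTheta n θ) (η : SmoothForm E M) :
    X.jc (X.twPd θ η) = X.twPdJ θ (X.jc η) := by
  rw [twPd, twPdJ, LinearMap.add_apply, LinearMap.add_apply, map_add, jc_pd, LinearMap.smul_apply,
    LinearMap.smul_apply, map_smulₛₗ, jc_wedS, map_div₀, map_one, map_ofNat]

end IsTheta

/-- The operator `Λ_Ω` on smooth forms. -/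
def lamS : Module.End ℂ (SmoothForm E M) :=
  ofPointwise (fun x => lam (X.fld quatJ x) (X.onb x)) fun _ h => X.isSmooth_lamM h

theorem lamS_at (η : SmoothForm E M) (x : M) :
    (X.lamS η).at' x = lam (X.fld quatJ x) (X.onb x) (η.at' x) := rfl

theorem isHolS_lamS {η : SmoothForm E M} (h : X.IsHolS η) : X.IsHolS (X.lamS η) :=
  X.isHolS_of_isHol fun x => (h.isHol x).lam _ _

theorem lamS_wedS {n : ℕ} (hm : Module.finrank ℝ E = 4 * n) {η : SmoothForm E M}
    (h : X.IsHolS η) :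
    X.lamS (wedS X.OmS η) = wedS X.OmS (X.lamS η) + (n : ℂ) • η - degS η := by
  ext1 x
  exact (X.quatHerm x).lam_wedge hm (X.isON_onb x) (h.isHol x)

end HypercomplexHermitian

/-! ### Adjointness, and the given operators in terms of smooth forms -/

namespace HypercomplexHermitian

open Tot TotForm SmoothForm HypercomplexStructure

variable {E : Type*} [NormedAddCommGroup E] [NormedSpace ℝ E] [FiniteDimensional ℝ E]
  {M : Type*} [TopologicalSpace M] [ChartedSpace E M] [IsManifold 𝓘(ℝ, E) ∞ M]
  (X : HypercomplexHermitian E M)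

/-- The Hermitian product of two families of forms in an orthonormal basis. -/
theorem hermProd_eq {m : ℕ} {x : M} (e : Fin m → E) (α β : X.HalfForms) :
    X.hermProd (x := x) e α β = ∑ k ∈ Finset.range (m + 1), ((k.factorial : ℂ)⁻¹) *
      ∑ i : Fin k → Fin m, (X.emb α).at' x k (fun j => e (i j)) *
        starRingEnd ℂ ((X.emb β).at' x k (fun j => e (i j))) := rfl

/-- The range may be lengthened by two because the terms above `m` vanish; then the first two terms,
zero as well, are split off. -/
theorem sum_range_add_two {m : ℕ} {a b : ℕ → ℂ} (h0 : a 0 = 0) (h1 : a 1 = 0)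
    (h : ∀ k, a (k + 2) = b k) (ha : ∀ k, m < k → a k = 0) :
    ∑ k ∈ Finset.range (m + 1), a k = ∑ k ∈ Finset.range (m + 1), b k := by
  have e1 : ∑ k ∈ Finset.range (m + 3), a k = ∑ k ∈ Finset.range (m + 1), a k := by
    rw [Finset.sum_range_succ, Finset.sum_range_succ, ha (m + 1) (by omega),
      ha (m + 2) (by omega), add_zero, add_zero]
  rw [← e1, Finset.sum_range_succ', Finset.sum_range_succ', h0, h1, add_zero, add_zero]
  exact Finset.sum_congr rfl fun k _ => h k

theorem hermProd_L {L : Module.End ℂ X.HalfForms}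
    (hL : ∀ η, X.emb (L η) = wedS X.OmS (X.emb η)) {x : M}
    {e : Fin (Module.finrank ℝ E) → E} (he : IsON (X.met x) e) (α β γ : X.HalfForms)
    (hγ : X.emb γ = X.lamS (X.emb β)) :
    X.hermProd (x := x) e (L α) β = X.hermProd (x := x) e α γ := by
  rw [hermProd_eq, hermProd_eq]
  have hz : ∀ k, k < 2 → (X.emb (L α)).at' x k = 0 := fun k hk => by
    rw [hL]; exact single_wedge_of_lt hk _ _
  refine sum_range_add_two ?_ ?_ (fun k => ?_) (fun k hk => ?_)
  · simp [hz 0 (by omega)]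
  · simp [hz 1 (by omega)]
  · have h1 := (X.quatHerm x).adjoint_lam he ((X.isHolS_emb β).isHol x) ((X.emb α).at' x k)
    have h2 : (X.emb (L α)).at' x (k + 2) =
        altWedge (Nat.add_comm 2 k) (X.om x) ((X.emb α).at' x k) := by
      rw [hL]; exact single_wedge (Nat.add_comm 2 k) _ _
    rw [h2, hγ, lamS_at, lam_eq_of_isON (X.quatHerm x).symm (X.isON_onb x) he]
    exact h1
  · simp [eq_zero_of_finrank_isON he hk ((X.emb β).at' x k)]

theorem emb_eq_zero_of_hermProd {α : X.HalfForms}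
    (h : ∀ x, X.hermProd (x := x) (X.onb x) α α = 0) : α = 0 := by
  apply X.emb_injective
  rw [map_zero]
  ext1 x
  funext k
  have h1 := h x
  rw [hermProd_eq] at h1
  simp only [Complex.mul_conj, ← Complex.ofReal_natCast, ← Complex.ofReal_inv, ← Complex.ofReal_sum,
    ← Complex.ofReal_mul] at h1
  rw [Complex.ofReal_eq_zero] at h1
  by_cases hk : k < Module.finrank ℝ E + 1
  · rw [Finset.sum_eq_zero_iff_of_nonneg] at h1
    · have h2 := h1 k (Finset.mem_range.2 hk)
      have h3 : ((k.factorial : ℝ)⁻¹) ≠ 0 := by positivity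
      have h4 := (mul_eq_zero.1 h2).resolve_left h3
      rw [Finset.sum_eq_zero_iff_of_nonneg (fun i _ => Complex.normSq_nonneg _)] at h4
      exact eq_zero_of_isON (X.isON_onb x) fun i =>
        Complex.normSq_eq_zero.1 (h4 i (Finset.mem_univ _))
    · intro i _
      have := fun j => Complex.normSq_nonneg ((X.emb α).at' x i j)
      exact mul_nonneg (by positivity) (Finset.sum_nonneg fun j _ => this _)
  · exact eq_zero_of_finrank_isON (X.isON_onb x) (by omega) _

/-- `Λ_Ω` is known only as an adjoint. The difference between it and the explicit contraction is
orthogonal to itself at every point, so it vanishes by positivity. -/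
theorem emb_Lam {L Lam : Module.End ℂ X.HalfForms}
    (hL : ∀ η, X.emb (L η) = wedS X.OmS (X.emb η)) (h : X.IsHermitianAdjoint L Lam)
    (η : X.HalfForms) : X.emb (Lam η) = X.lamS (X.emb η) := by
  let γ := X.ofHol (X.lamS (X.emb η)) (X.isHolS_lamS (X.isHolS_emb η))
  have hγ : X.emb γ = X.lamS (X.emb η) := X.emb_ofHol _ _
  have h1 : Lam η - γ = 0 := by
    refine X.emb_eq_zero_of_hermProd fun x => ?_
    have h2 := h x (X.onb x) (X.isON_onb x).orth (Lam η - γ) η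
    have h3 := X.hermProd_L hL (X.isON_onb x) (Lam η - γ) η γ hγ
    have h4 : X.hermProd (x := x) (X.onb x) (Lam η - γ) (Lam η - γ) =
        X.hermProd (x := x) (X.onb x) (Lam η - γ) (Lam η) -
          X.hermProd (x := x) (X.onb x) (Lam η - γ) γ := by
      rw [hermProd_eq, hermProd_eq, hermProd_eq, ← Finset.sum_sub_distrib]
      refine Finset.sum_congr rfl fun k _ => ?_
      rw [← mul_sub, ← Finset.sum_sub_distrib]
      congr 1
      refine Finset.sum_congr rfl fun i _ => ?_
      rw [← mul_sub, ← map_sub, map_sub X.emb]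
      rfl
    rw [h4, ← h3]
    exact sub_eq_zero.2 h2.symm
  rw [← hγ, sub_eq_zero.1 h1]

theorem isHermitianAdjoint_of_emb {L Lam : Module.End ℂ X.HalfForms}
    (hL : ∀ η, X.emb (L η) = wedS X.OmS (X.emb η))
    (hLam : ∀ η, X.emb (Lam η) = X.lamS (X.emb η)) : X.IsHermitianAdjoint L Lam := by
  intro x e he α β
  exact X.hermProd_L hL (isON_of_orth rfl he) α β (Lam β) (hLam β)

theorem isHolS_homog (θ : X.formsP0 1) : X.IsHolS (homog θ.1 θ.2.1) := by
  rw [isHolS_iff]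
  intro k
  by_cases hk : k = 1
  · subst hk
    have : comp (homog θ.1 θ.2.1).at' 1 = θ.1 := by
      funext x; exact single_same (E := E) 1 (θ.1 x)
    rw [this]
    exact θ.2.2
  · have : comp (homog θ.1 θ.2.1).at' k = 0 := by
      funext x; exact single_of_ne (E := E) hk (θ.1 x)
    rw [this]
    intro x z v
    simp

theorem isTheta_iff {n : ℕ} (θ : X.formsP0 1) : X.IsTheta n (homog θ.1 θ.2.1) ↔
    X.IsDel 0 (2 * n) (X.Omega.conj.wedgePow n)
    (DiffForm.wedge (Nat.add_comm 1 (2 * n)) θ.1 (X.Omega.conj.wedgePow n)) := by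
  have h1 := X.isDel_pd (p := 0) (q := 2 * n) (by omega) (X.isType_barPow n)
  have h2 : comp (wedS (homog θ.1 θ.2.1) (X.barPow n)).at' (2 * n + 1) =
      DiffForm.wedge (Nat.add_comm 1 (2 * n)) θ.1 (X.Omega.conj.wedgePow n) := by
    rw [← comp_barPow]
    funext x
    exact single_wedge (E := E) (Nat.add_comm 1 (2 * n)) (θ.1 x) ((X.barPow n).at' x)
  rw [comp_barPow] at h1
  constructor
  · intro h
    rw [← h2, ← h.eq]
    exact h1
  · intro h
    refine ⟨X.isHolS_homog θ, degS_homog _ _, ?_⟩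
    have h3 := IsDel.unique h1 h
    rw [← h2] at h3
    have h4 := degS_wedS (degS_homog θ.1 θ.2.1) (X.degS_barPow n)
    rw [add_comm] at h4
    exact eq_of_deg (degS_apply_of_degree X.degS_pd (X.degS_barPow n)) h4 (fun x => congrFun h3 x)

namespace Operators

variable {X} {n : ℕ} (O : X.Operators n)

/-- The form `θ` as a smooth form. -/
def th : SmoothForm E M := homog O.theta.1 O.theta.2.1

theorem isTheta : X.IsTheta n O.th := (X.isTheta_iff O.theta).2 O.theta_spec

theorem emb_Jc (η : X.HalfForms) : X.emb (O.Jc η) = X.jc (X.emb η) := by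
  ext1 x
  funext k
  exact congrFun (O.Jc_spec η k) x

theorem emb_L (η : X.HalfForms) : X.emb (O.L η) = wedS X.OmS (X.emb η) := by
  obtain ⟨h0, h1, h2⟩ := O.L_spec η
  ext1 x
  funext k
  match k with
  | 0 =>
    rw [emb_apply, h0]
    exact (single_wedge_of_lt (E := E) (by omega) (X.om x) ((X.emb η).at' x)).symm
  | 1 =>
    rw [emb_apply, h1]
    exact (single_wedge_of_lt (E := E) (by omega) (X.om x) ((X.emb η).at' x)).symm
  | p + 2 =>
    rw [emb_apply, h2]
    exact (single_wedge (E := E) (Nat.add_comm 2 p) (X.om x) ((X.emb η).at' x)).symm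

theorem emb_Lam (η : X.HalfForms) : X.emb (O.Lam η) = X.lamS (X.emb η) :=
  X.emb_Lam O.emb_L O.Lam_spec η

theorem emb_del (η : X.HalfForms) : X.emb (O.del η) = X.twPd O.th (X.emb η) := by
  obtain ⟨h0, h1⟩ := O.del_spec η
  ext1 x
  funext k
  cases k with
  | zero =>
    rw [apply_zero_of_degree O.isTheta.degS_twPd, emb_apply, h0]
    rfl
  | succ p =>
    obtain ⟨β, hβ, h2⟩ := h1 p
    have h3 := X.isDel_pd (k := p) (p := p) (q := 0) (by omega) (η := X.emb η) (η p).2.2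
    have h4 := IsDel.unique hβ h3
    rw [emb_apply, h2, h4]
    have h5 := single_wedge (E := E) (Nat.add_comm 1 p) (O.theta.1 x) ((X.emb η).at' x)
    exact congrArg (fun γ : E [⋀^Fin (p + 1)]→L[ℝ] ℂ =>
      (X.pd (X.emb η)).at' x (p + 1) + (1 / 2 : ℂ) • γ) h5.symm

theorem emb_delJ (η : X.HalfForms) : X.emb (O.delJ η) = X.twPdJ O.th (X.emb η) := by
  rw [O.delJ_spec, emb_Jc, emb_del, O.isTheta.jc_twPd, ← emb_Jc,
    LinearEquiv.apply_symm_apply]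

theorem emb_H {n : ℕ} (O : X.Operators n) (hm : Module.finrank ℝ E = 4 * n) (η : X.HalfForms) :
    X.emb (O.H η) = degS (X.emb η) - (n : ℂ) • X.emb η := by
  rw [O.H_spec, LinearMap.sub_apply, map_sub, Module.End.mul_apply, Module.End.mul_apply, emb_L,
    emb_Lam, emb_Lam, emb_L, X.lamS_wedS hm (X.isHolS_emb η)]
  abel

end Operators

end HypercomplexHermitian

/-! ### Existence of `θ` and of the operators -/

namespace Tot

variable {E : Type*} [NormedAddCommGroup E] [NormedSpace ℝ E] [FiniteDimensional ℝ E]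

theorem contr_single_one (α : E [⋀^Fin 1]→L[ℝ] ℂ) (v : E) :
    contr v (single 1 α) = α ![v] • one := by
  funext k
  cases k with
  | zero =>
    ext w
    change single 1 α 1 (Matrix.vecCons v w) = α ![v] * 1
    rw [single_same, mul_one]
    congr 1
    exact congrArg _ (Subsingleton.elim _ _)
  | succ k =>
    have h : contr v (single 1 α) (k + 1) = 0 := by
      rw [contr_apply, single_of_ne (by omega)]
      rfl
    have h' : (one : Tot E) (k + 1) = 0 := single_of_ne (by omega) _
    rw [h, Pi.smul_apply, h']
    module

theorem derv_of_antihol {I : E →L[ℝ] E} {z : Tot E}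
    (h : ∀ v, contr (I v) z = -Complex.I • contr v z) :
    derv I.toLinearMap z = -Complex.I • deg z := by
  rw [derv_apply, ← altz_contrAt_eq_deg, ← map_smul]
  exact altz_congr h

theorem eq_of_smul_eq {c : ℂ} (hc : c ≠ 0) {x y : Tot E} (h : c • x = c • y) : x = y := by
  have h1 : ∀ z : Tot E, z = c⁻¹ • c • z := fun z => by
    have : c⁻¹ • c • z = (c⁻¹ * c) • z := by module
    rw [this, inv_mul_cancel₀ hc]; module
  rw [h1 x, h1 y, h]

theorem deg_conj (x : Tot E) : deg (conj x) = conj (deg x) := by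
  funext k; ext v
  change (k : ℂ) * starRingEnd ℂ _ = starRingEnd ℂ ((k : ℂ) * _)
  rw [map_mul, Complex.conj_natCast]

namespace QuatHerm

variable {g : E →L[ℝ] E →L[ℝ] ℝ} {I J : E →L[ℝ] E} {Om : E [⋀^Fin 2]→L[ℝ] ℂ}

theorem antihol_conj_powOm (h : QuatHerm g I J Om) (k : ℕ) (v : E) :
    contr (I v) (conj (powOm Om k)) = -Complex.I • contr v (conj (powOm Om k)) := by
  rw [contr_conj, h.isHol_powOm k v, map_smulₛₗ, Complex.conj_I, contr_conj]

theorem exists_conj_powOm_ne (h : QuatHerm g I J Om) {n : ℕ} (hm : Module.finrank ℝ E = 4 * n) :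
    ∃ w, conj (powOm Om n) (2 * n) w ≠ 0 := by
  obtain ⟨e, he⟩ := exists_isON h.symm h.pos
  have h0 := h.powOm_ne_zero hm he n le_rfl
  by_contra! hw
  refine h0 ?_
  rw [← single_powOm, ← conj_conj (powOm Om n), conj_apply]
  have : conj (powOm Om n) (2 * n) = 0 := by ext w; exact hw w
  rw [this]
  funext k
  rcases eq_or_ne k (2 * n) with rfl | hk
  · rw [single_same]; ext v; simp
  · rw [single_of_ne hk]; rfl

/-- A form of type `(1, 2 n)` is the product of a form of type `(1, 0)` and of `\bar Ω^n`. -/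
theorem exists_wedge_conj_powOm (h : QuatHerm g I J Om) {n : ℕ}
    (hm : Module.finrank ℝ E = 4 * n) {b : Tot E} (hb : deg b = ((2 * n + 1 : ℕ) : ℂ) • b)
    (hbI : derv I.toLinearMap b = (Complex.I * (1 - (2 * n : ℕ))) • b) :
    ∃ α : E [⋀^Fin 1]→L[ℝ] ℂ, IsHol I (single 1 α) ∧ b = single 1 α ⋏ conj (powOm Om n) := by
  set y := conj (powOm Om n) with hy
  obtain ⟨w, hw⟩ := h.exists_conj_powOm_ne hm
  rw [← hy] at hw
  have hya := h.antihol_conj_powOm n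
  rw [← hy] at hya
  -- Contraction of `b` with the `(1, 0)`-part of `v` has type `(0, 2n)`. Its conjugate has type
  -- `(2n, 0)`, so `c v` is a multiple of `\bar Ω^n`.
  let c : E →ₗ[ℝ] Tot E :=
    { toFun := fun v => (1 / 2 : ℂ) • (contr v b - Complex.I • contr (I v) b)
      map_add' := fun u v => by
        simp only [map_add, LinearMap.add_apply]; module
      map_smul' := fun r v => by
        simp only [map_smul, LinearMap.smul_apply, real_smul, RingHom.id_apply]; module }
  have hc : ∀ v, ∃ t : ℂ, c v = t • y := by
    intro v
    have hd : deg (c v) = ((2 * n : ℕ) : ℂ) • c v := by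
      have e : ∀ u, deg (contr u b) = ((2 * n : ℕ) : ℂ) • contr u b := fun u => by
        have h1 := contr_deg u b
        rw [hb, map_smul] at h1
        have h2 : deg (contr u b) = ((2 * n + 1 : ℕ) : ℂ) • contr u b - contr u b := by
          rw [h1]; abel
        rw [h2]; push_cast; module
      change deg ((1 / 2 : ℂ) • (contr v b - Complex.I • contr (I v) b)) =
        ((2 * n : ℕ) : ℂ) • ((1 / 2 : ℂ) • (contr v b - Complex.I • contr (I v) b))
      rw [map_smul, map_sub, map_smul, e, e]
      module
    have hwt : derv I.toLinearMap (c v) = -Complex.I • deg (c v) := by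
      funext k
      have h1 := derv_contr_sub h.II b k (l := 1 - (2 * n : ℕ)) (by rw [hbI]; rfl) v
      change derv I.toLinearMap ((1 / 2 : ℂ) • (contr v b - Complex.I • contr (I v) b)) k = _
      rw [map_smul, Pi.smul_apply, h1, hd]
      change _ = (-Complex.I • ((2 * n : ℕ) : ℂ) • (1 / 2 : ℂ) •
        (contr v b - Complex.I • contr (I v) b)) k
      simp only [Pi.smul_apply]
      generalize (contr v b - Complex.I • contr (I v) b) k = a
      module
    have hol : IsHol I (conj (c v)) := by
      refine isHol_of_derv h.II ?_
      rw [← conj_derv, hwt, map_smulₛₗ, deg_conj]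
      simp
    obtain ⟨t, ht⟩ := h.exists_smul_powOm hm hol (by
      rw [deg_conj, hd, map_smulₛₗ, Complex.conj_natCast])
    refine ⟨starRingEnd ℂ t, ?_⟩
    rw [← conj_conj (c v), ht, map_smulₛₗ]
  -- The multiple is written as a quotient of values at the fixed tuple `w`, which makes its
  -- linearity in `v` evident.
  let t : E →ₗ[ℝ] ℂ :=
    { toFun := fun v => c v (2 * n) w / y (2 * n) w
      map_add' := fun u v => by
        rw [map_add, ← add_div]; rfl
      map_smul' := fun r v => by
        rw [map_smul, RingHom.id_apply, real_smul]
        change (r : ℂ) * c v (2 * n) w / _ = _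
        rw [mul_div_assoc]
        rfl }
  have ht : ∀ v, c v = t v • y := by
    intro v
    obtain ⟨s, hs⟩ := hc v
    have : t v = s := by
      change c v (2 * n) w / y (2 * n) w = s
      rw [hs]
      exact mul_div_cancel_right₀ s hw
    rw [this, hs]
  have htI : ∀ v, t (I v) = Complex.I * t v := by
    intro v
    have : c (I v) = Complex.I • c v := by
      change (1 / 2 : ℂ) • (contr (I v) b - Complex.I • contr (I (I v)) b) =
        Complex.I • (1 / 2 : ℂ) • (contr v b - Complex.I • contr (I v) b)
      rw [h.II, map_neg, LinearMap.neg_apply]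
      match_scalars
      · linear_combination (1 / 2 : ℂ) * Complex.I_mul_I
      · ring
    change c (I v) (2 * n) w / y (2 * n) w = Complex.I * (c v (2 * n) w / y (2 * n) w)
    rw [this, ← mul_div_assoc]
    rfl
  let α : E [⋀^Fin 1]→L[ℝ] ℂ :=
    ContinuousAlternatingMap.ofSubsingleton ℝ E ℂ 0 (LinearMap.toContinuousLinearMap t)
  have hα : ∀ v, α ![v] = t v := fun v => rfl
  have hαI : IsHol I (single 1 α) := by
    intro v
    rw [contr_single_one, contr_single_one, hα, hα, htI]
    module
  refine ⟨α, hαI, ?_⟩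
  -- `z` is annihilated by contraction with `(1, 0)`-vectors, so in degree `2n + 1` it has weight
  -- `-(2n + 1)`. As a form of type `(1, 2n)` it also has weight `1 - 2n`; hence it is zero.
  set z := b - single 1 α ⋏ y with hz
  have hz1 : ∀ v, contr (I v) z = -Complex.I • contr v z := by
    intro v
    have h1 := half_contr_wedge hαI hya v
    rw [contr_single_one, hα, map_smul, LinearMap.smul_apply, one_wedge, ← ht] at h1
    have h2 : (1 / 2 : ℂ) • (contr v z - Complex.I • contr (I v) z) = 0 := by
      rw [hz, map_sub, map_sub]
      have e : (1 / 2 : ℂ) • (contr v b - contr v (single 1 α ⋏ y) -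
          Complex.I • (contr (I v) b - contr (I v) (single 1 α ⋏ y))) = c v -
          (1 / 2 : ℂ) • (contr v (single 1 α ⋏ y) - Complex.I • contr (I v) (single 1 α ⋏ y)) := by
        change _ = (1 / 2 : ℂ) • (contr v b - Complex.I • contr (I v) b) - _
        module
      rw [e, h1, sub_self]
    have h3 : contr (I v) z = -Complex.I • contr v z + ((2 : ℂ) * Complex.I) •
        ((1 / 2 : ℂ) • (contr v z - Complex.I • contr (I v) z)) := by
      match_scalars
      · linear_combination Complex.I_mul_I
      · ring
    rw [h3, h2]; module
  have hz2 := derv_of_antihol hz1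
  have hyd : deg y = ((2 * n : ℕ) : ℂ) • y := by rw [hy, conj_powOm, deg_powOm]
  have hyw := derv_of_antihol hya
  have hzd : deg z = ((2 * n + 1 : ℕ) : ℂ) • z := by
    rw [hz, map_sub, hb, deg_wedge, hyd, deg_single, map_smul, map_smul, LinearMap.smul_apply]
    push_cast; module
  have hzw : derv I.toLinearMap z = (Complex.I * (1 - (2 * n : ℕ))) • z := by
    rw [hz, map_sub, hbI, derv_wedge, hαI.derv_eq, hyw, hyd, deg_single, map_smul, map_smul,
      map_smul, map_smul, LinearMap.smul_apply, LinearMap.smul_apply]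
    push_cast; module
  have hz0 : (2 * Complex.I) • z = (2 * Complex.I) • (0 : Tot E) := by
    have : (2 * Complex.I) • z = derv I.toLinearMap z - derv I.toLinearMap z := by
      nth_rewrite 1 [hzw]
      rw [hz2, hzd]; push_cast; module
    rw [this]; module
  have := eq_of_smul_eq (by simp [Complex.I_ne_zero]) hz0
  exact sub_eq_zero.1 this

end QuatHerm

end Tot

namespace HypercomplexHermitian

open Tot TotForm SmoothForm HypercomplexStructure

variable {E : Type*} [NormedAddCommGroup E] [NormedSpace ℝ E] [FiniteDimensional ℝ E]
  {M : Type*} [TopologicalSpace M] [ChartedSpace E M] [IsManifold 𝓘(ℝ, E) ∞ M]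
  (X : HypercomplexHermitian E M)

theorem contr_endC_inC (B : M → E →L[ℝ] E) {η : TotForm E M} {c : ℂ} {x₀ : M} {y : E}
    (hy : y ∈ (ch x₀).target)
    (h : ∀ v, Tot.contr (B ((ch x₀).symm y) v) (η ((ch x₀).symm y)) =
      c • Tot.contr v (η ((ch x₀).symm y))) (v : E) :
    Tot.contr (endC B x₀ y v) (inC η x₀ y) = c • Tot.contr v (inC η x₀ y) := by
  rw [inC, contr_pull, chartInv_endC _ hy, h, map_smul, contr_pull]

/-- A form `θ` of type `(1, 0)` is smooth if `θ ∧ \bar Ω^n` is. -/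
theorem isSmooth_of_wedge_barPow {n : ℕ} (hm : Module.finrank ℝ E = 4 * n) {β : SmoothForm E M}
    {α : DiffForm E M 1} (hα : ∀ x, IsHol (X.fld quatI x) (single (E := E) 1 (α x)))
    (h : ∀ x, β.at' x = single (E := E) 1 (α x) ⋏ (X.barPow n).at' x) : α.IsSmooth := by
  intro x₀
  refine contDiffOn_of_eval fun v => ?_
  set ξ : TotForm E M := fun x => single (E := E) 1 (α x) with hξ
  have hβ : SmoothFam (ch x₀).target (inC β.at' x₀) := β.isSmooth x₀
  have hΦ : SmoothFam (ch x₀).target (inC (X.barPow n).at' x₀) := (X.barPow n).isSmooth x₀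
  -- Contracting `β` with the `(1, 0)`-part of `v 0` isolates `α(v) \bar Ω^n`. Near `y₀` the
  -- coefficient `α(v)` is then a quotient of smooth functions, the denominator being a value of
  -- `\bar Ω^n` that is nonzero at `y₀`.
  have key : ∀ y ∈ (ch x₀).target, ∀ w, ((1 / 2 : ℂ) • (Tot.contr (v 0) (inC β.at' x₀ y) -
      Complex.I • Tot.contr (endC (X.fld quatI) x₀ y (v 0)) (inC β.at' x₀ y))) (2 * n) w =
      α.inChart x₀ y v * inC (X.barPow n).at' x₀ y (2 * n) w := by
    intro y hy w
    have h1 : inC β.at' x₀ y = inC ξ x₀ y ⋏ inC (X.barPow n).at' x₀ y := by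
      rw [← inC_wedge]
      exact congrArg (fun η => inC η x₀ y) (funext h)
    have h2 : IsHol (endC (X.fld quatI) x₀ y) (inC ξ x₀ y) :=
      contr_endC_inC _ hy (hα _)
    have h3 := half_contr_wedge h2 (contr_endC_inC (η := (X.barPow n).at') (X.fld quatI) hy
      (fun v => by
        rw [barPow_at]; exact (X.quatHerm _).antihol_conj_powOm n v)) (v 0)
    have h4 : inC ξ x₀ y = single 1 (α.inChart x₀ y) := by
      funext k
      rw [inC_apply]
      rcases eq_or_ne k 1 with rfl | hk
      · rw [single_same]
        have : comp ξ 1 = α := by funext x; exact single_same (E := E) 1 (α x)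
        rw [this]
      · rw [single_of_ne hk]
        have : comp ξ k = 0 := by funext x; exact single_of_ne (E := E) hk (α x)
        rw [this]
        ext u; rfl
    have h5 : (![v 0] : Fin 1 → E) = v := by
      funext i; rw [Subsingleton.elim i 0]; rfl
    rw [← h1, h4, contr_single_one, map_smul, LinearMap.smul_apply, one_wedge, h5] at h3
    rw [h3]
    rfl
  intro y₀ hy₀
  obtain ⟨w, hw⟩ : ∃ w, inC (X.barPow n).at' x₀ y₀ (2 * n) w ≠ 0 := by
    obtain ⟨w, hw⟩ := (X.quatHerm ((ch x₀).symm y₀)).exists_conj_powOm_ne hm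
    rw [← barPow_at] at hw
    refine ⟨fun i => chartDer x₀ ((ch x₀).symm y₀) (w i), ?_⟩
    change (X.barPow n).at' ((ch x₀).symm y₀) (2 * n)
      (fun i => chartInv x₀ y₀ (chartDer x₀ ((ch x₀).symm y₀) (w i))) ≠ 0
    simpa only [chartInv_chartDer hy₀] using hw
  have hc1 := contDiffOn_eval (hΦ (2 * n)) w
  have hc2 : ContDiffOn ℝ ∞ (fun y => ((1 / 2 : ℂ) • (Tot.contr (v 0) (inC β.at' x₀ y) -
      Complex.I • Tot.contr (endC (X.fld quatI) x₀ y (v 0)) (inC β.at' x₀ y))) (2 * n) w)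
      (ch x₀).target := by
    have e1 := contDiffOn_eval (hβ.contr (contDiffOn_const (c := v 0)) (2 * n)) w
    have e2 := contDiffOn_eval (hβ.contr (((X.smoothEnd_fld quatI) x₀).clm_apply
      (contDiffOn_const (c := v 0))) (2 * n)) w
    exact (contDiffOn_const (c := (1 / 2 : ℂ))).mul
      (e1.sub ((contDiffOn_const (c := Complex.I)).mul e2))
  have hev : ∀ᶠ y in nhdsWithin y₀ (ch (E := E) x₀).target,
      inC (X.barPow n).at' x₀ y (2 * n) w ≠ 0 :=
    (hc1.continuousOn y₀ hy₀).eventually_ne hw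
  refine ((hc2 y₀ hy₀).mul ((hc1 y₀ hy₀).inv (by exact hw))).congr_of_eventuallyEq ?_ ?_
  · filter_upwards [hev, self_mem_nhdsWithin] with y hy hy'
    rw [key y hy' w, Pi.inv_apply, mul_inv_cancel_right₀ hy]
  · rw [key y₀ hy₀ w, Pi.inv_apply, mul_inv_cancel_right₀ hw]

/-- Since `∂(\bar Ω^n)` has type `(1, 2n)`, it is divisible by `\bar Ω^n` at each point
(`exists_wedge_conj_powOm`); the pointwise quotients form a smooth form by
`isSmooth_of_wedge_barPow`. -/
theorem exists_theta {n : ℕ} (hm : Module.finrank ℝ E = 4 * n) :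
    ∃ θ : X.formsP0 1, X.IsTheta n (homog θ.1 θ.2.1) := by
  have hd := degS_apply_of_degree X.degS_pd (X.degS_barPow n)
  have ht := (X.isDel_pd (p := 0) (q := 2 * n) (by omega) (X.isType_barPow n)).1
  rw [isType_comp_iff _ _ (by omega)] at ht
  have hb : ∀ x, ∃ α : E [⋀^Fin 1]→L[ℝ] ℂ, IsHol (X.fld quatI x) (single 1 α) ∧
      (X.pd (X.barPow n)).at' x = single 1 α ⋏ (X.barPow n).at' x := by
    intro x
    have hdx : deg ((X.pd (X.barPow n)).at' x) =
        ((2 * n + 1 : ℕ) : ℂ) • (X.pd (X.barPow n)).at' x :=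
      congrArg (fun ω' : SmoothForm E M => ω'.at' x) hd
    rw [barPow_at]
    refine (X.quatHerm x).exists_wedge_conj_powOm hm hdx ?_
    funext k
    by_cases hk : k = 2 * n + 1
    · subst hk
      rw [ht x, Pi.smul_apply]
      congr 1
      push_cast; ring
    · have h1 := eq_single_of_deg hdx
      have hdx' : deg (derv (X.fld quatI x).toLinearMap ((X.pd (X.barPow n)).at' x)) =
          ((2 * n + 1 : ℕ) : ℂ) • derv (X.fld quatI x).toLinearMap ((X.pd (X.barPow n)).at' x) := by
        have h2 : deg (derv (X.fld quatI x).toLinearMap ((X.pd (X.barPow n)).at' x)) =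
            derv (X.fld quatI x).toLinearMap (deg ((X.pd (X.barPow n)).at' x)) :=
          (congrArg (fun ω' : SmoothForm E M => ω'.at' x)
            (end_congr X.wt_degS (X.pd (X.barPow n)))).symm
        rw [h2, hdx, map_smul]
      rw [eq_single_of_deg hdx', single_of_ne hk, h1, Pi.smul_apply, single_of_ne hk]
      module
  choose α hα hα' using hb
  have hs : DiffForm.IsSmooth (E := E) (M := M) α := X.isSmooth_of_wedge_barPow hm hα hα'
  have hh : X.IsHolS (homog (E := E) (M := M) α hs) := X.isHolS_of_isHol hα
  have h1 : X.IsType 1 0 (E := E) (M := M) (k := 1) α := by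
    have := (X.isHolS_iff _).1 hh 1
    have e : comp (homog (E := E) (M := M) α hs).at' 1 = α := by
      funext x; exact single_same (E := E) 1 (α x)
    rwa [e] at this
  refine ⟨⟨α, hs, h1⟩, hh, degS_homog _ _, ?_⟩
  ext1 x
  exact hα' x

/-- The operators of a hypercomplex Hermitian manifold exist. -/
theorem nonempty_operators {n : ℕ} (hm : Module.finrank ℝ E = 4 * n) :
    Nonempty (X.Operators n) := by
  obtain ⟨θ, hθ⟩ := X.exists_theta hm
  set ϑ := homog θ.1 θ.2.1 with hϑ
  -- An operator on smooth forms that preserves type `(*, 0)` restricts to the half-forms.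
  have lift : ∀ T : Module.End ℂ (SmoothForm E M), (∀ η, X.IsHolS η → X.IsHolS (T η)) →
      ∃ S : Module.End ℂ X.HalfForms, ∀ η, X.emb (S η) = T (X.emb η) := by
    intro T hT
    refine ⟨{ toFun := fun η => X.ofHol (T (X.emb η)) (hT _ (X.isHolS_emb η))
              map_add' := fun a b => X.emb_injective ?_
              map_smul' := fun c a => X.emb_injective ?_ }, fun η => rfl⟩
    · simp only [emb_ofHol, map_add]
    · simp only [RingHom.id_apply, emb_ofHol, map_smul]
  obtain ⟨L, hL⟩ := lift (wedS X.OmS) fun η hη => X.isHolS_OmS.wedS hη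
  obtain ⟨Lam, hLam⟩ := lift X.lamS fun η hη => X.isHolS_lamS hη
  obtain ⟨del, hdel⟩ := lift (X.twPd ϑ) fun η hη => hθ.isHolS_twPd hη
  have hpar : ∀ η, X.IsHolS η → X.IsHolS (parS η) := fun η hη => by
    rw [← X.jc_jc]; exact hη.jc.jc
  let Jc : X.HalfForms ≃ₛₗ[starRingEnd ℂ] X.HalfForms :=
    { toFun := fun η => X.ofHol (X.jc (X.emb η)) (X.isHolS_emb η).jc
      -- The square of `J_c` is the parity involution, so its inverse is the parity after `J_c`.
      invFun := fun η => X.ofHol (parS (X.jc (X.emb η))) (hpar _ (X.isHolS_emb η).jc)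
      map_add' := fun a b => X.emb_injective (by
        simp only [emb_ofHol, map_add])
      map_smul' := fun c a => X.emb_injective (by
        rw [emb_ofHol, map_smul X.emb, map_smul X.emb, emb_ofHol, map_smulₛₗ])
      left_inv := fun η => X.emb_injective (by
        rw [emb_ofHol, emb_ofHol, jc_jc]
        exact end_congr parS_mul_parS _)
      right_inv := fun η => X.emb_injective (by
        rw [emb_ofHol, emb_ofHol, ← jc_jc, jc_jc, jc_jc]
        exact end_congr parS_mul_parS _) }
  refine ⟨{ theta := θ
            theta_spec := (X.isTheta_iff θ).1 hθ
            Jc := Jc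
            Jc_spec := fun η p => rfl
            L := L
            L_spec := fun η => ⟨?_, ?_, fun p => ?_⟩
            Lam := Lam
            Lam_spec := X.isHermitianAdjoint_of_emb hL hLam
            H := L * Lam - Lam * L
            H_spec := rfl
            del := del
            del_spec := fun η => ⟨?_, fun p => ⟨comp (X.pd (X.emb η)).at' (p + 1), ?_, ?_⟩⟩
            delJ := (Jc : X.HalfForms →ₛₗ[starRingEnd ℂ] X.HalfForms).comp
              (del.comp (Jc.symm : X.HalfForms →ₛₗ[starRingEnd ℂ] X.HalfForms))
            delJ_spec := fun η => rfl }⟩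
  · refine Subtype.ext (funext fun x => ?_)
    rw [← emb_apply, hL]
    exact single_wedge_of_lt (E := E) (by omega) (X.om x) ((X.emb η).at' x)
  · refine Subtype.ext (funext fun x => ?_)
    rw [← emb_apply, hL]
    exact single_wedge_of_lt (E := E) (by omega) (X.om x) ((X.emb η).at' x)
  · funext x
    rw [← emb_apply, hL]
    exact single_wedge (E := E) (Nat.add_comm 2 p) (X.om x) ((X.emb η).at' x)
  · refine Subtype.ext (funext fun x => ?_)
    rw [← emb_apply, hdel]
    exact apply_zero_of_degree hθ.degS_twPd _ x
  · exact X.isDel_pd (k := p) (p := p) (q := 0) (by omega) (η := X.emb η) (η p).2.2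
  · funext x
    rw [← emb_apply, hdel]
    have h5 := single_wedge (E := E) (Nat.add_comm 1 p) (θ.1 x) ((X.emb η).at' x)
    exact congrArg (fun γ : E [⋀^Fin (p + 1)]→L[ℝ] ℂ =>
      (X.pd (X.emb η)).at' x (p + 1) + (1 / 2 : ℂ) • γ) h5

end HypercomplexHermitian

/-! ### Representations of the Kähler-de Rham superalgebra -/

/-- Operators that satisfy the defining relations of the generators `L, Λ, H, d, d^c` of the
Kähler-de Rham superalgebra, with `Λ` nilpotent. -/
structure KahlerRel {A : Type*} [Ring A] [Algebra ℂ A] (L Λ H d c : A) : Prop where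
  LΛ : L * Λ - Λ * L = H
  HL : H * L = L * H + (2 : ℂ) • L
  HΛ : H * Λ = Λ * H - (2 : ℂ) • Λ
  Hd : H * d = d * H + d
  Hc : H * c = c * H + c
  Ld : L * d = d * L
  Lc : L * c = c * L
  dd : d * d = 0
  cc : c * c = 0
  dc : d * c + c * d = 0
  nil : IsNilpotent Λ

namespace KahlerRel

variable {A : Type*} [Ring A] [Algebra ℂ A] {L Λ H d c : A}

/-- The commutator with a fixed element. -/
def adL (a : A) : A →ₗ[ℂ] A := LinearMap.mulLeft ℂ a - LinearMap.mulRight ℂ a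

theorem adL_apply (a x : A) : adL a x = a * x - x * a := rfl

theorem adL_adL (a b x : A) : adL a (adL b x) = adL (a * b - b * a) x + adL b (adL a x) := by
  simp only [adL_apply]; noncomm_ring

theorem adL_mul (a x y : A) : adL a (x * y) = adL a x * y + x * adL a y := by
  simp only [adL_apply]; noncomm_ring

theorem adL_nilpotent (h : IsNilpotent Λ) : IsNilpotent (adL Λ) := by
  refine Commute.isNilpotent_sub (LinearMap.commute_mulLeft_right Λ Λ) ?_ ?_
  · exact (LinearMap.isNilpotent_mulLeft_iff ℂ Λ).2 h
  · exact (LinearMap.isNilpotent_mulRight_iff ℂ Λ).2 h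

/-- A vector of weight `-3` annihilated by `L` in a representation of `sl₂` on which `Λ` is
nilpotent vanishes. -/
theorem eq_zero_of_weight_neg_three (h : KahlerRel L Λ H d c) {y : A} (hL : adL L y = 0)
    (hH : adL H y = (-3 : ℂ) • y) : y = 0 := by
  have hHΛ : H * Λ - Λ * H = (-2 : ℂ) • Λ := by rw [h.HΛ]; module
  have adsmul : ∀ (r : ℂ) (a x : A), adL (r • a) x = r • adL a x := fun r a x => by
    simp only [adL_apply, smul_mul_assoc, mul_smul_comm, smul_sub]
  have w : ∀ k : ℕ, adL H ((adL Λ ^ k) y) = (-3 - 2 * k : ℂ) • (adL Λ ^ k) y := by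
    intro k
    induction k with
    | zero => simpa using hH
    | succ k ih =>
      rw [pow_succ', Module.End.mul_apply, adL_adL, hHΛ, ih, map_smul, adsmul]
      push_cast; module
  -- The usual `sl₂`-formula: a vector of weight `λ` killed by `L` gives `(k + 1)(λ - k)`, here with
  -- `λ = -3`.
  have l : ∀ k : ℕ, adL L ((adL Λ ^ (k + 1)) y) =
      (((k : ℂ) + 1) * (-3 - k)) • (adL Λ ^ k) y := by
    intro k
    induction k with
    | zero =>
      rw [zero_add, pow_one, adL_adL, h.LΛ, hH, hL, map_zero]
      simp
    | succ k ih =>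
      rw [pow_succ', Module.End.mul_apply, adL_adL, h.LΛ, w, ih, map_smul,
        ← Module.End.mul_apply (adL Λ), ← pow_succ']
      push_cast; module
  obtain ⟨N, hN⟩ := adL_nilpotent h.nil
  have z : (adL Λ ^ N) y = 0 := by rw [hN]; rfl
  clear hN
  induction N with
  | zero => simpa using z
  | succ N ih =>
    refine ih ?_
    have h1 := l N
    rw [z, map_zero] at h1
    refine (smul_eq_zero.1 h1.symm).resolve_left ?_
    -- The coefficient vanishes for no natural number `N`, so the vanishing of `(ad Λ)^N y` descends
    -- to `N = 0`.
    have e : ((N : ℂ) + 1) * (-3 - N) = -(((N + 1) * (N + 3) : ℕ) : ℂ) := by push_cast; ring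
    rw [e, neg_eq_zero, Nat.cast_eq_zero]
    positivity

/-- For the adjoint action `x` is a vector of weight `1` killed by `L`. Then `(ad Λ)² x` has weight
`-3` and is killed by `L`, because `L (ad Λ)² x = -(ad Λ) x + (ad Λ) x`. Nilpotency of `Λ` rules out
such a vector unless it is zero. This takes the place of the Kähler identities: `d^*` and `(d^c)^*`
commute with `Λ`. -/
theorem adL_adL_eq_zero (h : KahlerRel L Λ H d c) {x : A} (hL : L * x = x * L)
    (hH : H * x = x * H + x) : adL Λ (adL Λ x) = 0 := by
  have hHΛ : H * Λ - Λ * H = (-2 : ℂ) • Λ := by rw [h.HΛ]; module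
  have adsmul : ∀ (r : ℂ) (a x : A), adL (r • a) x = r • adL a x := fun r a x => by
    simp only [adL_apply, smul_mul_assoc, mul_smul_comm, smul_sub]
  have h1 : adL L x = 0 := by rw [adL_apply, hL, sub_self]
  have h2 : adL H x = x := by rw [adL_apply, hH]; abel
  have h3 : adL H (adL Λ x) = -adL Λ x := by rw [adL_adL, hHΛ, h2, adsmul]; module
  have h4 : adL L (adL Λ x) = x := by rw [adL_adL, h.LΛ, h1, h2, map_zero, add_zero]
  refine h.eq_zero_of_weight_neg_three ?_ ?_
  · rw [adL_adL, h.LΛ, h3, h4]; abel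
  · rw [adL_adL, hHΛ, h3, adsmul, map_neg]; module

/-- The operator `d^*`. -/
def ds (Λ c : A) : A := Λ * c - c * Λ

/-- The operator `(d^c)^*`. -/
def dcs (Λ d : A) : A := d * Λ - Λ * d

/-- The Laplacian. -/
def lap (Λ d c : A) : A := d * ds Λ c + ds Λ c * d

theorem ds_eq : ds Λ c = adL Λ c := rfl

theorem dcs_eq : dcs Λ d = -adL Λ d := by rw [dcs, adL_apply, neg_sub]

theorem eq_sub_of_sub_eq_right {a b r : A} (h : a - b = r) : b = a - r := by rw [← h]; abel

theorem adL_H_Λ (h : KahlerRel L Λ H d c) (x : A) : adL H (adL Λ x) =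
    (-2 : ℂ) • adL Λ x + adL Λ (adL H x) := by
  rw [adL_adL, h.HΛ]
  simp only [adL_apply, smul_mul_assoc, mul_smul_comm, sub_mul, mul_sub]
  module

theorem adL_L_d (h : KahlerRel L Λ H d c) : adL L d = 0 := by rw [adL_apply, h.Ld, sub_self]

theorem adL_L_c (h : KahlerRel L Λ H d c) : adL L c = 0 := by rw [adL_apply, h.Lc, sub_self]

theorem adL_H_d (h : KahlerRel L Λ H d c) : adL H d = d := by
  rw [adL_apply, h.Hd, add_sub_cancel_left]

theorem adL_H_c (h : KahlerRel L Λ H d c) : adL H c = c := by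
  rw [adL_apply, h.Hc, add_sub_cancel_left]

theorem adL_Λ_d : adL Λ d = -dcs Λ d := by rw [dcs_eq, neg_neg]

theorem sL (h : KahlerRel L Λ H d c) : ds Λ c * L = L * ds Λ c - c := by
  have h1 : adL L (ds Λ c) = c := by
    rw [ds_eq, adL_adL, h.LΛ, h.adL_H_c, h.adL_L_c, map_zero, add_zero]
  exact eq_sub_of_sub_eq_right h1

theorem tL (h : KahlerRel L Λ H d c) : dcs Λ d * L = L * dcs Λ d + d := by
  have h1 : adL L (dcs Λ d) = -d := by
    rw [dcs_eq, map_neg, adL_adL, h.LΛ, h.adL_H_d, h.adL_L_d, map_zero, add_zero]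
  rw [← sub_neg_eq_add]
  exact eq_sub_of_sub_eq_right h1

theorem adL_Λ_ds (h : KahlerRel L Λ H d c) : adL Λ (ds Λ c) = 0 := h.adL_adL_eq_zero h.Lc h.Hc

theorem adL_Λ_dcs (h : KahlerRel L Λ H d c) : adL Λ (dcs Λ d) = 0 := by
  rw [dcs_eq, map_neg, h.adL_adL_eq_zero h.Ld h.Hd, neg_zero]

theorem sΛ (h : KahlerRel L Λ H d c) : ds Λ c * Λ = Λ * ds Λ c :=
  (sub_eq_zero.1 h.adL_Λ_ds).symm

theorem tΛ (h : KahlerRel L Λ H d c) : dcs Λ d * Λ = Λ * dcs Λ d :=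
  (sub_eq_zero.1 h.adL_Λ_dcs).symm

theorem adL_H_ds (h : KahlerRel L Λ H d c) : adL H (ds Λ c) = -ds Λ c := by
  rw [ds_eq, h.adL_H_Λ, h.adL_H_c]; module

theorem adL_H_dcs (h : KahlerRel L Λ H d c) : adL H (dcs Λ d) = -dcs Λ d := by
  rw [dcs_eq, map_neg, h.adL_H_Λ, h.adL_H_d]; module

theorem sH (h : KahlerRel L Λ H d c) : ds Λ c * H = H * ds Λ c + ds Λ c := by
  rw [← sub_neg_eq_add]
  exact eq_sub_of_sub_eq_right h.adL_H_ds

theorem tH (h : KahlerRel L Λ H d c) : dcs Λ d * H = H * dcs Λ d + dcs Λ d := by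
  rw [← sub_neg_eq_add]
  exact eq_sub_of_sub_eq_right h.adL_H_dcs

theorem dt (h : KahlerRel L Λ H d c) : d * dcs Λ d + dcs Λ d * d = 0 := by
  have h1 : d * dcs Λ d + dcs Λ d * d = (d * d) * Λ - Λ * (d * d) := by
    rw [dcs]; noncomm_ring
  rw [h1, h.dd]; simp

theorem cs (h : KahlerRel L Λ H d c) : c * ds Λ c + ds Λ c * c = 0 := by
  have h1 : c * ds Λ c + ds Λ c * c = Λ * (c * c) - (c * c) * Λ := by
    rw [ds]; noncomm_ring
  rw [h1, h.cc]; simp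

/-- Apply `ad Λ` to `{d, d^c} = 0`: the two resulting anticommutators are the two expressions for
the Laplacian. -/
theorem ct (h : KahlerRel L Λ H d c) : c * dcs Λ d + dcs Λ d * c = lap Λ d c := by
  have h1 := congrArg (adL Λ) h.dc
  rw [map_add, adL_mul, adL_mul, map_zero, adL_Λ_d, ← ds_eq] at h1
  have h2 : lap Λ d c - (c * dcs Λ d + dcs Λ d * c) = 0 := by
    rw [← h1, lap]; noncomm_ring
  exact (sub_eq_zero.1 h2).symm

/-- Apply `ad Λ` to `{d^c, d^*} = 0`; since `Λ` commutes with `d^*`, only twice its square remains.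
-/
theorem ss (h : KahlerRel L Λ H d c) : ds Λ c * ds Λ c = 0 := by
  have h1 := congrArg (adL Λ) h.cs
  rw [map_add, adL_mul, adL_mul, map_zero, h.adL_Λ_ds, ← ds_eq, mul_zero, zero_mul, add_zero,
    zero_add, ← two_smul ℂ] at h1
  exact (smul_eq_zero.1 h1).resolve_left two_ne_zero

theorem tt (h : KahlerRel L Λ H d c) : dcs Λ d * dcs Λ d = 0 := by
  have h1 := congrArg (adL Λ) h.dt
  rw [map_add, adL_mul, adL_mul, map_zero, h.adL_Λ_dcs, adL_Λ_d, mul_zero, zero_mul, add_zero,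
    zero_add, neg_mul, mul_neg, ← two_smul ℂ, smul_neg, neg_eq_zero] at h1
  exact (smul_eq_zero.1 h1).resolve_left two_ne_zero

theorem adL_Λ_lap (h : KahlerRel L Λ H d c) :
    adL Λ (lap Λ d c) = -(dcs Λ d * ds Λ c + ds Λ c * dcs Λ d) := by
  rw [lap, map_add, adL_mul, adL_mul, h.adL_Λ_ds, adL_Λ_d]; noncomm_ring

/-- Applying `ad Λ` to the two expressions for the Laplacian gives the anticommutator of `d^*` and
`(d^c)^*` with opposite signs, so it vanishes. -/
theorem st (h : KahlerRel L Λ H d c) : ds Λ c * dcs Λ d + dcs Λ d * ds Λ c = 0 := by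
  have h1 := h.adL_Λ_lap
  rw [← h.ct, map_add, adL_mul, adL_mul, h.adL_Λ_dcs, ← ds_eq, mul_zero, zero_mul, add_zero,
    zero_add] at h1
  have h2 : (2 : ℂ) • (ds Λ c * dcs Λ d + dcs Λ d * ds Λ c) = 0 := by
    rw [two_smul]
    nth_rewrite 1 [h1]
    abel
  exact (smul_eq_zero.1 h2).resolve_left two_ne_zero

theorem lapΛ (h : KahlerRel L Λ H d c) : lap Λ d c * Λ = Λ * lap Λ d c := by
  have h1 := h.adL_Λ_lap
  rw [add_comm, h.st, neg_zero] at h1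
  exact (sub_eq_zero.1 h1).symm

theorem lapL (h : KahlerRel L Λ H d c) : lap Λ d c * L = L * lap Λ d c := by
  have h1 : adL L (lap Λ d c) = 0 := by
    have h2 : adL L (ds Λ c) = c := by
      rw [ds_eq, adL_adL, h.LΛ, h.adL_H_c, h.adL_L_c, map_zero, add_zero]
    rw [lap, map_add, adL_mul, adL_mul, h.adL_L_d, h2, zero_mul, mul_zero, zero_add, add_zero, h.dc]
  exact (sub_eq_zero.1 h1).symm

theorem lapH (h : KahlerRel L Λ H d c) : lap Λ d c * H = H * lap Λ d c := by
  have h1 : adL H (lap Λ d c) = 0 := by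
    rw [lap, map_add, adL_mul, adL_mul, h.adL_H_d, h.adL_H_ds]; noncomm_ring
  exact (sub_eq_zero.1 h1).symm

/-- Both products equal `a b a`. In this way the Laplacian commutes with each odd generator that
squares to zero. -/
theorem anticomm_comm {a b l : A} (haa : a * a = 0) (h : a * b + b * a = l) : a * l = l * a := by
  rw [← h, mul_add, add_mul, ← mul_assoc, haa, mul_assoc b, haa, ← mul_assoc]; simp

theorem dlap (h : KahlerRel L Λ H d c) : d * lap Λ d c = lap Λ d c * d :=
  anticomm_comm h.dd (b := ds Λ c) rfl

theorem clap (h : KahlerRel L Λ H d c) : c * lap Λ d c = lap Λ d c * c :=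
  anticomm_comm h.cc h.ct

theorem slap (h : KahlerRel L Λ H d c) : ds Λ c * lap Λ d c = lap Λ d c * ds Λ c :=
  anticomm_comm h.ss (b := d) (by rw [lap, add_comm])

theorem tlap (h : KahlerRel L Λ H d c) : dcs Λ d * lap Λ d c = lap Λ d c * dcs Λ d :=
  anticomm_comm h.tt (b := c) (by rw [add_comm, h.ct])

end KahlerRel

section Representation

variable {V : Type*} [AddCommGroup V] [Module ℂ V] {P L Λ H d c : Module.End ℂ V}

open KahlerRel

/-- The images of the even part of the Kähler-de Rham superalgebra. -/
def repEven (L Λ H d c : Module.End ℂ V) (a : KahlerDeRham) : Module.End ℂ V :=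
  a 0 • L + a 1 • Λ + a 2 • H + a 7 • lap Λ d c

/-- The images of the odd part of the Kähler-de Rham superalgebra. -/
def repOdd (Λ d c : Module.End ℂ V) (a : KahlerDeRham) : Module.End ℂ V :=
  a 3 • d + a 4 • c + a 5 • ds Λ c + a 6 • dcs Λ d

/-- The representation of the Kähler-de Rham superalgebra. -/
def rep (L Λ H d c : Module.End ℂ V) : KahlerDeRham →ₗ[ℂ] Module.End ℂ V where
  toFun a := repEven L Λ H d c a + repOdd Λ d c a
  map_add' a b := by simp only [repEven, repOdd, Pi.add_apply]; module
  map_smul' r a := by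
    simp only [repEven, repOdd, Pi.smul_apply, smul_eq_mul, RingHom.id_apply]; module

/-- The relations serve as rewriting rules that bring all products into one order; afterwards only
coefficients are compared. The mixed and the odd brackets below are treated alike. -/
theorem superComm_rep_aux (h : KahlerRel L Λ H d c) (a b : KahlerDeRham) :
    repEven L Λ H d c a * repEven L Λ H d c b - repEven L Λ H d c b * repEven L Λ H d c a =
      (2 * (a 2 * b 0 - a 0 * b 2)) • L + (-2 * (a 2 * b 1 - a 1 * b 2)) • Λ +
        (a 0 * b 1 - a 1 * b 0) • H := by
  have e1 : Λ * L = L * Λ - H := by rw [← h.LΛ]; abel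
  simp only [repEven, mul_add, add_mul, smul_mul_assoc, mul_smul_comm, e1, h.HL, h.HΛ, h.lapL,
    h.lapΛ, h.lapH]
  module

theorem superComm_rep_aux' (h : KahlerRel L Λ H d c) (a b : KahlerDeRham) :
    repEven L Λ H d c a * repOdd Λ d c b - repOdd Λ d c b * repEven L Λ H d c a =
      (a 2 * b 3 - a 0 * b 6) • d + (a 2 * b 4 + a 0 * b 5) • c +
      (-(a 2 * b 5) + a 1 * b 4) • ds Λ c + (-(a 2 * b 6) - a 1 * b 3) • dcs Λ d := by
  have e1 : d * Λ = Λ * d + dcs Λ d := by rw [dcs]; abel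
  have e2 : c * Λ = Λ * c - ds Λ c := by rw [ds]; abel
  simp only [repEven, repOdd, mul_add, add_mul, smul_mul_assoc, mul_smul_comm, e1, e2, ← h.Ld,
    ← h.Lc, h.Hd, h.Hc, h.sL, h.tL, h.sΛ, h.tΛ, h.sH, h.tH, h.dlap, h.clap, h.slap, h.tlap]
  module

theorem superComm_rep_odd (h : KahlerRel L Λ H d c) (a b : KahlerDeRham) :
    repOdd Λ d c a * repOdd Λ d c b + repOdd Λ d c b * repOdd Λ d c a =
      (a 3 * b 5 + a 5 * b 3 + a 4 * b 6 + a 6 * b 4) • lap Λ d c := by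
  have e1 : c * d = -(d * c) := by rw [← add_eq_zero_iff_eq_neg, add_comm]; exact h.dc
  have e2 : ds Λ c * d = lap Λ d c - d * ds Λ c := by rw [lap]; abel
  have e3 : dcs Λ d * d = -(d * dcs Λ d) := by
    rw [← add_eq_zero_iff_eq_neg, add_comm]; exact h.dt
  have e4 : ds Λ c * c = -(c * ds Λ c) := by
    rw [← add_eq_zero_iff_eq_neg, add_comm]; exact h.cs
  have e5 : dcs Λ d * c = lap Λ d c - c * dcs Λ d := by rw [← h.ct]; abel
  have e6 : dcs Λ d * ds Λ c = -(ds Λ c * dcs Λ d) := by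
    rw [← add_eq_zero_iff_eq_neg, add_comm]; exact h.st
  simp only [repOdd, mul_add, add_mul, smul_mul_assoc, mul_smul_comm, e1, e2, e3, e4, e5, e6,
    h.dd, h.cc, h.ss, h.tt]
  module

end Representation

section Representation

variable {V : Type*} [AddCommGroup V] [Module ℂ V] {P L Λ H d c : Module.End ℂ V}

open KahlerRel

theorem rep_single (L Λ H d c : Module.End ℂ V) :
    rep L Λ H d c (Pi.single 0 1) = L ∧ rep L Λ H d c (Pi.single 1 1) = Λ ∧
    rep L Λ H d c (Pi.single 2 1) = H ∧ rep L Λ H d c (Pi.single 3 1) = d ∧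
    rep L Λ H d c (Pi.single 4 1) = c ∧ rep L Λ H d c (Pi.single 7 1) = lap Λ d c := by
  refine ⟨?_, ?_, ?_, ?_, ?_, ?_⟩ <;> simp [rep, repEven, repOdd, Pi.single_apply]

theorem repEven_of_mem {a : KahlerDeRham} (ha : a ∈ KahlerDeRham.gradedPart 1) :
    repEven L Λ H d c a = 0 := by
  rcases KahlerDeRham.mem_gradedPart_cases ha with ⟨h, _⟩ | ⟨_, h0, h1, h2, h7⟩
  · exact absurd h (by decide)
  · simp [repEven, h0, h1, h2, h7]

theorem repOdd_of_mem {a : KahlerDeRham} (ha : a ∈ KahlerDeRham.gradedPart 0) :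
    repOdd Λ d c a = 0 := by
  rcases KahlerDeRham.mem_gradedPart_cases ha with ⟨_, h0, h1, h2, h7⟩ | ⟨h, _⟩
  · simp [repOdd, h0, h1, h2, h7]
  · exact absurd h (by decide)

/-- The parities of the generators. -/
structure KahlerParity (P L Λ d c : Module.End ℂ V) : Prop where
  PP : P * P = 1
  L : L ∈ superEndPart P 0
  Λ : Λ ∈ superEndPart P 0
  d : d ∈ superEndPart P 1
  c : c ∈ superEndPart P 1

namespace KahlerParity

theorem mul_mem {a b : Module.End ℂ V} {i j k : ZMod 2} (ha : a ∈ superEndPart P i)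
    (hb : b ∈ superEndPart P j) (h : i + j = k) : a * b ∈ superEndPart P k :=
  h ▸ superEndPart_mul ha hb

theorem ds (h : KahlerParity P L Λ d c) : ds Λ c ∈ superEndPart P 1 :=
  Submodule.sub_mem _ (mul_mem h.Λ h.c (zero_add 1)) (mul_mem h.c h.Λ (add_zero 1))

theorem dcs (h : KahlerParity P L Λ d c) : dcs Λ d ∈ superEndPart P 1 :=
  Submodule.sub_mem _ (mul_mem h.d h.Λ (add_zero 1)) (mul_mem h.Λ h.d (zero_add 1))

theorem lap (h : KahlerParity P L Λ d c) : lap Λ d c ∈ superEndPart P 0 :=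
  Submodule.add_mem _ (mul_mem h.d h.ds rfl) (mul_mem h.ds h.d rfl)

theorem commutator_mem (h : KahlerParity P L Λ d c) (hr : KahlerRel L Λ H d c) : H ∈ superEndPart P 0 := by
  rw [← hr.LΛ]
  exact Submodule.sub_mem _ (mul_mem h.L h.Λ (zero_add 0)) (mul_mem h.Λ h.L (zero_add 0))

theorem repEven_mem (h : KahlerParity P L Λ d c) (hr : KahlerRel L Λ H d c) (a : KahlerDeRham) :
    repEven L Λ H d c a ∈ superEndPart P 0 := by
  rw [repEven]
  exact Submodule.add_mem _ (Submodule.add_mem _ (Submodule.add_mem _ (Submodule.smul_mem _ _ h.L)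
    (Submodule.smul_mem _ _ h.Λ)) (Submodule.smul_mem _ _ (h.commutator_mem hr))) (Submodule.smul_mem _ _ h.lap)

theorem repOdd_mem (h : KahlerParity P L Λ d c) (a : KahlerDeRham) :
    repOdd Λ d c a ∈ superEndPart P 1 := by
  rw [repOdd]
  exact Submodule.add_mem _ (Submodule.add_mem _ (Submodule.add_mem _ (Submodule.smul_mem _ _ h.d)
    (Submodule.smul_mem _ _ h.c)) (Submodule.smul_mem _ _ h.ds)) (Submodule.smul_mem _ _ h.dcs)

theorem rep_mem (h : KahlerParity P L Λ d c) (hr : KahlerRel L Λ H d c) {i : ZMod 2}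
    {a : KahlerDeRham} (ha : a ∈ KahlerDeRham.gradedPart i) :
    rep L Λ H d c a ∈ superEndPart P i := by
  rcases zmodTwo_cases i with rfl | rfl
  · have : rep L Λ H d c a = repEven L Λ H d c a := by
      change repEven L Λ H d c a + repOdd Λ d c a = _
      rw [repOdd_of_mem ha, add_zero]
    rw [this]; exact h.repEven_mem hr a
  · have : rep L Λ H d c a = repOdd Λ d c a := by
      change repEven L Λ H d c a + repOdd Λ d c a = _
      rw [repEven_of_mem ha, zero_add]
    rw [this]; exact h.repOdd_mem a

theorem superComm_rep (h : KahlerParity P L Λ d c) (hr : KahlerRel L Λ H d c)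
    (a b : KahlerDeRham) : superComm P (rep L Λ H d c a) (rep L Λ H d c b) =
      rep L Λ H d c (KahlerDeRham.bracket a b) := by
  have ea := h.repEven_mem hr a
  have eb := h.repEven_mem hr b
  have oa := h.repOdd_mem a
  have ob := h.repOdd_mem b
  have v0 : (0 : ZMod 2).val = 0 := rfl
  have v1 : (1 : ZMod 2).val = 1 := rfl
  change superComm P (repEven L Λ H d c a + repOdd Λ d c a)
    (repEven L Λ H d c b + repOdd Λ d c b) = _
  rw [map_add, map_add (superComm P), LinearMap.add_apply, LinearMap.add_apply,
    superComm_apply_of_mem h.PP ea eb,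
    superComm_apply_of_mem h.PP ea ob, superComm_apply_of_mem h.PP oa eb,
    superComm_apply_of_mem h.PP oa ob, v0, v1]
  simp only [mul_zero, zero_mul, mul_one, pow_zero, pow_one, one_smul, neg_smul, sub_neg_eq_add]
  rw [superComm_rep_aux hr, superComm_rep_aux' hr, superComm_rep_odd hr,
    ← neg_sub (repEven L Λ H d c b * repOdd Λ d c a), superComm_rep_aux' hr]
  change _ = repEven L Λ H d c (KahlerDeRham.bracketFun a b) +
    repOdd Λ d c (KahlerDeRham.bracketFun a b)
  have b0 : KahlerDeRham.bracketFun a b 0 = 2 * (a 2 * b 0 - a 0 * b 2) := rfl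
  have b1 : KahlerDeRham.bracketFun a b 1 = -2 * (a 2 * b 1 - a 1 * b 2) := rfl
  have b2 : KahlerDeRham.bracketFun a b 2 = a 0 * b 1 - a 1 * b 0 := rfl
  have b3 : KahlerDeRham.bracketFun a b 3 =
    (a 2 * b 3 - a 3 * b 2) - (a 0 * b 6 - a 6 * b 0) := rfl
  have b4 : KahlerDeRham.bracketFun a b 4 =
    (a 2 * b 4 - a 4 * b 2) + (a 0 * b 5 - a 5 * b 0) := rfl
  have b5 : KahlerDeRham.bracketFun a b 5 =
    -(a 2 * b 5 - a 5 * b 2) + (a 1 * b 4 - a 4 * b 1) := rfl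
  have b6 : KahlerDeRham.bracketFun a b 6 =
    -(a 2 * b 6 - a 6 * b 2) - (a 1 * b 3 - a 3 * b 1) := rfl
  have b7 : KahlerDeRham.bracketFun a b 7 =
    a 3 * b 5 + a 5 * b 3 + a 4 * b 6 + a 6 * b 4 := rfl
  rw [repEven, repOdd, b0, b1, b2, b3, b4, b5, b6, b7]
  module

/-- The representation is faithful if the Laplacian does not vanish. -/
theorem rep_injective (h : KahlerParity P L Λ d c) (hr : KahlerRel L Λ H d c)
    (hlap : KahlerRel.lap Λ d c ≠ 0) : Function.Injective (rep L Λ H d c) := by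
  -- The kernel is an ideal. Bracketing an element of it with suitable basis vectors leaves one
  -- coordinate, up to sign, as coefficient of `Δ`, and this coefficient must be zero.
  have ideal : ∀ b a, rep L Λ H d c a = 0 → rep L Λ H d c (KahlerDeRham.bracket b a) = 0 := by
    intro b a ha
    rw [← h.superComm_rep hr, ha, map_zero]
  have seven : ∀ z : ℂ, rep L Λ H d c (Pi.single 7 z) = 0 → z = 0 := by
    intro z hz
    have e : (Pi.single 7 z : KahlerDeRham) = z • Pi.single 7 1 := by
      rw [← Pi.single_smul, smul_eq_mul, mul_one]
    rw [e, map_smul, (rep_single L Λ H d c).2.2.2.2.2] at hz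
    exact (smul_eq_zero.1 hz).resolve_right hlap
  have br : ∀ (j : Fin 8) (a : KahlerDeRham), KahlerDeRham.bracket (Pi.single j 1) a =
      KahlerDeRham.bracketFun (Pi.single j 1) a := fun _ _ => rfl
  rw [injective_iff_map_eq_zero]
  intro a ha
  have a1 : a 1 = 0 := by
    refine seven _ ?_
    rw [← ideal (Pi.single 4 1) _ (ideal (Pi.single 3 1) a ha), br, br]
    congr 1
    funext k; fin_cases k <;> simp [KahlerDeRham.bracketFun, Pi.single_apply]
  have a2 : a 2 = 0 := by
    refine neg_eq_zero.1 (seven _ ?_)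
    rw [← ideal (Pi.single 5 1) _ (ideal (Pi.single 3 1) a ha), br, br]
    congr 1
    funext k; fin_cases k <;> simp [KahlerDeRham.bracketFun, Pi.single_apply]
  have a0 : a 0 = 0 := by
    refine seven _ ?_
    rw [← ideal (Pi.single 5 1) _ (ideal (Pi.single 6 1) a ha), br, br]
    congr 1
    funext k; fin_cases k <;> simp [KahlerDeRham.bracketFun, Pi.single_apply]
  -- Once the `sl₂`-coordinates are gone, one bracket with the odd vector paired with it under `{·,
  -- ·} = Δ` isolates an odd coordinate.
  have a5 : a 5 = 0 := by
    refine seven _ ?_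
    rw [← ideal (Pi.single 3 1) a ha, br]
    congr 1
    funext k; fin_cases k <;> simp [KahlerDeRham.bracketFun, Pi.single_apply, a0, a1, a2]
  have a6 : a 6 = 0 := by
    refine seven _ ?_
    rw [← ideal (Pi.single 4 1) a ha, br]
    congr 1
    funext k; fin_cases k <;> simp [KahlerDeRham.bracketFun, Pi.single_apply, a0, a1, a2]
  have a3 : a 3 = 0 := by
    refine seven _ ?_
    rw [← ideal (Pi.single 5 1) a ha, br]
    congr 1
    funext k; fin_cases k <;> simp [KahlerDeRham.bracketFun, Pi.single_apply, a0, a1, a2]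
  have a4 : a 4 = 0 := by
    refine seven _ ?_
    rw [← ideal (Pi.single 6 1) a ha, br]
    congr 1
    funext k; fin_cases k <;> simp [KahlerDeRham.bracketFun, Pi.single_apply, a0, a1, a2]
  have e : a = Pi.single 7 (a 7) := by
    funext k; fin_cases k <;> simp [Pi.single_apply, a0, a1, a2, a3, a4, a5, a6]
  have a7 : a 7 = 0 := seven _ (by rw [← e]; exact ha)
  rw [e, a7, Pi.single_zero]

/-- The range of the representation is a graded subalgebra containing the five generators.
Conversely `d^*`, `(d^c)^*` and the Laplacian are, up to sign, iterated brackets of the generators.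
-/
theorem generated_eq (h : KahlerParity P L Λ d c) (hr : KahlerRel L Λ H d c) :
    @LieSuperalgebra.generated _ _ _ (superEnd P h.PP)
      ({L, Λ, H, d, c} : Set (Module.End ℂ V)) = LinearMap.range (rep L Λ H d c) := by
  let _ := superEnd P h.PP
  obtain ⟨s0, s1, s2, s3, s4, -⟩ := rep_single L Λ H d c
  apply le_antisymm
  · refine sInf_le ⟨?_, ?_, ?_⟩
    · rintro x (rfl | rfl | rfl | rfl | rfl)
      · exact ⟨_, s0⟩
      · exact ⟨_, s1⟩
      · exact ⟨_, s2⟩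
      · exact ⟨_, s3⟩
      · exact ⟨_, s4⟩
    · rintro _ ⟨a, rfl⟩
      obtain ⟨u, hu, v, hv, huv⟩ := Submodule.mem_sup.1
        (show a ∈ KahlerDeRham.gradedPart 0 ⊔ KahlerDeRham.gradedPart 1 by
          have : IsCompl (KahlerDeRham.gradedPart 0) (KahlerDeRham.gradedPart 1) :=
            LieSuperalgebra.isCompl (A := KahlerDeRham)
          rw [this.sup_eq_top]; trivial)
      rw [← huv, map_add]
      exact Submodule.add_mem_sup ⟨⟨u, rfl⟩, h.rep_mem hr hu⟩ ⟨⟨v, rfl⟩, h.rep_mem hr hv⟩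
    · rintro _ ⟨a, rfl⟩ _ ⟨b, rfl⟩
      exact ⟨_, (h.superComm_rep hr a b).symm⟩
  · refine le_sInf ?_
    rintro N ⟨hN, hN'⟩
    have br : ∀ a ∈ N, ∀ b ∈ N, superComm P a b ∈ N := hN'.sbracket_mem
    have hL : L ∈ N := hN (by simp)
    have hΛ : Λ ∈ N := hN (by simp)
    have hH : H ∈ N := hN (by simp)
    have hd : d ∈ N := hN (by simp)
    have hc : c ∈ N := hN (by simp)
    have hs : KahlerRel.ds Λ c ∈ N := by
      have := br Λ hΛ c hc
      rw [superComm_apply_of_mem h.PP h.Λ h.c] at this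
      simpa [KahlerRel.ds] using this
    have ht : KahlerRel.dcs Λ d ∈ N := by
      have := N.neg_mem (br Λ hΛ d hd)
      rw [superComm_apply_of_mem h.PP h.Λ h.d] at this
      simpa [KahlerRel.dcs] using this
    have hl : KahlerRel.lap Λ d c ∈ N := by
      have := br d hd _ hs
      have v1 : (1 : ZMod 2).val = 1 := rfl
      rw [superComm_apply_of_mem h.PP h.d h.ds, v1, mul_one, pow_one, neg_one_smul,
        sub_neg_eq_add] at this
      exact this
    rintro _ ⟨a, rfl⟩
    change repEven L Λ H d c a + repOdd Λ d c a ∈ N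
    rw [repEven, repOdd]
    exact N.add_mem (N.add_mem (N.add_mem (N.add_mem (N.smul_mem _ hL) (N.smul_mem _ hΛ))
      (N.smul_mem _ hH)) (N.smul_mem _ hl)) (N.add_mem (N.add_mem (N.add_mem (N.smul_mem _ hd)
      (N.smul_mem _ hc)) (N.smul_mem _ hs)) (N.smul_mem _ ht))

/-- The superalgebra generated by the operators is the Kähler-de Rham superalgebra. -/
theorem exists_equiv (h : KahlerParity P L Λ d c) (hr : KahlerRel L Λ H d c)
    (hlap : KahlerRel.lap Λ d c ≠ 0) :
    ∃ φ : KahlerDeRham ≃ₗ[ℂ] @LieSuperalgebra.generated _ _ _ (superEnd P h.PP)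
        ({L, Λ, H, d, c} : Set (Module.End ℂ V)),
      ∀ a, (φ a : Module.End ℂ V) = rep L Λ H d c a :=
  ⟨(LinearEquiv.ofInjective _ (h.rep_injective hr hlap)).trans
    (LinearEquiv.ofEq _ _ (h.generated_eq hr).symm), fun a => rfl⟩

end KahlerParity

end Representation

/-! ### The relations satisfied by the operators on half-forms -/

namespace Tot

variable {E : Type*} [NormedAddCommGroup E] [NormedSpace ℝ E] [FiniteDimensional ℝ E]

theorem lam_congr {m : ℕ} (J : E →L[ℝ] E) (e : Fin m → E) {x y : Tot E} {k : ℕ} {c : ℂ}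
    (h : x (k + 2) = c • y (k + 2)) : lam J e x k = c • lam J e y k := by
  have h1 : ∀ u v, contr u (contr v x) k = (c • contr u (contr v y)) k := fun u v => by
    rw [← map_smul, ← map_smul]
    change ((x (k + 2)).curryLeft v).curryLeft u = (((c • y) (k + 2)).curryLeft v).curryLeft u
    rw [h]; rfl
  have h2 : lam J e x k = lam J e (c • y) k := by
    rw [lam_apply, lam_apply, Pi.smul_apply, Pi.smul_apply, Finset.sum_apply, Finset.sum_apply]
    congr 1
    refine Finset.sum_congr rfl fun j _ => ?_
    rw [h1, map_smul, map_smul]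
  rw [h2, map_smul]
  rfl

end Tot

namespace SmoothForm

open Tot TotForm

variable {E : Type*} [NormedAddCommGroup E] [NormedSpace ℝ E] [FiniteDimensional ℝ E]
  {M : Type*} [TopologicalSpace M] [ChartedSpace E M] [IsManifold 𝓘(ℝ, E) ∞ M]

theorem parS_apply (η : SmoothForm E M) (x : M) (k : ℕ) :
    (parS η).at' x k = (-1 : ℂ) ^ k • η.at' x k := rfl

theorem parS_of_degree {T : Module.End ℂ (SmoothForm E M)} (hT : degS * T = T * degS + T) :
    parS * T = -(T * parS) := by
  ext1 η; ext1 x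
  funext k
  change (-1 : ℂ) ^ k • (T η).at' x k = -(T (parS η)).at' x k
  cases k with
  | zero =>
    rw [apply_zero_of_degree hT, apply_zero_of_degree hT]
    simp
  | succ k =>
    have h := apply_succ_congr hT (η := parS η) (ξ := (-1 : ℂ) ^ k • η) (k := k)
      (fun y => rfl) x
    rw [h, map_smul, at_smul, Pi.smul_apply, pow_succ]
    module

theorem degS_mul_wedS {α : SmoothForm E M} {k : ℕ} (h : degS α = (k : ℂ) • α) :
    degS * wedS α = wedS α * degS + (k : ℂ) • wedS α := by
  ext1 η
  have e : degS (wedS α η) = wedS (degS α) η + wedS α (degS η) := by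
    ext1 x; exact deg_wedge _ _
  rw [Module.End.mul_apply, e, h, map_smul, LinearMap.smul_apply, add_comm]
  rfl

theorem parS_wedS (α η : SmoothForm E M) : parS (wedS α η) = wedS (parS α) (parS η) := by
  ext1 x; exact par_wedge _ _

end SmoothForm

namespace HypercomplexHermitian

open Tot TotForm SmoothForm HypercomplexStructure

variable {E : Type*} [NormedAddCommGroup E] [NormedSpace ℝ E] [FiniteDimensional ℝ E]
  {M : Type*} [TopologicalSpace M] [ChartedSpace E M] [IsManifold 𝓘(ℝ, E) ∞ M]
  (X : HypercomplexHermitian E M)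

theorem lamS_congr {η ξ : SmoothForm E M} {x : M} {k : ℕ} {c : ℂ}
    (h : η.at' x (k + 2) = c • ξ.at' x (k + 2)) :
    (X.lamS η).at' x k = c • (X.lamS ξ).at' x k := lam_congr _ _ h

theorem degS_lamS (η : SmoothForm E M) :
    degS (X.lamS η) = X.lamS (degS η) - (2 : ℂ) • X.lamS η := by
  ext1 x
  funext k
  rw [degS_apply, at_sub, at_smul, Pi.sub_apply, Pi.smul_apply,
    X.lamS_congr (η := degS η) (ξ := η) (c := ((k + 2 : ℕ) : ℂ)) rfl]
  push_cast
  module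

theorem parS_lamS (η : SmoothForm E M) : parS (X.lamS η) = X.lamS (parS η) := by
  ext1 x
  funext k
  rw [parS_apply, X.lamS_congr (η := parS η) (ξ := η) (c := (-1) ^ (k + 2)) rfl, pow_add]
  congr 1
  norm_num

/-- The degree `k` component of `Λ^N η` depends only on the component of `η` in degree `k + 2N`, and
forms above the real dimension vanish. This is the source of the nilpotency of `Λ_Ω`. -/
theorem lamS_pow (N : ℕ) (η : SmoothForm E M) (x : M) : ∀ k, Module.finrank ℝ E < k + 2 * N →
    ((X.lamS ^ N) η).at' x k = 0 := by
  induction N with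
  | zero => intro k hk; exact eq_zero_of_finrank_lt (by omega) _
  | succ N ih =>
    intro k hk
    rw [pow_succ', Module.End.mul_apply]
    have h := ih (k + 2) (by omega)
    rw [X.lamS_congr (ξ := 0) (c := 0) (by rw [h]; module)]
    module

namespace Operators

variable {X} {n : ℕ} (O : X.Operators n)

theorem emb_pow_Lam (N : ℕ) (η : X.HalfForms) :
    X.emb ((O.Lam ^ N) η) = (X.lamS ^ N) (X.emb η) := by
  induction N with
  | zero => rfl
  | succ N ih => rw [pow_succ', pow_succ', Module.End.mul_apply, Module.End.mul_apply, emb_Lam, ih]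

theorem ext_emb {S T : Module.End ℂ X.HalfForms} (h : ∀ η, X.emb (S η) = X.emb (T η)) : S = T :=
  LinearMap.ext fun η => X.emb_injective (h η)

theorem emb_degreeParity (η : X.HalfForms) : X.emb (X.degreeParity η) = parS (X.emb η) := rfl

theorem comm_H {O : X.Operators n} (hm : Module.finrank ℝ E = 4 * n) {S : Module.End ℂ X.HalfForms}
    {T : Module.End ℂ (SmoothForm E M)} (hS : ∀ η, X.emb (S η) = T (X.emb η)) {r : ℂ}
    (hT : degS * T = T * degS + r • T) : O.H * S = S * O.H + r • S := by
  refine ext_emb fun η => ?_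
  have h := end_congr hT (X.emb η)
  simp only [Module.End.mul_apply, LinearMap.add_apply, LinearMap.smul_apply] at h
  rw [LinearMap.add_apply, Module.End.mul_apply, Module.End.mul_apply, LinearMap.smul_apply,
    map_add, map_smul, O.emb_H hm, hS, hS, O.emb_H hm, h, map_sub, map_smul]
  abel

theorem comm_of_emb {S S' : Module.End ℂ X.HalfForms} {T T' : Module.End ℂ (SmoothForm E M)}
    (hS : ∀ η, X.emb (S η) = T (X.emb η)) (hS' : ∀ η, X.emb (S' η) = T' (X.emb η))
    (η : X.HalfForms) : X.emb ((S * S') η) = (T * T') (X.emb η) := by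
  rw [Module.End.mul_apply, Module.End.mul_apply, hS, hS']

/-- Each relation is checked after `emb`, where the operators are the explicit ones; `HL`, `HΛ`,
`Hd` and `Hc` only record degrees, as `H_Ω` is the degree minus `n`. -/
theorem kahlerRel (hm : Module.finrank ℝ E = 4 * n) (hX : X.IsHKT) :
    KahlerRel O.L O.Lam O.H O.del O.delJ where
  LΛ := O.H_spec.symm
  HL := comm_H hm O.emb_L (by exact_mod_cast degS_mul_wedS X.degS_OmS)
  HΛ := by
    have h := comm_H (O := O) hm O.emb_Lam (r := -2) (by
      ext1 η
      have h1 := X.degS_lamS η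
      rw [Module.End.mul_apply, LinearMap.add_apply, Module.End.mul_apply, LinearMap.smul_apply, h1]
      module)
    rw [h]; module
  Hd := by
    have h := comm_H (O := O) hm O.emb_del (r := 1) (by rw [one_smul, O.isTheta.degS_twPd])
    rw [h, one_smul]
  Hc := by
    have h := comm_H (O := O) hm O.emb_delJ (r := 1) (by rw [one_smul, O.isTheta.degS_twPdJ])
    rw [h, one_smul]
  Ld := ext_emb fun η => by
    rw [comm_of_emb O.emb_L O.emb_del, comm_of_emb O.emb_del O.emb_L, O.isTheta.twPd_OmS hX]
  Lc := ext_emb fun η => by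
    rw [comm_of_emb O.emb_L O.emb_delJ, comm_of_emb O.emb_delJ O.emb_L, O.isTheta.twPdJ_OmS hX]
  dd := ext_emb fun η => by
    rw [comm_of_emb O.emb_del O.emb_del, O.isTheta.twPd_sq hm, LinearMap.zero_apply,
      LinearMap.zero_apply, map_zero]
  cc := ext_emb fun η => by
    rw [comm_of_emb O.emb_delJ O.emb_delJ, O.isTheta.twPdJ_sq hm, LinearMap.zero_apply,
      LinearMap.zero_apply, map_zero]
  dc := ext_emb fun η => by
    rw [LinearMap.add_apply, map_add, comm_of_emb O.emb_del O.emb_delJ,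
      comm_of_emb O.emb_delJ O.emb_del, ← LinearMap.add_apply, O.isTheta.twPd_twPdJ hm,
      LinearMap.zero_apply, LinearMap.zero_apply, map_zero]
  nil := by
    refine ⟨Module.finrank ℝ E + 1, ext_emb fun η => ?_⟩
    rw [emb_pow_Lam, LinearMap.zero_apply, map_zero]
    ext1 x
    funext k
    exact X.lamS_pow _ _ x k (by omega)

theorem mem_even {S : Module.End ℂ X.HalfForms} {T : Module.End ℂ (SmoothForm E M)}
    (hS : ∀ η, X.emb (S η) = T (X.emb η)) (hT : ∀ η, parS (T η) = T (parS η)) :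
    S ∈ superEndPart X.degreeParity 0 := by
  change X.degreeParity * S = (-1 : ℂ) ^ 0 • (S * X.degreeParity)
  rw [pow_zero, one_smul]
  refine ext_emb fun η => ?_
  rw [Module.End.mul_apply, Module.End.mul_apply, emb_degreeParity, hS, hS, emb_degreeParity, hT]

theorem mem_odd {S : Module.End ℂ X.HalfForms} {T : Module.End ℂ (SmoothForm E M)}
    (hS : ∀ η, X.emb (S η) = T (X.emb η)) (hT : degS * T = T * degS + T) :
    S ∈ superEndPart X.degreeParity 1 := by
  change X.degreeParity * S = (-1 : ℂ) ^ 1 • (S * X.degreeParity)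
  rw [pow_one, neg_one_smul]
  refine ext_emb fun η => ?_
  have h := end_congr (parS_of_degree hT) (X.emb η)
  rw [Module.End.mul_apply] at h
  rw [Module.End.mul_apply, LinearMap.neg_apply, Module.End.mul_apply, map_neg, emb_degreeParity,
    hS, hS, emb_degreeParity, h]
  rfl

theorem kahlerParity : KahlerParity X.degreeParity O.L O.Lam O.del O.delJ where
  PP := X.degreeParity_sq
  L := mem_even O.emb_L fun η => by rw [parS_wedS, parS_OmS]
  Λ := mem_even O.emb_Lam fun η => X.parS_lamS η
  d := mem_odd O.emb_del O.isTheta.degS_twPd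
  c := mem_odd O.emb_delJ O.isTheta.degS_twPdJ

end Operators

end HypercomplexHermitian

/-! ### Nonvanishing of the Laplacian -/

namespace SmoothForm

open Tot TotForm

variable {E : Type*} [NormedAddCommGroup E] [NormedSpace ℝ E] [FiniteDimensional ℝ E]
  {M : Type*} [TopologicalSpace M] [ChartedSpace E M] [IsManifold 𝓘(ℝ, E) ∞ M]

/-- A smooth real function as a form of degree `0`. -/
def ofFun (f : M → ℝ) (hf : ContMDiff 𝓘(ℝ, E) 𝓘(ℝ, ℝ) ∞ f) : SmoothForm E M :=
  homog (k := 0) (fun x => ContinuousAlternatingMap.constOfIsEmpty ℝ E (Fin 0) (f x : ℂ))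
    (fun x₀ => by
      refine contDiffOn_of_eval fun v => ?_
      have h4 := hf.comp_contMDiffOn (contMDiffOn_extChartAt_symm (I := 𝓘(ℝ, E)) (n := ∞) x₀)
      exact Complex.ofRealCLM.contDiff.comp_contDiffOn (contMDiffOn_iff_contDiffOn.1 h4))

theorem ofFun_at (f : M → ℝ) (hf : ContMDiff 𝓘(ℝ, E) 𝓘(ℝ, ℝ) ∞ f) (x : M) :
    (ofFun (E := E) f hf).at' x = (f x : ℂ) • one := by
  have h := single_zero_wedge (E := E)
    (ContinuousAlternatingMap.constOfIsEmpty ℝ E (Fin 0) (f x : ℂ)) one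
  rw [wedge_one] at h
  exact h

theorem degS_ofFun (f : M → ℝ) (hf : ContMDiff 𝓘(ℝ, E) 𝓘(ℝ, ℝ) ∞ f) :
    degS (ofFun (E := E) f hf) = ((0 : ℕ) : ℂ) • ofFun f hf := degS_homog _ _

theorem conjS_ofFun (f : M → ℝ) (hf : ContMDiff 𝓘(ℝ, E) 𝓘(ℝ, ℝ) ∞ f) :
    conjS (ofFun (E := E) f hf) = ofFun f hf := by
  ext1 x
  change Tot.conj ((ofFun (E := E) f hf).at' x) = _
  rw [ofFun_at, map_smulₛₗ, Complex.conj_ofReal, conj_one]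

theorem pullS_ofFun {B : M → E →L[ℝ] E} (hB : SmoothEnd B) (f : M → ℝ)
    (hf : ContMDiff 𝓘(ℝ, E) 𝓘(ℝ, ℝ) ∞ f) : pullS hB (ofFun (E := E) f hf) = ofFun f hf := by
  ext1 x
  change pull (B x) ((ofFun (E := E) f hf).at' x) = _
  rw [ofFun_at, map_smul, pull_one]

/-- The differential of a function, in the chart at the point. -/
theorem dS_ofFun (f : M → ℝ) (hf : ContMDiff 𝓘(ℝ, E) 𝓘(ℝ, ℝ) ∞ f) (x : M) {l : E →L[ℝ] ℝ}
    (hl : HasFDerivAt (fun y => f ((ch (E := E) x).symm y)) l (ch x x)) (v : E) :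
    (dS (ofFun (E := E) f hf)).at' x 1 ![chartInv x (ch x x) v] = (l v : ℂ) := by
  have hy : ch (E := E) x x ∈ (ch (E := E) x).target := mem_extChartAt_target x
  set F := ofFun (E := E) f hf with hF
  have h1 := inC_d_succ F.isSmooth hy 0
  have h2 : inC (d F.at') x (ch x x) 1 ![v] =
      (dS F).at' x 1 ![chartInv x (ch x x) v] := by
    have hx : (ch (E := E) x).symm (ch x x) = x := extChartAt_to_inv x
    change d F.at' ((ch (E := E) x).symm (ch x x)) 1 (fun i => chartInv x (ch x x) (![v] i)) =
      d F.at' x 1 ![chartInv x (ch x x) v]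
    rw [hx]
    congr 1
    funext i; rw [Subsingleton.elim i 0]; rfl
  rw [← h2, h1, extDeriv, ContinuousAlternatingMap.alternatizeUncurryFin_apply]
  have h3 : DifferentiableAt ℝ (fun z => inC F.at' x z 0) (ch x x) :=
    ((F.isSmooth x 0).contDiffAt ((isOpen_target x).mem_nhds hy)).differentiableAt (by simp)
  have h4 := ((ContinuousAlternatingMap.apply ℝ E ℂ (![] : Fin 0 → E)).hasFDerivAt.comp _
    h3.hasFDerivAt)
  have h5 : HasFDerivAt (fun z => ((f ((ch (E := E) x).symm z) : ℝ) : ℂ))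
      (Complex.ofRealCLM ∘L l) (ch x x) := Complex.ofRealCLM.hasFDerivAt.comp _ hl
  have h6 : (fun z => ((f ((ch (E := E) x).symm z) : ℝ) : ℂ)) =
      (⇑(ContinuousAlternatingMap.apply ℝ E ℂ (![] : Fin 0 → E)) ∘ fun z => inC F.at' x z 0) := by
    funext z
    change _ = F.at' ((ch (E := E) x).symm z) 0 (fun i => chartInv x z ((![] : Fin 0 → E) i))
    rw [hF, ofFun_at]
    change _ = ((f ((ch (E := E) x).symm z) : ℝ) : ℂ) * 1
    rw [mul_one]
  rw [h6] at h5
  have h7 := DFunLike.congr_fun (h4.unique h5) v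
  rw [Fin.sum_univ_one]
  change (-1 : ℤ) ^ 0 • (fderiv ℝ (fun z => inC F.at' x z 0) (ch x x) v) _ = _
  rw [pow_zero, one_smul, Subsingleton.elim (Fin.removeNth 0 ![v]) ![]]
  exact h7

/-- A smooth function with a zero that is not critical. -/
theorem exists_function [T2Space M] (hm : 0 < Module.finrank ℝ E) (x : M) :
    ∃ (f : M → ℝ) (hf : ContMDiff 𝓘(ℝ, E) 𝓘(ℝ, ℝ) ∞ f), f x = 0 ∧
      ∃ u : E, (dS (ofFun (E := E) f hf)).at' x 1 ![u] ≠ 0 := by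
  let b := Module.finBasis ℝ E
  let i : Fin (Module.finrank ℝ E) := ⟨0, hm⟩
  let l : E →L[ℝ] ℝ := LinearMap.toContinuousLinearMap (b.coord i)
  have hl : l (b i) = 1 := by
    change b.coord i (b i) = 1
    simp
  let ρ : SmoothBumpFunction 𝓘(ℝ, E) x := Classical.arbitrary _
  -- A coordinate centred at `x`, cut off by a bump function that is `1` near `x`; the cutoff makes
  -- it globally smooth and does not affect its differential at `x`.
  let f : M → ℝ := fun z => ρ z • l (ch x z - ch x x)
  have hf : ContMDiff 𝓘(ℝ, E) 𝓘(ℝ, ℝ) ∞ f := by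
    refine ρ.contMDiff_smul ?_
    have h1 := contMDiffOn_extChartAt (I := 𝓘(ℝ, E)) (n := ∞) (x := x)
    have h2 : ContMDiff 𝓘(ℝ, E) 𝓘(ℝ, ℝ) ∞ (fun y : E => l (y - ch x x)) :=
      (l.contDiff.comp (contDiff_id.sub contDiff_const)).contMDiff
    exact h2.comp_contMDiffOn h1
  refine ⟨f, hf, ?_, chartInv x (ch x x) (b i), ?_⟩
  · change ρ x • l (ch x x - ch x x) = 0
    rw [sub_self, map_zero, smul_zero]
  · have hd : HasFDerivAt (fun y => f ((ch (E := E) x).symm y)) l (ch x x) := by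
      have h1 : HasFDerivAt (fun y : E => l (y - ch x x)) l (ch x x) :=
        l.hasFDerivAt.comp _ ((hasFDerivAt_id _).sub_const _)
      refine h1.congr_of_eventuallyEq ?_
      have h2 : ∀ᶠ y in nhds (ch (E := E) x x), ρ ((ch (E := E) x).symm y) = 1 := by
        have h3 : Filter.Tendsto (ch (E := E) x).symm (nhds (ch x x)) (nhds x) := by
          have := (continuousAt_extChartAt_symm (I := 𝓘(ℝ, E)) x).tendsto
          rwa [extChartAt_to_inv] at this
        exact h3.eventually ρ.eventuallyEq_one
      filter_upwards [h2, (isOpen_target x).mem_nhds (mem_extChartAt_target x)] with y hy hy'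
      change ρ ((ch (E := E) x).symm y) • l (ch x ((ch (E := E) x).symm y) - ch x x) = _
      rw [hy, one_smul, (ch x).right_inv hy']
    rw [dS_ofFun f hf x hd, hl]
    simp

end SmoothForm

namespace HypercomplexHermitian

open Tot TotForm SmoothForm HypercomplexStructure

variable {E : Type*} [NormedAddCommGroup E] [NormedSpace ℝ E] [FiniteDimensional ℝ E]
  {M : Type*} [TopologicalSpace M] [ChartedSpace E M] [IsManifold 𝓘(ℝ, E) ∞ M]
  (X : HypercomplexHermitian E M)

theorem single_of_degS {η : SmoothForm E M} {k : ℕ} (h : degS η = (k : ℂ) • η) (x : M) :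
    η.at' x = single k (η.at' x k) :=
  eq_single_of_deg (congrArg (fun ω' : SmoothForm E M => ω'.at' x) h)

theorem lamS_of_deg_lt {η : SmoothForm E M} {k : ℕ} (hk : k < 2) (h : degS η = (k : ℂ) • η) :
    X.lamS η = 0 := by
  ext1 x
  funext j
  have h1 : η.at' x (j + 2) = 0 := by rw [single_of_degS h x, single_of_ne (by omega)]
  rw [X.lamS_congr (ξ := 0) (c := 0) (by rw [h1]; module)]
  rw [at_zero]
  change (0 : ℂ) • _ = (0 : E [⋀^Fin j]→L[ℝ] ℂ)
  module

section Function

variable {f : M → ℝ} (hf : ContMDiff 𝓘(ℝ, E) 𝓘(ℝ, ℝ) ∞ f)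

theorem isHolS_ofFun : X.IsHolS (ofFun f hf) :=
  X.isHolS_of_isHol fun x => by rw [ofFun_at]; exact (IsHol.one _).smul _

theorem jc_ofFun : X.jc (ofFun f hf) = ofFun f hf := by
  rw [jc_apply, conjS_ofFun, RJ, pullS_ofFun]

theorem parS_ofFun : parS (ofFun (E := E) f hf) = ofFun f hf := by
  rw [parS_of_deg (degS_ofFun f hf), pow_zero, one_smul]

theorem twist_wedS_ofFun {D : Module.End ℂ (SmoothForm E M)} (hD : IsOddDer D)
    (θ ξ : SmoothForm E M) : (D + (1 / 2 : ℂ) • wedS θ) (wedS (ofFun f hf) ξ) =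
      wedS (D (ofFun f hf)) ξ + wedS (ofFun f hf) ((D + (1 / 2 : ℂ) • wedS θ) ξ) := by
  have h1 := end_congr (hD (ofFun f hf)) ξ
  rw [parS_ofFun] at h1
  have h2 : wedS θ (wedS (ofFun f hf) ξ) = wedS (ofFun f hf) (wedS θ ξ) := by
    have e := end_congr (wedS_mul θ (ofFun f hf)) ξ
    have e' := end_congr (wedS_mul (ofFun f hf) θ) ξ
    rw [wedS_comm_of_even (parS_ofFun hf)] at e'
    exact e.trans e'.symm
  simp only [Module.End.mul_apply, LinearMap.add_apply, LinearMap.smul_apply] at h1 ⊢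
  rw [h1, h2, map_add, map_smul, add_assoc]

theorem wedS_oneS (η : SmoothForm E M) : wedS η oneS = η := by
  ext1 x; exact wedge_one _

theorem pd_ofFun_apply (x : M) (v : E) : (X.pd (ofFun f hf)).at' x 1 ![v] =
    (1 / 2 : ℂ) * ((dS (ofFun f hf)).at' x 1 ![v] -
      Complex.I * (dS (ofFun f hf)).at' x 1 ![X.fld quatI x v]) := by
  have h0 : X.wt (ofFun f hf) = 0 := by
    rw [X.isHolS_ofFun hf, degS_ofFun, Nat.cast_zero, zero_smul, smul_zero]
  have h1 : X.pd (ofFun f hf) = (1 / 2 : ℂ) • (dS (ofFun f hf) -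
      Complex.I • X.wt (dS (ofFun f hf))) := by
    rw [pd, holPart]
    simp only [Module.End.mul_apply, LinearMap.sub_apply, LinearMap.smul_apply, h0, map_zero,
      sub_zero]
  have h2 : (X.wt (dS (ofFun f hf))).at' x 1 ![v] =
      (dS (ofFun f hf)).at' x 1 ![X.fld quatI x v] := by
    have h3 := congrFun (contr_derv (X.fld quatI x).toLinearMap
      ((dS (ofFun f hf)).at' x) v) 0
    rw [Pi.add_apply, derv_zero_deg, add_zero] at h3
    exact DFunLike.congr_fun h3 ![]
  rw [h1, at_smul, at_sub, at_smul, ← h2]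
  rfl

theorem conj_dS_ofFun (x : M) (v : E) : starRingEnd ℂ ((dS (ofFun f hf)).at' x 1 ![v]) =
    (dS (ofFun f hf)).at' x 1 ![v] := by
  have h := conjS_dS (ofFun (E := E) f hf)
  rw [conjS_ofFun] at h
  exact congrArg (fun ω' : SmoothForm E M => ω'.at' x 1 ![v]) h

/-- If `∂f` vanishes at `x`, then `df(u) = √-1 df(I u)` there; both differentials are real because
`f` is, so the two sides are real and imaginary. -/
theorem dS_ofFun_eq_zero {x : M} (h : (X.pd (ofFun f hf)).at' x 1 = 0) (u : E) :
    (dS (ofFun f hf)).at' x 1 ![u] = 0 := by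
  have h1 := X.pd_ofFun_apply hf x u
  rw [h] at h1
  have r1 := Complex.conj_eq_iff_im.1 (conj_dS_ofFun hf x u)
  have r2 := Complex.conj_eq_iff_im.1 (conj_dS_ofFun hf x (X.fld quatI x u))
  have h2 : (dS (ofFun f hf)).at' x 1 ![u] =
      Complex.I * (dS (ofFun f hf)).at' x 1 ![X.fld quatI x u] := by
    have e : (0 : ℂ) = (1 / 2 : ℂ) * ((dS (ofFun f hf)).at' x 1 ![u] -
      Complex.I * (dS (ofFun f hf)).at' x 1 ![X.fld quatI x u]) := h1
    linear_combination (-2 : ℂ) * e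
  apply Complex.ext
  · rw [h2, Complex.I_mul_re, r2, neg_zero, Complex.zero_re]
  · exact r1

theorem pdJ_ofFun_apply (x : M) (v : E) : (X.pdJ (ofFun f hf)).at' x 1 ![v] =
    starRingEnd ℂ ((X.pd (ofFun f hf)).at' x 1 ![X.fld quatJ x v]) := by
  have e := X.jc_pd (ofFun f hf)
  rw [jc_ofFun] at e
  rw [← e]
  change starRingEnd ℂ ((X.pd (ofFun f hf)).at' x 1 (fun i => X.fld quatJ x (![v] i))) = _
  have e2 : (fun i => X.fld quatJ x (![v] i)) = ![X.fld quatJ x v] := by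
    funext i; rw [Subsingleton.elim i 0]; rfl
  rw [e2]

/-- The Leibniz rule for `f²` at a zero of `f`: every term that keeps an undifferentiated factor `f`
vanishes, in particular those from the twists, and each factor is differentiated once. -/
theorem twist_twist_sq {D D' : Module.End ℂ (SmoothForm E M)} (hD : IsOddDer D)
    (hD' : IsOddDer D') (θ θ' : SmoothForm E M) {x : M} (hx : f x = 0) :
    ((D' + (1 / 2 : ℂ) • wedS θ') ((D + (1 / 2 : ℂ) • wedS θ)
      (wedS (ofFun f hf) (ofFun f hf)))).at' x =
        (2 : ℂ) • ((D' (ofFun f hf)).at' x ⋏ (D (ofFun f hf)).at' x) := by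
  have hFx : (ofFun (E := E) f hf).at' x = 0 := by
    rw [ofFun_at, hx, Complex.ofReal_zero]; module
  have tw := twist_wedS_ofFun hf hD θ
  have twJ := twist_wedS_ofFun hf hD' θ'
  generalize D + (1 / 2 : ℂ) • wedS θ = N at tw ⊢
  generalize D' + (1 / 2 : ℂ) • wedS θ' = N' at twJ ⊢
  have h2 : N (wedS (ofFun f hf) (ofFun f hf)) =
      wedS (ofFun f hf) (D (ofFun f hf) + N (ofFun f hf)) := by
    have e : wedS (D (ofFun f hf)) (ofFun f hf) = wedS (ofFun f hf) (D (ofFun f hf)) :=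
      (wedS_comm_of_even (parS_ofFun hf) _).symm
    rw [tw, map_add, e]
  have h3 : (D (ofFun f hf) + N (ofFun f hf)).at' x = (2 : ℂ) • (D (ofFun f hf)).at' x := by
    have e := tw oneS
    rw [wedS_oneS, wedS_oneS] at e
    rw [e, at_add, at_add, wedS_apply, hFx, map_zero, LinearMap.zero_apply]
    module
  rw [h2, twJ, at_add, wedS_apply, wedS_apply, hFx, h3, map_zero, LinearMap.zero_apply, map_smul,
    add_zero]

end Function

/-- By `lam_wedge_one_forms` the hypothesis makes a sum of squares vanish, and its terms include all
values of `α` on an orthonormal basis. -/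
theorem eq_zero_of_lam_wedge (x : M) (α β : E [⋀^Fin 1]→L[ℝ] ℂ)
    (h : ∀ v, β ![v] = starRingEnd ℂ (α ![X.fld quatJ x v]))
    (h0 : lam (X.fld quatJ x) (X.onb x) (single 1 β ⋏ single 1 α) 0 0 = 0) : α = 0 := by
  have h8 := QuatHerm.lam_wedge_one_forms (e := X.onb x) (fun v => X.fld_sq quatJ_sq x v) α β h
  rw [h8] at h0
  have h11 : ∑ j, (‖α ![X.onb x j]‖ ^ 2 + ‖α ![X.fld quatJ x (X.onb x j)]‖ ^ 2) = 0 := by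
    have e : -((1 / 2 : ℝ) * ∑ j, (‖α ![X.onb x j]‖ ^ 2 +
      ‖α ![X.fld quatJ x (X.onb x j)]‖ ^ 2)) = 0 := by exact_mod_cast h0
    linarith
  rw [Finset.sum_eq_zero_iff_of_nonneg (fun j _ => by positivity)] at h11
  refine eq_zero_of_isON (X.isON_onb x) fun i => ?_
  have e := h11 (i 0) (Finset.mem_univ _)
  have e1 : ‖α ![X.onb x (i 0)]‖ ^ 2 = 0 :=
    ((add_eq_zero_iff_of_nonneg (sq_nonneg _) (sq_nonneg _)).1 e).1
  have e2 : α ![X.onb x (i 0)] = 0 := norm_eq_zero.1 (pow_eq_zero_iff two_ne_zero |>.1 e1)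
  have e3 : (fun j => X.onb x (i j)) = ![X.onb x (i 0)] := by
    funext j; rw [Subsingleton.elim j 0]; rfl
  rw [e3, e2]

namespace Operators

variable {X} {n : ℕ} (O : X.Operators n)

/-- On functions `Λ_Ω` kills everything of degree zero or one, so of the four terms of the Laplacian
only `Λ ⁿ∂_J ⁿ∂` survives. -/
theorem emb_lap_ofHol {G : SmoothForm E M} (hG : X.IsHolS G)
    (hGd : degS G = ((0 : ℕ) : ℂ) • G) :
    X.emb (KahlerRel.lap O.Lam O.del O.delJ (X.ofHol G hG)) =
      X.lamS (X.twPdJ O.th (X.twPd O.th G)) := by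
  rw [KahlerRel.lap, KahlerRel.ds]
  simp only [LinearMap.add_apply, LinearMap.sub_apply, Module.End.mul_apply, map_sub, map_add,
    emb_del, emb_delJ, emb_Lam, emb_ofHol]
  rw [X.lamS_of_deg_lt (by omega) (degS_apply_of_degree O.isTheta.degS_twPdJ hGd),
    X.lamS_of_deg_lt (by omega) hGd,
    X.lamS_of_deg_lt (by omega) (degS_apply_of_degree O.isTheta.degS_twPd hGd)]
  simp only [map_zero, sub_zero, zero_add]

/-- The Laplacian does not vanish: it is detected on the square of a function with a zero at
which its differential does not vanish. -/
theorem lap_ne_zero [T2Space M] [Nonempty M] (hn : 0 < n) (hm : Module.finrank ℝ E = 4 * n) :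
    KahlerRel.lap O.Lam O.del O.delJ ≠ 0 := by
  obtain ⟨x⟩ := ‹Nonempty M›
  obtain ⟨f, hf, hfx, u, hu⟩ := exists_function (E := E) (M := M) (by omega) x
  have hFd : degS (ofFun (E := E) f hf) = ((0 : ℕ) : ℂ) • ofFun f hf := degS_ofFun f hf
  intro h0
  have h1 := O.emb_lap_ofHol ((X.isHolS_ofFun hf).wedS (X.isHolS_ofFun hf)) (degS_wedS hFd hFd)
  rw [h0, LinearMap.zero_apply, map_zero] at h1
  have h4 : (X.twPdJ O.th (X.twPd O.th (wedS (ofFun f hf) (ofFun f hf)))).at' x =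
      (2 : ℂ) • ((X.pdJ (ofFun f hf)).at' x ⋏ (X.pd (ofFun f hf)).at' x) :=
    twist_twist_sq hf X.isOddDer_pd X.isOddDer_pdJ O.th (X.jc O.th) hfx
  have h5 := single_of_degS (degS_apply_of_degree X.degS_pd hFd) x
  have h6 := single_of_degS (degS_apply_of_degree X.degS_pdJ hFd) x
  have h9 : (2 : ℂ) * lam (X.fld quatJ x) (X.onb x)
      ((X.pdJ (ofFun f hf)).at' x ⋏ (X.pd (ofFun f hf)).at' x) 0 0 = 0 := by
    have e := congrArg (fun ω' : SmoothForm E M => ω'.at' x 0 0) h1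
    change (0 : ℂ) = lam (X.fld quatJ x) (X.onb x)
      ((X.twPdJ O.th (X.twPd O.th (wedS (ofFun f hf) (ofFun f hf)))).at' x) 0 0 at e
    rw [h4, map_smul] at e
    exact e.symm
  have h10 := (mul_eq_zero.1 h9).resolve_left two_ne_zero
  rw [h5, h6] at h10
  exact hu (X.dS_ofFun_eq_zero hf
    (X.eq_zero_of_lam_wedge x _ _ (X.pdJ_ofFun_apply hf x) h10) u)

end Operators

end HypercomplexHermitian

end
theorem mainTheorem1 {E : Type*} [NormedAddCommGroup E] [NormedSpace ℝ E] [FiniteDimensional ℝ E]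
    {M : Type*} [TopologicalSpace M] [T2Space M] [SecondCountableTopology M] [Nonempty M]
    [ChartedSpace E M] [IsManifold 𝓘(ℝ, E) ∞ M]
    (n : ℕ) (hn : 0 < n) (hdim : Module.finrank ℝ E = 4 * n)
    (X : HypercomplexHermitian E M) (hX : X.IsHKT) :
    Nonempty (X.Operators n) ∧
    ∀ O : X.Operators n,
      O.del * O.del = 0 ∧
      O.delJ * O.delJ = 0 ∧
      O.del * O.delJ + O.delJ * O.del = 0 ∧
      ∃ φ : KahlerDeRham ≃ₗ[ℂ] LieSuperalgebra.generated
          ({O.L, O.Lam, O.H, O.del, O.delJ} : Set (Module.End ℂ X.HalfForms)),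
        (∀ (i : ZMod 2) (a : KahlerDeRham), a ∈ LieSuperalgebra.part i →
          (φ a : Module.End ℂ X.HalfForms) ∈
            LieSuperalgebra.part (A := Module.End ℂ X.HalfForms) i) ∧
        (∀ a b : KahlerDeRham,
          (φ (LieSuperalgebra.sbracket a b) : Module.End ℂ X.HalfForms) =
            LieSuperalgebra.sbracket (φ a : Module.End ℂ X.HalfForms)
              (φ b : Module.End ℂ X.HalfForms)) ∧
        (φ (Pi.single 0 1) : Module.End ℂ X.HalfForms) = O.L ∧
        (φ (Pi.single 1 1) : Module.End ℂ X.HalfForms) = O.Lam ∧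
        (φ (Pi.single 2 1) : Module.End ℂ X.HalfForms) = O.H ∧
        (φ (Pi.single 3 1) : Module.End ℂ X.HalfForms) = O.del ∧
        (φ (Pi.single 4 1) : Module.End ℂ X.HalfForms) = O.delJ := by
  refine ⟨X.nonempty_operators hdim, fun O => ?_⟩
  have hr := O.kahlerRel hdim hX
  refine ⟨hr.dd, hr.cc, hr.dc, ?_⟩
  obtain ⟨φ, hφ⟩ := O.kahlerParity.exists_equiv hr (O.lap_ne_zero hn hdim)
  obtain ⟨s0, s1, s2, s3, s4, -⟩ := rep_single O.L O.Lam O.H O.del O.delJ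
  refine ⟨φ, fun i a ha => ?_, fun a b => ?_, ?_, ?_, ?_, ?_, ?_⟩
  · rw [hφ]
    exact O.kahlerParity.rep_mem hr ha
  · rw [hφ, hφ, hφ]
    exact (O.kahlerParity.superComm_rep hr a b).symm
  · rw [hφ, s0]
  · rw [hφ, s1]
  · rw [hφ, s2]
  · rw [hφ, s3]
  · rw [hφ, s4]
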